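/- Write $\Lambda=\mathbb R^2$, $\mathbf x_k=(x_1,\dots,x_k)\in\Lambda^k$, and let $\mathcal L^1_k$ be the space of trace class operators on $L^2(\Lambda^k)$. Let $(J^{(k)}_i)_{i\ge1}$ be a sequence dense in the unit ball of the compact operators on $L^2(\Lambda^k)$, set $\eta_k(\gamma,\gamma')=\sum_{i\ge1}2^{-i}|\operatorname{Tr}J^{(k)}_i(\gamma-\gamma')|$, and let $C([0,T],\mathcal L^1_k)$ be the space of functions $[0,T]\to\mathcal L^1_k$ that are continuous with respect to the metric $\eta_k$. For $1\le j\le k$ let $B_{j,k+1}\gamma^{(k+1)}=\operatorname{Tr}_{k+1}[\delta(x_j-x_{k+1}),\gamma^{(k+1)}]$, where $\operatorname{Tr}_{k+1}$ is the partial trace over the $(k+1)$-th particle, that is, in terms of kernels, $$(B_{j,k+1}\gamma^{(k+1)})(\mathbf x_k;\mathbf x_k')=\int dx_{k+1}\,\bigl(\delta(x_j-x_{k+1})-\delta(x_j'-x_{k+1})\bigr)\,\gamma^{(k+1)}(\mathbf x_k,x_{k+1};\mathbf x_k',x_{k+1});$$ here, for a fixed Schwartz function $h:\mathbb R^2\to\mathbb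 R$ with $\int h=1$, $\delta$ is the limit of $\varepsilon^{-2}h(\cdot/\varepsilon)$ as $\varepsilon\to0^+$, the limit of the resulting operators being taken weakly on Schwartz functions. Let $\mathcal U^{(k)}(t)\gamma=e^{it\sum_{j=1}^k\Delta_{x_j}}\,\gamma\,e^{-it\sum_{j=1}^k\Delta_{x_j}}$ and $S^{(k,\alpha)}=\prod_{j=1}^k(1-\Delta_{x_j})^{\alpha/2}(1-\Delta_{x_j'})^{\alpha/2}$. **Theorem.** Fix $\alpha>1/2$, $T>0$, $b_0\in\mathbb R$ and $\Gamma=\{\gamma^{(k)}\}_{k\ge1}\in\bigoplus_{k\ge1}\mathcal L^1_k$. There is at most one family $\Gamma_t=\{\gamma^{(k)}_t\}_{k\ge1}\in\bigoplus_{k\ge1}C([0,T],\mathcal L^1_k)$ such that every $\gamma^{(k)}_t$ is symmetric with respect to permutations of the $k$ particles, i.e. $\gamma^{(k)}_t(x_{\sigma(1)},\dots,x_{\sigma(k)};x'_{\sigma(1)},\dots,x'_{\sigma(k)})=\gamma^{(k)}_t(\mathbf x_k;\mathbf x'_k)$ for all permutations $\sigma$; such that $\Gamma_{t=0}=\Gamma$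 and, for all $k\ge1$ and $t\in[0,T]$, $$\gamma^{(k)}_t=\mathcal U^{(k)}(t)\gamma^{(k)}-ib_0\sum_{j=1}^k\int_0^t ds\;\mathcal U^{(k)}(t-s)\,B_{j,k+1}\gamma^{(k+1)}_s ;$$ and such that, for some constant $C$, $$\bigl\|S^{(k,\alpha)}B_{j,k+1}\gamma^{(k+1)}_s\bigr\|_{L^2(\mathbb R^{2k}\times\mathbb R^{2k})}\le C^k\qquad\text{for all }k\ge1,\ 1\le j\le k,\ s\in[0,T].$$ (The constant $C$ may differ from one family to another.) -/

import Mathlib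

open MeasureTheory Filter Topology Set
open scoped FourierTransform SchwartzMap ENNReal ComplexConjugate BoundedContinuousFunction
open scoped InnerProductSpace

noncomputable section

namespace GPHierarchy

/-! ### Configurations -/

/-- One-particle position space `Λ = ℝ²`. -/
abbrev Plane : Type := EuclideanSpace ℝ (Fin 2)

/-- The configuration space `Λ^k = ℝ^{2k}` of `k` particles; `x (j, a)` is the `a`-th coordinate of
the `j`-th particle. -/
abbrev Config (k : ℕ) : Type := EuclideanSpace ℝ (Fin k × Fin 2)

/-- The space `Λ^k × Λ^k` of pairs `(𝐱 ; 𝐱')`, with its Euclidean structure. -/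
abbrev PairConfig (k : ℕ) : Type := WithLp 2 (Config k × Config k)

/-- The position `x_j ∈ ℝ²` of the `j`-th particle. -/
def pos {k : ℕ} (x : Config k) (j : Fin k) : Plane := WithLp.toLp 2 fun a => x (j, a)

/-- The first `k` of `k + 1` particles. -/
def firstParticles {k : ℕ} (x : Config (k + 1)) : Config k :=
  WithLp.toLp 2 fun p => x (p.1.castSucc, p.2)

/-- The configuration with particles relabelled by `σ`: the `j`-th particle of `relabel σ x` is
the `σ j`-th particle of `x`. -/
def relabel {k : ℕ} (σ : Equiv.Perm (Fin k)) (x : Config k) : Config k :=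
  WithLp.toLp 2 fun p => x (σ p.1, p.2)

lemma continuous_pos {k : ℕ} (j : Fin k) : Continuous fun x : Config k => pos x j := by
  unfold pos
  fun_prop

lemma measurePreserving_relabel {k : ℕ} (σ : Equiv.Perm (Fin k)) :
    MeasurePreserving (relabel (k := k) σ) := by
  have h := (LinearIsometryEquiv.piLpCongrLeft 2 ℝ ℝ
    (Equiv.prodCongr σ.symm (Equiv.refl (Fin 2)))).measurePreserving
  have e : relabel (k := k) σ = (LinearIsometryEquiv.piLpCongrLeft 2 ℝ ℝ
    (Equiv.prodCongr σ.symm (Equiv.refl (Fin 2)))) := by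
    funext x
    ext p
    simp [relabel, LinearIsometryEquiv.piLpCongrLeft_apply, Equiv.piCongrLeft'_apply, Prod.map]
  rw [e]
  exact h

/-- `(x_1, …, x_{k+1}) ↦ ((x_1, …, x_k), x_{k+1})` preserves Lebesgue measure. -/
lemma measurePreserving_split (k : ℕ) :
    MeasurePreserving (fun x : Config (k + 1) => (firstParticles x, pos x (Fin.last k)))
      volume (volume.prod volume) := by
  let e : (Fin k × Fin 2) ⊕ Fin 2 ≃ Fin (k + 1) × Fin 2 :=
    ((Equiv.sumCongr (Equiv.refl _) (Equiv.uniqueProd (Fin 2) (Fin 1)).symm).trans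
      (Equiv.sumProdDistrib (Fin k) (Fin 1) (Fin 2)).symm).trans
      (Equiv.prodCongr finSumFinEquiv (Equiv.refl _))
  have h1 := PiLp.volume_preserving_ofLp (Fin (k + 1) × Fin 2)
  have h2 := (volume_measurePreserving_piCongrLeft (fun _ : Fin (k + 1) × Fin 2 => ℝ) e).symm
  have h3 := volume_measurePreserving_sumPiEquivProdPi
    (fun _ : (Fin k × Fin 2) ⊕ Fin 2 => ℝ)
  have h4 := (PiLp.volume_preserving_toLp (Fin k × Fin 2)).prod
    (PiLp.volume_preserving_toLp (Fin 2))
  have h := h4.comp (h3.comp (h2.comp h1))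
  have heq : (fun x : Config (k + 1) => (firstParticles x, pos x (Fin.last k))) =
      Prod.map (WithLp.toLp 2) (WithLp.toLp 2) ∘
        (MeasurableEquiv.sumPiEquivProdPi (fun _ : (Fin k × Fin 2) ⊕ Fin 2 => ℝ)) ∘
        (MeasurableEquiv.piCongrLeft (fun _ : Fin (k + 1) × Fin 2 => ℝ) e).symm ∘
        WithLp.ofLp := by
    funext x
    rfl
  rw [heq]
  exact h

/-! ### Hilbert spaces and operators -/

/-- `L²(Λ^k)`. -/
abbrev L2 (k : ℕ) : Type := Lp ℂ 2 (volume : Measure (Config k))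

/-- `L²(Λ^k × Λ^k)`, the space of Hilbert–Schmidt kernels `K(𝐱 ; 𝐱')`. -/
abbrev KernelSpace (k : ℕ) : Type := Lp ℂ 2 (volume : Measure (PairConfig k))

/-- Bounded operators on `L²(Λ^k)`. -/
abbrev Op (k : ℕ) : Type := L2 k →L[ℂ] L2 k

/-- A bounded operator `A` on a Hilbert space is trace class when `A = ∑ₙ |φₙ⟩⟨ψₙ|` with
`∑ₙ ‖φₙ‖ ‖ψₙ‖ < ∞`. -/
def IsTraceClass {H : Type*} [NormedAddCommGroup H] [InnerProductSpace ℂ H] (A : H →L[ℂ] H) :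
    Prop :=
  ∃ φ ψ : ℕ → H, Summable (fun n => ‖φ n‖ * ‖ψ n‖) ∧
    ∀ u : H, HasSum (fun n => ⟪ψ n, u⟫_ℂ • φ n) (A u)

section Trace

variable (H : Type*) [NormedAddCommGroup H] [InnerProductSpace ℂ H] [CompleteSpace H]

/-- Index set of a chosen Hilbert basis. -/
def basisIndex : Set H := (exists_hilbertBasis ℂ H).choose

/-- A chosen Hilbert basis; traces of trace class operators do not depend on the choice. -/
def basis : HilbertBasis (basisIndex H) ℂ H := (exists_hilbertBasis ℂ H).choose_spec.choose

variable {H}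

/-- The trace `Tr A = ∑ᵢ ⟨eᵢ, A eᵢ⟩` (meaningful for trace class `A`). -/
def opTrace (A : H →L[ℂ] H) : ℂ := ∑' i, ⟪basis H i, A (basis H i)⟫_ℂ

end Trace

section Multiplication

variable {X : Type*} [TopologicalSpace X] [MeasurableSpace X] [BorelSpace X]

lemma memLp_top_bcf (m : X →ᵇ ℂ) (μ : Measure X) : MemLp m ∞ μ :=
  memLp_top_of_bound m.continuous.aestronglyMeasurable ‖m‖
    (Eventually.of_forall fun x => m.norm_coe_le_norm x)

/-- Multiplication by the bounded continuous function `m`, as an operator on `L²`. -/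
def mulOp (m : X →ᵇ ℂ) (μ : Measure X) : Lp ℂ 2 μ →L[ℂ] Lp ℂ 2 μ :=
  (ContinuousLinearMap.mul ℂ ℂ).holderL μ ∞ 2 2 ((memLp_top_bcf m μ).toLp m)

lemma coeFn_mulOp (m : X →ᵇ ℂ) (μ : Measure X) (u : Lp ℂ 2 μ) :
    mulOp m μ u =ᵐ[μ] fun x => m x * u x := by
  have h := (ContinuousLinearMap.mul ℂ ℂ).coeFn_holder (r := 2) ((memLp_top_bcf m μ).toLp m) u
  filter_upwards [h, (memLp_top_bcf m μ).coeFn_toLp] with x hx hm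
  rw [← hm]
  exact hx

end Multiplication

/-! ### Free evolution -/

section Evolution

variable {E : Type*} [NormedAddCommGroup E] [InnerProductSpace ℝ E] [FiniteDimensional ℝ E]
  [MeasurableSpace E] [BorelSpace E]

/-- The function `ξ ↦ e^{-i t θ(ξ)}`. -/
def phase (θ : C(E, ℝ)) (t : ℝ) : E →ᵇ ℂ :=
  BoundedContinuousFunction.ofNormedAddCommGroup
    (fun ξ => Complex.exp (-(Complex.I * ((t * θ ξ : ℝ) : ℂ)))) (by fun_prop) 1
    (fun ξ => by
      rw [← mul_neg, ← Complex.ofReal_neg, mul_comm, Complex.norm_exp_ofReal_mul_I])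

/-- The unitary group `e^{-itθ(D)}` on `L²(E)`: the Fourier transform of `u` is multiplied by
`e^{-itθ(ξ)}`. -/
def fourierFlow (θ : C(E, ℝ)) (t : ℝ) :
    Lp ℂ 2 (volume : Measure E) →L[ℂ] Lp ℂ 2 (volume : Measure E) :=
  (Lp.fourierTransformₗᵢ E ℂ).symm.toContinuousLinearEquiv.toContinuousLinearMap ∘L
    mulOp (phase θ t) volume ∘L
      (Lp.fourierTransformₗᵢ E ℂ).toContinuousLinearEquiv.toContinuousLinearMap

end Evolution

/-- The symbol of `-∑ⱼ Δ_{x_j}`; the Fourier transform is `û(ξ) = ∫ e^{-2πi x·ξ} u(x) dx`, so that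
`-Δ` becomes multiplication by `4π²|ξ|²`. -/
def laplaceSymbol (k : ℕ) : C(Config k, ℝ) where
  toFun ξ := 4 * Real.pi ^ 2 * ‖ξ‖ ^ 2

/-- The symbol of `-∑ⱼ Δ_{x_j} + ∑ⱼ Δ_{x'_j}`. -/
def pairSymbol (k : ℕ) : C(PairConfig k, ℝ) where
  toFun ζ := laplaceSymbol k ζ.fst - laplaceSymbol k ζ.snd

/-- `𝒰^{(k)}(t) A = e^{it∑ⱼΔⱼ} A e^{-it∑ⱼΔⱼ}` on operators. -/
def freeOp {k : ℕ} (t : ℝ) (A : Op k) : Op k :=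
  fourierFlow (laplaceSymbol k) t ∘L A ∘L fourierFlow (laplaceSymbol k) (-t)

/-- `𝒰^{(k)}(t)` on integral kernels: if `A` has kernel `K`, then `e^{it∑ⱼΔⱼ} A e^{-it∑ⱼΔⱼ}` has
kernel `e^{it∑ⱼ(Δ_{x_j} - Δ_{x'_j})} K`. -/
def freeKernel {k : ℕ} (t : ℝ) : KernelSpace k →L[ℂ] KernelSpace k :=
  fourierFlow (pairSymbol k) t

/-! ### Kernels, permutations, Sobolev weights -/

/-- `⟨f, K g⟩ = ∫∫ conj f(𝐱) K(𝐱 ; 𝐱') g(𝐱') d𝐱 d𝐱'`. -/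
def kernelForm {k : ℕ} (f : L2 k) (K : KernelSpace k) (g : L2 k) : ℂ :=
  ∫ z : PairConfig k, conj (f z.fst) * K z * g z.snd

/-- The operator `A` has the square integrable kernel `K`. -/
def HasKernel {k : ℕ} (A : Op k) (K : KernelSpace k) : Prop :=
  ∀ f g : L2 k, ⟪f, A g⟫_ℂ = kernelForm f K g

/-- The unitary operator `u ↦ u(x_{σ(1)}, …, x_{σ(k)})` on `L²(Λ^k)`. -/
def permOp {k : ℕ} (σ : Equiv.Perm (Fin k)) : Op k :=
  (Lp.compMeasurePreservingₗᵢ ℂ (relabel σ) (measurePreserving_relabel σ)).toContinuousLinearMap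

/-- `A` is symmetric with respect to permutations of the particles: for kernels,
`A(x_{σ(1)}, …, x_{σ(k)} ; x'_{σ(1)}, …, x'_{σ(k)}) = A(𝐱 ; 𝐱')`. -/
def IsPermSymmetric {k : ℕ} (A : Op k) : Prop :=
  ∀ σ : Equiv.Perm (Fin k), permOp σ ∘L A = A ∘L permOp σ

/-- The symbol of `S^{(k,α)} = ∏ⱼ (1 - Δ_{x_j})^{α/2} (1 - Δ_{x'_j})^{α/2}`. -/
def sobolevWeight {k : ℕ} (α : ℝ) (ζ : PairConfig k) : ℝ :=
  ∏ j : Fin k, (1 + 4 * Real.pi ^ 2 * ‖pos ζ.fst j‖ ^ 2) ^ (α / 2) *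
    (1 + 4 * Real.pi ^ 2 * ‖pos ζ.snd j‖ ^ 2) ^ (α / 2)

/-- `K` is in the domain of `S^{(k,α)}`, and `G = S^{(k,α)} K` in `L²(Λ^k × Λ^k)`. -/
def IsSobolevImage {k : ℕ} (α : ℝ) (K G : KernelSpace k) : Prop :=
  (𝓕 G : KernelSpace k) =ᵐ[volume]
    fun ζ => (sobolevWeight α ζ : ℂ) * (𝓕 K : KernelSpace k) ζ

/-! ### The collision operator -/

lemma memLp_tensor {k : ℕ} (f : L2 k) (e : Lp ℂ 2 (volume : Measure Plane)) :
    MemLp (fun x : Config (k + 1) => f (firstParticles x) * e (pos x (Fin.last k))) 2 volume := by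
  have h : MemLp (fun z : Config k × Plane => f z.1 * e z.2) 2 (volume.prod volume) := by
    have hf := Lp.memLp f
    have he := Lp.memLp e
    have hm : AEStronglyMeasurable (fun z : Config k × Plane => f z.1 * e z.2)
        (volume.prod volume) := hf.1.comp_fst.mul he.1.comp_snd
    rw [memLp_two_iff_integrable_sq_norm hm]
    have := ((memLp_two_iff_integrable_sq_norm hf.1).1 hf).mul_prod
      ((memLp_two_iff_integrable_sq_norm he.1).1 he)
    simpa [mul_pow] using this
  exact h.comp_measurePreserving (measurePreserving_split k)

/-- `(f ⊗ e)(x_1, …, x_{k+1}) = f(x_1, …, x_k) e(x_{k+1})`. -/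
def tensor {k : ℕ} (f : L2 k) (e : Lp ℂ 2 (volume : Measure Plane)) : L2 (k + 1) :=
  (memLp_tensor f e).toLp _

/-- The matrix element `⟨f, (Tr_{k+1} A) g⟩ = ∑ᵢ ⟨f ⊗ eᵢ, A (g ⊗ eᵢ)⟩` of the partial trace over the
`(k+1)`-th particle, `(eᵢ)` being a Hilbert basis of `L²(Λ)`; for trace class `A` it does not
depend on the basis. -/
def partialTraceForm {k : ℕ} (f : L2 k) (A : Op (k + 1)) (g : L2 k) : ℂ :=
  ∑' i, ⟪tensor f (basis (Lp ℂ 2 (volume : Measure Plane)) i),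
    A (tensor g (basis (Lp ℂ 2 (volume : Measure Plane)) i))⟫_ℂ

/-- The function `h_ε(x_j - x_{k+1})` on `Λ^{k+1}`, with `h_ε(x) = ε⁻² h(x/ε)`. -/
def mollifiedDelta {k : ℕ} (h : 𝓢(Plane, ℝ)) (j : Fin k) (ε : ℝ) : Config (k + 1) →ᵇ ℂ :=
  BoundedContinuousFunction.ofNormedAddCommGroup
    (fun x => (((ε⁻¹) ^ 2 *
      h (ε⁻¹ • (pos x j.castSucc - pos x (Fin.last k))) : ℝ) : ℂ))
    (by
      have h1 := continuous_pos (k := k + 1) j.castSucc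
      have h2 := continuous_pos (k := k + 1) (Fin.last k)
      have h3 := h.continuous
      fun_prop)
    ((ε⁻¹) ^ 2 * ‖h.toBoundedContinuousFunction‖)
    (fun x => by
      rw [Complex.norm_real, norm_mul, Real.norm_of_nonneg (by positivity)]
      gcongr
      exact h.toBoundedContinuousFunction.norm_coe_le_norm _)

/-- The commutator `[h_ε(x_j - x_{k+1}), A]`. -/
def mollifiedCommutator {k : ℕ} (h : 𝓢(Plane, ℝ)) (j : Fin k) (ε : ℝ) (A : Op (k + 1)) :
    Op (k + 1) :=
  mulOp (mollifiedDelta h j ε) volume ∘L A - A ∘L mulOp (mollifiedDelta h j ε) volume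

/-- `B_{j,k+1} A = K`, where `B_{j,k+1} A = Tr_{k+1} [δ(x_j - x_{k+1}), A]`. The delta function is
the limit of the approximate identity `h_ε` as `ε → 0⁺`, and the limit of the operators
`Tr_{k+1} [h_ε(x_j - x_{k+1}), A]` is taken in the weak sense, on Schwartz functions; the limit is
required to have a square integrable kernel. -/
def HasCollision {k : ℕ} (h : 𝓢(Plane, ℝ)) (j : Fin k) (A : Op (k + 1)) (K : KernelSpace k) :
    Prop :=
  ∀ f g : 𝓢(Config k, ℂ),
    Tendsto (fun ε : ℝ => partialTraceForm (f.toLp 2) (mollifiedCommutator h j ε A) (g.toLp 2))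
      (𝓝[>] 0) (𝓝 (kernelForm (f.toLp 2) K (g.toLp 2)))

/-! ### The metric on trace class operators -/

/-- `(J i)` is a sequence of compact operators of norm at most one, dense in the unit ball of the
space of compact operators on `L²(Λ^k)`. -/
structure IsDenseCompactSeq {k : ℕ} (J : ℕ → Op k) : Prop where
  compact : ∀ i, IsCompactOperator (J i)
  norm_le_one : ∀ i, ‖J i‖ ≤ 1
  dense : ∀ A : Op k, IsCompactOperator A → ‖A‖ ≤ 1 → A ∈ closure (range J)

/-- The metric `η_k(A, A') = ∑_{i ≥ 1} 2^{-i} |Tr J_i (A - A')|` (with `J` indexed from `0`). -/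
def etaDist {k : ℕ} (J : ℕ → Op k) (A A' : Op k) : ℝ :=
  ∑' i : ℕ, (2 : ℝ)⁻¹ ^ (i + 1) * ‖opTrace (J i ∘L (A - A'))‖

/-- `t ↦ γ_t` is an element of `C([0,T], 𝓛¹_k)`: it takes values in the trace class operators and is
continuous for the metric `η_k`. -/
structure IsTraceClassCurve {k : ℕ} (J : ℕ → Op k) (T : ℝ) (γ : ℝ → Op k) : Prop where
  traceClass : ∀ t ∈ Icc 0 T, IsTraceClass (γ t)
  continuous : ∀ t ∈ Icc 0 T, Tendsto (fun s => etaDist J (γ s) (γ t)) (𝓝[Icc 0 T] t) (𝓝 0)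

/-! ### The infinite hierarchy -/

/-- `Γ_t = {γ_t^{(k)}}_{k ≥ 1}` is a solution on `[0,T]`, in `⨁_{k ≥ 1} C([0,T], 𝓛¹_k)`, of the
infinite hierarchy
`γ_t^{(k)} = 𝒰^{(k)}(t) Γ^{(k)} - i b₀ ∑_{j=1}^k ∫_0^t 𝒰^{(k)}(t-s) B_{j,k+1} γ_s^{(k+1)} ds`
with initial data `Γ`. The equation is an identity between operators with square integrable
kernels, and the integral is a Bochner integral of kernels. -/
structure IsHierarchySolution (h : 𝓢(Plane, ℝ)) (b₀ T : ℝ) (J : ∀ k, ℕ → Op k)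
    (Γ : ∀ k, Op k) (γ : ∀ k, ℝ → Op k) : Prop where
  curve : ∀ k, 1 ≤ k → IsTraceClassCurve (J k) T (γ k)
  symmetric : ∀ k, 1 ≤ k → ∀ t ∈ Icc 0 T, IsPermSymmetric (γ k t)
  initial : ∀ k, 1 ≤ k → γ k 0 = Γ k
  equation : ∀ k, 1 ≤ k → ∃ B : Fin k → ℝ → KernelSpace k,
    (∀ j, ∀ s ∈ Icc 0 T, HasCollision h j (γ (k + 1) s) (B j s)) ∧
    ∀ t ∈ Icc 0 T,
      (∀ j, IntervalIntegrable (fun s => freeKernel (t - s) (B j s)) volume 0 t) ∧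
      HasKernel (γ k t - freeOp t (Γ k))
        (-(Complex.I * (b₀ : ℂ)) • ∑ j, ∫ s in (0 : ℝ)..t, freeKernel (t - s) (B j s))

/-- The bounds `‖S^{(k,α)} B_{j,k+1} γ_s^{(k+1)}‖_{L²} ≤ C^k` for all `k ≥ 1`, `j = 1, …, k` and
`s ∈ [0,T]`. -/
def CollisionBound (h : 𝓢(Plane, ℝ)) (α T C : ℝ) (γ : ∀ k, ℝ → Op k) : Prop :=
  ∀ k, 1 ≤ k → ∀ j : Fin k, ∀ s ∈ Icc 0 T, ∃ K G : KernelSpace k,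
    HasCollision h j (γ (k + 1) s) K ∧ IsSobolevImage α K G ∧ ‖G‖ ≤ C ^ k

end GPHierarchy

end

/-!
The difference of two solutions is studied through its matrix elements in the interaction picture
between products of functions from an orthonormal family, smooth and compactly supported in momentum
space, weighted by the symbol of `S^{(k,α)}` (`exists_isSmoothBasis`). A coefficient is indexed by a
word: the `m`-th letter is the pair of indices belonging to `x_m` and `x'_m`. The free evolution
disappears, and a coefficient is the sum over `j` of primitives of coefficients of the `j`-th
collision term. By the assumed collision bound and Bessel's inequality these sources are square
summable over the words of length `k`, with norm at most `R ^ k` (`IsCollisionKernel.isWordEquation`).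

The sources are then expressed by the coefficients of the next level. For fixed `ε`, the trace of the
commutator with `ε⁻² h(·/ε)` is a pairing with the square integrable kernel of the trace class
operator (`exists_isFourierKernel`, `IsSmoothBasis.partialTraceForm_sub_eq`). As a functional of the coefficients it
satisfies a square function estimate in time, uniformly in `ε`
(`IsSmoothBasis.lintegral_collisionFunctional_le`). This is local smoothing: the collision weight,
squared and averaged over approximately resonant momenta, is bounded when `α > 1/2`
(`exists_resonanceBound`). As the coefficients are primitives of square summable sources, the
restriction to finitely many letters costs an error that is small uniformly in `ε`
(`lintegral_enorm_sub_le`), so the limits in `ε` and in the set of letters may be interchanged. With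
permutation symmetry, the `j`-th source is the collision operator at position `j` of words, which
splits one letter in two (`IsCollisionKernel.tendsto_sourceCoeff`).

There remains a statement about hierarchies of words (`IsWordHierarchy.eq_zero`). Iterating the
equation yields time-ordered products of collision operators. Collisions of distinct particles
commute, so these products sum up to products of operators attached to planar binary trees
(`hierarchy_eq_integral_forestOp`), one tree for each letter. A tree with `n` nodes costs `n` factors
of the one-collision estimate, of size `√|t - s|`, and there are at most `4 ^ n` such trees
(`treeRate_bound`); no factorials appear. On short time intervals the remainder after `m` steps decays
geometrically, which compensates the bound `R ^ k` on the sources, and finitely many intervals cover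
`[0, T]`. The coefficients vanish, and the family is total, so the two solutions agree.
-/

noncomputable section

namespace GPHierarchy

/-! ### Planar trees of collisions -/

section Trees

variable {H : Type*} [NormedAddCommGroup H] [NormedSpace ℂ H]

/-- The sum over all planar binary trees with `n` nodes, hanging at position `j`, of the iterated
collision operators: every node carries a time between `s` and the time of its parent, the root
time is at most `t`, and `V i r` is the collision, at time `r`, of the particles `i` and `i + 1`
into the particle `i`. The left subtree of the root stays at position `j`; the right subtree sits
at `j + 1` once the left one has been collapsed, hence at `j + 1 + i` before, `i` being the number
of nodes of the left subtree. -/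
def treeOp (V : ℕ → ℝ → H →L[ℂ] H) : ℕ → ℕ → ℝ → ℝ → H →L[ℂ] H
  | 0 => fun _ _ _ => 1
  | n + 1 => fun j s t => ∫ r in s..t, V j r * ∑ i : Fin (n + 1),
      treeOp V i j s r * treeOp V (n - i) (j + 1 + i) s r

/-- The rate of change of `treeOp V (n + 1) j s` at time `r`. -/
def treeRate (V : ℕ → ℝ → H →L[ℂ] H) (n j : ℕ) (s r : ℝ) : H →L[ℂ] H :=
  V j r * ∑ i : Fin (n + 1), treeOp V i j s r * treeOp V (n - i) (j + 1 + i) s r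

/-- The sum over all forests with `q` trees at the positions `p, …, p + q - 1` and `n` nodes in
total. -/
def forestOp (V : ℕ → ℝ → H →L[ℂ] H) : ℕ → ℕ → ℕ → ℝ → ℝ → H →L[ℂ] H
  | 0 => fun n _ _ _ => if n = 0 then 1 else 0
  | q + 1 => fun n p s t => ∑ x ∈ Finset.HasAntidiagonal.antidiagonal n,
      treeOp V x.1 p s t * forestOp V q x.2 (p + 1 + x.1) s t

variable {V : ℕ → ℝ → H →L[ℂ] H}

lemma treeOp_zero (j : ℕ) (s t : ℝ) : treeOp V 0 j s t = 1 := by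
  rw [treeOp]

lemma treeOp_succ (n j : ℕ) (s t : ℝ) :
    treeOp V (n + 1) j s t = ∫ r in s..t, treeRate V n j s r := by
  rw [treeOp]; rfl

lemma treeRate_eq (n j : ℕ) (s r : ℝ) :
    treeRate V n j s r = V j r * ∑ x ∈ Finset.HasAntidiagonal.antidiagonal n,
      treeOp V x.1 j s r * treeOp V x.2 (j + 1 + x.1) s r := by
  rw [treeRate, Finset.Nat.sum_antidiagonal_eq_sum_range_succ_mk, Finset.sum_range]

lemma continuous_treeOp (hV : ∀ j, Continuous (V j)) (n : ℕ) :
    ∀ j, Continuous fun p : ℝ × ℝ => treeOp V n j p.1 p.2 := by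
  induction n using Nat.strong_induction_on with
  | _ n ih =>
    intro j
    rcases n with _ | n
    · simp only [treeOp_zero]; exact continuous_const
    · have hr : Continuous fun p : ℝ × ℝ => treeRate V n j p.1 p.2 := by
        unfold treeRate
        refine ((hV j).comp continuous_snd).mul (continuous_finsetSum _ fun i _ => ?_)
        exact (ih i (by omega) j).mul (ih (n - i) (by omega) _)
      have h0 : ∀ p : ℝ × ℝ, treeOp V (n + 1) j p.1 p.2 =
          (∫ r in (0 : ℝ)..p.2, treeRate V n j p.1 r) - ∫ r in (0 : ℝ)..p.1,
            treeRate V n j p.1 r := by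
        intro p
        have hc : Continuous fun r => treeRate V n j p.1 r :=
          hr.comp (Continuous.prodMk_right p.1)
        rw [treeOp_succ, intervalIntegral.integral_interval_sub_left
          (hc.intervalIntegrable _ _) (hc.intervalIntegrable _ _)]
      simp only [h0]
      have hu : Continuous (Function.uncurry fun (p : ℝ × ℝ) (r : ℝ) => treeRate V n j p.1 r) :=
        hr.comp (by fun_prop : Continuous fun x : (ℝ × ℝ) × ℝ => (x.1.1, x.2))
      exact (intervalIntegral.continuous_parametric_intervalIntegral_of_continuous hu
        continuous_snd).sub (intervalIntegral.continuous_parametric_intervalIntegral_of_continuous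
          hu continuous_fst)

lemma continuous_treeRate (hV : ∀ j, Continuous (V j)) (n j : ℕ) :
    Continuous fun p : ℝ × ℝ => treeRate V n j p.1 p.2 := by
  unfold treeRate
  refine ((hV j).comp continuous_snd).mul (continuous_finsetSum _ fun i _ => ?_)
  exact (continuous_treeOp hV i j).mul (continuous_treeOp hV (n - i) _)

lemma continuous_forestOp (hV : ∀ j, Continuous (V j)) (q : ℕ) :
    ∀ n p, Continuous fun x : ℝ × ℝ => forestOp V q n p x.1 x.2 := by
  induction q with
  | zero => intro n p; simp only [forestOp]; exact continuous_const
  | succ q ih =>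
    intro n p
    simp only [forestOp]
    exact continuous_finsetSum _ fun x _ => (continuous_treeOp hV _ _).mul (ih _ _)

lemma forestOp_zero_right (q : ℕ) : ∀ p s t, forestOp V q 0 p s t = 1 := by
  induction q with
  | zero => intro p s t; simp [forestOp]
  | succ q ih => intro p s t; simp [forestOp, treeOp_zero, ih]

lemma forestOp_self (q : ℕ) : ∀ n p s, forestOp V q (n + 1) p s s = 0 := by
  induction q with
  | zero => intro n p s; simp [forestOp]
  | succ q ih =>
    intro n p s
    rw [forestOp]
    refine Finset.sum_eq_zero fun x hx => ?_
    obtain ⟨_ | a, b⟩ := x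
    · have : b = n + 1 := by simpa using hx
      subst this
      simp [ih]
    · simp [treeOp_succ]

variable [CompleteSpace H]

/-- A tree commutes with a collision to its right, up to the shift of positions caused by the
particles the tree absorbs. -/
lemma treeOp_mul_comm (hV : ∀ j, Continuous (V j))
    (hcomm : ∀ i j, i < j → ∀ r r', V i r * V (j + 1) r' = V j r' * V i r) (n : ℕ) :
    ∀ i j, i < j → ∀ s t r, treeOp V n i s t * V (j + n) r = V j r * treeOp V n i s t := by
  induction n using Nat.strong_induction_on with
  | _ n ih =>
    intro i j hij s t r
    rcases n with _ | n
    · simp [treeOp_zero]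
    · have hc : Continuous fun r' => treeRate V n i s r' :=
        (continuous_treeRate hV n i).comp (Continuous.prodMk_right s)
      have h1 : treeOp V (n + 1) i s t * V (j + (n + 1)) r =
          ∫ r' in s..t, treeRate V n i s r' * V (j + (n + 1)) r := by
        rw [treeOp_succ]
        exact (((ContinuousLinearMap.mul ℂ (H →L[ℂ] H)).flip
          (V (j + (n + 1)) r)).intervalIntegral_comp_comm (hc.intervalIntegrable _ _)).symm
      have h2 : V j r * treeOp V (n + 1) i s t = ∫ r' in s..t, V j r * treeRate V n i s r' := by
        rw [treeOp_succ]
        exact ((ContinuousLinearMap.mul ℂ (H →L[ℂ] H)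
          (V j r)).intervalIntegral_comp_comm (hc.intervalIntegrable _ _)).symm
      rw [h1, h2]
      congr 1
      funext r'
      simp only [treeRate]
      rw [← mul_assoc, ← hcomm i j hij, mul_assoc, mul_assoc, Finset.mul_sum, Finset.sum_mul]
      congr 1
      refine Finset.sum_congr rfl fun l _ => ?_
      have hl := l.2
      have e1 := ih (n - l) (by omega) (i + 1 + l) (j + 1 + l) (by omega) s r' r
      have e2 := ih l (by omega) i (j + 1) (by omega) s r' r
      rw [show j + 1 + l + (n - l) = j + (n + 1) by omega] at e1
      rw [mul_assoc, e1, ← mul_assoc, e2, mul_assoc]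

lemma hasDerivAt_treeOp_succ (hV : ∀ j, Continuous (V j)) (n j : ℕ) (s t : ℝ) :
    HasDerivAt (fun t => treeOp V (n + 1) j s t) (treeRate V n j s t) t := by
  have hc : Continuous fun r' => treeRate V n j s r' :=
    (continuous_treeRate hV n j).comp (Continuous.prodMk_right s)
  simp only [treeOp_succ]
  exact intervalIntegral.integral_hasDerivAt_right (hc.intervalIntegrable _ _)
    (hc.stronglyMeasurableAtFilter _ _) hc.continuousAt

lemma sum_antidiagonal_assoc {M : Type*} [AddCommMonoid M] (n : ℕ) (f : ℕ → ℕ → ℕ → M) :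
    ∑ x ∈ Finset.HasAntidiagonal.antidiagonal n,
      ∑ y ∈ Finset.HasAntidiagonal.antidiagonal x.1, f y.1 y.2 x.2 =
    ∑ x ∈ Finset.HasAntidiagonal.antidiagonal n,
      ∑ y ∈ Finset.HasAntidiagonal.antidiagonal x.2, f x.1 y.1 y.2 := by
  rw [Finset.sum_sigma', Finset.sum_sigma']
  refine Finset.sum_nbij' (fun x => ⟨(x.2.1, x.2.2 + x.1.2), (x.2.2, x.1.2)⟩)
    (fun x => ⟨(x.1.1 + x.2.1, x.2.2), (x.1.1, x.2.1)⟩) ?_ ?_ ?_ ?_ ?_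
  · rintro ⟨⟨a, b⟩, ⟨c, d⟩⟩ h
    simp only [Finset.mem_sigma, Finset.HasAntidiagonal.mem_antidiagonal] at h ⊢
    exact ⟨by omega, trivial⟩
  · rintro ⟨⟨a, b⟩, ⟨c, d⟩⟩ h
    simp only [Finset.mem_sigma, Finset.HasAntidiagonal.mem_antidiagonal] at h ⊢
    exact ⟨by omega, trivial⟩
  · rintro ⟨⟨a, b⟩, ⟨c, d⟩⟩ h
    simp only [Finset.mem_sigma, Finset.HasAntidiagonal.mem_antidiagonal] at h
    obtain ⟨h1, h2⟩ := h
    subst h1 h2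
    rfl
  · rintro ⟨⟨a, b⟩, ⟨c, d⟩⟩ h
    simp only [Finset.mem_sigma, Finset.HasAntidiagonal.mem_antidiagonal] at h
    obtain ⟨h1, h2⟩ := h
    subst h1 h2
    rfl
  · rintro ⟨⟨a, b⟩, ⟨c, d⟩⟩ h
    rfl

/-- The forests solve the hierarchy: differentiating in time removes the last collision, which
joins two neighbouring trees of a forest with one more tree. -/
lemma hasDerivAt_forestOp (hV : ∀ j, Continuous (V j))
    (hcomm : ∀ i j, i < j → ∀ r r', V i r * V (j + 1) r' = V j r' * V i r) (q : ℕ) :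
    ∀ n p s t, HasDerivAt (fun t => forestOp V q (n + 1) p s t)
      (∑ i ∈ Finset.range q, V (p + i) t * forestOp V (q + 1) n p s t) t := by
  induction q with
  | zero =>
    intro n p s t
    simp only [forestOp, Finset.range_zero, Finset.sum_empty]
    exact hasDerivAt_const _ _
  | succ q ih =>
    intro n p s t
    -- the derivatives of the two factors, uniformly in the number of nodes
    let dT : ℕ → H →L[ℂ] H := fun a => Nat.casesOn a 0 fun a => treeRate V a p s t
    let dF : ℕ → ℕ → H →L[ℂ] H := fun b a => Nat.casesOn b 0 fun b =>
      ∑ i ∈ Finset.range q, V (p + 1 + a + i) t * forestOp V (q + 1) b (p + 1 + a) s t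
    have hT : ∀ a, HasDerivAt (fun t => treeOp V a p s t) (dT a) t := by
      rintro (_ | a)
      · simp only [treeOp_zero]; exact hasDerivAt_const _ _
      · exact hasDerivAt_treeOp_succ hV a p s t
    have hF : ∀ b a, HasDerivAt (fun t => forestOp V q b (p + 1 + a) s t) (dF b a) t := by
      rintro (_ | b) a
      · simp only [forestOp_zero_right]; exact hasDerivAt_const _ _
      · exact ih b (p + 1 + a) s t
    have hsum : HasDerivAt (fun t => forestOp V (q + 1) (n + 1) p s t)
        (∑ x ∈ Finset.HasAntidiagonal.antidiagonal (n + 1),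
          (dT x.1 * forestOp V q x.2 (p + 1 + x.1) s t +
            treeOp V x.1 p s t * dF x.2 x.1)) t := by
      simp only [forestOp]
      exact HasDerivAt.fun_sum fun x _ => (hT x.1).mul (hF x.2 x.1)
    convert! hsum using 1
    have hT0 : dT 0 = 0 := rfl
    have hT1 : ∀ a, dT (a + 1) = treeRate V a p s t := fun _ => rfl
    have hF0 : ∀ a, dF 0 a = 0 := fun _ => rfl
    have hF1 : ∀ b a, dF (b + 1) a = ∑ i ∈ Finset.range q,
      V (p + 1 + a + i) t * forestOp V (q + 1) b (p + 1 + a) s t := fun _ _ => rfl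
    clear_value dT dF
    rw [Finset.sum_add_distrib, Finset.sum_range_succ', add_comm]
    congr 1
    · rw [Finset.Nat.sum_antidiagonal_succ]
      simp only [hT0, hT1, zero_mul, zero_add, add_zero, treeRate_eq, Finset.sum_mul,
        Finset.mul_sum]
      have h := sum_antidiagonal_assoc n fun a b c => V p t * (treeOp V a p s t *
        treeOp V b (p + 1 + a) s t) * forestOp V q c (p + 1 + (a + b + 1)) s t
      have h1 : ∀ x ∈ Finset.HasAntidiagonal.antidiagonal n,
          ∑ y ∈ Finset.HasAntidiagonal.antidiagonal x.1, V p t * (treeOp V y.1 p s t *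
            treeOp V y.2 (p + 1 + y.1) s t) * forestOp V q x.2 (p + 1 + (x.1 + 1)) s t =
          ∑ y ∈ Finset.HasAntidiagonal.antidiagonal x.1, V p t * (treeOp V y.1 p s t *
            treeOp V y.2 (p + 1 + y.1) s t) * forestOp V q x.2 (p + 1 + (y.1 + y.2 + 1)) s t := by
        intro x _
        refine Finset.sum_congr rfl fun y hy => ?_
        rw [Finset.HasAntidiagonal.mem_antidiagonal.1 hy]
      rw [Finset.sum_congr rfl h1, h]
      simp only [forestOp, Finset.mul_sum]
      refine Finset.sum_congr rfl fun x _ => Finset.sum_congr rfl fun y _ => ?_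
      rw [show p + 1 + (x.1 + y.1 + 1) = p + 1 + x.1 + 1 + y.1 by omega]
      simp only [mul_assoc]
    · rw [Finset.Nat.sum_antidiagonal_succ']
      simp only [hF0, hF1, mul_zero, zero_add]
      rw [Finset.sum_congr rfl fun x _ => Finset.mul_sum _ _ _, Finset.sum_comm]
      refine Finset.sum_congr rfl fun i _ => ?_
      rw [forestOp, Finset.mul_sum]
      refine Finset.sum_congr rfl fun x _ => ?_
      rw [← mul_assoc, ← mul_assoc, show p + 1 + x.1 + i = (p + (i + 1)) + x.1 by omega,
        treeOp_mul_comm hV hcomm _ _ _ (by omega)]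

end Trees

/-! ### Bounds for sums over trees -/

section TreeBounds

variable {H : Type*} [NormedAddCommGroup H] [NormedSpace ℂ H]

lemma intervalIntegrable_clm_apply {Φ : ℝ → H →L[ℂ] H} (hΦ : Continuous Φ) {s t : ℝ} {f : ℝ → H}
    (hf : IntervalIntegrable f volume s t) :
    IntervalIntegrable (fun r => Φ r (f r)) volume s t := by
  obtain ⟨C, hC⟩ := (isCompact_uIcc (a := s) (b := t)).exists_bound_of_continuousOn
    hΦ.continuousOn
  rw [intervalIntegrable_iff] at hf ⊢
  refine Integrable.mono' (hf.norm.const_mul C) ?_ ?_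
  · exact (ContinuousLinearMap.id ℂ (H →L[ℂ] H)).aestronglyMeasurable_comp₂
      hΦ.aestronglyMeasurable hf.aestronglyMeasurable
  · refine (ae_restrict_iff' measurableSet_uIoc).2 (.of_forall fun r hr => ?_)
    exact (ContinuousLinearMap.le_opNorm _ _).trans
      (mul_le_mul_of_nonneg_right (hC r (uIoc_subset_uIcc hr)) (norm_nonneg _))

lemma integrable_simplex {G : ℝ → ℝ → H →L[ℂ] H}
    (hG : Continuous fun p : ℝ × ℝ => G p.1 p.2) {s t : ℝ} (hst : s ≤ t) {f : ℝ → H}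
    (hf : IntervalIntegrable f volume s t) :
    Integrable (fun p : ℝ × ℝ => {p : ℝ × ℝ | p.2 ≤ p.1}.indicator
      (fun p => G p.1 p.2 (f p.2)) p)
      ((volume.restrict (Ioc s t)).prod (volume.restrict (Ioc s t))) := by
  rw [intervalIntegrable_iff_integrableOn_Ioc_of_le hst] at hf
  obtain ⟨C, hC⟩ := ((isCompact_Icc (a := s) (b := t)).prod
    (isCompact_Icc (a := s) (b := t))).exists_bound_of_continuousOn hG.continuousOn
  refine Integrable.indicator ?_ (measurableSet_le measurable_snd measurable_fst)
  refine Integrable.mono' ((hf.norm.const_mul C).comp_snd _) ?_ ?_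
  · exact (ContinuousLinearMap.id ℂ (H →L[ℂ] H)).aestronglyMeasurable_comp₂
      hG.aestronglyMeasurable hf.aestronglyMeasurable.comp_snd
  · rw [Measure.prod_restrict]
    refine (ae_restrict_iff' (measurableSet_Ioc.prod measurableSet_Ioc)).2
      (.of_forall fun p hp => ?_)
    exact (ContinuousLinearMap.le_opNorm _ _).trans (mul_le_mul_of_nonneg_right
      (hC p ⟨Ioc_subset_Icc_self hp.1, Ioc_subset_Icc_self hp.2⟩) (norm_nonneg _))

lemma setIntegral_simplex_fst {E : Type*} [NormedAddCommGroup E] [NormedSpace ℝ E] {s t r : ℝ}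
    (hr : r ∈ Ioc s t) (g : ℝ → E) :
    ∫ r' in Ioc s t, {p : ℝ × ℝ | p.2 ≤ p.1}.indicator (fun p => g p.2) (r, r') =
      ∫ r' in s..r, g r' := by
  rw [intervalIntegral.integral_of_le hr.1.le]
  have : (fun r' => {p : ℝ × ℝ | p.2 ≤ p.1}.indicator (fun p => g p.2) (r, r')) =
      (Iic r).indicator g := by
    funext r'; by_cases h : r' ≤ r <;> simp [h]
  rw [this, setIntegral_indicator measurableSet_Iic]
  congr 2
  ext y; simp only [mem_inter_iff, mem_Ioc, mem_Iic]
  exact ⟨fun h => ⟨h.1.1, h.2⟩, fun h => ⟨⟨h.1, h.2.trans hr.2⟩, h.2⟩⟩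

lemma intervalIntegrable_simplex {G : ℝ → ℝ → H →L[ℂ] H}
    (hG : Continuous fun p : ℝ × ℝ => G p.1 p.2) {s t : ℝ} (hst : s ≤ t) {f : ℝ → H}
    (hf : IntervalIntegrable f volume s t) :
    IntervalIntegrable (fun r => ∫ r' in s..r, G r r' (f r')) volume s t := by
  rw [intervalIntegrable_iff_integrableOn_Ioc_of_le hst]
  refine (integrable_simplex hG hst hf).integral_prod_left.congr ?_
  refine (ae_restrict_iff' measurableSet_Ioc).2 (.of_forall fun r hr => ?_)
  exact setIntegral_simplex_fst hr fun r' => G r r' (f r')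

variable [CompleteSpace H]

/-- Composing a time-dependent operator with the primitive of another one: bounds in `L¹` of the
time, for every fixed vector, are multiplicative. -/
lemma integral_norm_mul_primitive_le {s t c c' : ℝ} (hst : s ≤ t) (hc : 0 ≤ c)
    {A B : ℝ → H →L[ℂ] H} (hA : Continuous A) (hB : Continuous B)
    (h1 : ∀ W, ∫ r in s..t, ‖A r W‖ ≤ c * ‖W‖) (h2 : ∀ W, ∫ r in s..t, ‖B r W‖ ≤ c' * ‖W‖)
    (W : H) : ∫ r in s..t, ‖(A r * ∫ r' in s..r, B r') W‖ ≤ c * c' * ‖W‖ := by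
  have hF : Continuous fun p : ℝ × ℝ => ‖A p.1 (B p.2 W)‖ := by fun_prop
  have hprim : Continuous fun r => ∫ r' in s..r, B r' :=
    intervalIntegral.continuous_primitive (fun _ _ => hB.intervalIntegrable _ _) _
  calc ∫ r in s..t, ‖(A r * ∫ r' in s..r, B r') W‖
      ≤ ∫ r in s..t, ∫ r' in s..t, ‖A r (B r' W)‖ := by
        refine intervalIntegral.integral_mono_on hst ?_ ?_ fun r hr => ?_
        · exact Continuous.intervalIntegrable (by fun_prop) _ _
        · exact (intervalIntegral.continuous_parametric_intervalIntegral_of_continuous'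
            (f := fun r r' => ‖A r (B r' W)‖) hF s t).intervalIntegrable _ _
        · have e : (A r * ∫ r' in s..r, B r') W = ∫ r' in s..r, A r (B r' W) := by
            have e1 : (∫ r' in s..r, B r') W = ∫ r' in s..r, B r' W :=
              ((ContinuousLinearMap.apply ℂ H W).intervalIntegral_comp_comm
                (hB.intervalIntegrable _ _)).symm
            rw [mul_apply_eq_comp, e1]
            exact ((A r).intervalIntegral_comp_comm
              ((by fun_prop : Continuous fun r' => B r' W).intervalIntegrable _ _)).symm
          rw [e]
          refine (intervalIntegral.norm_integral_le_integral_norm hr.1).trans ?_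
          refine intervalIntegral.integral_mono_interval le_rfl hr.1 hr.2
            (.of_forall fun _ => norm_nonneg _) ?_
          exact Continuous.intervalIntegrable (by fun_prop) _ _
    _ = ∫ r' in s..t, ∫ r in s..t, ‖A r (B r' W)‖ := by
        refine intervalIntegral_intervalIntegral_swap ?_
        exact (hF.continuousOn.integrableOn_compact
          (isCompact_uIcc.prod isCompact_uIcc)).mono_set
          (Set.prod_mono uIoc_subset_uIcc uIoc_subset_uIcc)
    _ ≤ ∫ r' in s..t, c * ‖B r' W‖ := by
        refine intervalIntegral.integral_mono_on hst ?_ ?_ fun r _ => h1 _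
        · exact (intervalIntegral.continuous_parametric_intervalIntegral_of_continuous'
            (f := fun r' r => ‖A r (B r' W)‖) (hF.comp continuous_swap) s t).intervalIntegrable _ _
        · exact Continuous.intervalIntegrable (by fun_prop) _ _
    _ ≤ c * c' * ‖W‖ := by
        rw [intervalIntegral.integral_const_mul, mul_assoc]
        exact mul_le_mul_of_nonneg_left (h2 W) hc

variable {V : ℕ → ℝ → H →L[ℂ] H}

/-- The smoothing estimate for single collisions bounds trees: each node costs one factor `κ`, and
the number of trees with `n` nodes is the Catalan number. -/
lemma treeRate_bound (hV : ∀ j, Continuous (V j)) {s t κ : ℝ} (hst : s ≤ t) (hκ : 0 ≤ κ)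
    (hb : ∀ j W, ∫ r in s..t, ‖V j r W‖ ≤ κ * ‖W‖) (n : ℕ) :
    ∀ j W, ∫ r in s..t, ‖treeRate V n j s r W‖ ≤ κ ^ (n + 1) * catalan (n + 1) * ‖W‖ := by
  induction n using Nat.strong_induction_on with
  | _ n ih =>
    intro j W
    have hc : ∀ m i, Continuous fun r => treeOp V m i s r := fun m i =>
      (continuous_treeOp hV m i).comp (Continuous.prodMk_right s)
    -- Composition with the tree operator of a child, whose rate is bounded by induction.
    have step : ∀ m, m ≤ n → ∀ i (A : ℝ → H →L[ℂ] H) (c : ℝ), Continuous A → 0 ≤ c →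
        (∀ W, ∫ r in s..t, ‖A r W‖ ≤ c * ‖W‖) →
        ∀ W, ∫ r in s..t, ‖(A r * treeOp V m i s r) W‖ ≤ c * (κ ^ m * catalan m) * ‖W‖ := by
      rintro (_ | m) hm i A c hA hc h1 W
      · simpa [treeOp_zero] using h1 W
      · simp only [treeOp_succ]
        exact integral_norm_mul_primitive_le hst hc hA
          ((continuous_treeRate hV m i).comp (Continuous.prodMk_right s)) h1 (ih m (by omega) i) W
    have key : ∀ i : Fin (n + 1), ∫ r in s..t,
        ‖(V j r * treeOp V i j s r * treeOp V (n - i) (j + 1 + i) s r) W‖ ≤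
        κ * (κ ^ (i : ℕ) * catalan i) * (κ ^ (n - i) * catalan (n - i)) * ‖W‖ := by
      intro i
      refine step (n - i) (by omega) _ (fun r => V j r * treeOp V i j s r) _
        ((hV j).mul (hc _ _)) (by positivity) ?_ W
      exact step i (by omega) j _ κ (hV j) hκ (hb j)
    calc ∫ r in s..t, ‖treeRate V n j s r W‖
        ≤ ∫ r in s..t, ∑ i : Fin (n + 1),
          ‖(V j r * treeOp V i j s r * treeOp V (n - i) (j + 1 + i) s r) W‖ := by
          refine intervalIntegral.integral_mono_on hst ?_ ?_ fun r _ => ?_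
          · exact Continuous.intervalIntegrable (((continuous_treeRate hV n j).comp
              (Continuous.prodMk_right s)).clm_apply continuous_const).norm _ _
          · refine Continuous.intervalIntegrable (continuous_finsetSum _ fun i _ => ?_) _ _
            exact ((((hV j).mul (hc _ _)).mul (hc _ _)).clm_apply continuous_const).norm
          · have e : treeRate V n j s r W = ∑ i : Fin (n + 1),
                (V j r * treeOp V i j s r * treeOp V (n - i) (j + 1 + i) s r) W := by
              rw [treeRate, Finset.mul_sum, sum_apply]
              simp only [mul_assoc]
            rw [e]
            exact norm_sum_le _ _
      _ = ∑ i : Fin (n + 1), ∫ r in s..t,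
          ‖(V j r * treeOp V i j s r * treeOp V (n - i) (j + 1 + i) s r) W‖ := by
          refine intervalIntegral.integral_finsetSum fun i _ => ?_
          exact Continuous.intervalIntegrable
            ((((hV j).mul (hc _ _)).mul (hc _ _)).clm_apply continuous_const).norm _ _
      _ ≤ ∑ i : Fin (n + 1), κ * (κ ^ (i : ℕ) * catalan i) *
            (κ ^ (n - i) * catalan (n - i)) * ‖W‖ := Finset.sum_le_sum fun i _ => key i
      _ = κ ^ (n + 1) * catalan (n + 1) * ‖W‖ := by
          rw [catalan_succ]
          push_cast
          rw [Finset.mul_sum, Finset.sum_mul]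
          refine Finset.sum_congr rfl fun i _ => ?_
          have : κ ^ (n + 1) = κ * (κ ^ (i : ℕ) * κ ^ (n - i)) := by
            rw [← pow_add, pow_succ', show (i : ℕ) + (n - i) = n by omega]
          rw [this]; ring

lemma catalan_le_four_pow (n : ℕ) : catalan n ≤ 4 ^ n := by
  rw [catalan_eq_centralBinom_div]
  exact (Nat.div_le_self _ _).trans (Nat.centralBinom_le_four_pow n)

lemma norm_treeOp_le (hV : ∀ j, Continuous (V j)) {s t κ : ℝ} (hst : s ≤ t) (hκ : 0 ≤ κ)
    (hb : ∀ j W, ∫ r in s..t, ‖V j r W‖ ≤ κ * ‖W‖) (n j : ℕ) :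
    ‖treeOp V n j s t‖ ≤ (4 * κ) ^ n := by
  rcases n with _ | n
  · rw [treeOp_zero, pow_zero]
    exact ContinuousLinearMap.norm_id_le
  · refine ContinuousLinearMap.opNorm_le_bound _ (by positivity) fun W => ?_
    have hc : Continuous fun r' => treeRate V n j s r' :=
      (continuous_treeRate hV n j).comp (Continuous.prodMk_right s)
    have e1 : treeOp V (n + 1) j s t W = ∫ r' in s..t, treeRate V n j s r' W := by
      rw [treeOp_succ]
      exact ((ContinuousLinearMap.apply ℂ H W).intervalIntegral_comp_comm
        (hc.intervalIntegrable _ _)).symm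
    rw [e1]
    refine (intervalIntegral.norm_integral_le_integral_norm hst).trans
      ((treeRate_bound hV hst hκ hb n j W).trans ?_)
    have h4 : (catalan (n + 1) : ℝ) ≤ 4 ^ (n + 1) := by exact_mod_cast catalan_le_four_pow (n + 1)
    rw [mul_pow, mul_comm (4 ^ (n + 1))]
    gcongr

lemma norm_forestOp_le (hV : ∀ j, Continuous (V j)) {s t κ : ℝ} (hst : s ≤ t) (hκ : 0 ≤ κ)
    (hb : ∀ j W, ∫ r in s..t, ‖V j r W‖ ≤ κ * ‖W‖) (q : ℕ) :
    ∀ n p, ‖forestOp V q n p s t‖ ≤ 2 ^ q * (8 * κ) ^ n := by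
  induction q with
  | zero =>
    intro n p
    simp only [forestOp]
    split_ifs with h
    · subst h
      rw [pow_zero, pow_zero, one_mul]
      exact ContinuousLinearMap.norm_id_le
    · simp only [norm_zero]; positivity
  | succ q ih =>
    intro n p
    simp only [forestOp]
    rw [Finset.Nat.sum_antidiagonal_eq_sum_range_succ_mk]
    calc ‖∑ k ∈ Finset.range n.succ,
          treeOp V k p s t * forestOp V q (n - k) (p + 1 + k) s t‖
        ≤ ∑ k ∈ Finset.range n.succ, 2 ^ q * (8 * κ) ^ n * (1 / 2) ^ k := by
          refine norm_sum_le_of_le _ fun k hk => ?_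
          have hk' : k ≤ n := by simpa [Nat.lt_succ_iff] using hk
          refine (norm_mul_le _ _).trans ((mul_le_mul (norm_treeOp_le hV hst hκ hb k p)
            (ih (n - k) _) (norm_nonneg _) (by positivity)).trans (le_of_eq ?_))
          have e : (8 * κ) ^ n = (8 * κ) ^ k * (8 * κ) ^ (n - k) := by
            rw [← pow_add, Nat.add_sub_cancel' hk']
          have e2 : (4 * κ) ^ k = (8 * κ) ^ k * (1 / 2) ^ k := by
            rw [← mul_pow]; congr 1; ring
          rw [e, e2]; ring
      _ = 2 ^ q * (8 * κ) ^ n * ∑ k ∈ Finset.range n.succ, (1 / 2 : ℝ) ^ k := by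
          rw [Finset.mul_sum]
      _ ≤ 2 ^ q * (8 * κ) ^ n * 2 := by
          gcongr
          exact sum_geometric_two_le _
      _ = 2 ^ (q + 1) * (8 * κ) ^ n := by ring

/-- Interchange of the integrations over a time simplex. -/
lemma integral_simplex_swap {G : ℝ → ℝ → H →L[ℂ] H}
    (hG : Continuous fun p : ℝ × ℝ => G p.1 p.2) {s t : ℝ} (hst : s ≤ t) {f : ℝ → H}
    (hf : IntervalIntegrable f volume s t) :
    ∫ r in s..t, ∫ r' in s..r, G r r' (f r') = ∫ r' in s..t, (∫ r in r'..t, G r r') (f r') := by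
  have hI := integrable_simplex hG hst hf
  have hsw := integral_integral_swap (f := fun r r' => {p : ℝ × ℝ | p.2 ≤ p.1}.indicator
      (fun p => G p.1 p.2 (f p.2)) (r, r')) hI
  rw [intervalIntegral.integral_of_le hst, intervalIntegral.integral_of_le hst]
  refine Eq.trans ?_ (hsw.trans ?_)
  · refine setIntegral_congr_fun measurableSet_Ioc fun r hr => ?_
    exact (setIntegral_simplex_fst hr fun r' => G r r' (f r')).symm
  · refine setIntegral_congr_fun measurableSet_Ioc fun r' hr => ?_
    have hc : Continuous fun r => G r r' := hG.comp (by fun_prop : Continuous fun r => (r, r'))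
    have e1 : (∫ r in r'..t, G r r') (f r') = ∫ r in r'..t, G r r' (f r') :=
      ((ContinuousLinearMap.apply ℂ H (f r')).intervalIntegral_comp_comm
        (hc.intervalIntegrable _ _)).symm
    rw [e1, intervalIntegral.integral_of_le hr.2, ← integral_Icc_eq_integral_Ioc (x := r')]
    have : (fun r => {p : ℝ × ℝ | p.2 ≤ p.1}.indicator (fun p => G p.1 p.2 (f p.2)) (r, r')) =
        (Ici r').indicator fun r => G r r' (f r') := by
      funext r; by_cases h : r' ≤ r <;> simp [h]
    rw [this, setIntegral_indicator measurableSet_Ici]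
    congr 2
    ext y; simp only [mem_inter_iff, mem_Ioc, mem_Ici, mem_Icc]
    exact ⟨fun h => ⟨h.2, h.1.2⟩, fun h => ⟨⟨hr.1.trans_le h.1, h.2⟩, h.1⟩⟩

/-- Variation of constants for the hierarchy: if `x k` is driven by the collisions of `x (k + 1)`
and a source `f k`, and `x N` by its source only, then `x k` is the sum over all forests of their
actions on the sources. -/
lemma hierarchy_eq_integral_forestOp (hV : ∀ j, Continuous (V j))
    (hcomm : ∀ i j, i < j → ∀ r r', V i r * V (j + 1) r' = V j r' * V i r)
    {s₀ t₀ : ℝ} {N : ℕ} {x f : ℕ → ℝ → H}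
    (hf : ∀ k ≤ N, IntervalIntegrable (f k) volume s₀ t₀)
    (hN : ∀ t ∈ Icc s₀ t₀, x N t = ∫ r in s₀..t, f N r)
    (hx : ∀ k < N, ∀ t ∈ Icc s₀ t₀, x k t =
      (∫ r in s₀..t, ∑ j ∈ Finset.range k, V j r (x (k + 1) r)) + ∫ r in s₀..t, f k r)
    (m : ℕ) : ∀ k, k + m = N → ∀ t ∈ Icc s₀ t₀, x k t =
      ∑ l ∈ Finset.range (m + 1), ∫ r in s₀..t, forestOp V k l 0 r t (f (k + l) r) := by
  induction m with
  | zero =>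
    intro k hk t ht
    obtain rfl : k = N := hk
    simp [forestOp_zero_right, hN t ht]
  | succ m ih =>
    intro k hk t ht
    rw [hx k (by omega) t ht, Finset.sum_range_succ' _ (m + 1)]
    simp only [forestOp_zero_right, add_zero, one_apply_eq_self]
    congr 1
    have hsub : ∀ {l} r, l ≤ N → r ∈ Icc s₀ t₀ → IntervalIntegrable (f l) volume s₀ r :=
      fun r hl hr => (hf _ hl).mono_set (by
        rw [uIcc_of_le hr.1, uIcc_of_le (hr.1.trans hr.2)]; exact Icc_subset_Icc_right hr.2)
    let G : ℕ → ℝ → ℝ → H →L[ℂ] H := fun l r r' =>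
      ∑ j ∈ Finset.range k, V j r * forestOp V (k + 1) l 0 r' r
    have hG : ∀ l, Continuous fun p : ℝ × ℝ => G l p.1 p.2 := fun l =>
      continuous_finsetSum _ fun j _ => ((hV j).comp continuous_fst).mul
        ((continuous_forestOp hV (k + 1) l 0).comp continuous_swap)
    have hint : ∀ l ≤ m, ∀ r ∈ Icc s₀ t, IntervalIntegrable
        (fun r' => forestOp V (k + 1) l 0 r' r (f (k + 1 + l) r')) volume s₀ r := fun l hl r hr =>
      intervalIntegrable_clm_apply ((continuous_forestOp hV (k + 1) l 0).comp
        (by fun_prop : Continuous fun r' : ℝ => (r', r)))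
        (hsub r (by omega) ⟨hr.1, hr.2.trans ht.2⟩)
    -- A collision followed by a forest on `k + 1` letters, summed over its position, is the rate of
    -- change of the forest on `k` letters with one more node.
    have e1 : ∫ r in s₀..t, ∑ j ∈ Finset.range k, V j r (x (k + 1) r) =
        ∫ r in s₀..t, ∑ l ∈ Finset.range (m + 1), ∫ r' in s₀..r, G l r r' (f (k + 1 + l) r') := by
      refine intervalIntegral.integral_congr fun r hr => ?_
      rw [uIcc_of_le ht.1] at hr
      rw [ih (k + 1) (by omega) r ⟨hr.1, hr.2.trans ht.2⟩]
      simp only [map_sum]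
      rw [Finset.sum_comm]
      refine Finset.sum_congr rfl fun l hl => ?_
      have hl' : l ≤ m := by simpa [Nat.lt_succ_iff] using hl
      have hi := hint l hl' r hr
      simp only [G, sum_apply, mul_apply_eq_comp]
      rw [intervalIntegral.integral_finsetSum]
      · refine Finset.sum_congr rfl fun j _ => ?_
        exact ((V j r).intervalIntegral_comp_comm hi).symm
      · intro j _
        rw [intervalIntegrable_iff] at hi ⊢
        exact (V j r).integrable_comp hi
    rw [e1, intervalIntegral.integral_finsetSum]
    · refine Finset.sum_congr rfl fun l hl => ?_
      have hl' : l ≤ m := by simpa [Nat.lt_succ_iff] using hl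
      rw [integral_simplex_swap (hG l) ht.1 (hsub t (by omega) ht)]
      refine intervalIntegral.integral_congr fun r _ => ?_
      rw [show k + 1 + l = k + (l + 1) by omega]
      congr 1
      have hd := hasDerivAt_forestOp hV hcomm k l 0 r
      rw [intervalIntegral.integral_eq_sub_of_hasDerivAt
        (f := fun t => forestOp V k (l + 1) 0 r t) (fun t _ => ?_)]
      · rw [forestOp_self, sub_zero]
      · exact Continuous.intervalIntegrable
          ((hG l).comp (by fun_prop : Continuous fun t : ℝ => (t, r))) _ _
      · simpa [G] using hd t
    · intro l hl
      have hl' : l ≤ m := by simpa [Nat.lt_succ_iff] using hl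
      exact intervalIntegrable_simplex (hG l) ht.1 (hsub t (by omega) ht)

/-- The a priori bound on the hierarchy: the sources reach `x k` through forests, and `l`
collisions cost `(8 κ) ^ l`. -/
lemma norm_hierarchy_le (hV : ∀ j, Continuous (V j))
    (hcomm : ∀ i j, i < j → ∀ r r', V i r * V (j + 1) r' = V j r' * V i r)
    {s₀ t₀ κ : ℝ} (hκ : 0 ≤ κ) (hb : ∀ j W, ∫ r in s₀..t₀, ‖V j r W‖ ≤ κ * ‖W‖)
    {N : ℕ} {x f : ℕ → ℝ → H}
    (hf : ∀ k ≤ N, IntervalIntegrable (f k) volume s₀ t₀)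
    (hN : ∀ t ∈ Icc s₀ t₀, x N t = ∫ r in s₀..t, f N r)
    (hx : ∀ k < N, ∀ t ∈ Icc s₀ t₀, x k t =
      (∫ r in s₀..t, ∑ j ∈ Finset.range k, V j r (x (k + 1) r)) + ∫ r in s₀..t, f k r)
    {k m : ℕ} (hkm : k + m = N) {t : ℝ} (ht : t ∈ Icc s₀ t₀) :
    ‖x k t‖ ≤ ∑ l ∈ Finset.range (m + 1),
      2 ^ k * (8 * κ) ^ l * ∫ r in s₀..t₀, ‖f (k + l) r‖ := by
  rw [hierarchy_eq_integral_forestOp hV hcomm hf hN hx m k hkm t ht]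
  refine norm_sum_le_of_le _ fun l hl => ?_
  have hl' : l ≤ m := by simpa [Nat.lt_succ_iff] using hl
  have hfl := hf (k + l) (by omega)
  have hflt : IntervalIntegrable (f (k + l)) volume s₀ t := hfl.mono_set (by
    rw [uIcc_of_le ht.1, uIcc_of_le (ht.1.trans ht.2)]; exact Icc_subset_Icc_right ht.2)
  calc ‖∫ r in s₀..t, forestOp V k l 0 r t (f (k + l) r)‖
      ≤ ∫ r in s₀..t, ‖forestOp V k l 0 r t (f (k + l) r)‖ :=
        intervalIntegral.norm_integral_le_integral_norm ht.1
    _ ≤ ∫ r in s₀..t, 2 ^ k * (8 * κ) ^ l * ‖f (k + l) r‖ := by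
        refine intervalIntegral.integral_mono_on ht.1 ?_ (hflt.norm.const_mul _) fun r hr => ?_
        · exact (intervalIntegrable_clm_apply ((continuous_forestOp hV k l 0).comp
            (by fun_prop : Continuous fun r : ℝ => (r, t))) hflt).norm
        · refine (ContinuousLinearMap.le_opNorm _ _).trans
            (mul_le_mul_of_nonneg_right ?_ (norm_nonneg _))
          refine norm_forestOp_le hV hr.2 hκ (fun j W => ?_) k l 0
          refine (intervalIntegral.integral_mono_interval hr.1 hr.2 ht.2
            (.of_forall fun _ => norm_nonneg _) ?_).trans (hb j W)
          exact Continuous.intervalIntegrable (((hV j).clm_apply continuous_const).norm) _ _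
    _ ≤ 2 ^ k * (8 * κ) ^ l * ∫ r in s₀..t₀, ‖f (k + l) r‖ := by
        rw [intervalIntegral.integral_const_mul]
        refine mul_le_mul_of_nonneg_left ?_ (by positivity)
        exact intervalIntegral.integral_mono_interval le_rfl ht.1 ht.2
          (.of_forall fun _ => norm_nonneg _) hfl.norm

end TreeBounds

/-! ### Collisions on words -/

section Words

variable {𝔞 : Type*}

/-- Replace the letter at position `j` of the word `C` by the two letters `a`, `b`. -/
def splitLetter (j : ℕ) (a b : 𝔞) (C : List 𝔞) : List 𝔞 := C.take j ++ a :: b :: C.drop (j + 1)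

lemma splitLetter_append (L R : List 𝔞) (c a b : 𝔞) :
    splitLetter L.length a b (L ++ c :: R) = L ++ a :: b :: R := by
  simp [splitLetter]

lemma eq_append_of_getElem? {C : List 𝔞} {j : ℕ} {c : 𝔞} (h : C[j]? = some c) :
    C = C.take j ++ c :: C.drop (j + 1) ∧ (C.take j).length = j := by
  obtain ⟨hj, rfl⟩ := List.getElem?_eq_some_iff.1 h
  constructor
  · simp
  · simp; omega

lemma length_splitLetter {C : List 𝔞} {j : ℕ} (h : j < C.length) (a b : 𝔞) :
    (splitLetter j a b C).length = C.length + 1 := by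
  simp [splitLetter]; omega

lemma getElem?_splitLetter {C : List 𝔞} {j : ℕ} (h : j < C.length) (a b : 𝔞) (m : ℕ) :
    (splitLetter j a b C)[m]? =
      if m < j then C[m]? else if m = j then some a else if m = j + 1 then some b
        else C[m - 1]? := by
  have hl : (C.take j).length = j := by simp; omega
  rw [splitLetter, List.getElem?_append, hl]
  split_ifs with h1 h2 h3
  · rw [List.getElem?_take_of_lt h1]
  · subst h2; simp
  · subst h3; simp
  · obtain ⟨d, rfl⟩ : ∃ d, m = j + 2 + d := ⟨m - (j + 2), by omega⟩
    rw [show j + 2 + d - j = d + 1 + 1 by omega]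
    simp only [List.getElem?_cons_succ, List.getElem?_drop]
    congr 1; omega

lemma splitLetter_comm {C : List 𝔞} {i j : ℕ} (hij : i < j) (h : j < C.length) (a b a' b' : 𝔞) :
    splitLetter (j + 1) a' b' (splitLetter i a b C) =
      splitLetter i a b (splitLetter j a' b' C) := by
  refine List.ext_getElem? fun m => ?_
  rw [getElem?_splitLetter (by rw [length_splitLetter (by omega)]; omega),
    getElem?_splitLetter (C := splitLetter j a' b' C)
      (by rw [length_splitLetter (by omega)]; omega)]
  simp only [getElem?_splitLetter h, getElem?_splitLetter (hij.trans h)]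
  split_ifs <;> first | rfl | (exfalso; omega)

/-- The Hilbert space of square summable families indexed by words. -/
abbrev WordSpace (𝔞 : Type*) : Type _ := lp (fun _ : List 𝔞 => ℂ) 2

lemma sum_norm_sq_le (Y : WordSpace 𝔞) (s : Finset (List 𝔞)) :
    ∑ C ∈ s, ‖Y C‖ ^ 2 ≤ ‖Y‖ ^ 2 := by
  have := lp.sum_rpow_le_norm_rpow (p := 2) (by norm_num) Y s
  simpa using this

open Classical in
lemma sum_splitLetter_le (j : ℕ) (c a b : 𝔞) (Y : WordSpace 𝔞) (s : Finset (List 𝔞)) :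
    ∑ C ∈ s, ‖if C[j]? = some c then Y (splitLetter j a b C) else 0‖ ^ 2 ≤ ‖Y‖ ^ 2 := by
  have e : ∑ C ∈ s, ‖if C[j]? = some c then Y (splitLetter j a b C) else 0‖ ^ 2 =
      ∑ C ∈ s.filter (fun C => C[j]? = some c), ‖Y (splitLetter j a b C)‖ ^ 2 := by
    rw [Finset.sum_filter]
    exact Finset.sum_congr rfl fun C _ => by split_ifs <;> simp
  have hinj : Set.InjOn (splitLetter j a b)
      (s.filter (fun C => C[j]? = some c) : Set (List 𝔞)) := by
    intro C hC D hD h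
    simp only [Finset.coe_filter, mem_ofPred_eq] at hC hD
    obtain ⟨h1, h1'⟩ := eq_append_of_getElem? hC.2
    obtain ⟨h2, h2'⟩ := eq_append_of_getElem? hD.2
    simp only [splitLetter] at h
    obtain ⟨h3, h4⟩ := List.append_inj h (h1'.trans h2'.symm)
    rw [h1, h2, h3]
    simpa using h4
  rw [e, ← Finset.sum_image (f := fun C => ‖Y C‖ ^ 2) hinj]
  exact sum_norm_sq_le _ _

open Classical in
/-- The elementary collision at position `j`: the component of the image at a word `C` with letter
`c` at position `j` is the component at the word in which this letter is replaced by `a`, `b`. -/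
def elemCollision (j : ℕ) (c a b : 𝔞) : WordSpace 𝔞 →L[ℂ] WordSpace 𝔞 :=
  LinearMap.mkContinuous
    { toFun := fun Y => ⟨fun C => if C[j]? = some c then Y (splitLetter j a b C) else 0,
        memℓp_gen' (C := ‖Y‖ ^ 2) fun s => by simpa using sum_splitLetter_le j c a b Y s⟩
      map_add' := fun Y Z => by
        ext C
        simp only [lp.coeFn_add, Pi.add_apply]
        split_ifs <;> simp
      map_smul' := fun r Y => by
        ext C
        simp only [lp.coeFn_smul, Pi.smul_apply, RingHom.id_apply]
        split_ifs <;> simp }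
    1 fun Y => by
      rw [one_mul]
      refine lp.norm_le_of_forall_sum_le (p := 2) (by norm_num) (norm_nonneg _) fun s => ?_
      simpa using sum_splitLetter_le j c a b Y s

open Classical in
lemma elemCollision_apply (j : ℕ) (c a b : 𝔞) (Y : WordSpace 𝔞) (C : List 𝔞) :
    elemCollision j c a b Y C = if C[j]? = some c then Y (splitLetter j a b C) else 0 := rfl

lemma elemCollision_comm {i j : ℕ} (hij : i < j) (c a b c' a' b' : 𝔞) :
    elemCollision i c a b * elemCollision (j + 1) c' a' b' =
      elemCollision j c' a' b' * elemCollision i c a b := by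
  classical
  ext Y C
  simp only [mul_apply_eq_comp, elemCollision_apply]
  by_cases hj : j < C.length
  · rw [getElem?_splitLetter (hij.trans hj), getElem?_splitLetter hj, splitLetter_comm hij hj]
    simp only [show ¬ (j + 1 < i) by omega, show ¬ (j + 1 = i) by omega,
      show ¬ (j + 1 = i + 1) by omega, hij, if_true, if_false, Nat.add_sub_cancel]
    split_ifs <;> rfl
  · have h1 : C[j]? ≠ some c' := by
      rw [List.getElem?_eq_none (by omega)]; simp
    rw [if_neg h1]
    split_ifs with h2 h3
    · obtain ⟨hi, -⟩ := List.getElem?_eq_some_iff.1 h2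
      rw [List.getElem?_eq_none (by rw [length_splitLetter hi]; omega)] at h3
      simp at h3
    · rfl
    · rfl

/-- The collision at position `j` with structure coefficients `v c a b`, restricted to letters
in `S`. -/
def collisionOp (v : 𝔞 → 𝔞 → 𝔞 → ℝ → ℂ) (S : Finset 𝔞) (j : ℕ) (r : ℝ) :
    WordSpace 𝔞 →L[ℂ] WordSpace 𝔞 :=
  ∑ c ∈ S, ∑ a ∈ S, ∑ b ∈ S, v c a b r • elemCollision j c a b

lemma continuous_collisionOp {v : 𝔞 → 𝔞 → 𝔞 → ℝ → ℂ} (hv : ∀ c a b, Continuous (v c a b))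
    (S : Finset 𝔞) (j : ℕ) : Continuous (collisionOp v S j) := by
  refine continuous_finsetSum _ fun c _ => continuous_finsetSum _ fun a _ =>
    continuous_finsetSum _ fun b _ => ?_
  exact (hv c a b).smul continuous_const

lemma collisionOp_comm (v : 𝔞 → 𝔞 → 𝔞 → ℝ → ℂ) (S : Finset 𝔞) {i j : ℕ} (hij : i < j)
    (r r' : ℝ) : collisionOp v S i r * collisionOp v S (j + 1) r' =
      collisionOp v S j r' * collisionOp v S i r := by
  have h : ∀ j r, collisionOp v S j r = ∑ x ∈ S ×ˢ S ×ˢ S,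
      v x.1 x.2.1 x.2.2 r • elemCollision j x.1 x.2.1 x.2.2 := fun j r => by
    simp only [collisionOp, Finset.sum_product]
  rw [h, h, h, Finset.sum_mul_sum, Finset.sum_mul_sum, Finset.sum_comm]
  refine Finset.sum_congr rfl fun x _ => Finset.sum_congr rfl fun y _ => ?_
  rw [smul_mul_smul_comm, smul_mul_smul_comm, elemCollision_comm hij, mul_comm]

open Classical in
lemma collisionOp_apply (v : 𝔞 → 𝔞 → 𝔞 → ℝ → ℂ) (S : Finset 𝔞) (j : ℕ) (r : ℝ)
    (Y : WordSpace 𝔞) {C : List 𝔞} {c : 𝔞} (hC : C[j]? = some c) :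
    collisionOp v S j r Y C =
      if c ∈ S then ∑ a ∈ S, ∑ b ∈ S, v c a b r * Y (splitLetter j a b C) else 0 := by
  have h : collisionOp v S j r Y C = ∑ c' ∈ S, ∑ a ∈ S, ∑ b ∈ S,
      v c' a b r * elemCollision j c' a b Y C := by
    simp only [collisionOp, sum_apply, lp.coeFn_sum, Finset.sum_apply]
    rfl
  rw [h]
  simp only [elemCollision_apply, hC, Option.some.injEq]
  split_ifs with hc
  · rw [Finset.sum_eq_single_of_mem c hc]
    · simp
    · intro c' _ hne
      simp [hne.symm]
  · refine Finset.sum_eq_zero fun c' hc' => ?_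
    have : c ≠ c' := fun h => hc (h ▸ hc')
    simp [this]

lemma collisionOp_apply_of_none (v : 𝔞 → 𝔞 → 𝔞 → ℝ → ℂ) (S : Finset 𝔞) (j : ℕ) (r : ℝ)
    (Y : WordSpace 𝔞) {C : List 𝔞} (hC : C[j]? = none) : collisionOp v S j r Y C = 0 := by
  classical
  have h : collisionOp v S j r Y C = ∑ c' ∈ S, ∑ a ∈ S, ∑ b ∈ S,
      v c' a b r * elemCollision j c' a b Y C := by
    simp only [collisionOp, sum_apply, lp.coeFn_sum, Finset.sum_apply]
    rfl
  rw [h]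
  simp [elemCollision_apply, hC]

lemma enorm_sq_eq_tsum (Y : WordSpace 𝔞) : ‖Y‖ₑ ^ 2 = ∑' C, ‖Y C‖ₑ ^ 2 := by
  have h := lp.hasSum_norm (p := 2) (by norm_num) Y
  simp only [ENNReal.toReal_ofNat, Real.rpow_two] at h
  have h2 : ∀ C, ‖Y C‖ₑ ^ 2 = ENNReal.ofReal (‖Y C‖ ^ 2) := fun C => by
    rw [← ofReal_norm, ENNReal.ofReal_pow (norm_nonneg _)]
  rw [← ofReal_norm, ← ENNReal.ofReal_pow (norm_nonneg _), ← h.tsum_eq,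
    ENNReal.ofReal_tsum_of_nonneg (fun _ => by positivity) h.summable]
  simp only [h2]

/-- The smoothing estimate for the structure coefficients, a bound on square integrals in time,
passes to collisions of words: the letters away from the collision are spectators. -/
lemma lintegral_collisionOp_sq_le {v : 𝔞 → 𝔞 → 𝔞 → ℝ → ℂ} (hv : ∀ c a b, Continuous (v c a b))
    (S : Finset 𝔞) {I : Set ℝ} {K : ℝ≥0∞}
    (hest : ∀ y : 𝔞 → 𝔞 → ℂ, ∫⁻ r in I, ∑ c ∈ S, ‖∑ a ∈ S, ∑ b ∈ S, v c a b r * y a b‖ₑ ^ 2 ≤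
      K * ∑ a ∈ S, ∑ b ∈ S, ‖y a b‖ₑ ^ 2) [Countable 𝔞] (j : ℕ) (Y : WordSpace 𝔞) :
    ∫⁻ r in I, ‖collisionOp v S j r Y‖ₑ ^ 2 ≤ K * ‖Y‖ₑ ^ 2 := by
  classical
  let P := {L : List 𝔞 // L.length = j} × List 𝔞
  let g : P → ℝ → ℝ≥0∞ := fun p r => ∑ c ∈ S, ‖∑ a ∈ S, ∑ b ∈ S,
    v c a b r * Y (p.1.1 ++ a :: b :: p.2)‖ₑ ^ 2
  -- Group the words by their letters away from position `j`.
  have hcomp : ∀ r, ‖collisionOp v S j r Y‖ₑ ^ 2 = ∑' p : P, g p r := by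
    intro r
    rw [enorm_sq_eq_tsum]
    let Φ : P × 𝔞 → List 𝔞 := fun q => q.1.1.1 ++ q.2 :: q.1.2
    have hΦ : Function.Injective Φ := by
      rintro ⟨⟨⟨L, hL⟩, R⟩, c⟩ ⟨⟨⟨L', hL'⟩, R'⟩, c'⟩ h
      obtain ⟨h3, h4⟩ := List.append_inj h (hL.trans hL'.symm)
      simp only [List.cons.injEq] at h4
      obtain ⟨h4, h5⟩ := h4
      subst h3 h4 h5
      rfl
    have hsupp : Function.support (fun C => ‖collisionOp v S j r Y C‖ₑ ^ 2) ⊆ Set.range Φ := by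
      intro C hC
      cases hj : C[j]? with
      | none => simp [collisionOp_apply_of_none v S j r Y hj] at hC
      | some c =>
        obtain ⟨h1, h2⟩ := eq_append_of_getElem? hj
        exact ⟨((⟨C.take j, h2⟩, C.drop (j + 1)), c), h1.symm⟩
    rw [← hΦ.tsum_eq hsupp]
    refine (ENNReal.tsum_prod
      (f := fun p c => ‖collisionOp v S j r Y (Φ (p, c))‖ₑ ^ 2)).trans ?_
    refine tsum_congr fun p => ?_
    obtain ⟨⟨L, rfl⟩, R⟩ := p
    have hΦj : ∀ c, (Φ ((⟨L, rfl⟩, R), c))[L.length]? = some c := fun c => by simp [Φ]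
    simp only [collisionOp_apply v S _ r Y (hΦj _)]
    rw [tsum_eq_sum (s := S)]
    · refine Finset.sum_congr rfl fun c hc => ?_
      simp only [hc, if_true, Φ, splitLetter_append]
    · intro c hc
      simp [hc]
  simp only [hcomp]
  rw [lintegral_tsum]
  · calc ∑' p : P, ∫⁻ r in I, g p r
        ≤ ∑' p : P, K * ∑ a ∈ S, ∑ b ∈ S, ‖Y (p.1.1 ++ a :: b :: p.2)‖ₑ ^ 2 :=
          ENNReal.tsum_le_tsum fun p => hest fun a b => Y (p.1.1 ++ a :: b :: p.2)
      _ = K * ∑' p : P, ∑ a ∈ S, ∑ b ∈ S, ‖Y (p.1.1 ++ a :: b :: p.2)‖ₑ ^ 2 :=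
          ENNReal.tsum_mul_left
      _ ≤ K * ∑' p : P, ∑' ab : 𝔞 × 𝔞, ‖Y (p.1.1 ++ ab.1 :: ab.2 :: p.2)‖ₑ ^ 2 := by
          gcongr with p
          rw [← Finset.sum_product' (f := fun a b => ‖Y (p.1.1 ++ a :: b :: p.2)‖ₑ ^ 2)]
          exact ENNReal.sum_le_tsum _
      _ ≤ K * ‖Y‖ₑ ^ 2 := by
          gcongr
          rw [enorm_sq_eq_tsum, ← ENNReal.tsum_prod
            (f := fun (p : P) (ab : 𝔞 × 𝔞) => ‖Y (p.1.1 ++ ab.1 :: ab.2 :: p.2)‖ₑ ^ 2)]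
          refine ENNReal.tsum_comp_le_tsum_of_injective
            (f := fun q : P × (𝔞 × 𝔞) => q.1.1.1 ++ q.2.1 :: q.2.2 :: q.1.2) ?_
            (fun C => ‖Y C‖ₑ ^ 2)
          rintro ⟨⟨⟨L, hL⟩, R⟩, a, b⟩ ⟨⟨⟨L', hL'⟩, R'⟩, a', b'⟩ h
          obtain ⟨h3, h4⟩ := List.append_inj h (hL.trans hL'.symm)
          simp only [List.cons.injEq] at h4
          obtain ⟨h4, h5, h6⟩ := h4
          subst h3 h4 h5 h6
          rfl
  · intro p
    refine Measurable.aemeasurable ?_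
    refine Finset.measurable_sum _ fun c _ => ?_
    have : Continuous fun r => ∑ a ∈ S, ∑ b ∈ S, v c a b r * Y (p.1.1 ++ a :: b :: p.2) :=
      continuous_finsetSum _ fun a _ => continuous_finsetSum _ fun b _ =>
        (hv c a b).mul continuous_const
    exact (this.measurable.enorm).pow_const 2

end Words

/-! ### Truncation of families indexed by words -/

section Truncation

variable {𝔞 : Type*} [DecidableEq 𝔞]

/-- The part of a family indexed by words that lives on the words of length `k` with letters
in `S`. -/
def truncWords (S : Finset 𝔞) (k : ℕ) : (List 𝔞 → ℂ) →ₗ[ℂ] WordSpace 𝔞 where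
  toFun u := ∑ w ∈ Fintype.piFinset fun _ : Fin k => S,
    lp.single 2 (List.ofFn w) (u (List.ofFn w))
  map_add' u v := by simp [Finset.sum_add_distrib]
  map_smul' r u := by
    simp only [Pi.smul_apply, lp.single_smul, Finset.smul_sum, RingHom.id_apply]

lemma truncWords_def (S : Finset 𝔞) (k : ℕ) (u : List 𝔞 → ℂ) :
    truncWords S k u = ∑ w ∈ Fintype.piFinset fun _ : Fin k => S,
      lp.single 2 (List.ofFn w) (u (List.ofFn w)) := rfl

lemma truncWords_apply (S : Finset 𝔞) (k : ℕ) (u : List 𝔞 → ℂ) (C : List 𝔞) :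
    truncWords S k u C = if C.length = k ∧ ∀ c ∈ C, c ∈ S then u C else 0 := by
  rw [truncWords_def, lp.coeFn_sum, Finset.sum_apply]
  split_ifs with h
  · obtain ⟨rfl, h⟩ := h
    rw [Finset.sum_eq_single_of_mem C.get (by simpa using fun i => h _ (List.get_mem C i))]
    · simp
    · intro w _ hw
      rw [lp.single_apply_ne]
      intro hC
      apply hw
      exact List.ofFn_injective (by simpa using hC.symm)
  · refine Finset.sum_eq_zero fun w hw => ?_
    rw [lp.single_apply_ne]
    rintro rfl
    refine h ⟨by simp, fun c hc => ?_⟩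
    obtain ⟨i, rfl⟩ := (List.mem_ofFn' _ _).1 hc
    exact Fintype.mem_piFinset.1 hw i

lemma norm_sq_truncWords (S : Finset 𝔞) (k : ℕ) (u : List 𝔞 → ℂ) :
    ‖truncWords S k u‖ ^ 2 = ∑ w ∈ Fintype.piFinset fun _ : Fin k => S,
      ‖u (List.ofFn w)‖ ^ 2 := by
  have h := lp.norm_sum_single (p := 2) (E := fun _ : List 𝔞 => ℂ) (by norm_num) u
    ((Fintype.piFinset fun _ : Fin k => S).image List.ofFn)
  rw [Finset.sum_image (List.ofFn_injective.injOn), Finset.sum_image (List.ofFn_injective.injOn)]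
    at h
  simpa [truncWords_def] using h

lemma norm_truncWords_le (S : Finset 𝔞) (k : ℕ) (Y : WordSpace 𝔞) :
    ‖truncWords S k Y‖ ≤ ‖Y‖ := by
  refine le_of_sq_le_sq ?_ (norm_nonneg _)
  rw [norm_sq_truncWords, ← Finset.sum_image (g := List.ofFn) (f := fun C => ‖Y C‖ ^ 2)
    (List.ofFn_injective.injOn)]
  exact sum_norm_sq_le _ _

lemma enorm_truncWords_le_sum (S : Finset 𝔞) (k : ℕ) (u : List 𝔞 → ℂ) :
    ‖truncWords S k u‖ₑ ≤ ∑ w ∈ Fintype.piFinset fun _ : Fin k => S, ‖u (List.ofFn w)‖ₑ := by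
  rw [truncWords_def]
  refine (enorm_sum_le _ _).trans (Finset.sum_le_sum fun w _ => ?_)
  rw [← ofReal_norm, ← ofReal_norm, lp.norm_single (by norm_num)]

lemma truncWords_truncWords {S S' : Finset 𝔞} (hS : S ⊆ S') (k : ℕ) (u : List 𝔞 → ℂ) :
    truncWords S' k (truncWords S k u) = truncWords S k u := by
  ext C
  simp only [truncWords_apply]
  split_ifs with h1 _ h2
  · rfl
  · rfl
  · exact absurd ⟨h2.1, fun c hc => hS (h2.2 c hc)⟩ h1
  · rfl

/-- A square summable family supported on words of length `k` is the limit of its truncations. -/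
lemma tendsto_truncWords (k : ℕ) (Y : WordSpace 𝔞) (hY : ∀ C, C.length ≠ k → Y C = 0) :
    Tendsto (fun S : Finset 𝔞 => truncWords S k Y) atTop (𝓝 Y) := by
  have h1 := lp.hasSum_single (p := 2) (by norm_num) Y
  have h2 : HasSum (fun w : Fin k → 𝔞 => lp.single (E := fun _ : List 𝔞 => ℂ) 2 (List.ofFn w)
      (Y (List.ofFn w))) Y := by
    refine (Function.Injective.hasSum_iff (List.ofFn_injective (n := k)) ?_).2 h1
    intro C hC
    have : C.length ≠ k := by
      rintro rfl
      exact hC ⟨C.get, by simp⟩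
    simp [hY C this]
  refine h2.comp (tendsto_atTop_finset_of_monotone ?_ fun w => ⟨Finset.univ.image w, ?_⟩)
  · intro S S' h
    exact Fintype.piFinset_subset _ _ fun _ => h
  · simp

lemma intervalIntegrable_truncWords (S : Finset 𝔞) (k : ℕ) {u : List 𝔞 → ℝ → ℂ} {a b : ℝ}
    (hu : ∀ C, C.length = k → IntervalIntegrable (u C) volume a b) :
    IntervalIntegrable (fun r => truncWords S k fun C => u C r) volume a b := by
  simp only [truncWords_def]
  have := IntervalIntegrable.sum (Fintype.piFinset fun _ : Fin k => S)
    (f := fun w r => lp.single (E := fun _ : List 𝔞 => ℂ) 2 (List.ofFn w) (u (List.ofFn w) r))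
    (μ := volume) (a := a) (b := b) fun w _ => by
      have h := hu (List.ofFn w) (by simp)
      rw [intervalIntegrable_iff] at h ⊢
      exact (lp.singleContinuousLinearMap ℂ (fun _ : List 𝔞 => ℂ) 2 (List.ofFn w)).integrable_comp h
  simpa [Finset.sum_fn] using this

lemma integral_truncWords (S : Finset 𝔞) (k : ℕ) {u : List 𝔞 → ℝ → ℂ} {a b : ℝ}
    (hu : ∀ C, C.length = k → IntervalIntegrable (u C) volume a b) :
    ∫ r in a..b, truncWords S k (fun C => u C r) =
      truncWords S k fun C => ∫ r in a..b, u C r := by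
  simp only [truncWords_def]
  have hi : ∀ w : Fin k → 𝔞, IntervalIntegrable (fun r =>
      lp.single (E := fun _ : List 𝔞 => ℂ) 2 (List.ofFn w) (u (List.ofFn w) r)) volume a b := by
    intro w
    have h := hu (List.ofFn w) (by simp)
    rw [intervalIntegrable_iff] at h ⊢
    exact (lp.singleContinuousLinearMap ℂ (fun _ : List 𝔞 => ℂ) 2 (List.ofFn w)).integrable_comp h
  rw [intervalIntegral.integral_finsetSum fun w _ => hi w]
  refine Finset.sum_congr rfl fun w _ => ?_
  exact (lp.singleContinuousLinearMap ℂ (fun _ : List 𝔞 => ℂ) 2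
    (List.ofFn w)).intervalIntegral_comp_comm (hu (List.ofFn w) (by simp))

/-- Enlarging the set of admissible letters does not change the collision of a family supported on
words with letters in the smaller set, seen on such words. -/
lemma truncWords_collisionOp (v : 𝔞 → 𝔞 → 𝔞 → ℝ → ℂ) {S S' : Finset 𝔞} (hS : S ⊆ S') {j k : ℕ}
    (hj : j < k) (r : ℝ) (u : List 𝔞 → ℂ) :
    truncWords S k (collisionOp v S' j r (truncWords S (k + 1) u)) =
      collisionOp v S j r (truncWords S (k + 1) u) := by
  ext C
  rw [truncWords_apply]
  by_cases hC : j < C.length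
  · obtain ⟨c, hc⟩ : ∃ c, C[j]? = some c := ⟨C[j], List.getElem?_eq_getElem hC⟩
    obtain ⟨e1, -⟩ := eq_append_of_getElem? hc
    have hmem : ∀ d, d ∈ C ↔ d ∈ C.take j ∨ d = c ∨ d ∈ C.drop (j + 1) := fun d => by
      conv_lhs => rw [e1]
      simp
    have hmem2 : ∀ a b d, d ∈ splitLetter j a b C ↔
        d ∈ C.take j ∨ d = a ∨ d = b ∨ d ∈ C.drop (j + 1) := fun a b d => by
      simp [splitLetter]
    -- Only letters `a`, `b` in `S` contribute.
    have hz : ∀ a b, ¬ (a ∈ S ∧ b ∈ S) → truncWords S (k + 1) u (splitLetter j a b C) = 0 := by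
      intro a b hab
      rw [truncWords_apply, if_neg]
      rintro ⟨-, h⟩
      exact hab ⟨h a ((hmem2 _ _ _).2 (by simp)), h b ((hmem2 _ _ _).2 (by simp))⟩
    rw [collisionOp_apply v S' j r _ hc, collisionOp_apply v S j r _ hc]
    have hsum : ∑ a ∈ S', ∑ b ∈ S', v c a b r * truncWords S (k + 1) u (splitLetter j a b C) =
        ∑ a ∈ S, ∑ b ∈ S, v c a b r * truncWords S (k + 1) u (splitLetter j a b C) := by
      symm
      refine Finset.sum_subset_zero_on_sdiff hS (fun a ha => ?_) fun a ha => ?_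
      · refine Finset.sum_eq_zero fun b _ => ?_
        rw [hz a b fun h => (Finset.mem_sdiff.1 ha).2 h.1, mul_zero]
      · refine Finset.sum_subset_zero_on_sdiff hS (fun b hb => ?_) fun _ _ => rfl
        rw [hz a b fun h => (Finset.mem_sdiff.1 hb).2 h.2, mul_zero]
    rw [hsum]
    by_cases h : C.length = k ∧ ∀ c ∈ C, c ∈ S
    · have hcS : c ∈ S := h.2 c ((hmem c).2 (by simp))
      rw [if_pos h, if_pos (hS hcS), if_pos hcS]
    · rw [if_neg h]
      split_ifs with hcS
      · refine (Finset.sum_eq_zero fun a _ => Finset.sum_eq_zero fun b _ => ?_).symm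
        rw [truncWords_apply, if_neg, mul_zero]
        rintro ⟨h1, h2⟩
        rw [length_splitLetter hC] at h1
        refine h ⟨by omega, fun d hd => ?_⟩
        rcases (hmem d).1 hd with h3 | rfl | h3
        · exact h2 d ((hmem2 _ _ _).2 (by simp [h3]))
        · exact hcS
        · exact h2 d ((hmem2 _ _ _).2 (by simp [h3]))
      · rfl
  · rw [if_neg fun h => hC (by omega), collisionOp_apply_of_none]
    exact List.getElem?_eq_none (by omega)

end Truncation

/-- The Cauchy–Schwarz inequality for the integral of one function. -/
lemma sq_lintegral_le {X : Type*} [MeasurableSpace X] {μ : Measure X} {f : X → ℝ≥0∞}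
    (hf : AEMeasurable f μ) : (∫⁻ x, f x ∂μ) ^ 2 ≤ μ univ * ∫⁻ x, f x ^ 2 ∂μ := by
  have h := ENNReal.lintegral_mul_le_Lp_mul_Lq μ (p := 2) (q := 2)
    (Real.HolderConjugate.two_two) hf (aemeasurable_const (b := 1))
  simp only [Pi.mul_apply, mul_one, ENNReal.rpow_two, one_pow, lintegral_const, one_mul] at h
  calc (∫⁻ x, f x ∂μ) ^ 2 ≤ ((∫⁻ x, f x ^ 2 ∂μ) ^ (1 / 2 : ℝ) * μ univ ^ (1 / 2 : ℝ)) ^ 2 := by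
        gcongr
    _ = μ univ * ∫⁻ x, f x ^ 2 ∂μ := by
        rw [mul_pow, ← ENNReal.rpow_two, ← ENNReal.rpow_two, ← ENNReal.rpow_mul,
          ← ENNReal.rpow_mul]
        norm_num [mul_comm]

/-! ### Uniqueness for hierarchies of words -/

section WordHierarchy

variable {𝔞 : Type*}

/-- A family `x` of functions of time, indexed by words, is the sum of the primitives of sources
`z j C`, one for each position `j` in the word `C`, which are square summable over words of fixed
length. -/
structure IsWordEquation (T : ℝ) (R : NNReal) (β : ℂ) (x : List 𝔞 → ℝ → ℂ)
    (z : ℕ → List 𝔞 → ℝ → ℂ) : Prop where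
  measurable : ∀ j C, j < C.length → AEStronglyMeasurable (z j C) (volume.restrict (Ioc 0 T))
  bound : ∀ k, ∀ j < k, ∀ s ∈ Icc 0 T, ∀ F : Finset (List 𝔞), (∀ C ∈ F, C.length = k) →
    ∑ C ∈ F, ‖z j C s‖ ^ 2 ≤ ((R : ℝ) ^ k) ^ 2
  equation : ∀ C, ∀ t ∈ Icc 0 T, x C t = β * ∑ j ∈ Finset.range C.length, ∫ s in (0 : ℝ)..t, z j C s

/-- In a hierarchy of words the source `z j C` is the collision of the components of `x` at the
words with the letter at position `j` split in two, the sum over pairs of letters being taken in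
`L¹` of the time. The structure coefficients `v` satisfy a smoothing estimate with constant `K`. -/
structure IsWordHierarchy (v : 𝔞 → 𝔞 → 𝔞 → ℝ → ℂ) (T : ℝ) (K R : NNReal) (β : ℂ)
    (x : List 𝔞 → ℝ → ℂ) (z : ℕ → List 𝔞 → ℝ → ℂ) : Prop extends IsWordEquation T R β x z where
  continuous : ∀ c a b, Continuous (v c a b)
  smoothing : ∀ (S : Finset 𝔞) (y : 𝔞 → 𝔞 → ℂ),
    ∫⁻ r in Ioc 0 T, ∑ c ∈ S, ‖∑ a ∈ S, ∑ b ∈ S, v c a b r * y a b‖ₑ ^ 2 ≤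
      K * ∑ a ∈ S, ∑ b ∈ S, ‖y a b‖ₑ ^ 2
  limit : ∀ C j c, C[j]? = some c → Tendsto (fun S : Finset 𝔞 => ∫⁻ s in Ioc 0 T,
    ‖z j C s - ∑ a ∈ S, ∑ b ∈ S, v c a b s * x (splitLetter j a b C) s‖ₑ) atTop (𝓝 0)

variable {v : 𝔞 → 𝔞 → 𝔞 → ℝ → ℂ} {T : ℝ} {K R : NNReal} {β : ℂ}
  {x : List 𝔞 → ℝ → ℂ} {z : ℕ → List 𝔞 → ℝ → ℂ}

/-- The source driving the component at the word `C`. -/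
def wordSource (β : ℂ) (z : ℕ → List 𝔞 → ℝ → ℂ) (C : List 𝔞) (r : ℝ) : ℂ :=
  β * ∑ j ∈ Finset.range C.length, z j C r

namespace IsWordEquation

lemma norm_le (h : IsWordEquation T R β x z) {C : List 𝔞} {j : ℕ} (hj : j < C.length) {s : ℝ}
    (hs : s ∈ Icc 0 T) : ‖z j C s‖ ≤ (R : ℝ) ^ C.length := by
  have := h.bound C.length j hj s hs {C} (by simp)
  simp only [Finset.sum_singleton] at this
  exact le_of_sq_le_sq this (by positivity)

lemma intervalIntegrable (h : IsWordEquation T R β x z) {C : List 𝔞} {j : ℕ}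
    (hj : j < C.length) {a b : ℝ} (ha : a ∈ Icc 0 T) (hb : b ∈ Icc 0 T) :
    IntervalIntegrable (z j C) volume a b := by
  have hT : 0 ≤ T := ha.1.trans ha.2
  have h0 : IntervalIntegrable (z j C) volume 0 T := by
    rw [intervalIntegrable_iff_integrableOn_Ioc_of_le hT]
    refine Integrable.of_bound (h.measurable j C hj) ((R : ℝ) ^ C.length) ?_
    refine (ae_restrict_iff' measurableSet_Ioc).2 (.of_forall fun s hs => ?_)
    exact h.norm_le hj (Ioc_subset_Icc_self hs)
  refine h0.mono_set ?_
  rw [uIcc_of_le hT]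
  exact uIcc_subset_Icc ha hb

lemma intervalIntegrable_source (h : IsWordEquation T R β x z) (C : List 𝔞)
    {a b : ℝ} (ha : a ∈ Icc 0 T) (hb : b ∈ Icc 0 T) :
    IntervalIntegrable (wordSource β z C) volume a b := by
  unfold wordSource
  refine IntervalIntegrable.const_mul ?_ β
  have := IntervalIntegrable.sum (Finset.range C.length) (f := fun j => z j C)
    (μ := volume) (a := a) (b := b) fun j hj =>
      h.intervalIntegrable (Finset.mem_range.1 hj) ha hb
  simpa [Finset.sum_fn] using this

lemma eq_integral_source (h : IsWordEquation T R β x z) (C : List 𝔞) {t : ℝ}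
    (ht : t ∈ Icc 0 T) : x C t = ∫ r in (0 : ℝ)..t, wordSource β z C r := by
  have h0 : (0 : ℝ) ∈ Icc 0 T := ⟨le_rfl, ht.1.trans ht.2⟩
  rw [h.equation C t ht]
  unfold wordSource
  rw [intervalIntegral.integral_const_mul, intervalIntegral.integral_finsetSum]
  exact fun j hj => h.intervalIntegrable (Finset.mem_range.1 hj) h0 ht

/-- Bound for the source on words of length `k`. -/
lemma exists_source (h : IsWordEquation T R β x z) (k : ℕ) {s : ℝ} (hs : s ∈ Icc 0 T) :
    ∃ Y : WordSpace 𝔞, (∀ C, Y C = if C.length = k then wordSource β z C s else 0) ∧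
      ‖Y‖ ≤ ‖β‖ * (k * (R : ℝ) ^ k) := by
  have hj : ∀ j : ℕ, ∃ Y : WordSpace 𝔞, (∀ C, Y C = if C.length = k ∧ j < k then z j C s else 0) ∧
      ‖Y‖ ≤ (R : ℝ) ^ k := by
    intro j
    have hsum : ∀ F : Finset (List 𝔞),
        ∑ C ∈ F, ‖if C.length = k ∧ j < k then z j C s else 0‖ ^ 2 ≤ ((R : ℝ) ^ k) ^ 2 := by
      intro F
      by_cases hjk : j < k
      · refine le_trans (le_of_eq ?_) (h.bound k j hjk s hs (F.filter fun C => C.length = k)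
          (by simp))
        rw [Finset.sum_filter]
        refine Finset.sum_congr rfl fun C _ => ?_
        by_cases hC : C.length = k <;> simp [hC, hjk]
      · simp only [hjk, and_false, if_false]
        simp only [norm_zero, ne_eq, OfNat.ofNat_ne_zero, not_false_eq_true, zero_pow,
          Finset.sum_const_zero]
        positivity
    refine ⟨⟨fun C => if C.length = k ∧ j < k then z j C s else 0,
      memℓp_gen' (C := ((R : ℝ) ^ k) ^ 2) fun F => by simpa using hsum F⟩, fun C => rfl, ?_⟩
    refine lp.norm_le_of_forall_sum_le (p := 2) (by norm_num) (by positivity) fun F => ?_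
    simpa using hsum F
  choose Y hY hYn using hj
  refine ⟨β • ∑ j ∈ Finset.range k, Y j, fun C => ?_, ?_⟩
  · rw [lp.coeFn_smul, lp.coeFn_sum, Pi.smul_apply, Finset.sum_apply, smul_eq_mul]
    split_ifs with hC
    · rw [wordSource, hC]
      congr 1
      refine Finset.sum_congr rfl fun j hj => ?_
      rw [hY, if_pos ⟨hC, Finset.mem_range.1 hj⟩]
    · simp [hY, hC]
  · rw [norm_smul]
    gcongr
    refine (norm_sum_le_of_le _ fun j _ => hYn j).trans ?_
    simp

end IsWordEquation

namespace IsWordHierarchy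

lemma lintegral_collisionOp_le [Countable 𝔞] (h : IsWordHierarchy v T K R β x z) (S : Finset 𝔞)
    (j : ℕ) {s₀ t₀ : ℝ} (hs : 0 ≤ s₀) (ht : t₀ ≤ T) (Y : WordSpace 𝔞) :
    ∫⁻ r in Ioc s₀ t₀, ‖collisionOp v S j r Y‖ₑ ≤
      ENNReal.ofReal (√((t₀ - s₀) * K)) * ‖Y‖ₑ := by
  have h1 := lintegral_collisionOp_sq_le (K := K) h.continuous S (I := Ioc s₀ t₀)
    (fun y => (lintegral_mono_set (Ioc_subset_Ioc hs ht)).trans (h.smoothing S y)) j Y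
  have hc : Continuous fun r => ‖collisionOp v S j r Y‖ₑ :=
    (((continuous_collisionOp h.continuous S j).clm_apply continuous_const)).enorm
  have h2 := sq_lintegral_le (μ := volume.restrict (Ioc s₀ t₀)) hc.aemeasurable
  rw [← ENNReal.pow_le_pow_left_iff (n := 2) (by norm_num)]
  refine h2.trans ?_
  rw [Measure.restrict_apply_univ, Real.volume_Ioc, mul_pow,
    ← ENNReal.ofReal_pow (Real.sqrt_nonneg _)]
  by_cases hst : s₀ ≤ t₀
  · have hsq : √((t₀ - s₀) * (K : ℝ)) ^ 2 = (t₀ - s₀) * K :=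
      Real.sq_sqrt (mul_nonneg (by linarith) K.2)
    rw [hsq, ENNReal.ofReal_mul (by linarith), ENNReal.ofReal_coe_nnreal, mul_assoc]
    gcongr
  · rw [ENNReal.ofReal_of_nonpos (by linarith), zero_mul]
    exact bot_le

/-- Collisions of a primitive: the smoothing estimate needs one integration in time only, so the
operators may act on a curve with integrable derivative. -/
lemma lintegral_collisionOp_primitive_le [Countable 𝔞] (h : IsWordHierarchy v T K R β x z)
    (S : Finset 𝔞) (j : ℕ) {s₀ t₀ : ℝ} (hs : 0 ≤ s₀) (ht : t₀ ≤ T) (hst : s₀ ≤ t₀)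
    {G : ℝ → WordSpace 𝔞} (hG : IntervalIntegrable G volume s₀ t₀) :
    ∫⁻ r in Ioc s₀ t₀, ‖collisionOp v S j r (∫ r' in s₀..r, G r')‖ₑ ≤
      ENNReal.ofReal (√((t₀ - s₀) * K)) * ∫⁻ r in Ioc s₀ t₀, ‖G r‖ₑ := by
  have hc := continuous_collisionOp h.continuous S j
  rw [intervalIntegrable_iff_integrableOn_Ioc_of_le hst] at hG
  calc ∫⁻ r in Ioc s₀ t₀, ‖collisionOp v S j r (∫ r' in s₀..r, G r')‖ₑ
      ≤ ∫⁻ r in Ioc s₀ t₀, ∫⁻ r' in Ioc s₀ t₀, ‖collisionOp v S j r (G r')‖ₑ := by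
        refine setLIntegral_mono' measurableSet_Ioc fun r hr => ?_
        have hGr : IntegrableOn G (Ioc s₀ r) := hG.mono_set (Ioc_subset_Ioc_right hr.2)
        rw [intervalIntegral.integral_of_le hr.1.le,
          ← ContinuousLinearMap.integral_comp_comm _ hGr]
        exact (enorm_integral_le_lintegral_enorm _).trans
          (lintegral_mono_set (Ioc_subset_Ioc_right hr.2))
    _ = ∫⁻ r' in Ioc s₀ t₀, ∫⁻ r in Ioc s₀ t₀, ‖collisionOp v S j r (G r')‖ₑ := by
        refine lintegral_lintegral_swap ?_
        refine AEStronglyMeasurable.enorm ?_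
        exact (ContinuousLinearMap.id ℂ (WordSpace 𝔞 →L[ℂ] WordSpace 𝔞)).aestronglyMeasurable_comp₂
          (hc.comp continuous_fst).aestronglyMeasurable hG.aestronglyMeasurable.comp_snd
    _ ≤ ∫⁻ r' in Ioc s₀ t₀, ENNReal.ofReal (√((t₀ - s₀) * K)) * ‖G r'‖ₑ :=
        lintegral_mono fun r' => h.lintegral_collisionOp_le S j hs ht (G r')
    _ = _ := lintegral_const_mul'' _ hG.aestronglyMeasurable.enorm

end IsWordHierarchy

namespace IsWordEquation

lemma continuousOn (h : IsWordEquation T R β x z) (hT : 0 ≤ T) (C : List 𝔞) :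
    ContinuousOn (x C) (Icc 0 T) := by
  have h1 := h.intervalIntegrable_source (β := β) C (a := 0) (b := T) ⟨le_rfl, hT⟩ ⟨hT, le_rfl⟩
  have h2 := intervalIntegral.continuousOn_primitive_interval' h1 left_mem_uIcc
  rw [uIcc_of_le hT] at h2
  exact h2.congr fun t ht => h.eq_integral_source C ht

lemma eq_integral_source_of_eq_zero (h : IsWordEquation T R β x z) (C : List 𝔞) {s t : ℝ}
    (hs : s ∈ Icc 0 T) (ht : t ∈ Icc 0 T) (h0 : x C s = 0) :
    x C t = ∫ r in s..t, wordSource β z C r := by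
  have hT : (0 : ℝ) ∈ Icc 0 T := ⟨le_rfl, hs.1.trans hs.2⟩
  rw [← intervalIntegral.integral_interval_sub_left (h.intervalIntegrable_source C hT ht)
    (h.intervalIntegrable_source C hT hs), ← h.eq_integral_source C ht,
    ← h.eq_integral_source C hs, h0, sub_zero]

variable [DecidableEq 𝔞] [Countable 𝔞]

/-- The sources on words of length `k`, as a curve of square summable families. -/
lemma exists_source_curve (h : IsWordEquation T R β x z) (k : ℕ) {s₀ t₀ : ℝ}
    (hs : s₀ ∈ Icc 0 T) (ht : t₀ ∈ Icc 0 T) (hst : s₀ ≤ t₀) :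
    ∃ g : ℝ → WordSpace 𝔞,
      (∀ r ∈ Ioc s₀ t₀, ∀ C, g r C = if C.length = k then wordSource β z C r else 0) ∧
      IntegrableOn g (Ioc s₀ t₀) ∧
      Tendsto (fun S : Finset 𝔞 => ∫⁻ r in Ioc s₀ t₀, ‖g r - truncWords S k (g r)‖ₑ)
        atTop (𝓝 0) := by
  have hsub : ∀ r ∈ Ioc s₀ t₀, r ∈ Icc 0 T := fun r hr => ⟨hs.1.trans hr.1.le, hr.2.trans ht.2⟩
  have hex : ∀ r, ∃ Y : WordSpace 𝔞, r ∈ Ioc s₀ t₀ →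
      (∀ C, Y C = if C.length = k then wordSource β z C r else 0) ∧
      ‖Y‖ ≤ ‖β‖ * (k * (R : ℝ) ^ k) := by
    intro r
    by_cases hr : r ∈ Ioc s₀ t₀
    · obtain ⟨Y, hY⟩ := h.exists_source k (hsub r hr)
      exact ⟨Y, fun _ => hY⟩
    · exact ⟨0, fun h => absurd h hr⟩
  choose g hg using hex
  refine ⟨g, fun r hr => (hg r hr).1, ?_⟩
  have htr : ∀ S : Finset 𝔞, ∀ r ∈ Ioc s₀ t₀,
      truncWords S k (g r) = truncWords S k fun C => wordSource β z C r := by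
    intro S r hr
    ext C
    rw [truncWords_apply, truncWords_apply]
    split_ifs with hC
    · rw [(hg r hr).1, if_pos hC.1]
    · rfl
  have hm : ∀ S : Finset 𝔞, AEStronglyMeasurable (fun r => truncWords S k (g r))
      (volume.restrict (Ioc s₀ t₀)) := by
    intro S
    have h1 := intervalIntegrable_truncWords S k (u := wordSource β z) (a := s₀) (b := t₀)
      fun C _ => h.intervalIntegrable_source C hs ht
    rw [intervalIntegrable_iff_integrableOn_Ioc_of_le hst] at h1
    refine h1.aestronglyMeasurable.congr ?_
    exact (ae_restrict_iff' measurableSet_Ioc).2 (.of_forall fun r hr =>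
      (htr S r hr).symm)
  have hlim : ∀ r ∈ Ioc s₀ t₀, Tendsto (fun S : Finset 𝔞 => truncWords S k (g r)) atTop
      (𝓝 (g r)) := fun r hr => tendsto_truncWords k (g r) fun C hC => by
    rw [(hg r hr).1, if_neg hC]
  -- The truncations have finitely many components, and measurability passes to the limit.
  have hgm : AEStronglyMeasurable g (volume.restrict (Ioc s₀ t₀)) :=
    aestronglyMeasurable_of_tendsto_ae atTop hm
      ((ae_restrict_iff' measurableSet_Ioc).2 (Eventually.of_forall hlim))
  refine ⟨Integrable.of_bound hgm (‖β‖ * (k * (R : ℝ) ^ k)) ((ae_restrict_iff' measurableSet_Ioc).2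
    (.of_forall fun r hr => (hg r hr).2)), ?_⟩
  have hz : (0 : ℝ≥0∞) = ∫⁻ r in Ioc s₀ t₀, (fun _ : ℝ => (0 : ℝ≥0∞)) r := by simp
  rw [hz]
  refine tendsto_lintegral_filter_of_dominated_convergence'
    (fun _ => ENNReal.ofReal (2 * (‖β‖ * (k * (R : ℝ) ^ k)))) ?_ ?_ ?_ ?_
  · exact Eventually.of_forall fun S => (hgm.sub (hm S)).enorm
  · refine Eventually.of_forall fun S => ?_
    refine (ae_restrict_iff' measurableSet_Ioc).2 (.of_forall fun r hr => ?_)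
    rw [← ofReal_norm]
    refine ENNReal.ofReal_le_ofReal ((norm_sub_le _ _).trans ?_)
    linarith [norm_truncWords_le S k (g r), (hg r hr).2]
  · rw [lintegral_const]
    exact ENNReal.mul_ne_top ENNReal.ofReal_ne_top (by simp)
  · refine (ae_restrict_iff' measurableSet_Ioc).2 (.of_forall fun r hr => ?_)
    have := ((tendsto_const_nhds (x := g r)).sub (hlim r hr)).enorm
    simpa using this

end IsWordEquation

namespace IsWordHierarchy

variable [DecidableEq 𝔞] [Countable 𝔞]

set_option maxHeartbeats 600000 in
/-- On words with letters in `S`, the sources are the collisions of the components with letters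
in `S`, up to an error that tends to zero in `L¹` of the time as `S` grows. -/
lemma tendsto_truncation_error (h : IsWordHierarchy v T K R β x z) {s₀ t₀ : ℝ}
    (hs : s₀ ∈ Icc 0 T) (ht : t₀ ∈ Icc 0 T) (hst : s₀ ≤ t₀) (h0 : ∀ C, x C s₀ = 0)
    {j k : ℕ} (hj : j < k) :
    Tendsto (fun S : Finset 𝔞 => ∫⁻ r in Ioc s₀ t₀, ‖truncWords S k (fun C => z j C r) -
      collisionOp v S j r (truncWords S (k + 1) fun C => x C r)‖ₑ) atTop (𝓝 0) := by
  obtain ⟨g, hg, -, hgl⟩ := h.exists_source_curve (k + 1) hs ht hst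
  have hT0 : 0 ≤ T := hs.1.trans hs.2
  set κ := ENNReal.ofReal (√((t₀ - s₀) * K)) with hκ
  have hlim : Tendsto (fun S : Finset 𝔞 =>
      κ * ∫⁻ r in Ioc s₀ t₀, ‖g r - truncWords S (k + 1) (g r)‖ₑ) atTop (𝓝 0) := by
    have := ENNReal.Tendsto.const_mul (a := κ) hgl (Or.inr ENNReal.ofReal_ne_top)
    simpa using this
  refine tendsto_of_tendsto_of_tendsto_of_le_of_le tendsto_const_nhds hlim
    (fun _ => zero_le) fun S => ?_
  -- the right side of the collision for a larger set of letters
  let u : Finset 𝔞 → List 𝔞 → ℝ → ℂ := fun S' C r =>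
    collisionOp v S' j r (truncWords S' (k + 1) fun C => x C r) C
  have hsub : Ioc s₀ t₀ ⊆ Ioc 0 T := Ioc_subset_Ioc hs.1 ht.2
  have hA : Tendsto (fun S' : Finset 𝔞 => ∑ w ∈ Fintype.piFinset fun _ : Fin k => S,
      ∫⁻ r in Ioc s₀ t₀, ‖z j (List.ofFn w) r - u S' (List.ofFn w) r‖ₑ) atTop (𝓝 0) := by
    rw [show (0 : ℝ≥0∞) = ∑ w ∈ Fintype.piFinset fun _ : Fin k => S, 0 by simp]
    refine tendsto_finsetSum _ fun w hw => ?_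
    have hwj : (List.ofFn w)[j]? = some (w ⟨j, hj⟩) := by simp [hj]
    have hw' : ∀ i, w i ∈ S := fun i => Fintype.mem_piFinset.1 hw i
    refine tendsto_of_tendsto_of_tendsto_of_le_of_le' tendsto_const_nhds
      (h.limit (List.ofFn w) j _ hwj) (.of_forall fun _ => zero_le) ?_
    filter_upwards [eventually_ge_atTop S] with S' hS'
    refine le_trans (lintegral_mono_set hsub) (le_of_eq ?_)
    refine lintegral_congr fun r => ?_
    simp only [u]
    rw [collisionOp_apply v S' j r _ hwj, if_pos (hS' (hw' _))]
    congr 2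
    refine Finset.sum_congr rfl fun a ha => Finset.sum_congr rfl fun b hb => ?_
    rw [truncWords_apply, if_pos]
    refine ⟨by rw [length_splitLetter (by simpa using hj)]; simp, fun d hd => ?_⟩
    simp only [splitLetter, List.mem_append, List.mem_cons] at hd
    have hin : ∀ d ∈ List.ofFn w, d ∈ S' := fun d hd => by
      obtain ⟨i, rfl⟩ := (List.mem_ofFn' _ _).1 hd
      exact hS' (hw' i)
    rcases hd with hd | rfl | rfl | hd
    · exact hin d (List.mem_of_mem_take hd)
    · exact ha
    · exact hb
    · exact hin d (List.mem_of_mem_drop hd)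
  have hA' := hA.add (tendsto_const_nhds (x :=
    κ * ∫⁻ r in Ioc s₀ t₀, ‖g r - truncWords S (k + 1) (g r)‖ₑ))
  rw [zero_add] at hA'
  refine ge_of_tendsto hA' ?_
  filter_upwards [eventually_ge_atTop S] with S' hS'
  have hS'' : S ⊆ S' := hS'
  have hxI : ∀ C, IntervalIntegrable (x C) volume s₀ t₀ := fun C =>
    ((h.continuousOn hT0 C).mono (Icc_subset_Icc hs.1 ht.2)).intervalIntegrable_of_Icc hst
  have hzI : ∀ C : List 𝔞, C.length = k → IntervalIntegrable (z j C) volume s₀ t₀ := fun C hC =>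
    h.intervalIntegrable (by omega) hs ht
  -- compare with the collision over the larger set, seen on words with letters in `S`
  have hsplit : ∀ r, truncWords S k (fun C => z j C r) -
      collisionOp v S j r (truncWords S (k + 1) fun C => x C r) =
      truncWords S k (fun C => z j C r - u S' C r) +
      truncWords S k (collisionOp v S' j r
        (truncWords S' (k + 1) (fun C => x C r) - truncWords S (k + 1) fun C => x C r)) := by
    intro r
    have e1 := truncWords_collisionOp v hS'' hj r fun C => x C r
    have e2 : (fun C => z j C r - u S' C r) = (fun C => z j C r) - fun C => u S' C r := rfl
    rw [map_sub (collisionOp v S' j r), lp.coeFn_sub, map_sub (truncWords S k), e1, e2, map_sub]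
    abel
  have hG : ∀ r ∈ Ioc s₀ t₀, truncWords S' (k + 1) (fun C => x C r) -
      truncWords S (k + 1) (fun C => x C r) =
      ∫ r' in s₀..r, (truncWords S' (k + 1) (fun C => wordSource β z C r') -
        truncWords S (k + 1) fun C => wordSource β z C r') := by
    intro r hr
    have hrT : r ∈ Icc 0 T := ⟨hs.1.trans hr.1.le, hr.2.trans ht.2⟩
    have hsI : ∀ C : List 𝔞, C.length = k + 1 → IntervalIntegrable (wordSource β z C) volume s₀ r :=
      fun C _ => h.intervalIntegrable_source C hs hrT
    rw [intervalIntegral.integral_sub (intervalIntegrable_truncWords S' (k + 1) hsI)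
      (intervalIntegrable_truncWords S (k + 1) hsI), integral_truncWords S' (k + 1) hsI,
      integral_truncWords S (k + 1) hsI]
    simp only [h.eq_integral_source_of_eq_zero _ hs hrT (h0 _)]
  have hGI : IntervalIntegrable (fun r' => truncWords S' (k + 1) (fun C => wordSource β z C r') -
      truncWords S (k + 1) fun C => wordSource β z C r') volume s₀ t₀ :=
    (intervalIntegrable_truncWords S' (k + 1) fun C _ => h.intervalIntegrable_source C hs ht).sub
      (intervalIntegrable_truncWords S (k + 1) fun C _ => h.intervalIntegrable_source C hs ht)
  have hmz : ∀ w ∈ Fintype.piFinset fun _ : Fin k => S,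
      AEMeasurable (fun r => ‖z j (List.ofFn w) r - u S' (List.ofFn w) r‖ₑ)
        (volume.restrict (Ioc s₀ t₀)) := by
    intro w _
    have h1 := hzI (List.ofFn w) (by simp)
    rw [intervalIntegrable_iff_integrableOn_Ioc_of_le hst] at h1
    refine (h1.aestronglyMeasurable.sub ?_).enorm
    have h2 := intervalIntegrable_clm_apply (continuous_collisionOp h.continuous S' j)
      (intervalIntegrable_truncWords S' (k + 1) (u := x) fun C _ => hxI C)
    rw [intervalIntegrable_iff_integrableOn_Ioc_of_le hst] at h2
    exact ((lp.evalCLM ℂ (fun _ : List 𝔞 => ℂ) 2 (List.ofFn w)).continuous.comp_aestronglyMeasurable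
      h2.aestronglyMeasurable)
  calc ∫⁻ r in Ioc s₀ t₀, ‖truncWords S k (fun C => z j C r) -
        collisionOp v S j r (truncWords S (k + 1) fun C => x C r)‖ₑ
      ≤ ∫⁻ r in Ioc s₀ t₀, ((∑ w ∈ Fintype.piFinset fun _ : Fin k => S,
          ‖z j (List.ofFn w) r - u S' (List.ofFn w) r‖ₑ) +
          ‖collisionOp v S' j r (∫ r' in s₀..r,
            (truncWords S' (k + 1) (fun C => wordSource β z C r') -
              truncWords S (k + 1) fun C => wordSource β z C r'))‖ₑ) := by
        refine setLIntegral_mono' measurableSet_Ioc fun r hr => ?_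
        rw [hsplit r, ← hG r hr]
        refine (enorm_add_le _ _).trans (add_le_add (enorm_truncWords_le_sum S k _) ?_)
        rw [← ofReal_norm, ← ofReal_norm]
        exact ENNReal.ofReal_le_ofReal (norm_truncWords_le _ _ _)
    _ = (∑ w ∈ Fintype.piFinset fun _ : Fin k => S,
          ∫⁻ r in Ioc s₀ t₀, ‖z j (List.ofFn w) r - u S' (List.ofFn w) r‖ₑ) +
          ∫⁻ r in Ioc s₀ t₀, ‖collisionOp v S' j r (∫ r' in s₀..r,
            (truncWords S' (k + 1) (fun C => wordSource β z C r') -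
              truncWords S (k + 1) fun C => wordSource β z C r'))‖ₑ := by
        rw [lintegral_add_left' (Finset.aemeasurable_fun_sum _ hmz), lintegral_finsetSum' _ hmz]
    _ ≤ _ := by
        gcongr
        refine (h.lintegral_collisionOp_primitive_le S' j hs.1 ht.2 hst hGI).trans ?_
        rw [← hκ]
        refine mul_le_mul_right (setLIntegral_mono' measurableSet_Ioc fun r hr => ?_) _
        have e : truncWords S' (k + 1) (fun C => wordSource β z C r) -
            truncWords S (k + 1) (fun C => wordSource β z C r) =
            truncWords S' (k + 1)
              ((g r - truncWords S (k + 1) (g r) : WordSpace 𝔞) : List 𝔞 → ℂ) := by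
          have htr : ∀ S : Finset 𝔞, truncWords S (k + 1) (g r) =
              truncWords S (k + 1) fun C => wordSource β z C r := by
            intro S
            ext C
            rw [truncWords_apply, truncWords_apply]
            split_ifs with hC
            · rw [hg r hr, if_pos hC.1]
            · rfl
          have e2 : ((g r - truncWords S (k + 1) (g r) : WordSpace 𝔞) : List 𝔞 → ℂ) =
              (g r : List 𝔞 → ℂ) - (truncWords S (k + 1) (g r) : List 𝔞 → ℂ) := rfl
          rw [e2, map_sub (truncWords S' (k + 1)), truncWords_truncWords hS'', htr, htr]
        rw [e, ← ofReal_norm, ← ofReal_norm]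
        exact ENNReal.ofReal_le_ofReal (norm_truncWords_le _ _ _)

set_option maxHeartbeats 600000 in
/-- The bound on the components at words of length `k` after `m` steps of the hierarchy, with all
letters in `S`. -/
lemma norm_truncWords_component_le (h : IsWordHierarchy v T K R β x z) {s₀ t₀ : ℝ}
    (hs : s₀ ∈ Icc 0 T) (ht : t₀ ∈ Icc 0 T) (hst : s₀ ≤ t₀) (h0 : ∀ C, x C s₀ = 0)
    (S : Finset 𝔞) (k m : ℕ) {t : ℝ} (htt : t ∈ Icc s₀ t₀) :
    ‖truncWords S k fun C => x C t‖ ≤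
      (∑ l ∈ Finset.range m, 2 ^ k * (8 * (‖β‖ * √((t₀ - s₀) * K))) ^ l *
        (‖β‖ * ∑ j ∈ Finset.range (k + l), (∫⁻ r in Ioc s₀ t₀,
          ‖truncWords S (k + l) (fun C => z j C r) -
            collisionOp v S j r (truncWords S (k + l + 1) fun C => x C r)‖ₑ).toReal)) +
      2 ^ k * (8 * (‖β‖ * √((t₀ - s₀) * K))) ^ m *
        ((t₀ - s₀) * (‖β‖ * ((k + m : ℕ) * (R : ℝ) ^ (k + m)))) := by
  have hT0 : 0 ≤ T := hs.1.trans hs.2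
  have hsubT : ∀ r ∈ Icc s₀ t₀, r ∈ Icc 0 T := fun r hr => ⟨hs.1.trans hr.1, hr.2.trans ht.2⟩
  have hκ : 0 ≤ ‖β‖ * √((t₀ - s₀) * K) := by positivity
  have hxI : ∀ C, ∀ t ∈ Icc s₀ t₀, IntervalIntegrable (x C) volume s₀ t := fun C t ht' =>
    ((h.continuousOn hT0 C).mono
      (Icc_subset_Icc hs.1 (ht'.2.trans ht.2))).intervalIntegrable_of_Icc ht'.1
  have hcI : ∀ j k, ∀ t ∈ Icc s₀ t₀, IntervalIntegrable (fun r =>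
      collisionOp v S j r (truncWords S (k + 1) fun C => x C r)) volume s₀ t := fun j k t ht' =>
    intervalIntegrable_clm_apply (continuous_collisionOp h.continuous S j)
      (intervalIntegrable_truncWords S (k + 1) (u := x) fun C _ => hxI C t ht')
  have hzI : ∀ j k, j < k → ∀ t ∈ Icc s₀ t₀, IntervalIntegrable (fun r =>
      truncWords S k fun C => z j C r) volume s₀ t := fun j k hjk t ht' =>
    intervalIntegrable_truncWords S k (u := z j) fun C hC =>
      h.intervalIntegrable (by omega) hs (hsubT t ht')
  let N := k + m
  -- A hierarchy on `WordSpace`, driven by the truncation errors `e` below level `N` and by the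
  -- sources at level `N`.
  let V : ℕ → ℝ → WordSpace 𝔞 →L[ℂ] WordSpace 𝔞 := fun j r => β • collisionOp v S j r
  let xx : ℕ → ℝ → WordSpace 𝔞 := fun k t => truncWords S k fun C => x C t
  let e : ℕ → ℕ → ℝ → WordSpace 𝔞 := fun k j r => truncWords S k (fun C => z j C r) -
    collisionOp v S j r (truncWords S (k + 1) fun C => x C r)
  let f : ℕ → ℝ → WordSpace 𝔞 := fun n r => if n < N then
    β • ∑ j ∈ Finset.range n, e n j r else truncWords S n fun C => wordSource β z C r
  have hsI : ∀ n, ∀ t ∈ Icc s₀ t₀, ∀ C : List 𝔞, C.length = n →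
      IntervalIntegrable (wordSource β z C) volume s₀ t := fun n t ht' C _ =>
    h.intervalIntegrable_source C hs (hsubT t ht')
  have heI : ∀ n, ∀ j < n, ∀ t ∈ Icc s₀ t₀, IntervalIntegrable (e n j) volume s₀ t :=
    fun n j hj t ht' => (hzI j n hj t ht').sub (hcI j n t ht')
  have heI' : ∀ n, ∀ t ∈ Icc s₀ t₀,
      IntervalIntegrable (fun r => β • ∑ j ∈ Finset.range n, e n j r) volume s₀ t := by
    intro n t ht'
    have := IntervalIntegrable.sum (Finset.range n) (f := fun j => e n j)
      (μ := volume) (a := s₀) (b := t) fun j hj => heI n j (Finset.mem_range.1 hj) t ht'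
    exact (by simpa [Finset.sum_fn] using this : IntervalIntegrable
      (fun r => ∑ j ∈ Finset.range n, e n j r) volume s₀ t).smul β
  have hfI : ∀ n, ∀ t ∈ Icc s₀ t₀, IntervalIntegrable (f n) volume s₀ t := by
    intro n t ht'
    by_cases hn : n < N
    · simp only [f, hn, if_true]
      exact heI' n t ht'
    · simp only [f, hn, if_false]
      exact intervalIntegrable_truncWords S n (hsI n t ht')
  have hxx : ∀ n, ∀ t ∈ Icc s₀ t₀, xx n t = ∫ r in s₀..t, truncWords S n fun C => wordSource β z C r := by
    intro n t ht'
    rw [integral_truncWords S n (hsI n t ht')]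
    simp only [xx, h.eq_integral_source_of_eq_zero _ hs (hsubT t ht') (h0 _)]
  have hmain := norm_hierarchy_le (V := V) (x := xx) (f := f) (κ := ‖β‖ * √((t₀ - s₀) * K))
    (s₀ := s₀) (t₀ := t₀) (N := N) (k := k) (m := m) (t := t)
    (fun j => (continuous_collisionOp h.continuous S j).const_smul β)
    (fun i j hij r r' => by
      simp only [V]
      rw [smul_mul_smul_comm, smul_mul_smul_comm, collisionOp_comm v S hij])
    hκ
    (fun j W => by
      have h1 := h.lintegral_collisionOp_le S j hs.1 ht.2 W
      have hc : Continuous fun r => collisionOp v S j r W :=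
        (continuous_collisionOp h.continuous S j).clm_apply continuous_const
      simp only [V, FunLike.coe_smul, Pi.smul_apply, norm_smul]
      rw [intervalIntegral.integral_const_mul, mul_assoc]
      refine mul_le_mul_of_nonneg_left ?_ (norm_nonneg _)
      rw [intervalIntegral.integral_of_le hst, integral_norm_eq_lintegral_enorm
        hc.aestronglyMeasurable]
      refine (ENNReal.toReal_mono ?_ h1).trans ?_
      · exact ENNReal.mul_ne_top ENNReal.ofReal_ne_top enorm_ne_top
      · rw [ENNReal.toReal_mul, ENNReal.toReal_ofReal (Real.sqrt_nonneg _), toReal_enorm])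
    (fun n _ => hfI n t₀ (right_mem_Icc.2 hst))
    (fun t ht' => by
      rw [hxx N t ht']
      simp only [f, lt_irrefl, if_false]
      rfl)
    (fun n hn t ht' => by
      rw [hxx n t ht', ← intervalIntegral.integral_add]
      · refine intervalIntegral.integral_congr fun r _ => ?_
        simp only [f, hn, if_true, V, xx, e, FunLike.coe_smul, Pi.smul_apply,
          ← Finset.smul_sum, Finset.sum_sub_distrib, smul_sub]
        rw [add_sub_cancel]
        have hsrc : truncWords S n (fun C => wordSource β z C r) =
            truncWords S n (β • ∑ j ∈ Finset.range n, fun C => z j C r) := by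
          ext C
          rw [truncWords_apply, truncWords_apply]
          split_ifs with hC
          · simp [wordSource, hC.1]
          · rfl
        rw [hsrc, map_smul, map_sum]
      · have := IntervalIntegrable.sum (Finset.range n) (f := fun j r => V j r (xx (n + 1) r))
          (μ := volume) (a := s₀) (b := t) fun j _ => (hcI j n t ht').smul β
        simpa [Finset.sum_fn] using this
      · exact hfI n t ht')
    rfl htt
  refine hmain.trans ?_
  rw [Finset.sum_range_succ]
  refine add_le_add (Finset.sum_le_sum fun l hl => ?_) ?_
  · refine mul_le_mul_of_nonneg_left ?_ (by positivity)
    have hlN : k + l < N := by have := Finset.mem_range.1 hl; omega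
    have hII := heI (k + l)
    simp only [f, hlN, if_true, norm_smul]
    rw [intervalIntegral.integral_const_mul]
    refine mul_le_mul_of_nonneg_left ?_ (norm_nonneg _)
    calc ∫ r in s₀..t₀, ‖∑ j ∈ Finset.range (k + l), e (k + l) j r‖
        ≤ ∫ r in s₀..t₀, ∑ j ∈ Finset.range (k + l), ‖e (k + l) j r‖ := by
          refine intervalIntegral.integral_mono_on hst ?_ ?_ fun r _ => norm_sum_le _ _
          · have := IntervalIntegrable.sum (Finset.range (k + l)) (f := fun j => e (k + l) j)
              (μ := volume) (a := s₀) (b := t₀) fun j hj =>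
                hII j (Finset.mem_range.1 hj) t₀ (right_mem_Icc.2 hst)
            exact (by simpa [Finset.sum_fn] using this : IntervalIntegrable
              (fun r => ∑ j ∈ Finset.range (k + l), e (k + l) j r) volume s₀ t₀).norm
          · have := IntervalIntegrable.sum (Finset.range (k + l)) (f := fun j r => ‖e (k + l) j r‖)
              (μ := volume) (a := s₀) (b := t₀) fun j hj =>
                (hII j (Finset.mem_range.1 hj) t₀ (right_mem_Icc.2 hst)).norm
            simpa [Finset.sum_fn] using this
      _ = ∑ j ∈ Finset.range (k + l), ∫ r in s₀..t₀, ‖e (k + l) j r‖ :=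
          intervalIntegral.integral_finsetSum fun j hj =>
            (hII j (Finset.mem_range.1 hj) t₀ (right_mem_Icc.2 hst)).norm
      _ = _ := by
          refine Finset.sum_congr rfl fun j hj => ?_
          have h1 := hII j (Finset.mem_range.1 hj) t₀ (right_mem_Icc.2 hst)
          rw [intervalIntegrable_iff_integrableOn_Ioc_of_le hst] at h1
          rw [intervalIntegral.integral_of_le hst,
            integral_norm_eq_lintegral_enorm h1.aestronglyMeasurable]
  · refine mul_le_mul_of_nonneg_left ?_ (by positivity)
    have hNN : ¬ k + m < N := by simp [N]
    simp only [f, hNN, if_false]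
    calc ∫ r in s₀..t₀, ‖truncWords S (k + m) fun C => wordSource β z C r‖
        ≤ ∫ _ in s₀..t₀, ‖β‖ * ((k + m : ℕ) * (R : ℝ) ^ (k + m)) := by
          refine intervalIntegral.integral_mono_on hst ?_ (by simp) fun r hr => ?_
          · exact (intervalIntegrable_truncWords S (k + m)
              (hsI (k + m) t₀ (right_mem_Icc.2 hst))).norm
          · obtain ⟨Y, hY, hYn⟩ := h.exists_source (k + m) (hsubT r hr)
            refine le_trans (le_of_eq ?_) ((norm_truncWords_le S (k + m) Y).trans hYn)
            congr 1
            ext C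
            rw [truncWords_apply, truncWords_apply]
            split_ifs with hC
            · rw [hY, if_pos hC.1]
            · rfl
      _ = _ := by
        rw [intervalIntegral.integral_const, smul_eq_mul]

/-- On a short time interval the series of collisions converges, and a solution that vanishes at the
beginning of the interval vanishes on it. -/
lemma eq_zero_of_short (h : IsWordHierarchy v T K R β x z) {s₀ t₀ : ℝ}
    (hs : s₀ ∈ Icc 0 T) (ht : t₀ ∈ Icc 0 T) (hst : s₀ ≤ t₀) (h0 : ∀ C, x C s₀ = 0)
    (hsmall : 8 * (‖β‖ * √((t₀ - s₀) * K)) * R < 1) (C : List 𝔞) {t : ℝ} (htt : t ∈ Icc s₀ t₀) :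
    x C t = 0 := by
  set q := 8 * (‖β‖ * √((t₀ - s₀) * K)) with hq
  have hq0 : 0 ≤ q := by positivity
  set k := C.length with hk
  have hle : ∀ m : ℕ, ‖x C t‖ ≤ 2 ^ k * q ^ m *
        ((t₀ - s₀) * (‖β‖ * ((k + m : ℕ) * (R : ℝ) ^ (k + m)))) := by
    intro m
    -- For fixed `m` the truncation errors disappear as `S` grows.
    have hlim : Tendsto (fun S : Finset 𝔞 =>
        (∑ l ∈ Finset.range m, 2 ^ k * q ^ l *
        (‖β‖ * ∑ j ∈ Finset.range (k + l), (∫⁻ r in Ioc s₀ t₀,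
          ‖truncWords S (k + l) (fun C => z j C r) -
            collisionOp v S j r (truncWords S (k + l + 1) fun C => x C r)‖ₑ).toReal)) +
        2 ^ k * q ^ m *
        ((t₀ - s₀) * (‖β‖ * ((k + m : ℕ) * (R : ℝ) ^ (k + m))))) atTop
        (𝓝 ((∑ l ∈ Finset.range m, 2 ^ k * q ^ l * (‖β‖ * ∑ j ∈ Finset.range (k + l), 0)) +
        2 ^ k * q ^ m * ((t₀ - s₀) * (‖β‖ * ((k + m : ℕ) * (R : ℝ) ^ (k + m)))))) := by
      refine Tendsto.add (tendsto_finsetSum _ fun l _ => ?_) tendsto_const_nhds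
      refine Tendsto.const_mul _ (Tendsto.const_mul _ (tendsto_finsetSum _ fun j hj => ?_))
      have := (ENNReal.tendsto_toReal ENNReal.zero_ne_top).comp
        (h.tendsto_truncation_error hs ht hst h0 (Finset.mem_range.1 hj))
      exact this
    simp only [Finset.sum_const_zero, mul_zero, zero_add] at hlim
    refine ge_of_tendsto hlim ?_
    filter_upwards [eventually_ge_atTop C.toFinset] with S hS
    refine le_trans ?_ (h.norm_truncWords_component_le hs ht hst h0 S k m htt)
    have h1 := lp.norm_apply_le_norm (p := 2) (by norm_num)
      (truncWords S k fun C => x C t) C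
    rw [truncWords_apply, if_pos ⟨rfl, fun c hc => hS (List.mem_toFinset.2 hc)⟩] at h1
    exact h1
  -- The remainder decays geometrically, up to the factor `k + m`.
  have hlim : Tendsto (fun m : ℕ => 2 ^ k * q ^ m *
        ((t₀ - s₀) * (‖β‖ * ((k + m : ℕ) * (R : ℝ) ^ (k + m))))) atTop (𝓝 0) := by
    have hqR : |q * R| < 1 := by rw [abs_of_nonneg (mul_nonneg hq0 R.coe_nonneg)]; exact hsmall
    have h1 := tendsto_pow_atTop_nhds_zero_of_abs_lt_one hqR
    have h2 := tendsto_self_mul_const_pow_of_abs_lt_one hqR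
    have h3 := ((h1.const_mul (k : ℝ)).add h2).const_mul
      (2 ^ k * (t₀ - s₀) * ‖β‖ * (R : ℝ) ^ k)
    simp only [mul_zero, add_zero] at h3
    refine h3.congr fun m => ?_
    push_cast
    rw [mul_pow, pow_add]
    ring
  exact norm_le_zero_iff.1 (ge_of_tendsto hlim (Eventually.of_forall hle))

/-- Uniqueness for hierarchies of words: short intervals, whose length does not depend on the
initial time, cover `[0, T]`. -/
theorem eq_zero (h : IsWordHierarchy v T K R β x z) (C : List 𝔞) {t : ℝ} (ht : t ∈ Icc 0 T) :
    x C t = 0 := by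
  obtain ⟨δ, hδ, hδs⟩ : ∃ δ > 0, 8 * (‖β‖ * √(δ * K)) * R < 1 := by
    have hc : Continuous fun δ : ℝ => 8 * (‖β‖ * √(δ * K)) * R := by fun_prop
    have h1 : ∀ᶠ δ in 𝓝 (0 : ℝ), 8 * (‖β‖ * √(δ * K)) * R < 1 :=
      hc.continuousAt.eventually (gt_mem_nhds (by simp))
    obtain ⟨δ, hδ, hδ'⟩ := ((h1.filter_mono nhdsWithin_le_nhds).and
      (self_mem_nhdsWithin : Ioi (0 : ℝ) ∈ 𝓝[>] 0)).exists
    exact ⟨δ, hδ', hδ⟩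
  have hT : 0 ≤ T := ht.1.trans ht.2
  have key : ∀ n : ℕ, ∀ C, ∀ t ∈ Icc 0 T, t ≤ n * δ → x C t = 0 := by
    intro n
    induction n with
    | zero =>
      intro C t ht htn
      have : t = 0 := le_antisymm (by simpa using htn) ht.1
      rw [this, h.equation C 0 ⟨le_rfl, hT⟩]
      simp
    | succ n ih =>
      intro C t ht htn
      rcases le_or_gt t (n * δ) with h1 | h1
      · exact ih C t ht h1
      · have hs : (n : ℝ) * δ ∈ Icc 0 T := ⟨by positivity, h1.le.trans ht.2⟩
        refine h.eq_zero_of_short hs ht h1.le (fun C => ih C _ hs le_rfl) ?_ C (right_mem_Icc.2 h1.le)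
        refine lt_of_le_of_lt ?_ hδs
        push_cast at htn
        gcongr
        linarith
  obtain ⟨n, hn⟩ := exists_nat_ge (t / δ)
  exact key n C t ht ((div_le_iff₀ hδ).1 hn)

end IsWordHierarchy

end WordHierarchy

/-! ### Integral estimates on the plane -/

section PlaneEstimates

lemma measurePreserving_coords :
    MeasurePreserving (fun y : Plane => (y 0, y 1)) volume (volume.prod volume) :=
  (volume_preserving_finTwoArrow ℝ).comp (PiLp.volume_preserving_ofLp (Fin 2))

/-- The symbol of `1 - Δ` on the plane. -/
def japanese (p : Plane) : ℝ := 1 + 4 * Real.pi ^ 2 * ‖p‖ ^ 2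

lemma one_le_japanese (p : Plane) : 1 ≤ japanese p := by
  unfold japanese
  have : 0 ≤ 4 * Real.pi ^ 2 * ‖p‖ ^ 2 := by positivity
  linarith

lemma japanese_pos (p : Plane) : 0 < japanese p := one_pos.trans_le (one_le_japanese p)

lemma continuous_japanese : Continuous japanese := by
  unfold japanese
  fun_prop

lemma continuous_japanese_rpow (s : ℝ) : Continuous fun p => japanese p ^ s :=
  continuous_japanese.rpow_const fun p => Or.inl (japanese_pos p).ne'

lemma lintegral_gaussian_affine {a : ℝ} (ha : a ≠ 0) (b : ℝ) :
    ∫⁻ s : ℝ, ENNReal.ofReal (Real.exp (-(a * s + b) ^ 2 / 4)) =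
      ENNReal.ofReal (|a|⁻¹ * √(4 * Real.pi)) := by
  have h1 : (fun x : ℝ => Real.exp (-x ^ 2 / 4)) = fun x => Real.exp (-(1 / 4) * x ^ 2) := by
    funext x
    congr 1
    ring
  have hi : Integrable fun x : ℝ => Real.exp (-x ^ 2 / 4) := by
    rw [h1]
    exact integrable_exp_neg_mul_sq (by norm_num)
  have e : ∀ s : ℝ, a * s + b = a * (s + b / a) := fun s => by field_simp
  simp only [e]
  rw [lintegral_add_right_eq_self (fun s => ENNReal.ofReal (Real.exp (-(a * s) ^ 2 / 4))),
    ← ofReal_integral_eq_lintegral_ofReal (hi.comp_mul_left' ha)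
      (.of_forall fun _ => (Real.exp_pos _).le),
    Measure.integral_comp_mul_left (fun x => Real.exp (-x ^ 2 / 4)), h1, integral_gaussian,
    abs_inv, smul_eq_mul]
  congr 3
  ring

lemma lintegral_one_add_sq_rpow_lt_top {α : ℝ} (hα : 1 / 2 < α) :
    ∫⁻ t : ℝ, ENNReal.ofReal ((1 + 4 * Real.pi ^ 2 * t ^ 2) ^ (-α)) < ∞ := by
  have h1 : Integrable (fun x : ℝ => (1 + ‖x‖ ^ 2) ^ (-(2 * α) / 2)) :=
    integrable_rpow_neg_one_add_norm_sq (by simp; linarith)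
  refine lt_of_le_of_lt (lintegral_mono fun t => ENNReal.ofReal_le_ofReal ?_)
    h1.lintegral_lt_top
  rw [show -(2 * α) / 2 = -α by ring]
  refine Real.rpow_le_rpow_of_nonpos (by positivity) ?_ (by linarith)
  have h2 : 1 ≤ 4 * Real.pi ^ 2 := by nlinarith [Real.pi_gt_three]
  rw [Real.norm_eq_abs, sq_abs]
  nlinarith [sq_nonneg t]

/-- A weight of order larger than `1/2` is integrable on lines, uniformly in the line: integrating a
Gaussian in a linear functional gains the inverse of its slope. -/
lemma exists_lintegral_gaussian_le {α : ℝ} (hα : 1 / 2 < α) : ∃ C : NNReal, ∀ (a : Plane), a ≠ 0 →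
    ∀ b : ℝ, ∫⁻ y : Plane, ENNReal.ofReal (japanese y ^ (-α) *
      Real.exp (-(⟪a, y⟫_ℝ + b) ^ 2 / 4)) ≤ C * ENNReal.ofReal ‖a‖⁻¹ := by
  obtain ⟨C, hC⟩ := ENNReal.lt_iff_exists_coe.1 (lintegral_one_add_sq_rpow_lt_top hα)
  refine ⟨C * (√2 * √(4 * Real.pi)).toNNReal, fun a ha b => ?_⟩
  -- the coordinate `i` carries the larger component of `a`
  have key : ∀ i j : Fin 2, MeasurePreserving (fun y : Plane => (y i, y j)) volume
      (volume.prod volume) → (∀ y : Plane, ‖y‖ ^ 2 = y i ^ 2 + y j ^ 2) →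
      (∀ y z : Plane, ⟪y, z⟫_ℝ = y i * z i + y j * z j) → |a j| ≤ |a i| →
      ∫⁻ y : Plane, ENNReal.ofReal (japanese y ^ (-α) *
        Real.exp (-(⟪a, y⟫_ℝ + b) ^ 2 / 4)) ≤ C * ENNReal.ofReal (|a i|⁻¹ * √(4 * Real.pi)) ∧
      |a i|⁻¹ ≤ √2 * ‖a‖⁻¹ := by
    intro i j hmp hn hin hij
    have hn0 : 0 < ‖a‖ := norm_pos_iff.2 ha
    have h1 : ‖a‖ ≤ √2 * |a i| := by
      rw [← Real.sqrt_sq hn0.le, ← Real.sqrt_sq (abs_nonneg (a i)), ← Real.sqrt_mul (by norm_num)]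
      refine Real.sqrt_le_sqrt ?_
      rw [hn, sq_abs]
      nlinarith [sq_le_sq' (by linarith [abs_nonneg (a j), abs_nonneg (a i)]) hij, sq_abs (a i),
        sq_abs (a j)]
    have hai : 0 < |a i| := by
      by_contra h
      have : |a i| = 0 := le_antisymm (not_lt.1 h) (abs_nonneg _)
      rw [this, mul_zero] at h1
      linarith
    refine ⟨?_, ?_⟩
    · let F : ℝ × ℝ → ℝ≥0∞ := fun q => ENNReal.ofReal ((1 + 4 * Real.pi ^ 2 * q.2 ^ 2) ^ (-α)) *
        ENNReal.ofReal (Real.exp (-(a i * q.1 + (a j * q.2 + b)) ^ 2 / 4))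
      have hF : Measurable F := by fun_prop
      calc ∫⁻ y : Plane, ENNReal.ofReal (japanese y ^ (-α) *
            Real.exp (-(⟪a, y⟫_ℝ + b) ^ 2 / 4))
          ≤ ∫⁻ y : Plane, F (y i, y j) := by
            refine lintegral_mono fun y => ?_
            rw [ENNReal.ofReal_mul (by have := japanese_pos y; positivity)]
            refine mul_le_mul' (ENNReal.ofReal_le_ofReal ?_) (le_of_eq ?_)
            · refine Real.rpow_le_rpow_of_nonpos (by positivity) ?_ (by linarith)
              unfold japanese
              rw [hn]
              nlinarith [sq_nonneg (y i), Real.pi_pos, mul_nonneg (sq_nonneg Real.pi)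
                (sq_nonneg (y i))]
            · rw [hin, add_assoc]
        _ = ∫⁻ q, F q ∂(volume.prod volume) := hmp.lintegral_comp hF
        _ = ∫⁻ t : ℝ, ∫⁻ s : ℝ, F (s, t) := lintegral_prod_symm _ hF.aemeasurable
        _ = ∫⁻ t : ℝ, ENNReal.ofReal ((1 + 4 * Real.pi ^ 2 * t ^ 2) ^ (-α)) *
              ENNReal.ofReal (|a i|⁻¹ * √(4 * Real.pi)) := by
            refine lintegral_congr fun t => ?_
            simp only [F]
            rw [lintegral_const_mul _ (by fun_prop),
              lintegral_gaussian_affine (abs_pos.1 hai)]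
        _ = _ := by rw [lintegral_mul_const _ (by fun_prop), hC.1]
    · rw [inv_le_iff_one_le_mul₀ hai]
      calc (1 : ℝ) = ‖a‖ * ‖a‖⁻¹ := (mul_inv_cancel₀ hn0.ne').symm
        _ ≤ (√2 * |a i|) * ‖a‖⁻¹ := by gcongr
        _ = _ := by ring
  have hfin : ∀ i : Fin 2, |a i|⁻¹ ≤ √2 * ‖a‖⁻¹ →
      (C : ℝ≥0∞) * ENNReal.ofReal (|a i|⁻¹ * √(4 * Real.pi)) ≤
      ((C * (√2 * √(4 * Real.pi)).toNNReal : NNReal) : ℝ≥0∞) *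
        ENNReal.ofReal ‖a‖⁻¹ := by
    intro i hi
    rw [ENNReal.coe_mul, mul_assoc]
    gcongr
    change _ ≤ ENNReal.ofReal _ * _
    rw [← ENNReal.ofReal_mul (by positivity)]
    refine ENNReal.ofReal_le_ofReal ?_
    calc |a i|⁻¹ * √(4 * Real.pi) ≤ (√2 * ‖a‖⁻¹) * √(4 * Real.pi) := by gcongr
      _ = _ := by ring
  rcases le_total |a 1| |a 0| with h | h
  · obtain ⟨h1, h2⟩ := key 0 1 measurePreserving_coords
      (fun y => by simp [EuclideanSpace.norm_sq_eq, Fin.sum_univ_two])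
      (fun y z => by simp [PiLp.inner_apply, Fin.sum_univ_two, mul_comm]) h
    exact h1.trans (hfin 0 h2)
  · obtain ⟨h1, h2⟩ := key 1 0 (Measure.measurePreserving_swap.comp measurePreserving_coords)
      (fun y => by simp [EuclideanSpace.norm_sq_eq, Fin.sum_univ_two, add_comm])
      (fun y z => by simp [PiLp.inner_apply, Fin.sum_univ_two, mul_comm, add_comm]) h
    exact h1.trans (hfin 1 h2)

/-- `∫ ⟨v⟩^{-2α} |v - ξ|^{-1} dv` is bounded uniformly in `ξ`; the decay at infinity is of order
`2 α + 1 > 2`. -/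
lemma exists_lintegral_japanese_inv_norm_le {α : ℝ} (hα : 1 / 2 < α) : ∃ C : NNReal, ∀ ξ : Plane,
    ∫⁻ v : Plane, ENNReal.ofReal (japanese v ^ (-α) * ‖v - ξ‖⁻¹) ≤ C := by
  have hdim : Module.finrank ℝ Plane = 2 := by simp
  let near : Plane → ℝ := fun x => if ‖x‖ ≤ 1 then ‖x‖⁻¹ else 0
  have hnear : Integrable near := by
    refine (integrable_fun_norm_addHaar volume (f := fun r : ℝ => if r ≤ 1 then r⁻¹ else 0)).2 ?_
    rw [hdim]
    have h1 : IntegrableOn (indicator (Iic (1 : ℝ)) fun _ => (1 : ℝ)) (Ioi 0) := by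
      rw [IntegrableOn, integrable_indicator_iff measurableSet_Iic, IntegrableOn,
        Measure.restrict_restrict measurableSet_Iic, Iic_inter_Ioi]
      simp
    refine h1.congr_fun (fun r hr => ?_) measurableSet_Ioi
    have hr' : r ≠ 0 := (show (0 : ℝ) < r from hr).ne'
    by_cases h : r ≤ 1 <;> simp [indicator, h, hr']
  let far : Plane → ℝ := fun x => (1 + ‖x‖) ^ (-(2 * α + 1))
  have hfar : Integrable far := integrable_one_add_norm (by rw [hdim]; push_cast; linarith)
  obtain ⟨C₁, hC₁⟩ := ENNReal.lt_iff_exists_coe.1 hnear.lintegral_lt_top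
  obtain ⟨C₂, hC₂⟩ := ENNReal.lt_iff_exists_coe.1 hfar.lintegral_lt_top
  refine ⟨C₁ + (2 * 2 ^ α : ℝ).toNNReal * (C₂ + C₂), fun ξ => ?_⟩
  have hpt : ∀ v : Plane, japanese v ^ (-α) * ‖v - ξ‖⁻¹ ≤
      near (v - ξ) + 2 * 2 ^ α * (far v + far (v - ξ)) := by
    intro v
    have hj := one_le_japanese v
    have hfp : ∀ x, 0 ≤ far x := fun x => by positivity
    by_cases h : ‖v - ξ‖ ≤ 1
    · have h1 : japanese v ^ (-α) ≤ 1 := Real.rpow_le_one_of_one_le_of_nonpos hj (by linarith)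
      have h2 : near (v - ξ) = ‖v - ξ‖⁻¹ := if_pos h
      rw [h2]
      have h3 : japanese v ^ (-α) * ‖v - ξ‖⁻¹ ≤ 1 * ‖v - ξ‖⁻¹ := by gcongr
      have h4 := hfp v
      have h5 := hfp (v - ξ)
      nlinarith [show (0 : ℝ) < 2 * 2 ^ α by positivity]
    · push Not at h
      have h2 : near (v - ξ) = 0 := if_neg (not_le.2 h)
      rw [h2, zero_add]
      set A := 1 + ‖v‖ with hA
      set B := 1 + ‖v - ξ‖ with hB
      have hA0 : 0 < A := by positivity
      have hB0 : 0 < B := by positivity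
      have hB1 : ‖v - ξ‖⁻¹ ≤ 2 * B⁻¹ := by
        rw [← div_eq_mul_inv, inv_le_iff_one_le_mul₀ (by linarith), div_mul_eq_mul_div,
          le_div_iff₀ hB0]
        linarith
      have hA1 : japanese v ^ (-α) ≤ 2 ^ α * A ^ (-(2 * α)) := by
        have h3 : A ^ 2 / 2 ≤ japanese v := by
          unfold japanese
          rw [hA]
          nlinarith [sq_nonneg (1 - ‖v‖), Real.pi_gt_three, sq_nonneg ‖v‖,
            mul_nonneg (sub_nonneg.2 (show (9 : ℝ) ≤ Real.pi ^ 2 by nlinarith [Real.pi_gt_three]))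
              (sq_nonneg ‖v‖)]
        refine (Real.rpow_le_rpow_of_nonpos (by positivity) h3 (by linarith)).trans
          (le_of_eq ?_)
        rw [Real.div_rpow (by positivity) (by norm_num), ← Real.rpow_natCast A 2,
          ← Real.rpow_mul hA0.le, Real.rpow_neg (by norm_num : (0 : ℝ) ≤ 2), div_inv_eq_mul]
        rw [mul_comm]
        congr 2
        push_cast
        ring
      have hAB : A ^ (-(2 * α)) * B⁻¹ ≤ far v + far (v - ξ) := by
        have e1 : ∀ X : ℝ, 0 < X → X ^ (-(2 * α)) * X⁻¹ = X ^ (-(2 * α + 1)) := by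
          intro X hX
          rw [← Real.rpow_neg_one X, ← Real.rpow_add hX]
          congr 1
          ring
        rcases le_total A B with h4 | h4
        · have : A ^ (-(2 * α)) * B⁻¹ ≤ A ^ (-(2 * α)) * A⁻¹ := by gcongr
          rw [e1 A hA0] at this
          have h5 := hfp (v - ξ)
          have h6 : far v = A ^ (-(2 * α + 1)) := rfl
          linarith
        · have : A ^ (-(2 * α)) * B⁻¹ ≤ B ^ (-(2 * α)) * B⁻¹ := by
            gcongr ?_ * _
            exact Real.rpow_le_rpow_of_nonpos hB0 h4 (by linarith)
          rw [e1 B hB0] at this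
          have h5 := hfp v
          have h6 : far (v - ξ) = B ^ (-(2 * α + 1)) := rfl
          linarith
      calc japanese v ^ (-α) * ‖v - ξ‖⁻¹ ≤ (2 ^ α * A ^ (-(2 * α))) * (2 * B⁻¹) := by gcongr
        _ = 2 * 2 ^ α * (A ^ (-(2 * α)) * B⁻¹) := by ring
        _ ≤ _ := by gcongr
  have hfarm : Measurable fun v => ENNReal.ofReal (far v) := by fun_prop
  have hnearm : Measurable fun v => ENNReal.ofReal (near v) :=
    (Measurable.ite (measurableSet_le measurable_norm measurable_const) (by fun_prop)
      measurable_const).ennreal_ofReal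
  calc ∫⁻ v : Plane, ENNReal.ofReal (japanese v ^ (-α) * ‖v - ξ‖⁻¹)
      ≤ ∫⁻ v : Plane, (ENNReal.ofReal (near (v - ξ)) + ENNReal.ofReal (2 * 2 ^ α) *
          (ENNReal.ofReal (far v) + ENNReal.ofReal (far (v - ξ)))) := by
        refine lintegral_mono fun v => ?_
        refine (ENNReal.ofReal_le_ofReal (hpt v)).trans ?_
        refine (ENNReal.ofReal_add_le).trans ?_
        rw [ENNReal.ofReal_mul (by positivity)]
        gcongr
        exact ENNReal.ofReal_add_le
    _ = _ := by
        have hnearm' : Measurable fun v => ENNReal.ofReal (near (v - ξ)) :=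
          hnearm.comp (measurable_id.sub_const ξ)
        rw [lintegral_add_left hnearm', lintegral_const_mul' _ _ ENNReal.ofReal_ne_top,
          lintegral_add_left hfarm,
          lintegral_sub_right_eq_self (fun v => ENNReal.ofReal (near v)),
          lintegral_sub_right_eq_self (fun v => ENNReal.ofReal (far v)), hC₁.1, hC₂.1]
        push_cast
        rfl

end PlaneEstimates

/-! ### The resonance estimate -/

section ResonanceEstimate

/-- The symbol of `(1 - Δ)^{α/2}` on the plane. -/
def sobolevSymbol (α : ℝ) (p : Plane) : ℝ := japanese p ^ (α / 2)

lemma sobolevSymbol_pos (α : ℝ) (p : Plane) : 0 < sobolevSymbol α p :=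
  Real.rpow_pos_of_pos (japanese_pos p) _

lemma one_le_sobolevSymbol {α : ℝ} (hα : 0 ≤ α) (p : Plane) : 1 ≤ sobolevSymbol α p :=
  Real.one_le_rpow (one_le_japanese p) (by linarith)

lemma continuous_sobolevSymbol (α : ℝ) : Continuous (sobolevSymbol α) :=
  continuous_japanese_rpow _

lemma sobolevSymbol_sq (α : ℝ) (p : Plane) : sobolevSymbol α p ^ 2 = japanese p ^ α := by
  rw [sobolevSymbol, ← Real.rpow_natCast, ← Real.rpow_mul (japanese_pos p).le]
  congr 1
  push_cast
  ring

/-- The difference of kinetic energies before and after a collision in which a particle of momentum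
`ξ` turns into particles of momenta `u`, `v` and a hole of momentum `u + v - ξ`. -/
def resonance (ξ u v : Plane) : ℝ :=
  4 * Real.pi ^ 2 * (‖u‖ ^ 2 + ‖v‖ ^ 2 - ‖u + v - ξ‖ ^ 2 - ‖ξ‖ ^ 2)

lemma resonance_eq (ξ u v : Plane) :
    resonance ξ u v = -(8 * Real.pi ^ 2) * ⟪u - ξ, v - ξ⟫_ℝ := by
  have h1 : ‖u + v - ξ‖ ^ 2 = ‖u‖ ^ 2 + ‖v‖ ^ 2 + ‖ξ‖ ^ 2 + 2 * ⟪u, v⟫_ℝ - 2 * ⟪u, ξ⟫_ℝ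
      - 2 * ⟪v, ξ⟫_ℝ := by
    rw [norm_sub_sq_real, norm_add_sq_real, inner_add_left]
    ring
  rw [resonance, h1, inner_sub_left, inner_sub_right, inner_sub_right, real_inner_self_eq_norm_sq,
    real_inner_comm ξ v]
  ring

lemma continuous_resonance : Continuous fun p : Plane × Plane × Plane =>
    resonance p.1 p.2.1 p.2.2 := by
  unfold resonance
  fun_prop

/-- The quotient of Sobolev weights after and before a collision. -/
def collisionWeight (α : ℝ) (ξ u v : Plane) : ℝ :=
  sobolevSymbol α ξ / (sobolevSymbol α u * sobolevSymbol α v * sobolevSymbol α (u + v - ξ))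

lemma continuous_collisionWeight (α : ℝ) : Continuous fun p : Plane × Plane × Plane =>
    collisionWeight α p.1 p.2.1 p.2.2 := by
  unfold collisionWeight
  have h := continuous_sobolevSymbol α
  refine Continuous.div (by fun_prop) (by fun_prop) fun p => ?_
  have h1 := sobolevSymbol_pos α p.2.1
  have h2 := sobolevSymbol_pos α p.2.2
  have h3 := sobolevSymbol_pos α (p.2.1 + p.2.2 - p.1)
  positivity

lemma japanese_rpow_le {α : ℝ} (hα : 0 ≤ α) (u v w : Plane) :
    japanese (u + v - w) ^ α ≤ 9 ^ α * (japanese u ^ α + japanese v ^ α + japanese w ^ α) := by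
  have hj : japanese (u + v - w) ≤ 3 * (japanese u + japanese v + japanese w) := by
    have h1 : ‖u + v - w‖ ≤ ‖u‖ + ‖v‖ + ‖w‖ :=
      (norm_sub_le _ _).trans (add_le_add_left (norm_add_le _ _) _)
    have h2 : ‖u + v - w‖ ^ 2 ≤ 3 * (‖u‖ ^ 2 + ‖v‖ ^ 2 + ‖w‖ ^ 2) := by
      refine (pow_le_pow_left₀ (norm_nonneg _) h1 2).trans ?_
      nlinarith [sq_nonneg (‖u‖ - ‖v‖), sq_nonneg (‖u‖ - ‖w‖), sq_nonneg (‖v‖ - ‖w‖)]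
    unfold japanese
    nlinarith [mul_le_mul_of_nonneg_left h2 (show 0 ≤ 4 * Real.pi ^ 2 by positivity)]
  have hu := japanese_pos u
  have hv := japanese_pos v
  have hw := japanese_pos w
  have hx : ∀ x : ℝ, 0 ≤ x → japanese u ≤ x → japanese v ≤ x → japanese w ≤ x →
      japanese (u + v - w) ^ α ≤ 9 ^ α * x ^ α := by
    intro x hx h1 h2 h3
    rw [← Real.mul_rpow (by norm_num) hx]
    exact Real.rpow_le_rpow (japanese_pos _).le (by linarith) hα
  have e1 : 0 ≤ japanese u ^ α := by positivity
  have e2 : 0 ≤ japanese v ^ α := by positivity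
  have e3 : 0 ≤ japanese w ^ α := by positivity
  have e4 : (0 : ℝ) ≤ 9 ^ α := by positivity
  rcases le_total (japanese u) (japanese v) with h1 | h1
  · rcases le_total (japanese v) (japanese w) with h2 | h2
    · exact (hx _ hw.le (h1.trans h2) h2 le_rfl).trans (by gcongr; linarith)
    · exact (hx _ hv.le h1 le_rfl h2).trans (by gcongr; linarith)
  · rcases le_total (japanese u) (japanese w) with h2 | h2
    · exact (hx _ hw.le h2 (h1.trans h2) le_rfl).trans (by gcongr; linarith)
    · exact (hx _ hu.le le_rfl h1 h2).trans (by gcongr; linarith)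

lemma collisionWeight_sq_le {α : ℝ} (hα : 0 ≤ α) (ξ u v : Plane) :
    collisionWeight α ξ u v ^ 2 ≤ 9 ^ α * (japanese v ^ (-α) * japanese (u + v - ξ) ^ (-α) +
      japanese u ^ (-α) * japanese (u + v - ξ) ^ (-α) + japanese v ^ (-α) * japanese u ^ (-α)) := by
  have h := japanese_rpow_le hα u v (u + v - ξ)
  rw [show u + v - (u + v - ξ) = ξ by abel] at h
  have hu := Real.rpow_pos_of_pos (japanese_pos u) α
  have hv := Real.rpow_pos_of_pos (japanese_pos v) α
  have hw := Real.rpow_pos_of_pos (japanese_pos (u + v - ξ)) α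
  rw [collisionWeight, div_pow, mul_pow, mul_pow]
  simp only [sobolevSymbol_sq]
  rw [Real.rpow_neg (japanese_pos _).le, Real.rpow_neg (japanese_pos _).le,
    Real.rpow_neg (japanese_pos _).le, div_le_iff₀ (by positivity)]
  refine h.trans (le_of_eq ?_)
  field_simp

lemma lintegral_lintegral_add_add {X Y : Type*} [MeasurableSpace X] [MeasurableSpace Y]
    {μ : Measure X} {ν : Measure Y} [SFinite ν] {f g k : X → Y → ℝ≥0∞}
    (hf : Measurable fun p : X × Y => f p.1 p.2) (hg : Measurable fun p : X × Y => g p.1 p.2) :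
    ∫⁻ x, ∫⁻ y, (f x y + g x y + k x y) ∂ν ∂μ =
      (∫⁻ x, ∫⁻ y, f x y ∂ν ∂μ) + (∫⁻ x, ∫⁻ y, g x y ∂ν ∂μ) + ∫⁻ x, ∫⁻ y, k x y ∂ν ∂μ := by
  have h₁ : ∀ x, Measurable (f x) := fun x => hf.comp measurable_prodMk_left
  have h₂ : ∀ x, Measurable (g x) := fun x => hg.comp measurable_prodMk_left
  have h₃ : Measurable fun x => ∫⁻ y, f x y ∂ν := hf.lintegral_prod_right'
  have h₄ : Measurable fun x => ∫⁻ y, g x y ∂ν := hg.lintegral_prod_right'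
  have h₅ : Measurable fun x => (∫⁻ y, f x y ∂ν) + ∫⁻ y, g x y ∂ν := h₃.add h₄
  rw [← lintegral_add_left h₃, ← lintegral_add_left h₅]
  refine lintegral_congr fun x => ?_
  have h₆ : Measurable fun y => f x y + g x y := (h₁ x).add (h₂ x)
  rw [lintegral_add_left h₆, lintegral_add_left (h₁ x)]

/-- The squares of the weight quotients, averaged over approximately resonant collisions, are bounded
by `C`. -/
def ResonanceBound (α : ℝ) (C : NNReal) : Prop := ∀ (ξ : Plane) (τ : ℝ),
  ∫⁻ u : Plane, ∫⁻ v : Plane, ENNReal.ofReal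
    (collisionWeight α ξ u v ^ 2 * Real.exp (-(resonance ξ u v - τ) ^ 2 / 4)) ≤ C

/-- The estimate behind the smoothing effect of collisions: the square of the weight quotient,
averaged over approximately resonant collisions, is bounded. One of the three weights in the
denominator compensates the numerator; integrating out one momentum along the direction in which
the resonance function grows gains `|v - ξ|^{-1}`, which the remaining weight makes integrable. -/
theorem exists_resonanceBound {α : ℝ} (hα : 1 / 2 < α) : ∃ C, ResonanceBound α C := by
  obtain ⟨C₁, h₁⟩ := exists_lintegral_gaussian_le hα
  obtain ⟨C₂, h₂⟩ := exists_lintegral_japanese_inv_norm_le hα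
  have hα0 : 0 ≤ α := by linarith
  have hjp : ∀ (p : Plane) (s : ℝ), 0 ≤ japanese p ^ s := fun p s =>
    (Real.rpow_pos_of_pos (japanese_pos p) s).le
  have hjc := continuous_japanese_rpow (-α)
  -- the generic term, `v` being the remaining momentum
  have key : ∀ (ξ : Plane) (b : Plane → ℝ), ∫⁻ v : Plane, ∫⁻ y : Plane,
      ENNReal.ofReal (japanese v ^ (-α) * japanese y ^ (-α) *
        Real.exp (-(⟪(-(8 * Real.pi ^ 2)) • (v - ξ), y⟫_ℝ + b v) ^ 2 / 4)) ≤ C₁ * C₂ := by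
    intro ξ b
    have hae : ∀ᵐ v : Plane, v ≠ ξ := by
      rw [ae_iff]
      simp
    calc ∫⁻ v : Plane, ∫⁻ y : Plane, ENNReal.ofReal (japanese v ^ (-α) * japanese y ^ (-α) *
          Real.exp (-(⟪(-(8 * Real.pi ^ 2)) • (v - ξ), y⟫_ℝ + b v) ^ 2 / 4))
        ≤ ∫⁻ v : Plane, C₁ * ENNReal.ofReal (japanese v ^ (-α) * ‖v - ξ‖⁻¹) := by
          refine lintegral_mono_ae ?_
          filter_upwards [hae] with v hv
          simp only [mul_assoc]
          simp only [ENNReal.ofReal_mul (hjp v (-α))]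
          rw [lintegral_const_mul' _ _ ENNReal.ofReal_ne_top, mul_left_comm]
          gcongr
          have h3 : (-(8 * Real.pi ^ 2)) • (v - ξ) ≠ 0 :=
            smul_ne_zero (neg_ne_zero.2 (by have := Real.pi_pos; positivity)) (sub_ne_zero.2 hv)
          refine (h₁ _ h3 (b v)).trans ?_
          gcongr
          · exact norm_pos_iff.2 (sub_ne_zero.2 hv)
          · rw [norm_smul, Real.norm_eq_abs, abs_neg, abs_of_nonneg (by positivity)]
            have : 1 ≤ 8 * Real.pi ^ 2 := by nlinarith [Real.pi_gt_three]
            nlinarith [norm_nonneg (v - ξ)]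
      _ ≤ C₁ * C₂ := by
          rw [lintegral_const_mul' _ _ ENNReal.coe_ne_top]
          gcongr
          exact h₂ ξ
  refine ⟨((9 : ℝ) ^ α).toNNReal * (C₁ * C₂ + C₁ * C₂ + C₁ * C₂), fun ξ τ => ?_⟩
  let m : Plane → Plane → ℝ := fun u v => Real.exp (-(resonance ξ u v - τ) ^ 2 / 4)
  have hmc : Continuous fun p : Plane × Plane => m p.1 p.2 := by
    have := continuous_resonance.comp (by fun_prop : Continuous fun p : Plane × Plane => (ξ, p))
    simp only [Function.comp_def] at this
    fun_prop
  have hm0 : ∀ u v, 0 ≤ m u v := fun u v => (Real.exp_pos _).le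
  let f₁ : Plane → Plane → ℝ≥0∞ := fun u v =>
    ENNReal.ofReal (japanese v ^ (-α) * japanese (u + v - ξ) ^ (-α) * m u v)
  let f₂ : Plane → Plane → ℝ≥0∞ := fun u v =>
    ENNReal.ofReal (japanese u ^ (-α) * japanese (u + v - ξ) ^ (-α) * m u v)
  let f₃ : Plane → Plane → ℝ≥0∞ := fun u v =>
    ENNReal.ofReal (japanese v ^ (-α) * japanese u ^ (-α) * m u v)
  have hf₁ : Measurable fun p : Plane × Plane => f₁ p.1 p.2 := by
    have : Continuous fun p : Plane × Plane =>
      japanese p.2 ^ (-α) * japanese (p.1 + p.2 - ξ) ^ (-α) * m p.1 p.2 :=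
      ((hjc.comp continuous_snd).mul (hjc.comp (g := fun p => japanese p ^ (-α))
        (f := fun p : Plane × Plane => p.1 + p.2 - ξ) (by fun_prop))).mul hmc
    exact this.measurable.ennreal_ofReal
  have hf₂ : Measurable fun p : Plane × Plane => f₂ p.1 p.2 := by
    have : Continuous fun p : Plane × Plane =>
      japanese p.1 ^ (-α) * japanese (p.1 + p.2 - ξ) ^ (-α) * m p.1 p.2 :=
      ((hjc.comp continuous_fst).mul (hjc.comp (g := fun p => japanese p ^ (-α))
        (f := fun p : Plane × Plane => p.1 + p.2 - ξ) (by fun_prop))).mul hmc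
    exact this.measurable.ennreal_ofReal
  have hf₃ : Measurable fun p : Plane × Plane => f₃ p.1 p.2 := by
    have : Continuous fun p : Plane × Plane =>
      japanese p.2 ^ (-α) * japanese p.1 ^ (-α) * m p.1 p.2 :=
      ((hjc.comp continuous_snd).mul (hjc.comp continuous_fst)).mul hmc
    exact this.measurable.ennreal_ofReal
  -- substitute the momentum of the hole for `v`
  have h₂' : ∫⁻ u, ∫⁻ v, f₂ u v ≤ C₁ * C₂ := by
    refine le_trans (le_of_eq ?_) (key ξ fun u => 8 * Real.pi ^ 2 * ⟪u - ξ, u⟫_ℝ - τ)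
    refine lintegral_congr fun u => ?_
    rw [← lintegral_sub_right_eq_self _ (u - ξ)]
    refine lintegral_congr fun y => ?_
    simp only [f₂, m]
    rw [show u + (y - (u - ξ)) - ξ = y by abel, resonance_eq,
      show y - (u - ξ) - ξ = y - u by abel, inner_sub_right, inner_smul_left]
    simp only [conj_trivial]
    congr 5
    ring
  have h₃' : ∫⁻ v, ∫⁻ u, f₃ u v ≤ C₁ * C₂ := by
    refine le_trans (le_of_eq ?_) (key ξ fun v => 8 * Real.pi ^ 2 * ⟪v - ξ, ξ⟫_ℝ - τ)
    refine lintegral_congr fun v => lintegral_congr fun u => ?_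
    simp only [f₃, m]
    rw [resonance_eq, inner_smul_left, real_inner_comm, inner_sub_right]
    simp only [conj_trivial]
    congr 5
    ring
  have hsym : ∫⁻ u, ∫⁻ v, f₁ u v = ∫⁻ u, ∫⁻ v, f₂ u v := by
    rw [lintegral_lintegral_swap hf₁.aemeasurable]
    refine lintegral_congr fun u => lintegral_congr fun v => ?_
    simp only [f₁, f₂, m]
    rw [resonance_eq, resonance_eq, real_inner_comm, add_comm v u]
  calc ∫⁻ u : Plane, ∫⁻ v : Plane, ENNReal.ofReal (collisionWeight α ξ u v ^ 2 * m u v)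
      ≤ ∫⁻ u : Plane, ∫⁻ v : Plane, ENNReal.ofReal (9 ^ α) * (f₁ u v + f₂ u v + f₃ u v) := by
        refine lintegral_mono fun u => lintegral_mono fun v => ?_
        have hw := mul_le_mul_of_nonneg_right (collisionWeight_sq_le hα0 ξ u v) (hm0 u v)
        refine (ENNReal.ofReal_le_ofReal hw).trans (le_of_eq ?_)
        have e : ∀ x y : Plane, 0 ≤ japanese x ^ (-α) * japanese y ^ (-α) * m u v := fun x y =>
          mul_nonneg (mul_nonneg (hjp _ _) (hjp _ _)) (hm0 _ _)
        simp only [f₁, f₂, f₃]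
        rw [← ENNReal.ofReal_add (e _ _) (e _ _), ← ENNReal.ofReal_add (add_nonneg (e _ _) (e _ _))
          (e _ _), ← ENNReal.ofReal_mul (by positivity)]
        congr 1
        ring
    _ = ENNReal.ofReal (9 ^ α) * ((∫⁻ u, ∫⁻ v, f₁ u v) + (∫⁻ u, ∫⁻ v, f₂ u v) +
          ∫⁻ u, ∫⁻ v, f₃ u v) := by
        simp only [lintegral_const_mul' _ _ (ENNReal.ofReal_ne_top (r := (9 : ℝ) ^ α))]
        rw [lintegral_lintegral_add_add hf₁ hf₂]
    _ ≤ _ := by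
        rw [hsym, lintegral_lintegral_swap (f := f₃) hf₃.aemeasurable]
        push_cast
        change _ ≤ ENNReal.ofReal (9 ^ α) * _
        gcongr

end ResonanceEstimate

/-! ### Square functions of oscillatory integrals -/

section Schur

/-- On a bounded time interval, where `exp (-s ^ 2)` is bounded below, a Gaussian weight may be
inserted into an integral over time. -/
lemma setLIntegral_le_gaussian (T : ℝ) (f : ℝ → ℝ≥0∞) :
    ∫⁻ s in Ioc 0 T, f s ≤
      ENNReal.ofReal (Real.exp (T ^ 2)) * ∫⁻ s, ENNReal.ofReal (Real.exp (-s ^ 2)) * f s := by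
  rw [← lintegral_const_mul' _ _ ENNReal.ofReal_ne_top]
  refine (setLIntegral_mono' measurableSet_Ioc fun s hs => ?_).trans (setLIntegral_le_lintegral _ _)
  rw [← mul_assoc, ← ENNReal.ofReal_mul (Real.exp_pos _).le, ← Real.exp_add]
  refine le_mul_of_one_le_left' ?_
  rw [ENNReal.one_le_ofReal, Real.one_le_exp_iff]
  nlinarith [hs.1, hs.2]

variable {X : Type*} [MeasurableSpace X] {μ : Measure X} [SFinite μ]

lemma integral_gaussian_mul_cexp (t : ℝ) :
    ∫ s : ℝ, (Real.exp (-s ^ 2) : ℂ) * Complex.exp (-(Complex.I * (s * t : ℝ))) =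
      (√Real.pi * Real.exp (-t ^ 2 / 4) : ℝ) := by
  have h := fourierIntegral_gaussian (b := 1) (by simp) (-t : ℂ)
  have e : ∀ s : ℝ, (Real.exp (-s ^ 2) : ℂ) * Complex.exp (-(Complex.I * (s * t : ℝ))) =
      Complex.exp (Complex.I * (-t) * s) * Complex.exp (-1 * s ^ 2) := by
    intro s
    push_cast
    rw [mul_comm]
    congr 2
    · ring
    · ring
  simp only [e]
  rw [h]
  push_cast
  rw [div_one, Real.sqrt_eq_rpow, Complex.ofReal_cpow Real.pi_pos.le]
  push_cast
  congr 2
  ring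

/-- The time average of the square of an oscillatory integral sees approximately resonant pairs of
points only. -/
theorem lintegral_sq_oscillatory_le {E Z : X → ℂ} {ω : X → ℝ} (hE : Measurable E) (hω : Measurable ω)
    (hZ : AEMeasurable Z μ) (hEZ : Integrable (fun x => E x * Z x) μ) {M : ℝ≥0∞}
    (hM : ∀ τ : ℝ, ∫⁻ x, ‖E x‖ₑ ^ 2 * ENNReal.ofReal (Real.exp (-(ω x - τ) ^ 2 / 4)) ∂μ ≤ M) :
    ∫⁻ s : ℝ, ENNReal.ofReal (Real.exp (-s ^ 2)) *
        ‖∫ x, E x * Z x * Complex.exp (-(Complex.I * (s * ω x : ℝ))) ∂μ‖ₑ ^ 2 ≤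
      ENNReal.ofReal √Real.pi * M * ∫⁻ x, ‖Z x‖ₑ ^ 2 ∂μ := by
  set u : X → ℂ := fun x => E x * Z x with hu
  let I : ℝ → ℂ := fun s => ∫ x, u x * Complex.exp (-(Complex.I * (s * ω x : ℝ))) ∂μ
  let g : X × X → ℂ := fun p => u p.1 * conj (u p.2)
  let d : X × X → ℝ := fun p => ω p.1 - ω p.2
  have hd : Measurable d := (hω.comp measurable_fst).sub (hω.comp measurable_snd)
  have hg : Integrable g (μ.prod μ) :=
    hEZ.mul_prod ((Complex.conjLIE.toContinuousLinearEquiv.toContinuousLinearMap).integrable_comp hEZ)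
  have hexp : Integrable fun s : ℝ => (Real.exp (-s ^ 2) : ℂ) := by
    have := (integrable_exp_neg_mul_sq (b := 1) one_pos).ofReal (𝕜 := ℂ)
    simpa using this
  -- the square is a double integral
  have hI : ∀ s, I s * conj (I s) =
      ∫ p, g p * Complex.exp (-(Complex.I * (s * d p : ℝ))) ∂(μ.prod μ) := by
    intro s
    simp only [I]
    rw [← integral_conj, ← integral_prod_mul]
    refine integral_congr_ae (.of_forall fun p => ?_)
    simp only [g, d, map_mul, ← Complex.exp_conj, map_neg, Complex.conj_I, Complex.conj_ofReal]
    rw [mul_mul_mul_comm, ← Complex.exp_add]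
    congr 2
    push_cast
    ring
  have hF : Integrable (fun q : ℝ × (X × X) => (Real.exp (-q.1 ^ 2) : ℂ) * (g q.2 *
      Complex.exp (-(Complex.I * (q.1 * d q.2 : ℝ))))) (volume.prod (μ.prod μ)) := by
    have h1 := hexp.mul_prod hg
    have h2 : AEStronglyMeasurable (fun q : ℝ × (X × X) =>
        Complex.exp (-(Complex.I * (q.1 * d q.2 : ℝ)))) (volume.prod (μ.prod μ)) := by
      refine Measurable.aestronglyMeasurable ?_
      have : Measurable fun q : ℝ × (X × X) => d q.2 := hd.comp measurable_snd
      fun_prop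
    refine (h1.mul_bdd h2 (c := 1) ?_).congr (.of_forall fun q => by simp only [mul_assoc])
    refine Eventually.of_forall fun q => le_of_eq ?_
    rw [← mul_neg, ← Complex.ofReal_neg, mul_comm, Complex.norm_exp_ofReal_mul_I]
  have hmain : ∫ s : ℝ, (Real.exp (-s ^ 2) : ℂ) * (I s * conj (I s)) =
      ∫ p, g p * (√Real.pi * Real.exp (-(d p) ^ 2 / 4) : ℝ) ∂(μ.prod μ) := by
    simp only [hI, ← integral_const_mul]
    rw [integral_integral_swap hF]
    refine integral_congr_ae (.of_forall fun p => ?_)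
    simp only []
    rw [← integral_gaussian_mul_cexp, ← integral_const_mul]
    refine integral_congr_ae (.of_forall fun s => ?_)
    simp only []
    ring
  have hreal : ∀ s, (Real.exp (-s ^ 2) : ℂ) * (I s * conj (I s)) =
      ((Real.exp (-s ^ 2) * ‖I s‖ ^ 2 : ℝ) : ℂ) := by
    intro s
    rw [Complex.mul_conj, Complex.normSq_eq_norm_sq]
    push_cast
    rfl
  have hint : Integrable fun s : ℝ => Real.exp (-s ^ 2) * ‖I s‖ ^ 2 := by
    have h1 := hF.integral_prod_left
    simp only [integral_const_mul, ← hI, hreal] at h1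
    exact h1.re
  have hcs : ∫⁻ p, ‖g p‖ₑ * ENNReal.ofReal (Real.exp (-(d p) ^ 2 / 4)) ∂(μ.prod μ) ≤
      M * ∫⁻ x, ‖Z x‖ₑ ^ 2 ∂μ := by
    let K : X → X → ℝ≥0∞ := fun x y => ‖Z x‖ₑ ^ 2 *
      (‖E y‖ₑ ^ 2 * ENNReal.ofReal (Real.exp (-(ω y - ω x) ^ 2 / 4)))
    have hpt : ∀ p : X × X, 2 * (‖g p‖ₑ * ENNReal.ofReal (Real.exp (-(d p) ^ 2 / 4))) ≤
        K p.1 p.2 + K p.2 p.1 := by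
      rintro ⟨x, y⟩
      have h2 : 2 * (‖E x‖ₑ * ‖Z y‖ₑ * (‖E y‖ₑ * ‖Z x‖ₑ)) ≤
          (‖E x‖ₑ * ‖Z y‖ₑ) ^ 2 + (‖E y‖ₑ * ‖Z x‖ₑ) ^ 2 := by
        have h3 : ∀ a b : NNReal, 2 * (a * b) ≤ a ^ 2 + b ^ 2 := fun a b => by
          have := two_mul_le_add_sq (a : ℝ) b
          rw [mul_assoc] at this
          exact_mod_cast this
        simp only [enorm_eq_nnnorm]
        exact_mod_cast h3 (‖E x‖₊ * ‖Z y‖₊) (‖E y‖₊ * ‖Z x‖₊)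
      have h4 : ‖g (x, y)‖ₑ = ‖E x‖ₑ * ‖Z y‖ₑ * (‖E y‖ₑ * ‖Z x‖ₑ) := by
        simp only [g, u, enorm_mul, RCLike.enorm_conj]
        ring
      have h5 : -(ω y - ω x) ^ 2 / 4 = -(ω x - ω y) ^ 2 / 4 := by ring
      simp only [K, d, h4, h5]
      calc 2 * (‖E x‖ₑ * ‖Z y‖ₑ * (‖E y‖ₑ * ‖Z x‖ₑ) *
            ENNReal.ofReal (Real.exp (-(ω x - ω y) ^ 2 / 4)))
          = 2 * (‖E x‖ₑ * ‖Z y‖ₑ * (‖E y‖ₑ * ‖Z x‖ₑ)) *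
            ENNReal.ofReal (Real.exp (-(ω x - ω y) ^ 2 / 4)) := by ring
        _ ≤ ((‖E x‖ₑ * ‖Z y‖ₑ) ^ 2 + (‖E y‖ₑ * ‖Z x‖ₑ) ^ 2) *
            ENNReal.ofReal (Real.exp (-(ω x - ω y) ^ 2 / 4)) := by gcongr
        _ = _ := by ring
    have hK : AEMeasurable (fun p : X × X => K p.1 p.2) (μ.prod μ) := by
      have h1 : AEMeasurable (fun p : X × X => Z p.1) (μ.prod μ) := hZ.comp_fst
      have h2 : Measurable fun p : X × X => ‖E p.2‖ₑ ^ 2 *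
          ENNReal.ofReal (Real.exp (-(ω p.2 - ω p.1) ^ 2 / 4)) := by fun_prop
      exact (h1.enorm.pow_const 2).mul h2.aemeasurable
    have hKint : ∫⁻ p, K p.1 p.2 ∂(μ.prod μ) ≤ M * ∫⁻ x, ‖Z x‖ₑ ^ 2 ∂μ := by
      rw [lintegral_prod _ hK]
      calc ∫⁻ x, ∫⁻ y, K x y ∂μ ∂μ ≤ ∫⁻ x, M * ‖Z x‖ₑ ^ 2 ∂μ := by
            refine lintegral_mono fun x => ?_
            simp only [K]
            rw [lintegral_const_mul' _ _ (by simp), mul_comm]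
            gcongr
            exact hM (ω x)
        _ = _ := lintegral_const_mul'' _ (hZ.enorm.pow_const 2)
    have h2 : 2 * ∫⁻ p, ‖g p‖ₑ * ENNReal.ofReal (Real.exp (-(d p) ^ 2 / 4)) ∂(μ.prod μ) ≤
        2 * (M * ∫⁻ x, ‖Z x‖ₑ ^ 2 ∂μ) := by
      rw [← lintegral_const_mul' _ _ (by simp)]
      refine (lintegral_mono hpt).trans ?_
      rw [lintegral_add_left' hK, two_mul]
      refine add_le_add hKint (le_trans (le_of_eq ?_) hKint)
      exact lintegral_prod_swap (f := fun p : X × X => K p.1 p.2)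
    rwa [ENNReal.mul_le_mul_iff_right (by simp) (by simp)] at h2
  calc ∫⁻ s : ℝ, ENNReal.ofReal (Real.exp (-s ^ 2)) * ‖I s‖ₑ ^ 2
      = ∫⁻ s : ℝ, ENNReal.ofReal (Real.exp (-s ^ 2) * ‖I s‖ ^ 2) := by
        refine lintegral_congr fun s => ?_
        rw [ENNReal.ofReal_mul (Real.exp_pos _).le, ENNReal.ofReal_pow (norm_nonneg _), ofReal_norm]
    _ = ENNReal.ofReal (∫ s : ℝ, Real.exp (-s ^ 2) * ‖I s‖ ^ 2) :=
        (ofReal_integral_eq_lintegral_ofReal hint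
          (.of_forall fun s => by positivity)).symm
    _ ≤ ‖∫ p, g p * (√Real.pi * Real.exp (-(d p) ^ 2 / 4) : ℝ) ∂(μ.prod μ)‖ₑ := by
        rw [← hmain]
        simp only [hreal]
        rw [integral_complex_ofReal, ← ofReal_norm, Complex.norm_real]
        exact ENNReal.ofReal_le_ofReal (le_abs_self _)
    _ ≤ ∫⁻ p, ENNReal.ofReal √Real.pi * (‖g p‖ₑ *
          ENNReal.ofReal (Real.exp (-(d p) ^ 2 / 4))) ∂(μ.prod μ) := by
        refine (enorm_integral_le_lintegral_enorm _).trans (le_of_eq (lintegral_congr fun p => ?_))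
        rw [enorm_mul, ← ofReal_norm (((_ : ℝ) : ℂ)), Complex.norm_real,
          Real.norm_of_nonneg (by positivity), ENNReal.ofReal_mul (Real.sqrt_nonneg _)]
        ring
    _ ≤ _ := by
        rw [lintegral_const_mul' _ _ ENNReal.ofReal_ne_top, mul_assoc]
        gcongr

end Schur

section SmoothBasis

variable {ι : Type*}

/-- An orthonormal family in `L²` of the plane, made of smooth functions with compact support, which
is total after multiplication by the weight `w`. -/
structure IsSmoothBasis (e : ι → Plane → ℂ) (w : Plane → ℝ) : Prop where
  contDiff : ∀ i, ContDiff ℝ (⊤ : ℕ∞) (e i)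
  hasCompactSupport : ∀ i, HasCompactSupport (e i)
  integral_conj_mul : ∀ i i' [Decidable (i = i')],
    ∫ x, conj (e i x) * e i' x = if i = i' then 1 else 0
  total_weighted : ∀ u : Plane → ℂ, MemLp u 2 → (∀ i, ∫ x, conj (e i x) * w x * u x = 0) →
    u =ᵐ[volume] 0

variable {e : ι → Plane → ℂ} {w : Plane → ℝ}

namespace IsSmoothBasis

lemma continuous (h : IsSmoothBasis e w) (i : ι) : Continuous (e i) := (h.contDiff i).continuous

lemma memLp (h : IsSmoothBasis e w) (i : ι) : MemLp (e i) 2 :=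
  (h.continuous i).memLp_of_hasCompactSupport (h.hasCompactSupport i)

lemma orthonormal (h : IsSmoothBasis e w) : Orthonormal ℂ fun i => (h.memLp i).toLp (e i) := by
  classical
  rw [orthonormal_iff_ite]
  intro i i'
  rw [← h.integral_conj_mul, L2.inner_def]
  refine integral_congr_ae ?_
  filter_upwards [(h.memLp i).coeFn_toLp, (h.memLp i').coeFn_toLp] with x h1 h2
  rw [h1, h2, RCLike.inner_apply, mul_comm]

/-- Bessel's inequality. -/
lemma sum_enorm_sq_integral_le (h : IsSmoothBasis e w) (S : Finset ι) {G : Plane → ℂ}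
    (hG : AEStronglyMeasurable G) :
    ∑ i ∈ S, ‖∫ x, conj (e i x) * G x‖ₑ ^ 2 ≤ ∫⁻ x, ‖G x‖ₑ ^ 2 := by
  by_cases hfin : ∫⁻ x, ‖G x‖ₑ ^ 2 = ∞
  · rw [hfin]
    exact le_top
  · have hL : MemLp G 2 := by
      refine ⟨hG, ?_⟩
      rw [eLpNorm_lt_top_iff_lintegral_rpow_enorm_lt_top (by simp) (by simp)]
      simpa using lt_top_iff_ne_top.2 hfin
    have h1 := h.orthonormal.sum_inner_products_le (hL.toLp G) (s := S)
    have h2 : ∀ i, ⟪(h.memLp i).toLp (e i), hL.toLp G⟫_ℂ = ∫ x, conj (e i x) * G x := by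
      intro i
      rw [L2.inner_def]
      refine integral_congr_ae ?_
      filter_upwards [(h.memLp i).coeFn_toLp, hL.coeFn_toLp] with x h1 h2
      rw [h1, h2, RCLike.inner_apply, mul_comm]
    simp only [h2] at h1
    have h3 : ENNReal.ofReal (‖hL.toLp G‖ ^ 2) = ∫⁻ x, ‖G x‖ₑ ^ 2 := by
      rw [ENNReal.ofReal_pow (norm_nonneg _), Lp.norm_toLp,
        ENNReal.ofReal_toReal hL.2.ne, eLpNorm_eq_lintegral_rpow_enorm_toReal (by simp) (by simp),
        ← ENNReal.rpow_two, ← ENNReal.rpow_mul]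
      simp
    rw [← h3]
    refine le_trans (le_of_eq ?_) (ENNReal.ofReal_le_ofReal h1)
    rw [ENNReal.ofReal_sum_of_nonneg fun _ _ => by positivity]
    refine Finset.sum_congr rfl fun i _ => ?_
    rw [ENNReal.ofReal_pow (norm_nonneg _), ofReal_norm]

/-- Pythagoras' theorem. -/
lemma lintegral_enorm_sq_sum (h : IsSmoothBasis e w) (S : Finset ι) (c : ι → ℂ) :
    ∫⁻ x, ‖∑ i ∈ S, c i * e i x‖ₑ ^ 2 = ∑ i ∈ S, ‖c i‖ₑ ^ 2 := by
  have hL : MemLp (fun x => ∑ i ∈ S, c i * e i x) 2 :=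
    memLp_finsetSum _ fun i _ => (h.memLp i).const_mul (c i)
  have h1 : hL.toLp _ = ∑ i ∈ S, c i • (h.memLp i).toLp (e i) := by
    refine Lp.ext ?_
    refine hL.coeFn_toLp.trans ?_
    refine EventuallyEq.trans ?_ (Lp.coeFn_finsetSum _ _).symm
    have h2 : ∀ i, (c i • (h.memLp i).toLp (e i) : Lp ℂ 2 volume) =ᵐ[volume]
        fun x => c i * e i x := fun i => by
      filter_upwards [Lp.coeFn_smul (c i) ((h.memLp i).toLp (e i)), (h.memLp i).coeFn_toLp]
        with x h3 h4
      rw [h3, Pi.smul_apply, h4, smul_eq_mul]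
    have h5 : ∀ᵐ x, ∀ i ∈ S, (c i • (h.memLp i).toLp (e i) : Lp ℂ 2 volume) x = c i * e i x :=
      (Finset.eventually_all S).2 fun i _ => h2 i
    filter_upwards [h5] with x hx
    rw [Finset.sum_apply]
    exact (Finset.sum_congr rfl hx).symm
  have h3 : ENNReal.ofReal (‖hL.toLp _‖ ^ 2) = ∫⁻ x, ‖∑ i ∈ S, c i * e i x‖ₑ ^ 2 := by
    rw [ENNReal.ofReal_pow (norm_nonneg _), Lp.norm_toLp,
      ENNReal.ofReal_toReal hL.2.ne, eLpNorm_eq_lintegral_rpow_enorm_toReal (by simp) (by simp),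
      ← ENNReal.rpow_two, ← ENNReal.rpow_mul]
    simp
  have h4 : ‖∑ i ∈ S, c i • (h.memLp i).toLp (e i)‖ ^ 2 = ∑ i ∈ S, ‖c i‖ ^ 2 := by
    have h5 := h.orthonormal.inner_sum c c S
    rw [inner_self_eq_norm_sq_to_K] at h5
    have h6 : ∀ i, conj (c i) * c i = ((‖c i‖ ^ 2 : ℝ) : ℂ) := fun i => by
      rw [mul_comm, Complex.mul_conj, Complex.normSq_eq_norm_sq]
    simp only [h6] at h5
    refine Complex.ofReal_injective ?_
    push_cast at h5 ⊢
    exact h5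
  rw [← h3, h1, h4, ENNReal.ofReal_sum_of_nonneg fun _ _ => by positivity]
  refine Finset.sum_congr rfl fun i _ => ?_
  rw [ENNReal.ofReal_pow (norm_nonneg _), ofReal_norm]

end IsSmoothBasis

end SmoothBasis

/-! ### The smoothing estimate for structure coefficients -/

section CollisionCoeff

variable {ι : Type*} {e : ι → Plane → ℂ} {w : Plane → ℝ}

/-- The product of basis functions at the momenta `u`, `v`, `u + v - ξ` of a collision. -/
def collisionProduct (e : ι → Plane → ℂ) (p q r : ι) (z : Plane × Plane × Plane) : ℂ :=
  e p z.2.1 * e q z.2.2 * conj (e r (z.2.1 + z.2.2 - z.1))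

/-- The structure coefficients of the collision, in the interaction picture, with respect to
products of basis functions in weighted momentum space. -/
def collisionCoeff (α : ℝ) (e : ι → Plane → ℂ) (i p q r : ι) (s : ℝ) : ℂ :=
  ∫ z : Plane × Plane × Plane, conj (e i z.1) * ((collisionWeight α z.1 z.2.1 z.2.2 : ℂ) *
    collisionProduct e p q r z * Complex.exp (-(Complex.I * (s * resonance z.1 z.2.1 z.2.2 : ℝ))))

lemma lintegral_enorm_collisionWeight_le {α : ℝ} (ξ : Plane) (τ : ℝ) {C : ℝ≥0∞}
    (hC : ∫⁻ u : Plane, ∫⁻ v : Plane, ENNReal.ofReal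
      (collisionWeight α ξ u v ^ 2 * Real.exp (-(resonance ξ u v - τ) ^ 2 / 4)) ≤ C) :
    ∫⁻ q : Plane × Plane, ‖(collisionWeight α ξ q.1 q.2 : ℂ)‖ₑ ^ 2 *
      ENNReal.ofReal (Real.exp (-(resonance ξ q.1 q.2 - τ) ^ 2 / 4)) ≤ C := by
  refine le_trans (le_of_eq ?_) hC
  have h0 : Continuous fun q : Plane × Plane => (ξ, q) := by fun_prop
  have hWξ : Continuous fun q : Plane × Plane => collisionWeight α ξ q.1 q.2 :=
    by simpa only [Function.comp_def] using (continuous_collisionWeight α).comp h0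
  have hΩξ : Continuous fun q : Plane × Plane => resonance ξ q.1 q.2 := by
    simpa only [Function.comp_def] using continuous_resonance.comp h0
  have hc : Continuous fun q : Plane × Plane => collisionWeight α ξ q.1 q.2 ^ 2 *
      Real.exp (-(resonance ξ q.1 q.2 - τ) ^ 2 / 4) :=
    (hWξ.pow 2).mul (Real.continuous_exp.comp (((hΩξ.sub continuous_const).pow 2).neg.div_const 4))
  have hp := lintegral_prod (μ := (volume : Measure Plane)) (ν := (volume : Measure Plane))
    (fun q : Plane × Plane => ENNReal.ofReal (collisionWeight α ξ q.1 q.2 ^ 2 *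
      Real.exp (-(resonance ξ q.1 q.2 - τ) ^ 2 / 4))) hc.measurable.ennreal_ofReal.aemeasurable
  rw [← hp, Measure.volume_eq_prod]
  refine lintegral_congr fun q => ?_
  rw [ENNReal.ofReal_mul (sq_nonneg _), ← ofReal_norm, Complex.norm_real,
    ← ENNReal.ofReal_pow (norm_nonneg _), Real.norm_eq_abs, sq_abs]

namespace IsSmoothBasis

lemma continuous_collisionProduct (h : IsSmoothBasis e w) (p q r : ι) :
    Continuous (collisionProduct e p q r) := by
  have h1 := h.continuous p
  have h2 := h.continuous q
  have h3 := h.continuous r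
  unfold collisionProduct
  exact ((h1.comp (by fun_prop)).mul (h2.comp (by fun_prop))).mul
    (Complex.continuous_conj.comp (h3.comp (by fun_prop)))

lemma hasCompactSupport_mul_collisionProduct (h : IsSmoothBasis e w) (i p q r : ι) :
    HasCompactSupport fun z : Plane × Plane × Plane => conj (e i z.1) * collisionProduct e p q r z := by
  refine HasCompactSupport.of_support_subset_isCompact
    ((h.hasCompactSupport i).isCompact.prod
      ((h.hasCompactSupport p).isCompact.prod (h.hasCompactSupport q).isCompact)) ?_
  intro z hz
  simp only [collisionProduct, Function.mem_support, ne_eq, mul_eq_zero, map_eq_zero, not_or] at hz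
  exact ⟨subset_tsupport _ hz.1, subset_tsupport _ hz.2.1.1, subset_tsupport _ hz.2.1.2⟩

lemma integrable_collisionCoeff (h : IsSmoothBasis e w) (α : ℝ) (i p q r : ι) (s : ℝ) :
    Integrable fun z : Plane × Plane × Plane => conj (e i z.1) *
      ((collisionWeight α z.1 z.2.1 z.2.2 : ℂ) * collisionProduct e p q r z *
        Complex.exp (-(Complex.I * (s * resonance z.1 z.2.1 z.2.2 : ℝ)))) := by
  have hW := continuous_collisionWeight α
  have hΩ := continuous_resonance
  have h1 := h.continuous i
  have h2 := h.continuous_collisionProduct p q r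
  refine Continuous.integrable_of_hasCompactSupport ?_ ?_
  · refine (Complex.continuous_conj.comp (h1.comp continuous_fst)).mul (((Complex.continuous_ofReal.comp
      hW).mul h2).mul (Complex.continuous_exp.comp ?_))
    fun_prop
  · refine (h.hasCompactSupport_mul_collisionProduct i p q r).mono fun z hz => ?_
    simp only [Function.mem_support, ne_eq, mul_eq_zero, not_or] at hz ⊢
    exact ⟨hz.1, hz.2.1.2⟩

lemma continuous_collisionCoeff (h : IsSmoothBasis e w) (α : ℝ) (i p q r : ι) :
    Continuous (collisionCoeff α e i p q r) := by
  have h0 := (h.integrable_collisionCoeff α i p q r 0).norm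
  refine continuous_of_dominated (fun s => (h.integrable_collisionCoeff α i p q r s).1) (fun s => ?_)
    h0 ?_
  · refine Eventually.of_forall fun z => le_of_eq ?_
    have hn : ∀ x : ℝ, ‖Complex.exp (-(Complex.I * (x : ℂ)))‖ = 1 := fun x => by
      rw [← mul_neg, ← Complex.ofReal_neg, mul_comm, Complex.norm_exp_ofReal_mul_I]
    simp only [norm_mul, hn]
  · refine Eventually.of_forall fun z => ?_
    fun_prop

lemma lintegral_sum_triple (h : IsSmoothBasis e w) (P : Finset ι) (y : ι × ι × ι → ℂ) :
    ∫⁻ ξ : Plane, ∫⁻ q : Plane × Plane,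
      ‖∑ d ∈ P ×ˢ P ×ˢ P, y d * collisionProduct e d.1 d.2.1 d.2.2 (ξ, q)‖ₑ ^ 2 =
    ∑ d ∈ P ×ˢ P ×ˢ P, ‖y d‖ₑ ^ 2 := by
  have hm : Continuous fun z : Plane × Plane × Plane =>
      ∑ d ∈ P ×ˢ P ×ˢ P, y d * collisionProduct e d.1 d.2.1 d.2.2 z :=
    continuous_finsetSum _ fun d _ => continuous_const.mul (h.continuous_collisionProduct _ _ _)
  -- a sum over the last index
  have h3 : ∀ q : Plane × Plane, ∫⁻ ξ : Plane,
      ‖∑ d ∈ P ×ˢ P ×ˢ P, y d * collisionProduct e d.1 d.2.1 d.2.2 (ξ, q)‖ₑ ^ 2 =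
      ∑ c ∈ P, ‖∑ b ∈ P, (∑ a ∈ P, y (a, b, c) * e a q.1) * e b q.2‖ₑ ^ 2 := by
    intro q
    have hl := h.lintegral_enorm_sq_sum P
      fun c => conj (∑ b ∈ P, (∑ a ∈ P, y (a, b, c) * e a q.1) * e b q.2)
    simp only [RCLike.enorm_conj] at hl
    rw [← hl, ← lintegral_sub_left_eq_self _ (q.1 + q.2)]
    refine lintegral_congr fun ξ => ?_
    congr 1
    rw [← RCLike.enorm_conj (∑ d ∈ P ×ˢ P ×ˢ P, _)]
    congr 1
    simp only [map_sum, map_mul, collisionProduct, Finset.sum_mul, sub_sub_cancel,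
      Finset.sum_product, Complex.conj_conj]
    refine (Finset.sum_congr rfl fun a _ => Finset.sum_comm).trans ?_
    rw [Finset.sum_comm]
    refine Finset.sum_congr rfl fun c _ => ?_
    rw [Finset.sum_comm]
    refine Finset.sum_congr rfl fun b _ => Finset.sum_congr rfl fun a _ => ?_
    ring
  rw [lintegral_lintegral_swap (f := fun ξ q => ‖∑ d ∈ P ×ˢ P ×ˢ P,
    y d * collisionProduct e d.1 d.2.1 d.2.2 (ξ, q)‖ₑ ^ 2)
    (hm.enorm.measurable.pow_const 2).aemeasurable]
  simp only [h3]
  have hm2 : ∀ c, Measurable fun q : Plane × Plane =>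
      ‖∑ b ∈ P, (∑ a ∈ P, y (a, b, c) * e a q.1) * e b q.2‖ₑ ^ 2 := by
    intro c
    have : Continuous fun q : Plane × Plane =>
        ∑ b ∈ P, (∑ a ∈ P, y (a, b, c) * e a q.1) * e b q.2 :=
      continuous_finsetSum _ fun b _ => (continuous_finsetSum _ fun a _ =>
        continuous_const.mul ((h.continuous a).comp continuous_fst)).mul
        ((h.continuous b).comp continuous_snd)
    exact this.enorm.measurable.pow_const 2
  rw [lintegral_finsetSum _ fun c _ => hm2 c]
  have h2 : ∀ c, ∫⁻ q : Plane × Plane, ‖∑ b ∈ P, (∑ a ∈ P, y (a, b, c) * e a q.1) * e b q.2‖ₑ ^ 2 =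
      ∑ b ∈ P, ∑ a ∈ P, ‖y (a, b, c)‖ₑ ^ 2 := by
    intro c
    rw [Measure.volume_eq_prod, lintegral_prod _ (hm2 c).aemeasurable]
    simp only [h.lintegral_enorm_sq_sum P]
    rw [lintegral_finsetSum]
    · exact Finset.sum_congr rfl fun b _ => h.lintegral_enorm_sq_sum P fun a => y (a, b, c)
    · intro b _
      have : Continuous fun x => ∑ a ∈ P, y (a, b, c) * e a x :=
        continuous_finsetSum _ fun a _ => continuous_const.mul (h.continuous a)
      exact this.enorm.measurable.pow_const 2
  simp only [h2, Finset.sum_product]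
  rw [Finset.sum_comm]
  refine (Finset.sum_congr rfl fun b _ => Finset.sum_comm).trans ?_
  rw [Finset.sum_comm]

lemma sum_collisionCoeff (h : IsSmoothBasis e w) (α : ℝ) (Q : Finset (ι × ι × ι))
    (y : ι × ι × ι → ℂ) (s : ℝ) (i : ι) :
    ∑ d ∈ Q, collisionCoeff α e i d.1 d.2.1 d.2.2 s * y d =
      ∫ ξ : Plane, conj (e i ξ) * ∫ q : Plane × Plane, (collisionWeight α ξ q.1 q.2 : ℂ) *
        (∑ d ∈ Q, y d * collisionProduct e d.1 d.2.1 d.2.2 (ξ, q)) *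
        Complex.exp (-(Complex.I * (s * resonance ξ q.1 q.2 : ℝ))) := by
  have hint := fun d : ι × ι × ι => (h.integrable_collisionCoeff α i d.1 d.2.1 d.2.2 s).mul_const (y d)
  have hpt : ∀ z : Plane × Plane × Plane, ∑ d ∈ Q, conj (e i z.1) *
      ((collisionWeight α z.1 z.2.1 z.2.2 : ℂ) * collisionProduct e d.1 d.2.1 d.2.2 z *
        Complex.exp (-(Complex.I * (s * resonance z.1 z.2.1 z.2.2 : ℝ)))) * y d =
      conj (e i z.1) * ((collisionWeight α z.1 z.2.1 z.2.2 : ℂ) *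
        (∑ d ∈ Q, y d * collisionProduct e d.1 d.2.1 d.2.2 z) *
        Complex.exp (-(Complex.I * (s * resonance z.1 z.2.1 z.2.2 : ℝ)))) := by
    intro z
    simp only [Finset.mul_sum, Finset.sum_mul]
    refine Finset.sum_congr rfl fun d _ => ?_
    ring
  simp only [collisionCoeff, ← integral_mul_const]
  rw [← integral_finsetSum _ fun d _ => hint d]
  have hI := integrable_finsetSum Q fun d _ => hint d
  simp only [hpt] at hI ⊢
  refine (integral_prod _ hI).trans ?_
  simp only [integral_const_mul]

lemma integrable_collisionSection (h : IsSmoothBasis e w) (α : ℝ) (Q : Finset (ι × ι × ι))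
    (y : ι × ι × ι → ℂ) (ξ : Plane) :
    Integrable fun q : Plane × Plane => (collisionWeight α ξ q.1 q.2 : ℂ) *
      ∑ d ∈ Q, y d * collisionProduct e d.1 d.2.1 d.2.2 (ξ, q) := by
  simp only [Finset.mul_sum]
  refine integrable_finsetSum _ fun d _ => Continuous.integrable_of_hasCompactSupport ?_ ?_
  · have hW := (continuous_collisionWeight α).comp
      (by fun_prop : Continuous fun q : Plane × Plane => (ξ, q))
    have h1 := (h.continuous_collisionProduct d.1 d.2.1 d.2.2).comp
      (by fun_prop : Continuous fun q : Plane × Plane => (ξ, q))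
    exact (Complex.continuous_ofReal.comp hW).mul (continuous_const.mul h1)
  · refine HasCompactSupport.of_support_subset_isCompact
      ((h.hasCompactSupport d.1).isCompact.prod (h.hasCompactSupport d.2.1).isCompact) ?_
    intro q hq
    simp only [collisionProduct, Function.mem_support, ne_eq, mul_eq_zero, not_or] at hq
    exact ⟨subset_tsupport _ hq.2.2.1.1, subset_tsupport _ hq.2.2.1.2⟩

/-- The smoothing estimate in terms of structure coefficients: Bessel's inequality removes the sum
over `i`, and the oscillatory integral estimate applies for each value of the momentum. -/
theorem lintegral_collisionCoeff_le (h : IsSmoothBasis e w) {α : ℝ} {C : NNReal}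
    (hC : ResonanceBound α C) (P : Finset ι) (y : ι × ι × ι → ℂ) :
    ∫⁻ s : ℝ, ENNReal.ofReal (Real.exp (-s ^ 2)) *
      ∑ i ∈ P, ‖∑ d ∈ P ×ˢ P ×ˢ P, collisionCoeff α e i d.1 d.2.1 d.2.2 s * y d‖ₑ ^ 2 ≤
    ENNReal.ofReal √Real.pi * C * ∑ d ∈ P ×ˢ P ×ˢ P, ‖y d‖ₑ ^ 2 := by
  have hW := continuous_collisionWeight α
  have hΩ := continuous_resonance
  let Y : Plane × Plane × Plane → ℂ := fun z =>
    ∑ d ∈ P ×ˢ P ×ˢ P, y d * collisionProduct e d.1 d.2.1 d.2.2 z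
  have hY : Continuous Y :=
    continuous_finsetSum _ fun d _ => continuous_const.mul (h.continuous_collisionProduct _ _ _)
  let g : (ℝ × Plane) → Plane × Plane → ℂ := fun p q =>
    (collisionWeight α p.2 q.1 q.2 : ℂ) * Y (p.2, q) *
      Complex.exp (-(Complex.I * (p.1 * resonance p.2 q.1 q.2 : ℝ)))
  have hg : Continuous fun p : (ℝ × Plane) × (Plane × Plane) => g p.1 p.2 := by
    have h0 : Continuous fun p : (ℝ × Plane) × (Plane × Plane) => (p.1.2, p.2) := by fun_prop
    exact ((Complex.continuous_ofReal.comp (hW.comp h0)).mul (hY.comp h0)).mul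
      (Complex.continuous_exp.comp (continuous_const.mul (Complex.continuous_ofReal.comp
        ((by fun_prop : Continuous fun p : (ℝ × Plane) × (Plane × Plane) => p.1.1).mul
          (hΩ.comp h0)))).neg)
  let G : ℝ × Plane → ℂ := fun p => ∫ q : Plane × Plane, g p q
  have hGm : StronglyMeasurable G := StronglyMeasurable.integral_prod_right hg.stronglyMeasurable
  -- Bessel's inequality in `ξ`, exchange of integrals, and the oscillatory estimate for fixed `ξ`.
  calc ∫⁻ s : ℝ, ENNReal.ofReal (Real.exp (-s ^ 2)) *
        ∑ i ∈ P, ‖∑ d ∈ P ×ˢ P ×ˢ P, collisionCoeff α e i d.1 d.2.1 d.2.2 s * y d‖ₑ ^ 2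
      ≤ ∫⁻ s : ℝ, ∫⁻ ξ : Plane, ENNReal.ofReal (Real.exp (-s ^ 2)) * ‖G (s, ξ)‖ₑ ^ 2 := by
        refine lintegral_mono fun s => ?_
        rw [lintegral_const_mul' _ _ ENNReal.ofReal_ne_top]
        simp only [h.sum_collisionCoeff α]
        gcongr
        exact h.sum_enorm_sq_integral_le P (G := fun ξ => G (s, ξ))
          (hGm.comp_measurable measurable_prodMk_left).aestronglyMeasurable
    _ = ∫⁻ ξ : Plane, ∫⁻ s : ℝ, ENNReal.ofReal (Real.exp (-s ^ 2)) * ‖G (s, ξ)‖ₑ ^ 2 := by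
        refine lintegral_lintegral_swap (f := fun s ξ => ENNReal.ofReal (Real.exp (-s ^ 2)) *
          ‖G (s, ξ)‖ₑ ^ 2) (Measurable.aemeasurable ?_)
        have h1 : Measurable fun p : ℝ × Plane => ENNReal.ofReal (Real.exp (-p.1 ^ 2)) := by fun_prop
        exact h1.mul (hGm.enorm.pow_const 2)
    _ ≤ ∫⁻ ξ : Plane, ENNReal.ofReal √Real.pi * C * ∫⁻ q : Plane × Plane, ‖Y (ξ, q)‖ₑ ^ 2 := by
        refine lintegral_mono fun ξ => ?_
        have h0 : Continuous fun q : Plane × Plane => (ξ, q) := by fun_prop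
        have hWξ : Continuous fun q : Plane × Plane => collisionWeight α ξ q.1 q.2 := by
          simpa only [Function.comp_def] using hW.comp h0
        have hΩξ : Continuous fun q : Plane × Plane => resonance ξ q.1 q.2 := by
          simpa only [Function.comp_def] using hΩ.comp h0
        have hI : Integrable fun q : Plane × Plane => (collisionWeight α ξ q.1 q.2 : ℂ) * Y (ξ, q) :=
          h.integrable_collisionSection α (P ×ˢ P ×ˢ P) y ξ
        have hE : Measurable fun q : Plane × Plane => (collisionWeight α ξ q.1 q.2 : ℂ) :=
          (Complex.continuous_ofReal.comp hWξ).measurable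
        exact lintegral_sq_oscillatory_le (μ := volume)
          (E := fun q : Plane × Plane => (collisionWeight α ξ q.1 q.2 : ℂ))
          (Z := fun q : Plane × Plane => Y (ξ, q))
          (ω := fun q : Plane × Plane => resonance ξ q.1 q.2)
          hE hΩξ.measurable (hY.comp h0).measurable.aemeasurable hI
          fun τ => lintegral_enorm_collisionWeight_le ξ τ (hC ξ τ)
    _ = _ := by
        rw [lintegral_const_mul', h.lintegral_sum_triple]
        exact ENNReal.mul_ne_top ENNReal.ofReal_ne_top ENNReal.coe_ne_top

end IsSmoothBasis

open Classical in
/-- The structure coefficients of the collision for pairs of a particle and a primed particle: the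
letter `c` turns into the letter `a`, which inherits one of the components of `c`, and the new
letter `b`. The two terms come from the two terms of a commutator. -/
def pairCoeff (α : ℝ) (e : ι → Plane → ℂ) (c a b : ι × ι) (s : ℝ) : ℂ :=
  (if a.2 = c.2 then collisionCoeff α e c.1 a.1 b.1 b.2 s else 0) -
    if a.1 = c.1 then conj (collisionCoeff α e c.2 a.2 b.2 b.1 s) else 0

lemma enorm_add_sq_le (x y : ℂ) : ‖x - y‖ₑ ^ 2 ≤ 2 * (‖x‖ₑ ^ 2 + ‖y‖ₑ ^ 2) := by
  have h1 : ‖x - y‖ ^ 2 ≤ 2 * (‖x‖ ^ 2 + ‖y‖ ^ 2) := by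
    have := norm_sub_le x y
    nlinarith [sq_nonneg (‖x‖ - ‖y‖), norm_nonneg (x - y)]
  have h2 : ∀ z : ℂ, ‖z‖ₑ ^ 2 = ENNReal.ofReal (‖z‖ ^ 2) := fun z => by
    rw [ENNReal.ofReal_pow (norm_nonneg _), ofReal_norm]
  rw [h2, h2, h2, ← ENNReal.ofReal_add (by positivity) (by positivity),
    show (2 : ℝ≥0∞) = ENNReal.ofReal 2 by simp, ← ENNReal.ofReal_mul (by norm_num)]
  exact ENNReal.ofReal_le_ofReal h1

namespace IsSmoothBasis

lemma continuous_pairCoeff (h : IsSmoothBasis e w) (α : ℝ) (c a b : ι × ι) :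
    Continuous (pairCoeff α e c a b) := by
  have h1 := h.continuous_collisionCoeff α
  unfold pairCoeff
  refine Continuous.sub ?_ ?_
  · split_ifs
    · exact h1 _ _ _ _
    · exact continuous_const
  · split_ifs
    · exact Complex.continuous_conj.comp (h1 _ _ _ _)
    · exact continuous_const

/-- The smoothing estimate for the structure coefficients of pairs, with spectator components. -/
theorem lintegral_spectator_le (h : IsSmoothBasis e w) {α : ℝ} {C : NNReal}
    (hC : ResonanceBound α C) (P : Finset ι) (y : ι → ι × ι × ι → ℂ) :
    ∫⁻ s : ℝ, ENNReal.ofReal (Real.exp (-s ^ 2)) *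
      ∑ m ∈ P, ∑ i ∈ P, ‖∑ d ∈ P ×ˢ P ×ˢ P, collisionCoeff α e i d.1 d.2.1 d.2.2 s * y m d‖ₑ ^ 2 ≤
    ENNReal.ofReal √Real.pi * C * ∑ m ∈ P, ∑ d ∈ P ×ˢ P ×ˢ P, ‖y m d‖ₑ ^ 2 := by
  simp only [Finset.mul_sum]
  rw [lintegral_finsetSum]
  · refine Finset.sum_le_sum fun m _ => ?_
    have := h.lintegral_collisionCoeff_le hC P (y m)
    simpa only [Finset.mul_sum] using this
  · intro m _
    refine Finset.measurable_sum _ fun i _ => ?_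
    have h1 : Continuous fun s => ∑ d ∈ P ×ˢ P ×ˢ P,
        collisionCoeff α e i d.1 d.2.1 d.2.2 s * y m d :=
      continuous_finsetSum _ fun d _ => (h.continuous_collisionCoeff α _ _ _ _).mul continuous_const
    exact (by fun_prop : Measurable fun s : ℝ => ENNReal.ofReal (Real.exp (-s ^ 2))).mul
      (h1.enorm.measurable.pow_const 2)

/-- The smoothing estimate for pairs of letters, on a bounded time interval. The component of a pair
that is not involved in the collision is a spectator. -/
theorem lintegral_pairCoeff_le (h : IsSmoothBasis e w) {α : ℝ} {C : NNReal}
    (hC : ResonanceBound α C) (T : ℝ) (S : Finset (ι × ι)) (y : ι × ι → ι × ι → ℂ) :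
    ∫⁻ s in Ioc 0 T, ∑ c ∈ S, ‖∑ a ∈ S, ∑ b ∈ S, pairCoeff α e c a b s * y a b‖ₑ ^ 2 ≤
      (Real.exp (T ^ 2)).toNNReal * (2 * (2 * ((√Real.pi).toNNReal * C))) *
        ∑ a ∈ S, ∑ b ∈ S, ‖y a b‖ₑ ^ 2 := by
  classical
  let P : Finset ι := S.image Prod.fst ∪ S.image Prod.snd
  have hSP : S ⊆ P ×ˢ P := fun a ha => Finset.mem_product.2
    ⟨Finset.mem_union_left _ (Finset.mem_image_of_mem _ ha),
      Finset.mem_union_right _ (Finset.mem_image_of_mem _ ha)⟩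
  let y' : ι × ι → ι × ι → ℂ := fun a b => if a ∈ S ∧ b ∈ S then y a b else 0
  let y₁ : ι → ι × ι × ι → ℂ := fun m d => y' (d.1, m) (d.2.1, d.2.2)
  let y₂ : ι → ι × ι × ι → ℂ := fun m d => conj (y' (m, d.1) (d.2.2, d.2.1))
  let U : (ι → ι × ι × ι → ℂ) → ι → ι → ℝ → ℂ := fun Y m i s =>
    ∑ d ∈ P ×ˢ P ×ˢ P, collisionCoeff α e i d.1 d.2.1 d.2.2 s * Y m d
  have hext : ∀ f : ι × ι → ι × ι → ℂ, ∑ a ∈ S, ∑ b ∈ S, f a b * y a b =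
      ∑ a ∈ P ×ˢ P, ∑ b ∈ P ×ˢ P, f a b * y' a b := by
    intro f
    refine Finset.sum_subset_zero_on_sdiff hSP (fun a ha => ?_) fun a ha => ?_
    · exact Finset.sum_eq_zero fun b _ => by simp [y', (Finset.mem_sdiff.1 ha).2]
    · refine Finset.sum_subset_zero_on_sdiff hSP (fun b hb => ?_) fun b hb => ?_
      · simp [y', (Finset.mem_sdiff.1 hb).2]
      · simp [y', ha, hb]
  have hext2 : ∑ a ∈ S, ∑ b ∈ S, ‖y a b‖ₑ ^ 2 = ∑ a ∈ P ×ˢ P, ∑ b ∈ P ×ˢ P, ‖y' a b‖ₑ ^ 2 := by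
    refine Finset.sum_subset_zero_on_sdiff hSP (fun a ha => ?_) fun a ha => ?_
    · exact Finset.sum_eq_zero fun b _ => by simp [y', (Finset.mem_sdiff.1 ha).2]
    · refine Finset.sum_subset_zero_on_sdiff hSP (fun b hb => ?_) fun b hb => ?_
      · simp [y', (Finset.mem_sdiff.1 hb).2]
      · simp [y', ha, hb]
  -- The two terms of the commutator; `m` is the component that does not take part.
  have hsplit : ∀ c ∈ P ×ˢ P, ∀ s, ∑ a ∈ S, ∑ b ∈ S, pairCoeff α e c a b s * y a b =
      U y₁ c.2 c.1 s - conj (U y₂ c.1 c.2 s) := by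
    intro c hc s
    obtain ⟨hc1, hc2⟩ := Finset.mem_product.1 hc
    rw [hext]
    simp only [pairCoeff, sub_mul, Finset.sum_sub_distrib, U, map_sum, map_mul]
    congr 1
    · simp only [Finset.sum_product (s := P) (t := P), Finset.sum_product (s := P) (t := P ×ˢ P)]
      refine Finset.sum_congr rfl fun a1 _ => ?_
      rw [Finset.sum_eq_single_of_mem c.2 hc2 fun a2 _ hne => by simp [hne]]
      simp [y₁]
    · simp only [Finset.sum_product (s := P) (t := P), Finset.sum_product (s := P) (t := P ×ˢ P)]
      rw [Finset.sum_eq_single_of_mem c.1 hc1 fun a1 _ hne => by simp [hne]]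
      refine Finset.sum_congr rfl fun a2 _ => ?_
      rw [Finset.sum_comm]
      simp [y₂]
  have hy₁ : ∑ m ∈ P, ∑ d ∈ P ×ˢ P ×ˢ P, ‖y₁ m d‖ₑ ^ 2 = ∑ a ∈ S, ∑ b ∈ S, ‖y a b‖ₑ ^ 2 := by
    rw [hext2]
    simp only [Finset.sum_product (s := P) (t := P), Finset.sum_product (s := P) (t := P ×ˢ P)]
    rw [Finset.sum_comm]
  have hy₂ : ∑ m ∈ P, ∑ d ∈ P ×ˢ P ×ˢ P, ‖y₂ m d‖ₑ ^ 2 = ∑ a ∈ S, ∑ b ∈ S, ‖y a b‖ₑ ^ 2 := by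
    rw [hext2]
    simp only [Finset.sum_product (s := P) (t := P), Finset.sum_product (s := P) (t := P ×ˢ P)]
    refine Finset.sum_congr rfl fun m _ => Finset.sum_congr rfl fun a _ => ?_
    rw [Finset.sum_comm]
    simp only [y₂, RCLike.enorm_conj]
  have hUm : ∀ Y m i, Measurable fun s => ‖U Y m i s‖ₑ ^ 2 := by
    intro Y m i
    have h1 : Continuous (U Y m i) :=
      continuous_finsetSum _ fun d _ => (h.continuous_collisionCoeff α _ _ _ _).mul continuous_const
    exact h1.enorm.measurable.pow_const 2
  have hexpm : Measurable fun s : ℝ => ENNReal.ofReal (Real.exp (-s ^ 2)) := by fun_prop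
  have hmain : ∫⁻ s : ℝ, ENNReal.ofReal (Real.exp (-s ^ 2)) *
      ∑ c ∈ S, ‖∑ a ∈ S, ∑ b ∈ S, pairCoeff α e c a b s * y a b‖ₑ ^ 2 ≤
      2 * (2 * (ENNReal.ofReal √Real.pi * C)) * ∑ a ∈ S, ∑ b ∈ S, ‖y a b‖ₑ ^ 2 := by
    calc ∫⁻ s : ℝ, ENNReal.ofReal (Real.exp (-s ^ 2)) *
          ∑ c ∈ S, ‖∑ a ∈ S, ∑ b ∈ S, pairCoeff α e c a b s * y a b‖ₑ ^ 2
        ≤ ∫⁻ s : ℝ, 2 * (ENNReal.ofReal (Real.exp (-s ^ 2)) * ∑ m ∈ P, ∑ i ∈ P, ‖U y₁ m i s‖ₑ ^ 2 +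
            ENNReal.ofReal (Real.exp (-s ^ 2)) * ∑ m ∈ P, ∑ i ∈ P, ‖U y₂ m i s‖ₑ ^ 2) := by
          refine lintegral_mono fun s => ?_
          rw [← mul_add, mul_left_comm]
          gcongr
          calc ∑ c ∈ S, ‖∑ a ∈ S, ∑ b ∈ S, pairCoeff α e c a b s * y a b‖ₑ ^ 2
              ≤ ∑ c ∈ P ×ˢ P, ‖∑ a ∈ S, ∑ b ∈ S, pairCoeff α e c a b s * y a b‖ₑ ^ 2 :=
                Finset.sum_le_sum_of_subset hSP
            _ ≤ ∑ c ∈ P ×ˢ P, 2 * (‖U y₁ c.2 c.1 s‖ₑ ^ 2 + ‖U y₂ c.1 c.2 s‖ₑ ^ 2) := by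
                refine Finset.sum_le_sum fun c hc => ?_
                rw [hsplit c hc, ← RCLike.enorm_conj (U y₂ c.1 c.2 s)]
                exact enorm_add_sq_le _ _
            _ = _ := by
                rw [← Finset.mul_sum, Finset.sum_add_distrib, Finset.sum_product,
                  Finset.sum_product, Finset.sum_comm]
      _ = 2 * ((∫⁻ s : ℝ, ENNReal.ofReal (Real.exp (-s ^ 2)) *
              ∑ m ∈ P, ∑ i ∈ P, ‖U y₁ m i s‖ₑ ^ 2) +
            ∫⁻ s : ℝ, ENNReal.ofReal (Real.exp (-s ^ 2)) *
              ∑ m ∈ P, ∑ i ∈ P, ‖U y₂ m i s‖ₑ ^ 2) := by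
          rw [lintegral_const_mul' _ _ (by simp), lintegral_add_left]
          exact hexpm.mul (Finset.measurable_sum _ fun m _ => Finset.measurable_sum _
            fun i _ => hUm y₁ m i)
      _ ≤ 2 * (ENNReal.ofReal √Real.pi * C * (∑ a ∈ S, ∑ b ∈ S, ‖y a b‖ₑ ^ 2) +
            ENNReal.ofReal √Real.pi * C * ∑ a ∈ S, ∑ b ∈ S, ‖y a b‖ₑ ^ 2) := by
          refine mul_le_mul_right (add_le_add ?_ ?_) _
          · rw [← hy₁]
            exact h.lintegral_spectator_le hC P y₁
          · rw [← hy₂]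
            exact h.lintegral_spectator_le hC P y₂
      _ = _ := by ring
  refine (setLIntegral_le_gaussian T _).trans ?_
  rw [mul_assoc]
  exact mul_le_mul_right hmain _

end IsSmoothBasis

end CollisionCoeff

/-! ### A smooth orthonormal family adapted to a weight -/

section BasisExistence

/-- The square integrable functions with a smooth compactly supported representative. -/
def smoothClasses : Submodule ℂ (Lp ℂ 2 (volume : Measure Plane)) where
  carrier := {f | ∃ g : Plane → ℂ, f =ᵐ[volume] g ∧ HasCompactSupport g ∧ ContDiff ℝ (⊤ : ℕ∞) g}
  zero_mem' := ⟨0, Lp.coeFn_zero _ _ _, HasCompactSupport.zero, contDiff_const⟩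
  add_mem' := by
    rintro f f' ⟨g, h1, h2, h3⟩ ⟨g', h1', h2', h3'⟩
    refine ⟨g + g', ?_, h2.add h2', h3.add h3'⟩
    filter_upwards [Lp.coeFn_add f f', h1, h1'] with x hx hx1 hx2
    rw [hx, Pi.add_apply, Pi.add_apply, hx1, hx2]
  smul_mem' := by
    rintro c f ⟨g, h1, h2, h3⟩
    refine ⟨fun x => c * g x, ?_, h2.mul_left, contDiff_const.mul h3⟩
    filter_upwards [Lp.coeFn_smul c f, h1] with x hx hx1
    rw [hx, Pi.smul_apply, hx1, smul_eq_mul]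

lemma exists_dense_smooth_sequence : ∃ d : ℕ → Plane → ℂ,
    (∀ n, ContDiff ℝ (⊤ : ℕ∞) (d n)) ∧ (∀ n, HasCompactSupport (d n)) ∧
    ∀ u : Plane → ℂ, MemLp u 2 → (∀ n, ∫ x, conj (d n x) * u x = 0) → u =ᵐ[volume] 0 := by
  have : Fact ((2 : ℝ≥0∞) ≠ ∞) := ⟨by simp⟩
  have hd : Dense (smoothClasses : Set (Lp ℂ 2 (volume : Measure Plane))) :=
    MeasureTheory.Lp.dense_hasCompactSupport_contDiff (F := ℂ) (μ := (volume : Measure Plane))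
      (p := 2) (by simp)
  have : SecondCountableTopology (Lp ℂ 2 (volume : Measure Plane)) :=
    Lp.SecondCountableTopology
  obtain ⟨t, hts, htc, htd⟩ := hd.exists_countable_dense_subset
  have htn : t.Nonempty := htd.nonempty
  obtain ⟨s, rfl⟩ := htc.exists_eq_range htn
  have h1 : ∀ n, ∃ g : Plane → ℂ,
      s n =ᵐ[volume] g ∧ HasCompactSupport g ∧ ContDiff ℝ (⊤ : ℕ∞) g := fun n => hts ⟨n, rfl⟩
  choose d hd1 hd2 hd3 using h1
  refine ⟨d, hd3, hd2, fun u hu h0 => ?_⟩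
  have h2 : hu.toLp u = 0 := by
    refine htd.eq_zero_of_inner_left (𝕜 := ℂ) ?_
    rintro _ ⟨n, rfl⟩
    rw [← inner_conj_symm, L2.inner_def]
    refine (congrArg conj (Eq.trans (integral_congr_ae ?_) (h0 n))).trans (map_zero _)
    filter_upwards [hd1 n, hu.coeFn_toLp] with x hx1 hx2
    rw [RCLike.inner_apply, hx1, hx2, mul_comm]
  filter_upwards [hu.coeFn_toLp, Lp.coeFn_zero ℂ 2 (volume : Measure Plane)] with x hx1 hx2
  rw [← hx1, h2, hx2, Pi.zero_apply]

/-- An orthonormal family of smooth compactly supported functions which is total after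
multiplication by `w`. It is obtained by orthonormalizing `w⁻¹ d` for a dense sequence of smooth
compactly supported functions `d`. -/
theorem exists_isSmoothBasis {w : Plane → ℝ} (hw : ContDiff ℝ (⊤ : ℕ∞) w) (hpos : ∀ x, 0 < w x) :
    ∃ (N : Set ℕ) (e : N → Plane → ℂ), IsSmoothBasis e w := by
  obtain ⟨d, hd1, hd2, hd3⟩ := exists_dense_smooth_sequence
  have hwc : Continuous w := hw.continuous
  let b : ℕ → Plane → ℂ := fun n x => ((w x)⁻¹ : ℝ) * d n x
  have hb1 : ∀ n, ContDiff ℝ (⊤ : ℕ∞) (b n) := fun n =>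
    (Complex.ofRealCLM.contDiff.comp (hw.inv fun x => (hpos x).ne')).mul (hd1 n)
  have hb2 : ∀ n, HasCompactSupport (b n) := fun n => (hd2 n).mul_left
  have hb3 : ∀ n, MemLp (b n) 2 := fun n =>
    (hb1 n).continuous.memLp_of_hasCompactSupport (hb2 n)
  let f : ℕ → Lp ℂ 2 (volume : Measure Plane) := fun n => (hb3 n).toLp (b n)
  have hf : ∀ n, f n ∈ smoothClasses := fun n => ⟨b n, (hb3 n).coeFn_toLp, hb2 n, hb1 n⟩
  let v := InnerProductSpace.gramSchmidtNormed ℂ f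
  -- The Gram–Schmidt process stays in the span, hence among smooth functions.
  have hspan : Submodule.span ℂ (range v) = Submodule.span ℂ (range f) := by
    rw [InnerProductSpace.span_gramSchmidtNormed_range, InnerProductSpace.span_gramSchmidt]
  have hv : ∀ n, v n ∈ smoothClasses := fun n => by
    have h1 : v n ∈ Submodule.span ℂ (range f) := hspan ▸ Submodule.subset_span ⟨n, rfl⟩
    exact Submodule.span_le.2 (by rintro _ ⟨m, rfl⟩; exact hf m) h1
  choose g hg1 hg2 hg3 using hv
  have hon := InnerProductSpace.gramSchmidtNormed_orthonormal' (𝕜 := ℂ) (f := f)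
  refine ⟨{n | v n ≠ 0}, fun n => g n, ⟨fun n => hg3 n, fun n => hg2 n, ?_, ?_⟩⟩
  · intro i i' _
    have h1 := orthonormal_iff_ite.1 hon i i'
    rw [L2.inner_def] at h1
    refine Eq.trans (integral_congr_ae ?_) (h1.trans (by congr))
    filter_upwards [hg1 i, hg1 i'] with x h2 h3
    rw [RCLike.inner_apply, ← h2, ← h3, mul_comm]
  · intro u hu h0
    refine hd3 u hu fun n => ?_
    have key : ∀ φ ∈ Submodule.span ℂ (range v),
        Integrable (fun x => conj (φ x) * w x * u x) ∧ ∫ x, conj (φ x) * w x * u x = 0 := by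
      intro φ hφ
      induction hφ using Submodule.span_induction with
      | mem φ hφ =>
        obtain ⟨m, rfl⟩ := hφ
        have h3 : Integrable fun x => conj (g m x) * w x * u x := by
          have h4 : Continuous fun x => conj (g m x) * (w x : ℂ) :=
            (Complex.continuous_conj.comp (hg3 m).continuous).mul
              (Complex.continuous_ofReal.comp hwc)
          have h5 : HasCompactSupport fun x => conj (g m x) * (w x : ℂ) :=
            ((hg2 m).comp_left (g := conj) (map_zero _)).mul_right
          exact (h4.memLp_of_hasCompactSupport (p := 2) h5).integrable_mul hu
        have h6 : (fun x => conj (v m x) * w x * u x) =ᵐ[volume]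
            fun x => conj (g m x) * w x * u x := by
          filter_upwards [hg1 m] with x hx
          rw [hx]
        refine ⟨h3.congr h6.symm, ?_⟩
        rw [integral_congr_ae h6]
        by_cases hm : v m = 0
        · rw [integral_congr_ae (g := fun _ => 0), integral_zero]
          filter_upwards [hg1 m, Lp.coeFn_zero ℂ 2 (volume : Measure Plane)] with x hx hx0
          rw [← hx, hm, hx0]
          simp
        · exact h0 ⟨m, hm⟩
      | zero =>
        have h6 : (fun x => conj ((0 : Lp ℂ 2 (volume : Measure Plane)) x) * w x * u x) =ᵐ[volume]
            fun _ => 0 := by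
          filter_upwards [Lp.coeFn_zero ℂ 2 (volume : Measure Plane)] with x hx0
          rw [hx0]
          simp
        exact ⟨(integrable_zero _ _ _).congr h6.symm, by rw [integral_congr_ae h6, integral_zero]⟩
      | add φ ψ _ _ h1 h2 =>
        have h6 : (fun x => conj ((φ + ψ) x) * w x * u x) =ᵐ[volume]
            fun x => conj (φ x) * w x * u x + conj (ψ x) * w x * u x := by
          filter_upwards [Lp.coeFn_add φ ψ] with x hx
          rw [hx, Pi.add_apply, map_add]
          ring
        exact ⟨(h1.1.add h2.1).congr h6.symm, by
          rw [integral_congr_ae h6, integral_add h1.1 h2.1, h1.2, h2.2, add_zero]⟩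
      | smul c φ _ h1 =>
        have h6 : (fun x => conj ((c • φ) x) * w x * u x) =ᵐ[volume]
            fun x => conj c * (conj (φ x) * w x * u x) := by
          filter_upwards [Lp.coeFn_smul c φ] with x hx
          rw [hx, Pi.smul_apply, smul_eq_mul, map_mul]
          ring
        exact ⟨(h1.1.const_mul _).congr h6.symm, by
          rw [integral_congr_ae h6, integral_const_mul, h1.2, mul_zero]⟩
    rw [← (key (f n) (hspan ▸ Submodule.subset_span ⟨n, rfl⟩)).2]
    refine integral_congr_ae ?_
    filter_upwards [(hb3 n).coeFn_toLp] with x hx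
    have hwx : (w x : ℂ) ≠ 0 := Complex.ofReal_ne_zero.2 (hpos x).ne'
    rw [show f n x = b n x from hx]
    simp only [b, map_mul, Complex.conj_ofReal]
    push_cast
    field_simp

lemma contDiff_sobolevSymbol (α : ℝ) : ContDiff ℝ (⊤ : ℕ∞) (sobolevSymbol α) := by
  unfold sobolevSymbol
  refine ContDiff.rpow_const_of_ne ?_ fun x => (japanese_pos x).ne'
  unfold japanese
  exact contDiff_const.add (contDiff_const.mul (contDiff_norm_sq ℝ))

end BasisExistence

/-! ### Total families -/

section TotalFamilies

/-- A family of square integrable functions whose orthogonal complement is trivial. -/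
structure IsTotalFamily {X ι : Type*} [MeasurableSpace X] (μ : Measure X) (F : ι → X → ℂ) :
    Prop where
  memLp : ∀ i, MemLp (F i) 2 μ
  eq_zero : ∀ u : X → ℂ, MemLp u 2 μ → (∀ i, ∫ x, conj (F i x) * u x ∂μ = 0) → u =ᵐ[μ] 0

section General

variable {X Y ι κ : Type*} [MeasurableSpace X] [MeasurableSpace Y] {μ : Measure X} {ν : Measure Y}

lemma memLp_conj {f : X → ℂ} (hf : MemLp f 2 μ) : MemLp (fun x => conj (f x)) 2 μ :=
  (memLp_congr_norm (Complex.continuous_conj.comp_aestronglyMeasurable hf.1) hf.1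
    (.of_forall fun x => by simp)).2 hf

lemma lintegral_enorm_sq_lt_top {f : X → ℂ} (hf : MemLp f 2 μ) : ∫⁻ x, ‖f x‖ₑ ^ 2 ∂μ < ∞ := by
  have h := hf.2
  rw [eLpNorm_lt_top_iff_lintegral_rpow_enorm_lt_top (by simp) (by simp)] at h
  simpa using h

lemma memLp_two_of_lintegral {f : X → ℂ} (hf : AEStronglyMeasurable f μ)
    (h : ∫⁻ x, ‖f x‖ₑ ^ 2 ∂μ < ∞) : MemLp f 2 μ := by
  refine ⟨hf, ?_⟩
  rw [eLpNorm_lt_top_iff_lintegral_rpow_enorm_lt_top (by simp) (by simp)]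
  simpa using h

/-- The Cauchy–Schwarz inequality. -/
lemma enorm_integral_mul_sq_le {f g : X → ℂ} (hf : AEStronglyMeasurable f μ)
    (hg : AEStronglyMeasurable g μ) :
    ‖∫ x, f x * g x ∂μ‖ₑ ^ 2 ≤ (∫⁻ x, ‖f x‖ₑ ^ 2 ∂μ) * ∫⁻ x, ‖g x‖ₑ ^ 2 ∂μ := by
  have h := ENNReal.lintegral_mul_le_Lp_mul_Lq μ (p := 2) (q := 2)
    (Real.HolderConjugate.two_two) hf.enorm hg.enorm
  have h1 : ‖∫ x, f x * g x ∂μ‖ₑ ≤ (∫⁻ x, ‖f x‖ₑ ^ 2 ∂μ) ^ (1 / 2 : ℝ) *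
      (∫⁻ x, ‖g x‖ₑ ^ 2 ∂μ) ^ (1 / 2 : ℝ) := by
    refine (enorm_integral_le_lintegral_enorm _).trans ?_
    simpa [enorm_mul] using h
  calc ‖∫ x, f x * g x ∂μ‖ₑ ^ 2 ≤ ((∫⁻ x, ‖f x‖ₑ ^ 2 ∂μ) ^ (1 / 2 : ℝ) *
        (∫⁻ x, ‖g x‖ₑ ^ 2 ∂μ) ^ (1 / 2 : ℝ)) ^ 2 := by gcongr
    _ = _ := by
      rw [mul_pow, ← ENNReal.rpow_natCast, ← ENNReal.rpow_natCast, ← ENNReal.rpow_mul,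
        ← ENNReal.rpow_mul]
      norm_num

lemma memLp_prod_mul [SFinite ν] {f : X → ℂ} {g : Y → ℂ} (hf : MemLp f 2 μ)
    (hg : MemLp g 2 ν) : MemLp (fun z : X × Y => f z.1 * g z.2) 2 (μ.prod ν) := by
  have hm : AEStronglyMeasurable (fun z : X × Y => f z.1 * g z.2) (μ.prod ν) :=
    hf.1.comp_fst.mul hg.1.comp_snd
  rw [memLp_two_iff_integrable_sq_norm hm]
  have := ((memLp_two_iff_integrable_sq_norm hf.1).1 hf).mul_prod
    ((memLp_two_iff_integrable_sq_norm hg.1).1 hg)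
  simpa [mul_pow] using this

namespace IsTotalFamily

variable {F : ι → X → ℂ} {G : κ → Y → ℂ}

lemma star (h : IsTotalFamily μ F) : IsTotalFamily μ fun i x => conj (F i x) where
  memLp i := memLp_conj (h.memLp i)
  eq_zero u hu h0 := by
    have h1 := h.eq_zero (fun x => starRingEnd ℂ (u x)) (memLp_conj hu) fun i => by
      rw [← map_zero (starRingEnd ℂ), ← h0 i, ← integral_conj]
      exact integral_congr_ae (.of_forall fun x => by simp)
    filter_upwards [h1] with x hx
    simpa using hx

lemma comp_measurePreserving (h : IsTotalFamily ν G) (e : X ≃ᵐ Y) (he : MeasurePreserving e μ ν) :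
    IsTotalFamily μ fun i x => G i (e x) where
  memLp i := (h.memLp i).comp_measurePreserving he
  eq_zero u hu h0 := by
    have he' : MeasurePreserving e.symm ν μ := he.symm e
    have h1 := h.eq_zero (fun y => u (e.symm y)) (hu.comp_measurePreserving he') fun i => by
      rw [← h0 i, ← he.integral_comp']
      simp
    have h2 := he.quasiMeasurePreserving.ae h1
    filter_upwards [h2] with x hx
    simpa using hx

lemma comp_surjective (h : IsTotalFamily μ F) {ι' : Type*} {p : ι' → ι}
    (hp : Function.Surjective p) : IsTotalFamily μ fun i => F (p i) where
  memLp i := h.memLp _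
  eq_zero u hu h0 := h.eq_zero u hu fun i => by
    obtain ⟨i', rfl⟩ := hp i
    exact h0 i'

/-- Products of the members of two total families form a total family: the partial coefficients
`∫ conj (F i x) u(x, y) dx` of an orthogonal function `u` vanish for almost every `y`. -/
theorem prod [Countable ι] [SFinite μ] [SFinite ν] (hF : IsTotalFamily μ F)
    (hG : IsTotalFamily ν G) :
    IsTotalFamily (μ.prod ν) fun (i : ι × κ) z => F i.1 z.1 * G i.2 z.2 where
  memLp i := memLp_prod_mul (hF.memLp _) (hG.memLp _)
  eq_zero u hu h0 := by
    have hum := hu.1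
    set u' := hum.mk u with hu'
    have huu : u =ᵐ[μ.prod ν] u' := hum.ae_eq_mk
    have hu'm : StronglyMeasurable u' := hum.stronglyMeasurable_mk
    have hu'L : MemLp u' 2 (μ.prod ν) := (memLp_congr_ae huu).1 hu
    have hsq := lintegral_enorm_sq_lt_top hu'L
    rw [lintegral_prod_symm _ (by fun_prop)] at hsq
    let p : ι → Y → ℂ := fun i y => ∫ x, starRingEnd ℂ (F i x) * u' (x, y) ∂μ
    have hpm : ∀ i, AEStronglyMeasurable (p i) ν := fun i => by
      have h1 : AEStronglyMeasurable (fun z : X × Y => starRingEnd ℂ (F i z.1) * u' z)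
          (μ.prod ν) := (memLp_conj (hF.memLp i)).1.comp_fst.mul hu'm.aestronglyMeasurable
      exact h1.prod_swap.integral_prod_right'
    have hpL : ∀ i, MemLp (p i) 2 ν := fun i => by
      refine memLp_two_of_lintegral (hpm i) ?_
      calc ∫⁻ y, ‖p i y‖ₑ ^ 2 ∂ν
          ≤ ∫⁻ y, (∫⁻ x, ‖starRingEnd ℂ (F i x)‖ₑ ^ 2 ∂μ) * ∫⁻ x, ‖u' (x, y)‖ₑ ^ 2 ∂μ ∂ν := by
            refine lintegral_mono fun y => enorm_integral_mul_sq_le (memLp_conj (hF.memLp i)).1 ?_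
            exact (hu'm.comp_measurable measurable_prodMk_right).aestronglyMeasurable
        _ = (∫⁻ x, ‖starRingEnd ℂ (F i x)‖ₑ ^ 2 ∂μ) * ∫⁻ y, ∫⁻ x, ‖u' (x, y)‖ₑ ^ 2 ∂μ ∂ν := by
            rw [lintegral_const_mul']
            exact (lintegral_enorm_sq_lt_top (memLp_conj (hF.memLp i))).ne
        _ < ∞ := ENNReal.mul_lt_top (lintegral_enorm_sq_lt_top (memLp_conj (hF.memLp i))) hsq
    -- The partial coefficients are orthogonal to all `G`.
    have hp0 : ∀ i, p i =ᵐ[ν] 0 := fun i => by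
      refine hG.eq_zero _ (hpL i) fun j => ?_
      rw [← h0 (i, j)]
      have hint : Integrable (fun z : X × Y =>
          starRingEnd ℂ (F i z.1 * G j z.2) * u' z) (μ.prod ν) :=
        (memLp_conj (memLp_prod_mul (hF.memLp i) (hG.memLp j))).integrable_mul hu'L
      trans ∫ z : X × Y, starRingEnd ℂ (F i z.1 * G j z.2) * u' z ∂(μ.prod ν)
      · rw [integral_prod_symm _ hint]
        refine integral_congr_ae (.of_forall fun y => ?_)
        simp only [p]
        rw [← integral_const_mul]
        refine integral_congr_ae (.of_forall fun x => ?_)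
        simp only [map_mul]
        ring
      · refine integral_congr_ae ?_
        filter_upwards [huu] with z hz
        rw [hz]
    have hall : ∀ᵐ y ∂ν, ∀ i, p i y = 0 := ae_all_iff.2 fun i => hp0 i
    have hsec : ∀ᵐ y ∂ν, ∫⁻ x, ‖u' (x, y)‖ₑ ^ 2 ∂μ < ∞ :=
      ae_lt_top (hu'm.measurable.enorm.pow_const 2).lintegral_prod_left' hsq.ne
    have hzero : ∀ᵐ y ∂ν, ∀ᵐ x ∂μ, u' (x, y) = 0 := by
      filter_upwards [hall, hsec] with y hy1 hy2
      exact hF.eq_zero (fun x => u' (x, y)) (memLp_two_of_lintegral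
        (hu'm.comp_measurable measurable_prodMk_right).aestronglyMeasurable hy2) hy1
    have hms : MeasurableSet {z : X × Y | u' z = 0} :=
      hu'm.measurable (measurableSet_singleton 0)
    have h2 : ∀ᵐ z ∂(ν.prod μ), u' z.swap = 0 :=
      (Measure.ae_prod_iff_ae_ae (hms.preimage measurable_swap)).2 hzero
    have h3 : ∀ᵐ z ∂(μ.prod ν), u' z = 0 := by
      have := (Measure.measurePreserving_swap (μ := μ) (ν := ν)).quasiMeasurePreserving.ae h2
      simpa using this
    filter_upwards [huu, h3] with z hz1 hz2
    rw [hz1, hz2, Pi.zero_apply]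

/-- Products over finitely many coordinates of the members of a total family. -/
theorem pi {Z : Type*} [MeasureSpace Z] [SigmaFinite (volume : Measure Z)] [Countable ι]
    {F : ι → Z → ℂ} (hF : IsTotalFamily volume F) (n : ℕ) :
    IsTotalFamily (volume : Measure (Fin n → Z)) fun (I : Fin n → ι) q => ∏ m, F (I m) (q m) := by
  induction n with
  | zero =>
    have hv : (volume : Measure (Fin 0 → Z)) = Measure.dirac isEmptyElim := Measure.volume_pi_eq_dirac _
    refine ⟨fun I => ?_, fun u hu h0 => ?_⟩
    · simp only [Finset.univ_eq_empty, Finset.prod_empty, hv]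
      exact memLp_const 1
    · have h1 := h0 isEmptyElim
      simp only [Finset.univ_eq_empty, Finset.prod_empty, map_one, one_mul, hv,
        integral_dirac] at h1
      refine Eventually.of_forall fun x => ?_
      rw [← Subsingleton.elim isEmptyElim x, h1, Pi.zero_apply]
  | succ n ih =>
    have h1 := (hF.prod ih).comp_measurePreserving
      (MeasurableEquiv.piFinSuccAbove (fun _ : Fin (n + 1) => Z) 0)
      (volume_preserving_piFinSuccAbove (fun _ : Fin (n + 1) => Z) 0)
    have h2 := h1.comp_surjective (p := fun I : Fin (n + 1) → ι => (I 0, fun m => I m.succ))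
      fun ⟨a, I⟩ => ⟨Fin.cons a I, by simp⟩
    have h3 : (fun (I : Fin (n + 1) → ι) (q : Fin (n + 1) → Z) => ∏ m, F (I m) (q m)) =
        fun I q => F (I 0) (q 0) * ∏ m : Fin n, F (I m.succ) (q m.succ) := by
      funext I q
      rw [Fin.prod_univ_succ]
    rw [h3]
    exact h2

end IsTotalFamily

end General

end TotalFamilies

/-! ### Limits of functionals with a square function estimate -/

section Functionals

variable {V : Type*} [NormedAddCommGroup V] [NormedSpace ℂ V]

lemma lintegral_enorm_functional_le {Λ : ℝ → V →L[ℂ] ℂ} {T : ℝ} {κ : NNReal} (hT : 0 ≤ T)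
    (hcont : ∀ Y, Continuous fun s => Λ s Y)
    (hbd : ∀ Y, ∫⁻ s in Ioc 0 T, ‖Λ s Y‖ₑ ^ 2 ≤ κ * ‖Y‖ₑ ^ 2) (Y : V) :
    ∫⁻ s in Ioc 0 T, ‖Λ s Y‖ₑ ≤ ENNReal.ofReal (√(T * κ)) * ‖Y‖ₑ := by
  have h1 := sq_lintegral_le (μ := volume.restrict (Ioc 0 T)) (hcont Y).enorm.measurable.aemeasurable
  have h2 : (∫⁻ s in Ioc 0 T, ‖Λ s Y‖ₑ) ^ 2 ≤ (ENNReal.ofReal (√(T * κ)) * ‖Y‖ₑ) ^ 2 := by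
    refine h1.trans ?_
    rw [Measure.restrict_apply_univ, Real.volume_Ioc, sub_zero, mul_pow,
      ← ENNReal.ofReal_pow (by positivity), Real.sq_sqrt (by positivity), ENNReal.ofReal_mul hT,
      ENNReal.ofReal_coe_nnreal, mul_assoc]
    exact mul_le_mul_right (hbd Y) _
  exact (ENNReal.pow_le_pow_left_iff two_ne_zero).1 h2

/-- Suppose that functionals `Λ n s` satisfy a square function estimate in the time `s`, uniformly
in `n`, and that `X` is the primitive of an integrable curve `g`. Then the limits of `Λ n s (X s)`
and of `Λ n s (P (X s))` differ, in `L¹` of the time, by at most a multiple of `∫ ‖g - P g‖`. -/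
theorem lintegral_enorm_sub_le [CompleteSpace V] {Λ : ℕ → ℝ → V →L[ℂ] ℂ} {T : ℝ} {κ : NNReal}
    (hT : 0 ≤ T) (hcont : ∀ n Y, Continuous fun s => Λ n s Y)
    (hbd : ∀ n Y, ∫⁻ s in Ioc 0 T, ‖Λ n s Y‖ₑ ^ 2 ≤ κ * ‖Y‖ₑ ^ 2)
    {g X : ℝ → V} (hg : IntegrableOn g (Ioc 0 T))
    (hX : ∀ s ∈ Ioc 0 T, X s = ∫ r in (0 : ℝ)..s, g r) (P : V →L[ℂ] V) {l z : ℝ → ℂ}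
    (hl : ∀ s ∈ Ioc 0 T, Tendsto (fun n => Λ n s (P (X s))) atTop (𝓝 (l s)))
    (hz : ∀ s ∈ Ioc 0 T, Tendsto (fun n => Λ n s (X s)) atTop (𝓝 (z s))) :
    ∫⁻ s in Ioc 0 T, ‖z s - l s‖ₑ ≤
      ENNReal.ofReal (√(T * κ)) * ∫⁻ r in Ioc 0 T, ‖g r - P (g r)‖ₑ := by
  have hG : IntegrableOn (fun r => g r - P (g r)) (Ioc 0 T) := hg.sub (P.integrable_comp hg)
  obtain ⟨G, hGm, hGG⟩ := hG.aestronglyMeasurable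
  have hjoint : ∀ n, Measurable fun p : ℝ × ℝ => ‖Λ n p.1 (G p.2)‖ₑ := by
    intro n
    have h1 : StronglyMeasurable (Function.uncurry fun (s r : ℝ) => Λ n s (G r)) :=
      stronglyMeasurable_uncurry_of_continuous_of_stronglyMeasurable
        (fun r => hcont n (G r)) fun s => (Λ n s).continuous.comp_stronglyMeasurable hGm
    exact h1.measurable.enorm
  let m : ℕ → ℝ → ℝ≥0∞ := fun n s => ∫⁻ r in Ioc 0 T, ‖Λ n s (G r)‖ₑ
  have hm : ∀ n, Measurable (m n) := fun n => (hjoint n).lintegral_prod_right'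
  have hint : ∀ n, ∫⁻ s in Ioc 0 T, m n s ≤
      ENNReal.ofReal (√(T * κ)) * ∫⁻ r in Ioc 0 T, ‖g r - P (g r)‖ₑ := by
    intro n
    simp only [m]
    rw [lintegral_lintegral_swap (hjoint n).aemeasurable,
      ← lintegral_const_mul' _ _ ENNReal.ofReal_ne_top]
    refine lintegral_mono_ae ?_
    filter_upwards [hGG] with r hr
    rw [hr]
    exact lintegral_enorm_functional_le hT (hcont n) (hbd n) _
  -- The functionals may be applied to the primitive under the integral sign.
  have hpt : ∀ s ∈ Ioc 0 T, ‖z s - l s‖ₑ ≤ liminf (fun n => m n s) atTop := by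
    intro s hs
    have h1 : Tendsto (fun n => ‖Λ n s (X s) - Λ n s (P (X s))‖ₑ) atTop (𝓝 ‖z s - l s‖ₑ) :=
      ((hz s hs).sub (hl s hs)).enorm
    rw [← h1.liminf_eq]
    refine liminf_le_liminf (.of_forall fun n => ?_)
    have hgs : IntegrableOn g (Ioc 0 s) := hg.mono_set (Ioc_subset_Ioc_right hs.2)
    have hGs : IntegrableOn (fun r => g r - P (g r)) (Ioc 0 s) :=
      hG.mono_set (Ioc_subset_Ioc_right hs.2)
    have h2 : X s - P (X s) = ∫ r in Ioc 0 s, (g r - P (g r)) := by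
      rw [hX s hs, intervalIntegral.integral_of_le hs.1.le,
        integral_sub hgs (P.integrable_comp hgs), P.integral_comp_comm hgs]
    rw [← map_sub, h2, ← (Λ n s).integral_comp_comm hGs]
    refine (enorm_integral_le_lintegral_enorm _).trans ?_
    refine (lintegral_mono_set (Ioc_subset_Ioc_right hs.2)).trans (le_of_eq ?_)
    refine lintegral_congr_ae ?_
    filter_upwards [hGG] with r hr
    rw [hr]
  calc ∫⁻ s in Ioc 0 T, ‖z s - l s‖ₑ ≤ ∫⁻ s in Ioc 0 T, liminf (fun n => m n s) atTop :=
        setLIntegral_mono' measurableSet_Ioc hpt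
    _ ≤ liminf (fun n => ∫⁻ s in Ioc 0 T, m n s) atTop := lintegral_liminf_le hm
    _ ≤ _ := by
        refine liminf_le_of_frequently_le' (Frequently.of_forall hint)

end Functionals

section WordIsometry

variable {𝔞 : Type*} {H : Type*} [NormedAddCommGroup H] [InnerProductSpace ℂ H] [CompleteSpace H]

/-- The components at the words of length `n`. -/
def wordComponents (n : ℕ) : WordSpace 𝔞 →L[ℂ] lp (fun _ : Fin n → 𝔞 => ℂ) 2 :=
  LinearMap.mkContinuous
    { toFun := fun Y => ⟨fun c => Y (List.ofFn c), by
        classical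
        refine memℓp_gen' (C := ‖Y‖ ^ 2) fun F => ?_
        have := sum_norm_sq_le Y (F.image List.ofFn)
        rw [Finset.sum_image List.ofFn_injective.injOn] at this
        simpa using this⟩
      map_add' := fun Y Y' => by ext c; rfl
      map_smul' := fun r Y => by ext c; rfl } 1 fun Y => by
    classical
    rw [one_mul]
    refine lp.norm_le_of_forall_sum_le (p := 2) (by norm_num) (norm_nonneg _) fun F => ?_
    have := sum_norm_sq_le Y (F.image List.ofFn)
    rw [Finset.sum_image List.ofFn_injective.injOn] at this
    simpa using this

/-- The synthesis operator `Y ↦ ∑ Y_c • b_c` of an orthonormal family indexed by words of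
length `n`. -/
def synthesis {n : ℕ} {b : (Fin n → 𝔞) → H} (hb : Orthonormal ℂ b) : WordSpace 𝔞 →L[ℂ] H :=
  hb.orthogonalFamily.linearIsometry.toContinuousLinearMap ∘L wordComponents n

lemma norm_synthesis_le {n : ℕ} {b : (Fin n → 𝔞) → H} (hb : Orthonormal ℂ b) (Y : WordSpace 𝔞) :
    ‖synthesis hb Y‖ ≤ ‖Y‖ := by
  rw [synthesis, ContinuousLinearMap.comp_apply, LinearIsometry.coe_toContinuousLinearMap,
    LinearIsometry.norm_map]
  simpa using (wordComponents n).le_of_opNorm_le (LinearMap.mkContinuous_norm_le _ zero_le_one _) Y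

lemma synthesis_single [DecidableEq 𝔞] {n : ℕ} {b : (Fin n → 𝔞) → H} (hb : Orthonormal ℂ b)
    (c : Fin n → 𝔞) (r : ℂ) :
    synthesis hb (lp.single (E := fun _ : List 𝔞 => ℂ) 2 (List.ofFn c) r) = r • b c := by
  have h : wordComponents n (lp.single (E := fun _ : List 𝔞 => ℂ) 2 (List.ofFn c) r) =
      lp.single 2 (E := fun _ : Fin n → 𝔞 => ℂ) c r := by
    ext c'
    change lp.single (E := fun _ : List 𝔞 => ℂ) 2 (List.ofFn c) r (List.ofFn c') = _
    by_cases hc : c' = c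
    · subst hc
      simp
    · rw [lp.single_apply_ne _ _ _ hc,
        lp.single_apply_ne _ _ _ fun h => hc (List.ofFn_injective h)]
  rw [synthesis, ContinuousLinearMap.comp_apply, h, LinearIsometry.coe_toContinuousLinearMap,
    OrthogonalFamily.linearIsometry_apply_single]
  simp

lemma inner_synthesis {n : ℕ} {b : (Fin n → 𝔞) → H} (hb : Orthonormal ℂ b)
    (Y : WordSpace 𝔞) (c : Fin n → 𝔞) : ⟪b c, synthesis hb Y⟫_ℂ = Y (List.ofFn c) := by
  classical
  have h := hb.orthogonalFamily.hasSum_linearIsometry (wordComponents n Y)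
  have h1 := h.mapL (innerSL ℂ (b c))
  have h2 := hasSum_ite_eq c (Y (List.ofFn c))
  have h4 : (fun c' => innerSL ℂ (b c) (LinearIsometry.toSpanSingleton ℂ H (hb.1 c')
      (wordComponents n Y c'))) = fun c' => if c' = c then Y (List.ofFn c) else 0 := by
    funext c'
    have h3 : wordComponents n Y c' = Y (List.ofFn c') := rfl
    rw [innerSL_apply_apply, LinearIsometry.toSpanSingleton_apply, inner_smul_right,
      orthonormal_iff_ite.1 hb, h3]
    by_cases hc : c' = c
    · subst hc
      simp
    · simp [hc, Ne.symm hc]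
  rw [h4] at h1
  exact h1.unique h2

end WordIsometry

/-! ### Configurations of pairs of points -/

section Coordinates

/-- The positions of the particles of a configuration, as a measurable equivalence. -/
def positions (k : ℕ) : Config k ≃ᵐ (Fin k → Plane) where
  toFun x j := pos x j
  invFun p := WithLp.toLp 2 fun a => p a.1 a.2
  left_inv x := by ext a; rfl
  right_inv p := by funext j; ext a; rfl
  measurable_toFun := measurable_pi_lambda _ fun j => (continuous_pos j).measurable
  measurable_invFun := by
    have : Continuous fun p : Fin k → Plane =>
        (WithLp.toLp 2 fun a : Fin k × Fin 2 => p a.1 a.2 : Config k) := by fun_prop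
    exact this.measurable

@[simp] lemma positions_apply {k : ℕ} (x : Config k) (j : Fin k) : positions k x j = pos x j := rfl

lemma measurePreserving_positions (k : ℕ) : MeasurePreserving (positions k) := by
  induction k with
  | zero =>
    have h1 := PiLp.volume_preserving_ofLp (Fin 0 × Fin 2)
    refine ⟨(positions 0).measurable, ?_⟩
    rw [Measure.volume_pi_eq_dirac (isEmptyElim : Fin 0 → Plane)]
    have h2 : (positions 0 : Config 0 → Fin 0 → Plane) =
        (fun _ : Fin 0 × Fin 2 → ℝ => (isEmptyElim : Fin 0 → Plane)) ∘ WithLp.ofLp := by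
      funext x
      exact Subsingleton.elim _ _
    rw [h2, ← Measure.map_map measurable_const h1.measurable, h1.map_eq,
      Measure.volume_pi_eq_dirac isEmptyElim]
    exact Measure.map_dirac' measurable_const _
  | succ k ih =>
    have h1 := (volume_preserving_piFinSuccAbove (fun _ : Fin (k + 1) => Plane) (Fin.last k)).symm
    have h2 := (Measure.measurePreserving_swap (μ := (volume : Measure (Fin k → Plane)))
      (ν := (volume : Measure Plane)))
    have h3 := ih.prod (MeasurePreserving.id (volume : Measure Plane))
    have h := h1.comp (h2.comp (h3.comp (measurePreserving_split k)))
    have h4 : (positions (k + 1) : Config (k + 1) → Fin (k + 1) → Plane) =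
        (MeasurableEquiv.piFinSuccAbove (fun _ : Fin (k + 1) => Plane) (Fin.last k)).symm ∘
          Prod.swap ∘ Prod.map (positions k) id ∘
            fun x => (firstParticles x, pos x (Fin.last k)) := by
      funext x j
      refine Fin.lastCases ?_ (fun i => ?_) j
      · simp
      · simp [firstParticles, pos]
    rw [h4]
    exact h

/-- A configuration of pairs of planar points, as a pair of configurations. -/
def pairPositions (k : ℕ) : (Fin k → Plane × Plane) ≃ᵐ Config k × Config k :=
  (MeasurableEquiv.arrowProdEquivProdArrow Plane Plane (Fin k)).trans
    ((positions k).symm.prodCongr (positions k).symm)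

@[simp] lemma pos_pairPositions_fst {k : ℕ} (q : Fin k → Plane × Plane) (j : Fin k) :
    pos (pairPositions k q).1 j = (q j).1 := rfl

@[simp] lemma pos_pairPositions_snd {k : ℕ} (q : Fin k → Plane × Plane) (j : Fin k) :
    pos (pairPositions k q).2 j = (q j).2 := rfl

lemma measurePreserving_pairPositions (k : ℕ) :
    MeasurePreserving (pairPositions k) volume (volume.prod volume) := by
  have h1 := volume_measurePreserving_arrowProdEquivProdArrow Plane Plane (Fin k)
  have h2 := (measurePreserving_positions k).symm
  exact (h2.prod h2).comp h1

lemma norm_sq_eq_sum_pos {k : ℕ} (x : Config k) : ‖x‖ ^ 2 = ∑ j, ‖pos x j‖ ^ 2 := by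
  rw [EuclideanSpace.norm_sq_eq, Fintype.sum_prod_type]
  refine Finset.sum_congr rfl fun j _ => ?_
  rw [EuclideanSpace.norm_sq_eq]
  rfl

end Coordinates

section WordFunctions

variable {ι : Type*} {e : ι → Plane → ℂ} {w : Plane → ℝ}

/-- The function `e_i(ξ) conj (e_{i'}(η))` of a pair of planar points. -/
def pairFun (e : ι → Plane → ℂ) (a : ι × ι) (p : Plane × Plane) : ℂ :=
  e a.1 p.1 * conj (e a.2 p.2)

/-- The product of the functions `pairFun` along a word. -/
def wordFun {k : ℕ} (e : ι → Plane → ℂ) (c : Fin k → ι × ι) (q : Fin k → Plane × Plane) : ℂ :=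
  ∏ m, pairFun e (c m) (q m)

/-- The product of the weights of all the points of a configuration of pairs. -/
def pairWeight {k : ℕ} (w : Plane → ℝ) (q : Fin k → Plane × Plane) : ℝ :=
  ∏ m, w (q m).1 * w (q m).2

lemma memLp_fintype_prod {Z : Type*} [MeasureSpace Z] [SigmaFinite (volume : Measure Z)] {k : ℕ}
    {f : Fin k → Z → ℂ} (hf : ∀ m, MemLp (f m) 2) :
    MemLp (fun q : Fin k → Z => ∏ m, f m (q m)) 2 := by
  have hm : AEStronglyMeasurable (fun q : Fin k → Z => ∏ m, f m (q m)) volume := by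
    refine Finset.aestronglyMeasurable_fun_prod _ fun m _ => ?_
    exact (hf m).1.comp_quasiMeasurePreserving (Measure.quasiMeasurePreserving_eval _ m)
  rw [memLp_two_iff_integrable_sq_norm hm]
  have := Integrable.fintype_prod (μ := fun _ : Fin k => (volume : Measure Z))
    (f := fun m x => ‖f m x‖ ^ 2) fun m => (memLp_two_iff_integrable_sq_norm (hf m).1).1 (hf m)
  rw [volume_pi]
  simpa only [norm_prod, Finset.prod_pow] using this

namespace IsSmoothBasis

lemma memLp_pairFun (h : IsSmoothBasis e w) (a : ι × ι) : MemLp (pairFun e a) 2 :=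
  memLp_prod_mul (h.memLp a.1) (memLp_conj (h.memLp a.2))

lemma continuous_pairFun (h : IsSmoothBasis e w) (a : ι × ι) : Continuous (pairFun e a) :=
  ((h.continuous a.1).comp continuous_fst).mul
    (Complex.continuous_conj.comp ((h.continuous a.2).comp continuous_snd))

lemma memLp_wordFun (h : IsSmoothBasis e w) {k : ℕ} (c : Fin k → ι × ι) : MemLp (wordFun e c) 2 :=
  memLp_fintype_prod fun m => h.memLp_pairFun (c m)

lemma integral_conj_pairFun_mul [DecidableEq ι] (h : IsSmoothBasis e w) (a b : ι × ι) :
    ∫ p, conj (pairFun e a p) * pairFun e b p = if a = b then 1 else 0 := by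
  have h1 : ∀ p : Plane × Plane, conj (pairFun e a p) * pairFun e b p =
      (conj (e a.1 p.1) * e b.1 p.1) * conj (conj (e a.2 p.2) * e b.2 p.2) := by
    intro p
    simp only [pairFun, map_mul, Complex.conj_conj]
    ring
  simp only [h1]
  rw [Measure.volume_eq_prod, integral_prod_mul (fun x => conj (e a.1 x) * e b.1 x)
    (fun y => conj (conj (e a.2 y) * e b.2 y)), integral_conj, h.integral_conj_mul,
    h.integral_conj_mul]
  by_cases h2 : a.1 = b.1 <;> by_cases h3 : a.2 = b.2 <;> simp [h2, h3, Prod.ext_iff]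

lemma integral_conj_wordFun_mul [DecidableEq ι] (h : IsSmoothBasis e w) {k : ℕ}
    (c c' : Fin k → ι × ι) :
    ∫ q, conj (wordFun e c q) * wordFun e c' q = if c = c' then 1 else 0 := by
  have h1 : ∀ q : Fin k → Plane × Plane, conj (wordFun e c q) * wordFun e c' q =
      ∏ m, conj (pairFun e (c m) (q m)) * pairFun e (c' m) (q m) := by
    intro q
    simp only [wordFun, map_prod, Finset.prod_mul_distrib]
  simp only [h1]
  rw [integral_fintype_prod_volume_eq_prod (fun m p => conj (pairFun e (c m) p) *
    pairFun e (c' m) p)]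
  simp only [h.integral_conj_pairFun_mul, Finset.prod_ite_zero, Finset.prod_const_one,
    Finset.mem_univ, true_implies, funext_iff]

lemma orthonormal_wordFun (h : IsSmoothBasis e w) (k : ℕ) :
    Orthonormal ℂ fun c : Fin k → ι × ι => (h.memLp_wordFun c).toLp (wordFun e c) := by
  classical
  rw [orthonormal_iff_ite]
  intro c c'
  rw [← h.integral_conj_wordFun_mul, L2.inner_def]
  refine integral_congr_ae ?_
  filter_upwards [(h.memLp_wordFun c).coeFn_toLp, (h.memLp_wordFun c').coeFn_toLp] with x h1 h2
  rw [h1, h2, RCLike.inner_apply, mul_comm]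

lemma isTotalFamily_weighted (h : IsSmoothBasis e w) (hw : Continuous w) :
    IsTotalFamily volume fun i x => e i x * w x where
  memLp i := ((h.continuous i).mul (Complex.continuous_ofReal.comp hw)).memLp_of_hasCompactSupport
    (h.hasCompactSupport i).mul_right
  eq_zero u hu h0 := h.total_weighted u hu fun i => by
    rw [← h0 i]
    simp

lemma isTotalFamily_wordFun [Countable ι] (h : IsSmoothBasis e w) (hw : Continuous w) (k : ℕ) :
    IsTotalFamily volume fun (c : Fin k → ι × ι) q => wordFun e c q * pairWeight w q := by
  have h1 := h.isTotalFamily_weighted hw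
  have h2 := (h1.prod h1.star).pi k
  have h3 : (fun (c : Fin k → ι × ι) (q : Fin k → Plane × Plane) => wordFun e c q *
      (pairWeight w q : ℂ)) = fun c q => ∏ m, (e (c m).1 (q m).1 * w (q m).1) *
        conj (e (c m).2 (q m).2 * w (q m).2) := by
    funext c q
    rw [wordFun, pairWeight]
    push_cast
    rw [← Finset.prod_mul_distrib]
    refine Finset.prod_congr rfl fun m _ => ?_
    rw [pairFun, map_mul, Complex.conj_ofReal]
    ring
  rw [h3]
  exact h2

end IsSmoothBasis

end WordFunctions

/-! ### The partial trace of a trace class operator -/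

section PartialTrace

lemma coeFn_tensor {k : ℕ} (f : L2 k) (e : Lp ℂ 2 (volume : Measure Plane)) :
    tensor f e =ᵐ[volume] fun x => f (firstParticles x) * e (pos x (Fin.last k)) :=
  (memLp_tensor f e).coeFn_toLp

lemma integral_split {k : ℕ} (G : Config k × Plane → ℂ)
    (hG : AEStronglyMeasurable G (volume.prod volume)) :
    ∫ x : Config (k + 1), G (firstParticles x, pos x (Fin.last k)) = ∫ z, G z ∂(volume.prod volume) := by
  have h := measurePreserving_split k
  rw [← h.map_eq] at hG ⊢
  rw [integral_map h.measurable.aemeasurable hG]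

lemma inner_tensor {k : ℕ} (f f' : L2 k) (e e' : Lp ℂ 2 (volume : Measure Plane)) :
    ⟪tensor f e, tensor f' e'⟫_ℂ = ⟪f, f'⟫_ℂ * ⟪e, e'⟫_ℂ := by
  rw [L2.inner_def, L2.inner_def, L2.inner_def, ← integral_prod_mul, ← integral_split]
  · refine integral_congr_ae ?_
    filter_upwards [coeFn_tensor f e, coeFn_tensor f' e'] with x h1 h2
    rw [h1, h2]
    simp only [RCLike.inner_apply, map_mul]
    ring
  · have h1 : AEStronglyMeasurable (fun x => ⟪f x, f' x⟫_ℂ) volume :=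
      (Lp.aestronglyMeasurable f).inner (Lp.aestronglyMeasurable f')
    have h2 : AEStronglyMeasurable (fun x => ⟪e x, e' x⟫_ℂ) volume :=
      (Lp.aestronglyMeasurable e).inner (Lp.aestronglyMeasurable e')
    exact h1.comp_fst.mul h2.comp_snd

lemma norm_tensor {k : ℕ} (f : L2 k) (e : Lp ℂ 2 (volume : Measure Plane)) :
    ‖tensor f e‖ = ‖f‖ * ‖e‖ := by
  have h := inner_tensor f f e e
  rw [inner_self_eq_norm_sq_to_K, inner_self_eq_norm_sq_to_K, inner_self_eq_norm_sq_to_K] at h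
  have h2 : ‖tensor f e‖ ^ 2 = (‖f‖ * ‖e‖) ^ 2 := by
    rw [mul_pow]
    exact_mod_cast h
  exact (sq_eq_sq₀ (norm_nonneg _) (by positivity)).1 h2

/-- `e ↦ f ⊗ e` as a bounded operator. -/
def tensorL {k : ℕ} (f : L2 k) : Lp ℂ 2 (volume : Measure Plane) →L[ℂ] L2 (k + 1) :=
  LinearMap.mkContinuous
    { toFun := tensor f
      map_add' := fun e e' => by
        refine Lp.ext ?_
        have h := (measurePreserving_split k).quasiMeasurePreserving
        have h1 := h.ae (Measure.quasiMeasurePreserving_snd.ae (Lp.coeFn_add e e'))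
        filter_upwards [coeFn_tensor f (e + e'), coeFn_tensor f e, coeFn_tensor f e',
          Lp.coeFn_add (tensor f e) (tensor f e'), h1] with x h2 h3 h4 h5 h6
        rw [h2, h5, Pi.add_apply, h3, h4, h6, Pi.add_apply, mul_add]
      map_smul' := fun c e => by
        refine Lp.ext ?_
        have h := (measurePreserving_split k).quasiMeasurePreserving
        have h1 := h.ae (Measure.quasiMeasurePreserving_snd.ae (Lp.coeFn_smul c e))
        filter_upwards [coeFn_tensor f (c • e), coeFn_tensor f e,
          Lp.coeFn_smul c (tensor f e), h1] with x h2 h3 h5 h6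
        rw [h2, RingHom.id_apply, h5, Pi.smul_apply, h3, h6, Pi.smul_apply, smul_eq_mul,
          smul_eq_mul]
        ring } ‖f‖ fun e => (norm_tensor f e).le

/-- The partial inner product with `f` in the first `k` particles; the adjoint of `e ↦ f ⊗ e`. -/
def slice {k : ℕ} (f : L2 k) : L2 (k + 1) →L[ℂ] Lp ℂ 2 (volume : Measure Plane) :=
  ContinuousLinearMap.adjoint (tensorL f)

lemma inner_slice_right {k : ℕ} (f : L2 k) (e : Lp ℂ 2 (volume : Measure Plane)) (φ : L2 (k + 1)) :
    ⟪e, slice f φ⟫_ℂ = ⟪tensor f e, φ⟫_ℂ :=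
  ContinuousLinearMap.adjoint_inner_right _ _ _

lemma norm_slice_le {k : ℕ} (f : L2 k) (φ : L2 (k + 1)) : ‖slice f φ‖ ≤ ‖f‖ * ‖φ‖ := by
  refine (slice f).le_of_opNorm_le ?_ φ
  rw [slice, LinearIsometryEquiv.norm_map]
  exact LinearMap.mkContinuous_norm_le _ (norm_nonneg _) _

lemma slice_tensor {k : ℕ} (f r : L2 k) (b : Lp ℂ 2 (volume : Measure Plane)) :
    slice f (tensor r b) = ⟪f, r⟫_ℂ • b := by
  refine ext_inner_left ℂ fun e => ?_
  rw [inner_slice_right, inner_tensor, inner_smul_right]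

/-- For an operator `∑ₙ |φₙ⟩⟨ψₙ|` the partial trace is a sum over `n` of inner products of
partial inner products. -/
theorem hasSum_partialTrace {k : ℕ} (f g : L2 k) {A : Op (k + 1)} {φ ψ : ℕ → L2 (k + 1)}
    (hs : Summable fun n => ‖φ n‖ * ‖ψ n‖)
    (hA : ∀ u, HasSum (fun n => ⟪ψ n, u⟫_ℂ • φ n) (A u)) :
    HasSum (fun i => ⟪tensor f (basis (Lp ℂ 2 (volume : Measure Plane)) i),
      A (tensor g (basis (Lp ℂ 2 (volume : Measure Plane)) i))⟫_ℂ)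
      (∑' n, ⟪slice g (ψ n), slice f (φ n)⟫_ℂ) := by
  set b := basis (Lp ℂ 2 (volume : Measure Plane))
  let t : ℕ → basisIndex (Lp ℂ 2 (volume : Measure Plane)) → ℂ := fun n i =>
    ⟪slice g (ψ n), b i⟫_ℂ * ⟪b i, slice f (φ n)⟫_ℂ
  -- Absolute summability, by the inequalities of Cauchy–Schwarz and Bessel, allows the exchange of
  -- the trace with the sum over `n`.
  have hfin : ∀ n (F : Finset (basisIndex (Lp ℂ 2 (volume : Measure Plane)))),
      ∑ i ∈ F, ‖t n i‖ ≤ ‖slice g (ψ n)‖ * ‖slice f (φ n)‖ := by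
    intro n F
    have hb := b.orthonormal
    have h1 := hb.sum_inner_products_le (slice g (ψ n)) (s := F)
    have h2 := hb.sum_inner_products_le (slice f (φ n)) (s := F)
    calc ∑ i ∈ F, ‖t n i‖ = ∑ i ∈ F, ‖⟪b i, slice g (ψ n)⟫_ℂ‖ * ‖⟪b i, slice f (φ n)⟫_ℂ‖ := by
          refine Finset.sum_congr rfl fun i _ => ?_
          rw [norm_mul, norm_inner_symm]
      _ ≤ √(∑ i ∈ F, ‖⟪b i, slice g (ψ n)⟫_ℂ‖ ^ 2) * √(∑ i ∈ F, ‖⟪b i, slice f (φ n)⟫_ℂ‖ ^ 2) :=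
          Real.sum_mul_le_sqrt_mul_sqrt _ _ _
      _ ≤ √(‖slice g (ψ n)‖ ^ 2) * √(‖slice f (φ n)‖ ^ 2) := by gcongr
      _ = _ := by rw [Real.sqrt_sq (norm_nonneg _), Real.sqrt_sq (norm_nonneg _)]
  have ht : ∀ n, Summable fun i => ‖t n i‖ := fun n =>
    summable_of_sum_le (fun _ => norm_nonneg _) (hfin n)
  have hsum : Summable fun p : ℕ × basisIndex (Lp ℂ 2 (volume : Measure Plane)) => t p.1 p.2 := by
    refine Summable.of_norm ?_
    rw [summable_prod_of_nonneg fun _ => norm_nonneg _]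
    refine ⟨ht, Summable.of_nonneg_of_le (fun n => tsum_nonneg fun _ => norm_nonneg _)
      (fun n => ?_) (hs.mul_left (‖g‖ * ‖f‖))⟩
    refine ((ht n).tsum_le_of_sum_le (hfin n)).trans ?_
    calc ‖slice g (ψ n)‖ * ‖slice f (φ n)‖ ≤ (‖g‖ * ‖ψ n‖) * (‖f‖ * ‖φ n‖) := by
          gcongr
          · exact norm_slice_le _ _
          · exact norm_slice_le _ _
      _ = ‖g‖ * ‖f‖ * (‖φ n‖ * ‖ψ n‖) := by ring
  have h1 : HasSum (fun p : ℕ × basisIndex (Lp ℂ 2 (volume : Measure Plane)) => t p.1 p.2)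
      (∑' n, ⟪slice g (ψ n), slice f (φ n)⟫_ℂ) := by
    have h2 := hsum.hasSum.prod_fiberwise fun n => b.hasSum_inner_mul_inner (slice g (ψ n))
      (slice f (φ n))
    rw [h2.tsum_eq]
    exact hsum.hasSum
  have h3 := (Equiv.prodComm _ _).hasSum_iff.2 h1
  refine h3.prod_fiberwise fun i => ?_
  have h4 := (hA (tensor g (b i))).mapL (innerSL ℂ (tensor f (b i)))
  have h5 : ∀ n, innerSL ℂ (tensor f (b i)) (⟪ψ n, tensor g (b i)⟫_ℂ • φ n) = t n i := by
    intro n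
    rw [innerSL_apply_apply, inner_smul_right, ← inner_slice_right f]
    simp only [t]
    rw [← inner_conj_symm (slice g (ψ n)), inner_slice_right g, inner_conj_symm]
  simpa only [h5] using! h4

end PartialTrace

/-! ### The approximate identity in Fourier variables -/

section FourierIdentities

open Real (fourierChar)

section Shift

variable {E : Type*} [NormedAddCommGroup E] [InnerProductSpace ℝ E] [FiniteDimensional ℝ E]
  [MeasurableSpace E] [BorelSpace E]

/-- Plancherel's identity with a translation on the Fourier side. -/
lemma integral_conj_add_mul_fourier {F p : E → ℂ} (hF : Integrable F) (hp : Integrable p) (c : E) :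
    ∫ ξ, conj (F (ξ + c)) * 𝓕 p ξ =
      ∫ x, conj (𝓕⁻ F x) * (fourierChar ⟪c, x⟫_ℝ : ℂ) * p x := by
  have hg : Integrable fun ξ => conj (F (ξ + c)) := 
    (Complex.conjCLE : ℂ →L[ℝ] ℂ).integrable_comp (hF.comp_add_right c)
  have h1 := VectorFourier.integral_fourierIntegral_smul_eq_flip (μ := (volume : Measure E))
    (ν := (volume : Measure E)) (L := innerₗ E) Real.continuous_fourierChar continuous_inner hp hg
  rw [flip_innerₗ] at h1
  have h2 : ∀ x, 𝓕 (fun ξ => conj (F (ξ + c))) x = (fourierChar ⟪c, x⟫_ℝ : ℂ) * conj (𝓕⁻ F x) := by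
    intro x
    rw [Real.fourier_eq, Real.fourierInv_eq, ← integral_conj, ← integral_const_mul,
      ← integral_sub_right_eq_self _ c]
    refine integral_congr_ae (.of_forall fun ξ => ?_)
    simp only [sub_add_cancel, Circle.smul_def, smul_eq_mul, map_mul]
    rw [inner_sub_left, neg_sub, sub_eq_add_neg, AddChar.map_add_eq_mul, AddChar.map_neg_eq_inv,
      Circle.coe_mul, Circle.coe_inv_eq_conj]
    ring
  calc ∫ ξ, conj (F (ξ + c)) * 𝓕 p ξ = ∫ ξ, 𝓕 p ξ • conj (F (ξ + c)) := by
        simp only [smul_eq_mul, mul_comm]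
    _ = ∫ x, p x • 𝓕 (fun ξ => conj (F (ξ + c))) x := h1
    _ = _ := by
        refine integral_congr_ae (.of_forall fun x => ?_)
        simp only [h2, smul_eq_mul]
        ring

end Shift

/-- The Fourier transform of the profile of the approximate identity. -/
def profileHat (h : 𝓢(Plane, ℝ)) : 𝓢(Plane, ℂ) :=
  𝓕 (SchwartzMap.postcompCLM (𝕜 := ℝ) Complex.ofRealCLM h)

lemma profileHat_zero (h : 𝓢(Plane, ℝ)) : profileHat h 0 = ((∫ x, h x : ℝ) : ℂ) := by
  rw [profileHat, SchwartzMap.fourier_coe, Real.fourier_eq, ← integral_complex_ofReal]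
  refine integral_congr_ae (.of_forall fun x => ?_)
  simp

lemma integrable_profileHat_smul (h : 𝓢(Plane, ℝ)) {ε : ℝ} (hε : 0 < ε) :
    Integrable fun ζ : Plane => profileHat h (ε • ζ) :=
  (integrable_comp_smul_iff volume _ hε.ne').2 (profileHat h).integrable

/-- The approximate identity as a superposition of exponentials. -/
lemma mollifier_eq_integral (h : 𝓢(Plane, ℝ)) {ε : ℝ} (hε : 0 < ε) (z : Plane) :
    (((ε⁻¹) ^ 2 * h (ε⁻¹ • z) : ℝ) : ℂ) =
      ∫ ζ : Plane, profileHat h (ε • ζ) * (fourierChar ⟪ζ, z⟫_ℝ : ℂ) := by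
  set hc : 𝓢(Plane, ℂ) := SchwartzMap.postcompCLM (𝕜 := ℝ) Complex.ofRealCLM h with hhc
  have h1 : (𝓕⁻ (profileHat h) : 𝓢(Plane, ℂ)) = hc := by
    rw [profileHat, FourierTransform.fourierInv_fourier_eq]
  have h2 : hc (ε⁻¹ • z) = ∫ ζ : Plane, profileHat h ζ * (fourierChar ⟪ζ, ε⁻¹ • z⟫_ℝ : ℂ) := by
    rw [← h1, SchwartzMap.fourierInv_coe, Real.fourierInv_eq]
    refine integral_congr_ae (.of_forall fun x => ?_)
    simp only [Circle.smul_def, smul_eq_mul, mul_comm]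
  have h3 := Measure.integral_comp_smul (volume : Measure Plane)
    (fun ζ : Plane => profileHat h ζ * (fourierChar ⟪ζ, ε⁻¹ • z⟫_ℝ : ℂ)) ε
  rw [← h2] at h3
  have h4 : ∀ ζ : Plane, ⟪ε • ζ, ε⁻¹ • z⟫_ℝ = ⟪ζ, z⟫_ℝ := by
    intro ζ
    rw [real_inner_smul_left, real_inner_smul_right, ← mul_assoc, mul_inv_cancel₀ hε.ne', one_mul]
  simp only [h4] at h3
  rw [h3, finrank_euclideanSpace_fin, abs_of_nonneg (by positivity), inv_pow]
  change _ = _ • ((h (ε⁻¹ • z) : ℝ) : ℂ)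
  rw [Complex.real_smul]
  push_cast
  rfl

/-- The configuration with the `j`-th particle at `ζ` and the others at the origin. -/
def singleConfig {k : ℕ} (j : Fin k) (ζ : Plane) : Config k :=
  WithLp.toLp 2 fun a => if a.1 = j then ζ a.2 else 0

lemma pos_singleConfig {k : ℕ} (j m : Fin k) (ζ : Plane) :
    pos (singleConfig j ζ) m = if m = j then ζ else 0 := by
  ext a
  simp only [pos, singleConfig]
  split_ifs <;> simp

lemma pos_add {k : ℕ} (x y : Config k) (m : Fin k) : pos (x + y) m = pos x m + pos y m := by
  ext a
  simp [pos]

lemma inner_eq_sum_pos {k : ℕ} (x y : Config k) : ⟪x, y⟫_ℝ = ∑ m, ⟪pos x m, pos y m⟫_ℝ := by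
  simp only [PiLp.inner_apply, Fintype.sum_prod_type]
  rfl

lemma inner_singleConfig {k : ℕ} (j : Fin k) (ζ : Plane) (x : Config k) :
    ⟪singleConfig j ζ, x⟫_ℝ = ⟪ζ, pos x j⟫_ℝ := by
  rw [inner_eq_sum_pos, Finset.sum_eq_single_of_mem j (Finset.mem_univ j)]
  · simp [pos_singleConfig]
  · intro m _ hm
    simp [pos_singleConfig, hm]

lemma continuous_singleConfig {k : ℕ} (j : Fin k) : Continuous (singleConfig (k := k) j) := by
  unfold singleConfig
  refine (PiLp.continuous_toLp 2 _).comp (continuous_pi fun a => ?_)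
  split_ifs
  · fun_prop
  · exact continuous_const

lemma inner_split {k : ℕ} (x y : Config (k + 1)) :
    ⟪x, y⟫_ℝ = ⟪firstParticles x, firstParticles y⟫_ℝ +
      ⟪pos x (Fin.last k), pos y (Fin.last k)⟫_ℝ := by
  rw [inner_eq_sum_pos, Fin.sum_univ_castSucc, inner_eq_sum_pos]
  rfl

/-- The Fourier transform of a product. -/
lemma fourierInv_tensor {k : ℕ} {Φ : 𝓢(Config (k + 1), ℂ)} {p : 𝓢(Config k, ℂ)} {a : 𝓢(Plane, ℂ)}
    (hΦ : ∀ ξ, Φ ξ = p (firstParticles ξ) * a (pos ξ (Fin.last k))) (x : Config (k + 1)) :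
    (𝓕⁻ Φ : 𝓢(Config (k + 1), ℂ)) x =
      (𝓕⁻ p : 𝓢(Config k, ℂ)) (firstParticles x) * (𝓕⁻ a : 𝓢(Plane, ℂ)) (pos x (Fin.last k)) := by
  rw [SchwartzMap.fourierInv_coe, SchwartzMap.fourierInv_coe, SchwartzMap.fourierInv_coe,
    Real.fourierInv_eq, Real.fourierInv_eq, Real.fourierInv_eq, ← integral_prod_mul,
    ← integral_split]
  · refine integral_congr_ae (.of_forall fun ξ => ?_)
    simp only [hΦ, Circle.smul_def, smul_eq_mul]
    rw [inner_split, AddChar.map_add_eq_mul, Circle.coe_mul]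
    ring
  · have h1 : Continuous fun v : Config k => fourierChar ⟪v, firstParticles x⟫_ℝ • p v :=
      (Real.continuous_fourierChar.comp (by fun_prop)).smul p.continuous
    have h2 : Continuous fun v : Plane => fourierChar ⟪v, pos x (Fin.last k)⟫_ℝ • a v :=
      (Real.continuous_fourierChar.comp (by fun_prop)).smul a.continuous
    exact ((h1.comp continuous_fst).mul (h2.comp continuous_snd)).aestronglyMeasurable

lemma toLp_fourierInv_tensor {k : ℕ} {Φ : 𝓢(Config (k + 1), ℂ)} {p : 𝓢(Config k, ℂ)}
    {a : 𝓢(Plane, ℂ)} (hΦ : ∀ ξ, Φ ξ = p (firstParticles ξ) * a (pos ξ (Fin.last k))) :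
    (𝓕⁻ Φ : 𝓢(Config (k + 1), ℂ)).toLp 2 =
      tensor ((𝓕⁻ p : 𝓢(Config k, ℂ)).toLp 2) ((𝓕⁻ a : 𝓢(Plane, ℂ)).toLp 2) := by
  refine Lp.ext ?_
  have h := (measurePreserving_split k).quasiMeasurePreserving
  have h1 := h.ae (Measure.quasiMeasurePreserving_fst.ae ((𝓕⁻ p : 𝓢(Config k, ℂ)).coeFn_toLp 2
    volume))
  have h2 := h.ae (Measure.quasiMeasurePreserving_snd.ae ((𝓕⁻ a : 𝓢(Plane, ℂ)).coeFn_toLp 2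
    volume))
  filter_upwards [(𝓕⁻ Φ : 𝓢(Config (k + 1), ℂ)).coeFn_toLp 2 volume, coeFn_tensor
    ((𝓕⁻ p : 𝓢(Config k, ℂ)).toLp 2) ((𝓕⁻ a : 𝓢(Plane, ℂ)).toLp 2), h1, h2] with x e1 e2 e3 e4
  rw [e1, e2, e3, e4, fourierInv_tensor hΦ]

/-- Integrals against the approximate identity `h_ε(x_j - y)`, on the Fourier side. -/
lemma integral_mul_mollifier_mul {k : ℕ} (h : 𝓢(Plane, ℝ)) (j : Fin k) {ε : ℝ} (hε : 0 < ε)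
    {u : Config k → ℂ} {v : Plane → ℂ} (hu : Integrable u) (hv : Integrable v) :
    ∫ z : Config k × Plane, u z.1 * (((ε⁻¹) ^ 2 * h (ε⁻¹ • (pos z.1 j - z.2)) : ℝ) : ℂ) * v z.2
      ∂(volume.prod volume) =
    ∫ ζ : Plane, profileHat h (ε • ζ) * (∫ x, (fourierChar ⟪ζ, pos x j⟫_ℝ : ℂ) * u x) *
      ∫ y, conj (fourierChar ⟪ζ, y⟫_ℝ : ℂ) * v y := by
  have h1 : ∀ z : Config k × Plane,
      u z.1 * (((ε⁻¹) ^ 2 * h (ε⁻¹ • (pos z.1 j - z.2)) : ℝ) : ℂ) * v z.2 =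
      ∫ ζ : Plane, (fourierChar ⟪ζ, pos z.1 j - z.2⟫_ℝ : ℂ) *
        ((u z.1 * v z.2) * profileHat h (ε • ζ)) := by
    intro z
    rw [mollifier_eq_integral h hε, mul_assoc, mul_comm _ (v z.2), ← mul_assoc,
      ← integral_const_mul]
    refine integral_congr_ae (.of_forall fun ζ => ?_)
    ring
  simp only [h1]
  rw [integral_integral_swap]
  · refine integral_congr_ae (.of_forall fun ζ => ?_)
    simp only
    rw [mul_assoc, ← integral_prod_mul, ← integral_const_mul]
    refine integral_congr_ae (.of_forall fun z => ?_)
    simp only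
    rw [inner_sub_right, sub_eq_add_neg ⟪ζ, pos z.1 j⟫_ℝ, AddChar.map_add_eq_mul,
      AddChar.map_neg_eq_inv, Circle.coe_mul, Circle.coe_inv_eq_conj]
    ring
  · have h2 := (hu.mul_prod hv).mul_prod (integrable_profileHat_smul h hε)
    refine h2.mono ?_ (.of_forall fun p => le_of_eq ?_)
    · refine Continuous.aestronglyMeasurable ?_ |>.mul h2.aestronglyMeasurable
      have h3 : Continuous fun p : (Config k × Plane) × Plane => ⟪p.2, pos p.1.1 j - p.1.2⟫_ℝ :=
        continuous_snd.inner (((continuous_pos j).comp (continuous_fst.comp continuous_fst)).sub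
          (continuous_snd.comp continuous_fst))
      exact continuous_subtype_val.comp (Real.continuous_fourierChar.comp h3)
    · simp [Function.uncurry, Circle.norm_coe]

end FourierIdentities

/-! ### Operators with bounded kernels -/

section BoundedKernels

variable {X : Type*} [MeasurableSpace X] {μ : Measure X}

lemma enorm_sq_eq_lintegral (φ : Lp ℂ 2 μ) : ‖φ‖ₑ ^ 2 = ∫⁻ x, ‖φ x‖ₑ ^ 2 ∂μ := by
  rw [Lp.enorm_def, eLpNorm_eq_lintegral_rpow_enorm_toReal (by simp) (by simp)]
  simp only [ENNReal.toReal_ofNat, ENNReal.rpow_ofNat]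
  rw [← ENNReal.rpow_natCast, ← ENNReal.rpow_mul]
  norm_num

/-- Two continuous functionals on `L²` which agree on a total family are equal. -/
lemma IsTotalFamily.functional_ext {ι : Type*} {F : ι → X → ℂ} (hF : IsTotalFamily μ F)
    {D D' : Lp ℂ 2 μ →L[ℂ] ℂ}
    (h : ∀ i, D ((hF.memLp i).toLp (F i)) = D' ((hF.memLp i).toLp (F i))) : D = D' := by
  set u := (InnerProductSpace.toDual ℂ (Lp ℂ 2 μ)).symm (D - D') with hu
  have h1 : ∀ φ, ⟪u, φ⟫_ℂ = (D - D') φ := fun φ => InnerProductSpace.toDual_symm_apply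
  have h2 : (u : X → ℂ) =ᵐ[μ] 0 := by
    refine hF.eq_zero u (Lp.memLp u) fun i => ?_
    have h3 := h1 ((hF.memLp i).toLp (F i))
    rw [sub_apply, h i, sub_self, ← inner_conj_symm, map_eq_zero,
      L2.inner_def] at h3
    rw [← h3]
    refine integral_congr_ae ?_
    filter_upwards [(hF.memLp i).coeFn_toLp] with x hx
    rw [hx, RCLike.inner_apply, mul_comm]
  have h4 : u = 0 := Lp.eq_zero_iff_ae_eq_zero.2 h2
  refine sub_eq_zero.1 (ContinuousLinearMap.ext fun φ => ?_)
  rw [← h1 φ, h4, inner_zero_left, zero_apply]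

/-- A kernel `E` such that `∫∫ |E(x, y) φ(x) ψ(y)| dx dy ≤ c ‖φ‖ ‖ψ‖` for all square integrable
functions `φ`, `ψ`. -/
structure IsBoundedKernel (μ : Measure X) (E : X × X → ℂ) (c : NNReal) : Prop where
  measurable : Measurable E
  bound : ∀ φ ψ : Lp ℂ 2 μ,
    ∫⁻ z, ‖E z‖ₑ * (‖φ z.1‖ₑ * ‖ψ z.2‖ₑ) ∂(μ.prod μ) ≤ c * (‖φ‖ₑ * ‖ψ‖ₑ)

namespace IsBoundedKernel

variable {E : X × X → ℂ} {c : NNReal}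

lemma lintegral_enorm_eq (E : X × X → ℂ) (φ ψ : Lp ℂ 2 μ) :
    ∫⁻ z, ‖E z * (φ z.1 * conj (ψ z.2))‖ₑ ∂(μ.prod μ) =
      ∫⁻ z, ‖E z‖ₑ * (‖φ z.1‖ₑ * ‖ψ z.2‖ₑ) ∂(μ.prod μ) := by
  simp only [enorm_mul, RCLike.enorm_conj]

lemma integrable (h : IsBoundedKernel μ E c) (φ ψ : Lp ℂ 2 μ) :
    Integrable (fun z => E z * (φ z.1 * conj (ψ z.2))) (μ.prod μ) := by
  refine ⟨h.measurable.aestronglyMeasurable.mul ((Lp.aestronglyMeasurable φ).comp_fst.mul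
    (Complex.continuous_conj.comp_aestronglyMeasurable (Lp.aestronglyMeasurable ψ).comp_snd)), ?_⟩
  rw [HasFiniteIntegral, lintegral_enorm_eq]
  exact (h.bound φ ψ).trans_lt (ENNReal.mul_lt_top ENNReal.coe_lt_top
    (ENNReal.mul_lt_top enorm_lt_top enorm_lt_top))

lemma norm_integral_le (h : IsBoundedKernel μ E c) (φ ψ : Lp ℂ 2 μ) :
    ‖∫ z, E z * (φ z.1 * conj (ψ z.2)) ∂(μ.prod μ)‖ ≤ c * ‖ψ‖ * ‖φ‖ := by
  have h1 : ‖∫ z, E z * (φ z.1 * conj (ψ z.2)) ∂(μ.prod μ)‖ₑ ≤ c * (‖φ‖ₑ * ‖ψ‖ₑ) :=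
    (enorm_integral_le_lintegral_enorm _).trans
      ((lintegral_enorm_eq E φ ψ).le.trans (h.bound φ ψ))
  have h2 := ENNReal.toReal_mono (ENNReal.mul_lt_top ENNReal.coe_lt_top
    (ENNReal.mul_lt_top enorm_lt_top enorm_lt_top)).ne h1
  simp only [toReal_enorm, ENNReal.toReal_mul, ENNReal.coe_toReal] at h2
  linarith [mul_comm ‖φ‖ ‖ψ‖, mul_assoc (c : ℝ) ‖ψ‖ ‖φ‖, congrArg (fun r => (c : ℝ) * r)
    (mul_comm ‖φ‖ ‖ψ‖)]

/-- The functional `φ ↦ ∫∫ E(x, y) φ(x) conj ψ(y) dx dy`. -/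
def functional (h : IsBoundedKernel μ E c) (ψ : Lp ℂ 2 μ) : Lp ℂ 2 μ →L[ℂ] ℂ :=
  LinearMap.mkContinuous
    { toFun := fun φ => ∫ z, E z * (φ z.1 * conj (ψ z.2)) ∂(μ.prod μ)
      map_add' := fun φ φ' => by
        rw [← integral_add (h.integrable φ ψ) (h.integrable φ' ψ)]
        refine integral_congr_ae ?_
        filter_upwards [Measure.quasiMeasurePreserving_fst.ae (Lp.coeFn_add φ φ')] with z hz
        rw [hz, Pi.add_apply]
        ring
      map_smul' := fun r φ => by
        rw [RingHom.id_apply, smul_eq_mul, ← integral_const_mul]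
        refine integral_congr_ae ?_
        filter_upwards [Measure.quasiMeasurePreserving_fst.ae (Lp.coeFn_smul r φ)] with z hz
        rw [hz, Pi.smul_apply, smul_eq_mul]
        ring } (c * ‖ψ‖) fun φ => h.norm_integral_le φ ψ

lemma functional_apply (h : IsBoundedKernel μ E c) (φ ψ : Lp ℂ 2 μ) :
    h.functional ψ φ = ∫ z, E z * (φ z.1 * conj (ψ z.2)) ∂(μ.prod μ) := rfl

variable [SFinite μ]

lemma swap (h : IsBoundedKernel μ E c) : IsBoundedKernel μ (fun z => conj (E z.swap)) c where
  measurable := Complex.continuous_conj.measurable.comp (h.measurable.comp measurable_swap)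
  bound φ ψ := by
    refine le_trans (le_of_eq ?_) ((h.bound ψ φ).trans_eq (by rw [mul_comm ‖ψ‖ₑ]))
    rw [← lintegral_prod_swap]
    refine lintegral_congr fun z => ?_
    simp only [Prod.fst_swap, Prod.snd_swap, RCLike.enorm_conj, Prod.swap_swap]
    rw [mul_comm ‖φ z.2‖ₑ]

lemma functional_swap (h : IsBoundedKernel μ E c) (φ ψ : Lp ℂ 2 μ) :
    h.swap.functional φ ψ = conj (h.functional ψ φ) := by
  rw [functional_apply, functional_apply, ← integral_conj, ← integral_prod_swap]
  refine integral_congr_ae (.of_forall fun z => ?_)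
  simp only [Prod.swap_swap, Prod.fst_swap, Prod.snd_swap, map_mul, Complex.conj_conj]
  ring

/-- A bounded operator whose matrix elements with respect to a total family are given by a bounded
kernel is given by this kernel. -/
theorem inner_eq_integral (h : IsBoundedKernel μ E c) {ι : Type*} {F : ι → X → ℂ}
    (hF : IsTotalFamily μ F) {W : Lp ℂ 2 μ →L[ℂ] Lp ℂ 2 μ}
    (hW : ∀ i i', ⟪(hF.memLp i').toLp (F i'), W ((hF.memLp i).toLp (F i))⟫_ℂ =
      ∫ z, E z * (F i z.1 * conj (F i' z.2)) ∂(μ.prod μ)) (φ ψ : Lp ℂ 2 μ) :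
    ⟪ψ, W φ⟫_ℂ = ∫ z, E z * (φ z.1 * conj (ψ z.2)) ∂(μ.prod μ) := by
  have h1 : ∀ i', innerSL ℂ ((hF.memLp i').toLp (F i')) ∘L W =
      h.functional ((hF.memLp i').toLp (F i')) := by
    intro i'
    refine hF.functional_ext fun i => ?_
    rw [ContinuousLinearMap.comp_apply, innerSL_apply_apply, hW, functional_apply]
    refine integral_congr_ae ?_
    filter_upwards [Measure.quasiMeasurePreserving_fst.ae (hF.memLp i).coeFn_toLp,
      Measure.quasiMeasurePreserving_snd.ae (hF.memLp i').coeFn_toLp] with z hz hz'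
    rw [hz, hz']
  have h2 : innerSL ℂ (W φ) = h.swap.functional φ := by
    refine hF.functional_ext fun i' => ?_
    rw [innerSL_apply_apply, ← inner_conj_symm, h.functional_swap, ← h1 i',
      ContinuousLinearMap.comp_apply, innerSL_apply_apply]
  have h3 := congrArg (fun D => conj (D ψ)) h2
  simp only [innerSL_apply_apply, inner_conj_symm] at h3
  rw [h3, h.functional_swap, Complex.conj_conj, functional_apply]

end IsBoundedKernel

variable [SFinite μ]

/-- A kernel `H A B` is bounded if `∫ H(x, y) A(x, y)² dx` and `∫ H(x, y) B(x, y)² dy` are bounded;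
this is the Cauchy–Schwarz inequality with respect to the weight `H`. -/
lemma lintegral_weighted_le {H A B : X × X → ℝ≥0∞} (hH : Measurable H) (hA : Measurable A)
    (hB : Measurable B) {c₁ c₂ : ℝ≥0∞}
    (h1 : ∀ y, ∫⁻ x, H (x, y) * A (x, y) ^ 2 ∂μ ≤ c₁)
    (h2 : ∀ x, ∫⁻ y, H (x, y) * B (x, y) ^ 2 ∂μ ≤ c₂) (φ ψ : Lp ℂ 2 μ) :
    (∫⁻ z, (H z * A z * B z) * (‖φ z.1‖ₑ * ‖ψ z.2‖ₑ) ∂(μ.prod μ)) ^ 2 ≤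
      c₁ * c₂ * (‖φ‖ₑ * ‖ψ‖ₑ) ^ 2 := by
  have hφ : AEMeasurable (fun z : X × X => ‖φ z.1‖ₑ) (μ.prod μ) :=
    (Lp.aestronglyMeasurable φ).comp_fst.enorm
  have hψ : AEMeasurable (fun z : X × X => ‖ψ z.2‖ₑ) (μ.prod μ) :=
    (Lp.aestronglyMeasurable ψ).comp_snd.enorm
  -- Cauchy–Schwarz for `√H A |ψ|` and `√H B |φ|`.
  have hcs := ENNReal.lintegral_mul_le_Lp_mul_Lq (μ.prod μ) (p := 2) (q := 2)
    (Real.HolderConjugate.two_two) (f := fun z => H z ^ (1 / 2 : ℝ) * (A z * ‖ψ z.2‖ₑ))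
    (g := fun z => H z ^ (1 / 2 : ℝ) * (B z * ‖φ z.1‖ₑ))
    ((hH.pow_const _).aemeasurable.mul (hA.aemeasurable.mul hψ))
    ((hH.pow_const _).aemeasurable.mul (hB.aemeasurable.mul hφ))
  have hsq : ∀ a b : ℝ≥0∞, (a ^ (1 / 2 : ℝ) * b) ^ (2 : ℝ) = a * b ^ 2 := by
    intro a b
    rw [ENNReal.mul_rpow_of_nonneg _ _ (by norm_num), ← ENNReal.rpow_mul]
    norm_num
  have hhalf : ∀ a : ℝ≥0∞, a ^ (1 / 2 : ℝ) * a ^ (1 / 2 : ℝ) = a := by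
    intro a
    rw [← ENNReal.rpow_add_of_nonneg _ _ (by norm_num) (by norm_num)]
    norm_num
  simp only [hsq, Pi.mul_apply] at hcs
  have hI1 : ∫⁻ z, H z * (A z * ‖ψ z.2‖ₑ) ^ 2 ∂(μ.prod μ) ≤ c₁ * ‖ψ‖ₑ ^ 2 := by
    rw [lintegral_prod_symm (fun z : X × X => H z * (A z * ‖ψ z.2‖ₑ) ^ 2)
      (hH.aemeasurable.mul ((hA.aemeasurable.mul hψ).pow_const 2)),
      enorm_sq_eq_lintegral, ← lintegral_const_mul'' _ ((Lp.aestronglyMeasurable ψ).enorm.pow_const 2)]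
    refine lintegral_mono fun y => ?_
    simp only [mul_pow, ← mul_assoc]
    rw [lintegral_mul_const' _ _ (by simp)]
    gcongr
    exact h1 y
  have hI2 : ∫⁻ z, H z * (B z * ‖φ z.1‖ₑ) ^ 2 ∂(μ.prod μ) ≤ c₂ * ‖φ‖ₑ ^ 2 := by
    rw [lintegral_prod (fun z : X × X => H z * (B z * ‖φ z.1‖ₑ) ^ 2)
      (hH.aemeasurable.mul ((hB.aemeasurable.mul hφ).pow_const 2)),
      enorm_sq_eq_lintegral, ← lintegral_const_mul'' _ ((Lp.aestronglyMeasurable φ).enorm.pow_const 2)]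
    refine lintegral_mono fun x => ?_
    simp only [mul_pow, ← mul_assoc]
    rw [lintegral_mul_const' _ _ (by simp)]
    gcongr
    exact h2 x
  calc (∫⁻ z, (H z * A z * B z) * (‖φ z.1‖ₑ * ‖ψ z.2‖ₑ) ∂(μ.prod μ)) ^ 2
      ≤ ((c₁ * ‖ψ‖ₑ ^ 2) ^ (1 / 2 : ℝ) * (c₂ * ‖φ‖ₑ ^ 2) ^ (1 / 2 : ℝ)) ^ 2 := by
        gcongr
        refine le_trans (le_of_eq (lintegral_congr fun z => ?_)) (hcs.trans (by gcongr))
        rw [mul_mul_mul_comm (H z ^ (1 / 2 : ℝ)), hhalf]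
        ring
    _ = c₁ * c₂ * (‖φ‖ₑ * ‖ψ‖ₑ) ^ 2 := by
        rw [mul_pow, sq ((c₁ * ‖ψ‖ₑ ^ 2) ^ (1 / 2 : ℝ)), sq ((c₂ * ‖φ‖ₑ ^ 2) ^ (1 / 2 : ℝ)), hhalf,
          hhalf]
        ring

end BoundedKernels

/-! ### Products of one-particle functions -/

section TestFunctions

/-- The position of a particle as a linear map. -/
def posL {k : ℕ} (j : Fin k) : Config k →L[ℝ] Plane :=
  LinearMap.toContinuousLinearMap
    { toFun := fun x => pos x j
      map_add' := fun x y => pos_add x y j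
      map_smul' := fun c x => by ext a; simp [pos] }

lemma hasCompactSupport_prod {k : ℕ} {φ : Fin k → Plane → ℂ} (hφ : ∀ m, HasCompactSupport (φ m)) :
    HasCompactSupport fun ξ : Config k => ∏ m, φ m (pos ξ m) := by
  have h1 : ∀ m, ∃ r : ℝ, ∀ p, r < ‖p‖ → φ m p = 0 := by
    intro m
    obtain ⟨r, hr⟩ := (hφ m).isCompact.isBounded.subset_closedBall 0
    refine ⟨r, fun p hp => image_eq_zero_of_notMem_tsupport fun hp' => ?_⟩
    have := hr hp'
    rw [mem_closedBall_zero_iff] at this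
    linarith
  choose r hr using h1
  refine HasCompactSupport.intro (isCompact_closedBall (0 : Config k) (1 + ∑ m, r m ^ 2))
    fun ξ hξ => ?_
  by_contra hne
  have h2 : ∀ m, ‖pos ξ m‖ ≤ r m := by
    intro m
    by_contra hm
    exact hne (Finset.prod_eq_zero (Finset.mem_univ m) (hr m _ (not_le.1 hm)))
  apply hξ
  rw [mem_closedBall_zero_iff]
  have h3 : ‖ξ‖ ^ 2 ≤ ∑ m, r m ^ 2 := by
    rw [norm_sq_eq_sum_pos]
    exact Finset.sum_le_sum fun m _ => pow_le_pow_left₀ (norm_nonneg _) (h2 m) 2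
  nlinarith [norm_nonneg ξ, sq_nonneg (‖ξ‖ - 1)]

/-- The product of smooth compactly supported functions of the particles. -/
def productSchwartz {k : ℕ} (φ : Fin k → 𝓢(Plane, ℂ)) (hφ : ∀ m, HasCompactSupport (φ m)) :
    𝓢(Config k, ℂ) :=
  (hasCompactSupport_prod hφ).toSchwartzMap
    (contDiff_prod fun m _ => ((φ m).smooth ⊤).comp (posL m).contDiff)

namespace IsSmoothBasis

variable {ι : Type*} {e : ι → Plane → ℂ} {w : Plane → ℝ}

lemma hasCompactSupport_particle (h : IsSmoothBasis e w) (i : ι) (t : ℝ) : HasCompactSupport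
    fun p => e i p * w p * Complex.exp (-(Complex.I * ((t * (4 * Real.pi ^ 2 * ‖p‖ ^ 2) : ℝ)))) :=
  (h.hasCompactSupport i).mul_right.mul_right

/-- The function `e_i(p) w(p)`, evolved freely for the time `t` on the Fourier side. -/
def particleSchwartz (h : IsSmoothBasis e w) (hw : ContDiff ℝ (⊤ : ℕ∞) w) (i : ι) (t : ℝ) :
    𝓢(Plane, ℂ) :=
  (h.hasCompactSupport_particle i t).toSchwartzMap
    (((h.contDiff i).mul (Complex.ofRealCLM.contDiff.comp hw)).mul
      (Complex.contDiff_exp.comp (contDiff_const.mul (Complex.ofRealCLM.contDiff.comp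
        (contDiff_const.mul (contDiff_const.mul (contDiff_norm_sq ℝ))))).neg))

lemma particleSchwartz_apply (h : IsSmoothBasis e w) (hw : ContDiff ℝ (⊤ : ℕ∞) w) (i : ι) (t : ℝ)
    (p : Plane) : h.particleSchwartz hw i t p =
      e i p * w p * Complex.exp (-(Complex.I * ((t * (4 * Real.pi ^ 2 * ‖p‖ ^ 2) : ℝ)))) := rfl

/-- The product of the weighted basis functions along a word, evolved freely for the time `t` on
the Fourier side. -/
def wordSchwartz (h : IsSmoothBasis e w) (hw : ContDiff ℝ (⊤ : ℕ∞) w) {k : ℕ} (c : Fin k → ι)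
    (t : ℝ) : 𝓢(Config k, ℂ) :=
  productSchwartz (fun m => h.particleSchwartz hw (c m) t)
    fun m => h.hasCompactSupport_particle (c m) t

lemma wordSchwartz_apply (h : IsSmoothBasis e w) (hw : ContDiff ℝ (⊤ : ℕ∞) w) {k : ℕ}
    (c : Fin k → ι) (t : ℝ) (ξ : Config k) :
    h.wordSchwartz hw c t ξ = ∏ m, h.particleSchwartz hw (c m) t (pos ξ m) := rfl

lemma wordSchwartz_eq (h : IsSmoothBasis e w) (hw : ContDiff ℝ (⊤ : ℕ∞) w) {k : ℕ}
    (c : Fin k → ι) (t : ℝ) (ξ : Config k) :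
    h.wordSchwartz hw c t ξ = (∏ m, e (c m) (pos ξ m) * w (pos ξ m)) *
      Complex.exp (-(Complex.I * ((t * laplaceSymbol k ξ : ℝ)))) := by
  have h1 : laplaceSymbol k ξ = ∑ m, 4 * Real.pi ^ 2 * ‖pos ξ m‖ ^ 2 := by
    change 4 * Real.pi ^ 2 * ‖ξ‖ ^ 2 = _
    rw [norm_sq_eq_sum_pos, Finset.mul_sum]
  rw [wordSchwartz_apply, h1]
  simp only [particleSchwartz_apply]
  rw [Finset.prod_mul_distrib, ← Complex.exp_sum, Finset.mul_sum]
  push_cast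
  rw [Finset.mul_sum, Finset.sum_neg_distrib]

lemma wordSchwartz_split (h : IsSmoothBasis e w) (hw : ContDiff ℝ (⊤ : ℕ∞) w) {k : ℕ}
    (c : Fin (k + 1) → ι) (t : ℝ) (ξ : Config (k + 1)) :
    h.wordSchwartz hw c t ξ = h.wordSchwartz hw (fun m => c m.castSucc) t (firstParticles ξ) *
      h.particleSchwartz hw (c (Fin.last k)) t (pos ξ (Fin.last k)) := by
  rw [wordSchwartz_apply, wordSchwartz_apply, Fin.prod_univ_castSucc]
  rfl

lemma isTotalFamily_wordSchwartz [Countable ι] (h : IsSmoothBasis e w)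
    (hw : ContDiff ℝ (⊤ : ℕ∞) w) (k : ℕ) :
    IsTotalFamily volume fun (c : Fin k → ι) ξ => h.wordSchwartz hw c 0 ξ := by
  have h1 := ((h.isTotalFamily_weighted hw.continuous).pi k).comp_measurePreserving (positions k)
    (measurePreserving_positions k)
  have h2 : (fun (c : Fin k → ι) ξ => h.wordSchwartz hw c 0 ξ) =
      fun c ξ => ∏ m, e (c m) (positions k ξ m) * (w (positions k ξ m) : ℂ) := by
    funext c ξ
    rw [wordSchwartz_eq]
    simp
  rw [h2]
  exact h1

end IsSmoothBasis

end TestFunctions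

/-! ### The regularized collision in Fourier variables -/

section TraceFormula

open Real (fourierChar)

lemma continuous_firstParticles {k : ℕ} : Continuous (firstParticles (k := k)) := by
  unfold firstParticles
  fun_prop

/-- The kernel, in Fourier variables, of the operator `W` for which `⟨Ψ, W Φ⟩` is the partial
inner product of `h_ε(x_j - x_{k+1}) Φ` with `f` paired with that of `Ψ` with `g`; here `F`, `G`
are the Fourier transforms of `f`, `g`. -/
def collisionKernel {k : ℕ} (h : 𝓢(Plane, ℝ)) (j : Fin k) (ε : ℝ) (F G : Config k → ℂ)
    (z : Config (k + 1) × Config (k + 1)) : ℂ :=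
  profileHat h (ε • (pos z.1 (Fin.last k) - pos z.2 (Fin.last k))) *
    conj (F (firstParticles z.1 + singleConfig j (pos z.1 (Fin.last k) - pos z.2 (Fin.last k)))) *
    G (firstParticles z.2)

lemma lintegral_split {k : ℕ} (H : Config k → Plane → ℝ≥0∞)
    (hH : Measurable (Function.uncurry H)) :
    ∫⁻ x : Config (k + 1), H (firstParticles x) (pos x (Fin.last k)) = ∫⁻ w, ∫⁻ ξ, H ξ w := by
  have h := measurePreserving_split k
  exact (h.lintegral_comp hH).trans (lintegral_prod_symm' (Function.uncurry H) hH)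

variable {k : ℕ} (h : 𝓢(Plane, ℝ)) (j : Fin k) {ε : ℝ}

lemma exists_isBoundedKernel_collisionKernel (hε : 0 < ε) (F G : 𝓢(Config k, ℂ)) :
    ∃ c, IsBoundedKernel volume (collisionKernel h j ε F G) c := by
  have hN : ∫⁻ ζ : Plane, ‖profileHat h (ε • ζ)‖ₑ < ⊤ := (integrable_profileHat_smul h hε).2
  have hsq : ∀ F : 𝓢(Config k, ℂ), ∫⁻ ξ, ‖F ξ‖ₑ ^ 2 < ⊤ := fun F =>
    lintegral_enorm_sq_lt_top (F.memLp 2)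
  obtain ⟨N, hN'⟩ := ENNReal.canLift.prf _ hN.ne
  obtain ⟨a, ha⟩ := ENNReal.canLift.prf _ (hsq F).ne
  obtain ⟨b, hb⟩ := ENNReal.canLift.prf _ (hsq G).ne
  have hc := (profileHat h).continuous
  have hF := F.continuous
  have hG := G.continuous
  have hf := continuous_firstParticles (k := k)
  have hp := continuous_pos (Fin.last k)
  have hs := continuous_singleConfig j
  -- The factors `ĥ`, `F`, `G` play the roles of `H`, `A`, `B` in `lintegral_weighted_le`.
  have cH : Continuous fun z : Config (k + 1) × Config (k + 1) =>
      profileHat h (ε • (pos z.1 (Fin.last k) - pos z.2 (Fin.last k))) := by fun_prop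
  have cA : Continuous fun z : Config (k + 1) × Config (k + 1) => F (firstParticles z.1 +
      singleConfig j (pos z.1 (Fin.last k) - pos z.2 (Fin.last k))) := by fun_prop
  have cB : Continuous fun z : Config (k + 1) × Config (k + 1) => G (firstParticles z.2) := by
    fun_prop
  refine ⟨N * NNReal.sqrt (a * b), ?_, fun φ ψ => ?_⟩
  · exact ((cH.mul (Complex.continuous_conj.comp cA)).mul cB).measurable
  · have h1 : ∀ y : Config (k + 1), ∫⁻ x : Config (k + 1),
        ‖profileHat h (ε • (pos x (Fin.last k) - pos y (Fin.last k)))‖ₑ *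
        ‖F (firstParticles x + singleConfig j (pos x (Fin.last k) - pos y (Fin.last k)))‖ₑ ^ 2
        ≤ N * a := by
      intro y
      rw [lintegral_split (fun ξ w => ‖profileHat h (ε • (w - pos y (Fin.last k)))‖ₑ *
        ‖F (ξ + singleConfig j (w - pos y (Fin.last k)))‖ₑ ^ 2)]
      · have : ∀ w, ∫⁻ ξ : Config k, ‖profileHat h (ε • (w - pos y (Fin.last k)))‖ₑ *
            ‖F (ξ + singleConfig j (w - pos y (Fin.last k)))‖ₑ ^ 2 =
            ‖profileHat h (ε • (w - pos y (Fin.last k)))‖ₑ * a := by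
          intro w
          rw [lintegral_const_mul' _ _ (by simp),
            lintegral_add_right_eq_self (fun ξ => ‖F ξ‖ₑ ^ 2), ha]
        simp only [this]
        rw [lintegral_mul_const' _ _ (by simp),
          lintegral_sub_right_eq_self (fun w => ‖profileHat h (ε • w)‖ₑ), hN']
      · have : Continuous fun z : Config k × Plane => profileHat h (ε • (z.2 - pos y (Fin.last k))) := by
          fun_prop
        have h4 : Continuous fun z : Config k × Plane =>
            F (z.1 + singleConfig j (z.2 - pos y (Fin.last k))) := by
          fun_prop
        exact this.measurable.enorm.mul (h4.measurable.enorm.pow_const 2)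
    have h2 : ∀ x : Config (k + 1), ∫⁻ y : Config (k + 1),
        ‖profileHat h (ε • (pos x (Fin.last k) - pos y (Fin.last k)))‖ₑ *
        ‖G (firstParticles y)‖ₑ ^ 2 ≤ N * b := by
      intro x
      rw [lintegral_split (fun η v => ‖profileHat h (ε • (pos x (Fin.last k) - v))‖ₑ *
        ‖G η‖ₑ ^ 2)]
      · have : ∀ v, ∫⁻ η : Config k, ‖profileHat h (ε • (pos x (Fin.last k) - v))‖ₑ *
            ‖G η‖ₑ ^ 2 = ‖profileHat h (ε • (pos x (Fin.last k) - v))‖ₑ * b := by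
          intro v
          rw [lintegral_const_mul' _ _ (by simp), hb]
        simp only [this]
        rw [lintegral_mul_const' _ _ (by simp),
          lintegral_sub_left_eq_self (fun v => ‖profileHat h (ε • v)‖ₑ), hN']
      · have : Continuous fun z : Config k × Plane => profileHat h (ε • (pos x (Fin.last k) - z.2)) := by
          fun_prop
        have h4 : Continuous fun z : Config k × Plane => G z.1 := by fun_prop
        exact this.measurable.enorm.mul (h4.measurable.enorm.pow_const 2)
    have h3 := lintegral_weighted_le (μ := volume) cH.measurable.enorm cA.measurable.enorm
      cB.measurable.enorm h1 h2 φ ψ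
    refine (ENNReal.pow_right_strictMono two_ne_zero).le_iff_le.1 ?_
    refine le_trans (le_of_eq ?_) (h3.trans (le_of_eq ?_))
    · simp only [collisionKernel, enorm_mul, RCLike.enorm_conj]
    · have : (N * a * (N * b) : ℝ≥0∞) = ((N * NNReal.sqrt (a * b) : NNReal) : ℝ≥0∞) ^ 2 := by
        norm_cast
        rw [mul_pow, NNReal.sq_sqrt]
        ring
      rw [this]
      ring

/-- The integral of the collision kernel against products of Schwartz functions. -/
lemma integral_collisionKernel_mul (hε : 0 < ε) (F G p r : 𝓢(Config k, ℂ)) (a b : 𝓢(Plane, ℂ))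
    {Φ Ψ : Config (k + 1) → ℂ} (hΦ2 : MemLp Φ 2) (hΨ2 : MemLp Ψ 2)
    (hΦ : ∀ ξ, Φ ξ = p (firstParticles ξ) * a (pos ξ (Fin.last k)))
    (hΨ : ∀ ξ, Ψ ξ = r (firstParticles ξ) * b (pos ξ (Fin.last k))) :
    ∫ z, collisionKernel h j ε F G z * (Φ z.1 * conj (Ψ z.2)) ∂(volume.prod volume) =
      (∫ η, conj (r η) * G η) * ∫ ζ : Plane, profileHat h (ε • ζ) *
        (∫ ξ, conj (F (ξ + singleConfig j ζ)) * p ξ) * ∫ w, conj (b (w - ζ)) * a w := by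
  have hc := (profileHat h).continuous
  have hF := F.continuous
  have hG := G.continuous
  have hp := p.continuous
  have hr := r.continuous
  have ha := a.continuous
  have hb := b.continuous
  have hs := continuous_singleConfig j
  have hfp := continuous_firstParticles (k := k)
  have hpos := continuous_pos (Fin.last k)
  set K : (Config k × Plane) × (Config k × Plane) → ℂ := fun z =>
    (profileHat h (ε • (z.1.2 - z.2.2)) * conj (F (z.1.1 + singleConfig j (z.1.2 - z.2.2))) *
      G z.2.1) * ((p z.1.1 * a z.1.2) * conj (r z.2.1 * b z.2.2)) with hK
  have cK : Continuous K := by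
    have := Complex.continuous_conj
    simp only [hK]
    fun_prop
  have hT := (measurePreserving_split k).prod (measurePreserving_split k)
  have hKT : (fun z : Config (k + 1) × Config (k + 1) =>
      collisionKernel h j ε F G z * (Φ z.1 * conj (Ψ z.2))) =
      K ∘ Prod.map (fun x : Config (k + 1) => (firstParticles x, pos x (Fin.last k)))
        (fun x : Config (k + 1) => (firstParticles x, pos x (Fin.last k))) := by
    funext z
    simp only [hΦ, hΨ]
    rfl
  have iK : Integrable K ((volume.prod volume).prod (volume.prod volume)) := by
    rw [← hT.integrable_comp cK.aestronglyMeasurable, ← hKT]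
    obtain ⟨c, hc⟩ := exists_isBoundedKernel_collisionKernel h j hε F G
    refine (hc.integrable (hΦ2.toLp Φ) (hΨ2.toLp Ψ)).congr ?_
    filter_upwards [Measure.quasiMeasurePreserving_fst.ae hΦ2.coeFn_toLp,
      Measure.quasiMeasurePreserving_snd.ae hΨ2.coeFn_toLp] with z hz hz'
    rw [hz, hz']
  rw [hKT]
  have e1 : ∫ z, (K ∘ Prod.map (fun x : Config (k + 1) => (firstParticles x, pos x (Fin.last k)))
        (fun x : Config (k + 1) => (firstParticles x, pos x (Fin.last k)))) z
        ∂(volume.prod volume) = ∫ z, K z ∂((volume.prod volume).prod (volume.prod volume)) := by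
    rw [← hT.map_eq, integral_map hT.measurable.aemeasurable cK.aestronglyMeasurable]
    rfl
  rw [e1, integral_prod _ iK]
  -- The substitution `ζ = x - v`, where `x` and `v` are the two momenta of the last particle.
  have e2 : ∀ x : Config k × Plane, ∫ y, K (x, y) ∂(volume.prod volume) =
      (∫ η, conj (r η) * G η) * ∫ ζ : Plane, profileHat h (ε • ζ) *
        ((conj (F (x.1 + singleConfig j ζ)) * p x.1) * (conj (b (x.2 - ζ)) * a x.2)) := by
    intro x
    have e3 : ∀ y : Config k × Plane, K (x, y) = (conj (r y.1) * G y.1) *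
        (fun v => profileHat h (ε • (x.2 - v)) *
        ((conj (F (x.1 + singleConfig j (x.2 - v))) * p x.1) *
          (conj (b (x.2 - (x.2 - v))) * a x.2))) y.2 := by
      intro y
      simp only [hK, map_mul, sub_sub_cancel]
      ring
    simp only [e3]
    rw [integral_prod_mul (fun η => conj (r η) * G η) (fun v => profileHat h (ε • (x.2 - v)) *
        ((conj (F (x.1 + singleConfig j (x.2 - v))) * p x.1) *
          (conj (b (x.2 - (x.2 - v))) * a x.2))),
      integral_sub_left_eq_self (fun ζ => profileHat h (ε • ζ) *
        ((conj (F (x.1 + singleConfig j ζ)) * p x.1) * (conj (b (x.2 - ζ)) * a x.2)))]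
  simp only [e2]
  rw [integral_const_mul]
  congr 1
  rw [integral_integral_swap]
  · refine integral_congr_ae (.of_forall fun ζ => ?_)
    simp only
    rw [integral_const_mul, mul_assoc]
    congr 1
    exact integral_prod_mul (fun ξ => conj (F (ξ + singleConfig j ζ)) * p ξ)
      (fun w => conj (b (w - ζ)) * a w)
  · have h2 := ((p.integrable (μ := volume)).mul_prod (a.integrable (μ := volume))).mul_prod
      (integrable_profileHat_smul h hε)
    refine (h2.norm.const_mul (‖F.toBoundedContinuousFunction‖ *
      ‖b.toBoundedContinuousFunction‖)).mono ?_ (.of_forall fun z => ?_)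
    · refine Continuous.aestronglyMeasurable ?_
      have := Complex.continuous_conj
      simp only [Function.uncurry_def]
      fun_prop
    · have hF' := F.toBoundedContinuousFunction.norm_coe_le_norm (z.1.1 + singleConfig j z.2)
      have hb' := b.toBoundedContinuousFunction.norm_coe_le_norm (z.1.2 - z.2)
      simp only [Function.uncurry_def, norm_mul, RCLike.norm_conj, norm_norm]
      calc _ = ‖F (z.1.1 + singleConfig j z.2)‖ * ‖b (z.1.2 - z.2)‖ *
            (‖p z.1.1‖ * ‖a z.1.2‖ * ‖profileHat h (ε • z.2)‖) := by ring
        _ ≤ _ := by gcongr <;> assumption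

lemma inner_toLp {E : Type*} [NormedAddCommGroup E] [InnerProductSpace ℝ E]
    [FiniteDimensional ℝ E] [MeasurableSpace E] [BorelSpace E] (f p : 𝓢(E, ℂ)) :
    ⟪f.toLp 2 volume, p.toLp 2 volume⟫_ℂ = ∫ x, conj (f x) * p x := by
  rw [L2.inner_def]
  refine integral_congr_ae ?_
  filter_upwards [f.coeFn_toLp 2 volume, p.coeFn_toLp 2 volume] with x h1 h2
  rw [h1, h2, RCLike.inner_apply, mul_comm]

lemma inner_tensor_mulOp (hε : 0 < ε) (f p : L2 k) (a b : Lp ℂ 2 (volume : Measure Plane)) :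
    ⟪tensor f b, mulOp (mollifiedDelta h j ε) volume (tensor p a)⟫_ℂ =
      ∫ ζ : Plane, profileHat h (ε • ζ) * (∫ x, (fourierChar ⟪ζ, pos x j⟫_ℝ : ℂ) * ⟪f x, p x⟫_ℂ) *
      ∫ y, conj (fourierChar ⟪ζ, y⟫_ℝ : ℂ) * ⟪b y, a y⟫_ℂ := by
  have hu := L2.integrable_inner (𝕜 := ℂ) f p
  have hv := L2.integrable_inner (𝕜 := ℂ) b a
  have hG : AEStronglyMeasurable (fun z : Config k × Plane => ⟪f z.1, p z.1⟫_ℂ *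
      (((ε⁻¹) ^ 2 * h (ε⁻¹ • (pos z.1 j - z.2)) : ℝ) : ℂ) * ⟪b z.2, a z.2⟫_ℂ)
      (volume.prod volume) := by
    have h5 := h.continuous
    have h6 := continuous_pos (k := k) j
    have h7 : Continuous fun z : Config k × Plane =>
      (((ε⁻¹) ^ 2 * h (ε⁻¹ • (pos z.1 j - z.2)) : ℝ) : ℂ) := by fun_prop
    exact (hu.1.comp_fst.mul h7.aestronglyMeasurable).mul hv.1.comp_snd
  rw [← integral_mul_mollifier_mul h j hε hu hv, ← integral_split _ hG, L2.inner_def]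
  refine integral_congr_ae ?_
  filter_upwards [coeFn_tensor f b, coeFn_tensor p a,
    coeFn_mulOp (mollifiedDelta h j ε) volume (tensor p a)] with x h1 h2 h3
  have h8 : mollifiedDelta h j ε x =
    (((ε⁻¹) ^ 2 * h (ε⁻¹ • (pos (firstParticles x) j - pos x (Fin.last k))) : ℝ) : ℂ) := rfl
  rw [h3, h1, h2, h8]
  simp only [RCLike.inner_apply, map_mul]
  ring

lemma integral_inner_toLp {E : Type*} [NormedAddCommGroup E] [InnerProductSpace ℝ E]
    [FiniteDimensional ℝ E] [MeasurableSpace E] [BorelSpace E] (f p : 𝓢(E, ℂ)) (m : E → ℂ) :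
    ∫ x, m x * ⟪f.toLp 2 volume x, p.toLp 2 volume x⟫_ℂ = ∫ x, conj (f x) * m x * p x := by
  refine integral_congr_ae ?_
  filter_upwards [f.coeFn_toLp 2 volume, p.coeFn_toLp 2 volume] with x h1 h2
  rw [h1, h2, RCLike.inner_apply]
  ring

/-- The square integrable function whose Fourier transform is the Schwartz function `F`. -/
def ofFourier {E : Type*} [NormedAddCommGroup E] [InnerProductSpace ℝ E]
    [FiniteDimensional ℝ E] [MeasurableSpace E] [BorelSpace E] (F : 𝓢(E, ℂ)) :
    Lp ℂ 2 (volume : Measure E) := (𝓕⁻ F : 𝓢(E, ℂ)).toLp 2 volume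

lemma ofFourier_eq {E : Type*} [NormedAddCommGroup E] [InnerProductSpace ℝ E]
    [FiniteDimensional ℝ E] [MeasurableSpace E] [BorelSpace E] (F : 𝓢(E, ℂ)) :
    ofFourier F = (Lp.fourierTransformₗᵢ E ℂ).symm (F.toLp 2 volume) :=
  (SchwartzMap.toLp_fourierInv_eq F).symm

lemma fourier_ofFourier {E : Type*} [NormedAddCommGroup E] [InnerProductSpace ℝ E]
    [FiniteDimensional ℝ E] [MeasurableSpace E] [BorelSpace E] (F : 𝓢(E, ℂ)) :
    (𝓕 (ofFourier F) : Lp ℂ 2 (volume : Measure E)) = F.toLp 2 volume := by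
  rw [ofFourier_eq]
  exact (Lp.fourierTransformₗᵢ E ℂ).apply_symm_apply _

lemma inner_ofFourier {E : Type*} [NormedAddCommGroup E] [InnerProductSpace ℝ E]
    [FiniteDimensional ℝ E] [MeasurableSpace E] [BorelSpace E] (F G : 𝓢(E, ℂ)) :
    ⟪ofFourier F, ofFourier G⟫_ℂ = ∫ x, conj (F x) * G x := by
  rw [ofFourier_eq, ofFourier_eq, LinearIsometryEquiv.inner_map_map, inner_toLp]

lemma fourier_fourierInv_schwartz {E : Type*} [NormedAddCommGroup E] [InnerProductSpace ℝ E]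
    [FiniteDimensional ℝ E] [MeasurableSpace E] [BorelSpace E] (f : 𝓢(E, ℂ)) :
    𝓕 ((𝓕⁻ f : 𝓢(E, ℂ)) : E → ℂ) = f := by
  rw [← SchwartzMap.fourier_coe, FourierTransform.fourier_fourierInv_eq]

/-- The matrix elements of `h_ε(x_j - x_{k+1})` between products of Schwartz functions, in Fourier
variables. -/
lemma inner_tensor_mollifiedDelta (hε : 0 < ε) (F p : 𝓢(Config k, ℂ)) (a b : 𝓢(Plane, ℂ)) :
    ⟪tensor (ofFourier F) (ofFourier b),
      mulOp (mollifiedDelta h j ε) volume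
        (tensor (ofFourier p) (ofFourier a))⟫_ℂ =
      ∫ ζ : Plane, profileHat h (ε • ζ) *
        (∫ ξ, conj (F (ξ + singleConfig j ζ)) * p ξ) * ∫ w, conj (b (w - ζ)) * a w := by
  rw [inner_tensor_mulOp h j hε]
  unfold ofFourier
  refine integral_congr_ae (.of_forall fun ζ => ?_)
  simp only
  rw [integral_inner_toLp, integral_inner_toLp]
  have hp := fourier_fourierInv_schwartz p
  have ha := fourier_fourierInv_schwartz a
  have e2 := integral_conj_add_mul_fourier (F.integrable (μ := volume))
    ((𝓕⁻ p : 𝓢(Config k, ℂ)).integrable (μ := volume)) (singleConfig j ζ)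
  have e3 := integral_conj_add_mul_fourier (b.integrable (μ := volume))
    ((𝓕⁻ a : 𝓢(Plane, ℂ)).integrable (μ := volume)) (-ζ)
  rw [hp, ← SchwartzMap.fourierInv_coe] at e2
  rw [ha, ← SchwartzMap.fourierInv_coe] at e3
  simp only [inner_singleConfig, inner_neg_left, AddChar.map_neg_eq_inv,
    Circle.coe_inv_eq_conj, ← sub_eq_add_neg] at e2 e3
  rw [e2, e3]

lemma ofFourier_tensor {Φ : 𝓢(Config (k + 1), ℂ)} {p : 𝓢(Config k, ℂ)}
    {a : 𝓢(Plane, ℂ)} (hΦ : ∀ ξ, Φ ξ = p (firstParticles ξ) * a (pos ξ (Fin.last k))) :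
    ofFourier Φ = tensor (ofFourier p) (ofFourier a) :=
  toLp_fourierInv_tensor hΦ

/-- The operator whose matrix elements, in Fourier variables, are the inner products of the images
under two bounded operators. -/
lemma exists_fourier_sandwich {E H : Type*} [NormedAddCommGroup E] [InnerProductSpace ℝ E]
    [FiniteDimensional ℝ E] [MeasurableSpace E] [BorelSpace E] [NormedAddCommGroup H]
    [InnerProductSpace ℂ H] [CompleteSpace H] (A B : Lp ℂ 2 (volume : Measure E) →L[ℂ] H) :
    ∃ W : Lp ℂ 2 (volume : Measure E) →L[ℂ] Lp ℂ 2 (volume : Measure E),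
      ∀ φ ψ : Lp ℂ 2 (volume : Measure E),
        ⟪(𝓕 ψ : Lp ℂ 2 (volume : Measure E)), W (𝓕 φ : Lp ℂ 2 (volume : Measure E))⟫_ℂ =
          ⟪A ψ, B φ⟫_ℂ := by
  refine ⟨(Lp.fourierTransformₗᵢ E ℂ).toContinuousLinearEquiv.toContinuousLinearMap ∘L
    ContinuousLinearMap.adjoint A ∘L B ∘L
      (Lp.fourierTransformₗᵢ E ℂ).symm.toContinuousLinearEquiv.toContinuousLinearMap,
    fun φ ψ => ?_⟩
  rw [← ContinuousLinearMap.adjoint_inner_right]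
  have h1 : (Lp.fourierTransformₗᵢ E ℂ).symm (𝓕 φ) = φ :=
    (Lp.fourierTransformₗᵢ E ℂ).symm_apply_apply φ
  simp only [ContinuousLinearMap.comp_apply, ContinuousLinearEquiv.coe_coe,
    LinearIsometryEquiv.coe_toContinuousLinearEquiv, h1]
  exact (Lp.fourierTransformₗᵢ E ℂ).inner_map_map _ _

/-- The matrix elements of `inner_slice_mollifiedDelta` between products. -/
lemma inner_slice_mollifiedDelta_tensor (hε : 0 < ε) (F G p r : 𝓢(Config k, ℂ)) (a b : 𝓢(Plane, ℂ))
    {Φ Ψ : Config (k + 1) → ℂ} (hΦ2 : MemLp Φ 2) (hΨ2 : MemLp Ψ 2)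
    (hΦ : ∀ ξ, Φ ξ = p (firstParticles ξ) * a (pos ξ (Fin.last k)))
    (hΨ : ∀ ξ, Ψ ξ = r (firstParticles ξ) * b (pos ξ (Fin.last k))) :
    ⟪slice (ofFourier G)
        (tensor (ofFourier r) (ofFourier b)),
      slice (ofFourier F) (mulOp (mollifiedDelta h j ε) volume
        (tensor (ofFourier p) (ofFourier a)))⟫_ℂ =
    ∫ z, collisionKernel h j ε F G z * (Φ z.1 * conj (Ψ z.2)) ∂(volume.prod volume) := by
  rw [slice_tensor, inner_smul_left,
    inner_slice_right, inner_tensor_mollifiedDelta h j hε,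
    integral_collisionKernel_mul h j hε F G p r a b hΦ2 hΨ2 hΦ hΨ,
    inner_conj_symm, inner_ofFourier]

/-- The partial inner product with the Schwartz functions `f`, `g` of the operator of
multiplication by `h_ε(x_j - x_{k+1})`, in Fourier variables. -/
theorem inner_slice_mollifiedDelta (hε : 0 < ε) (F G : 𝓢(Config k, ℂ)) (φ ψ : L2 (k + 1)) :
    ⟪slice (ofFourier G) ψ, slice (ofFourier F)
      (mulOp (mollifiedDelta h j ε) volume φ)⟫_ℂ =
    ∫ z, collisionKernel h j ε F G z * ((𝓕 φ : L2 (k + 1)) z.1 * conj ((𝓕 ψ : L2 (k + 1)) z.2))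
      ∂(volume.prod volume) := by
  obtain ⟨c, hc⟩ := exists_isBoundedKernel_collisionKernel h j hε F G
  obtain ⟨N, e, he⟩ := exists_isSmoothBasis (w := fun _ => 1) contDiff_const fun _ => one_pos
  have hw : ContDiff ℝ (⊤ : ℕ∞) fun _ : Plane => (1 : ℝ) := contDiff_const
  have hF := he.isTotalFamily_wordSchwartz hw (k + 1)
  obtain ⟨W, hW⟩ := exists_fourier_sandwich (slice (ofFourier G))
    (slice (ofFourier F) ∘L mulOp (mollifiedDelta h j ε) volume)
  refine (hW φ ψ).symm.trans (hc.inner_eq_integral hF (fun i i' => ?_) _ _)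
  have h1 : ∀ i, (hF.memLp i).toLp _ =
      (𝓕 (ofFourier (he.wordSchwartz hw i 0)) : L2 (k + 1)) := by
    intro i
    exact (fourier_ofFourier _).symm
  rw [h1, h1, hW, ofFourier_tensor (he.wordSchwartz_split hw i 0),
    ofFourier_tensor (he.wordSchwartz_split hw i' 0)]
  exact inner_slice_mollifiedDelta_tensor h j hε F G _ _ _ _ (hF.memLp i) (hF.memLp i')
    (he.wordSchwartz_split hw i 0) (he.wordSchwartz_split hw i' 0)

end TraceFormula

/-! ### Kernels of trace class operators in Fourier variables -/

section FourierKernel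

section General

variable {X : Type*} [MeasurableSpace X] {μ : Measure X}

lemma enorm_toLp_prod_mul [SFinite μ] {φ ψ : Lp ℂ 2 μ} (hm : MemLp (fun z : X × X => φ z.1 * conj (ψ z.2)) 2
    (μ.prod μ)) : ‖hm.toLp _‖ₑ = ‖φ‖ₑ * ‖ψ‖ₑ := by
  refine (ENNReal.pow_right_strictMono two_ne_zero).injective ?_
  rw [mul_pow, enorm_sq_eq_lintegral, enorm_sq_eq_lintegral, enorm_sq_eq_lintegral,
    ← lintegral_prod_mul ((Lp.aestronglyMeasurable φ).enorm.pow_const 2)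
      ((Lp.aestronglyMeasurable ψ).enorm.pow_const 2)]
  refine lintegral_congr_ae ?_
  filter_upwards [hm.coeFn_toLp] with z hz
  rw [hz, enorm_mul, RCLike.enorm_conj, mul_pow]

/-- The kernel `∑ₙ φₙ(x) conj ψₙ(y)` is square integrable if `∑ₙ ‖φₙ‖ ‖ψₙ‖` is finite. -/
lemma exists_memLp_hasSum [SFinite μ] {φ ψ : ℕ → Lp ℂ 2 μ} (hs : Summable fun n => ‖φ n‖ * ‖ψ n‖) :
    ∃ κ : X × X → ℂ, MemLp κ 2 (μ.prod μ) ∧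
      ∀ᵐ z ∂μ.prod μ, HasSum (fun n => φ n z.1 * conj (ψ n z.2)) (κ z) := by
  have hm : ∀ n, MemLp (fun z : X × X => φ n z.1 * conj (ψ n z.2)) 2 (μ.prod μ) := fun n =>
    memLp_prod_mul (Lp.memLp _) (memLp_conj (Lp.memLp _))
  have hsum : ∑' n, ‖(hm n).toLp _‖ₑ ≠ ⊤ := by
    simp only [enorm_toLp_prod_mul]
    have h1 : ∀ n, ‖φ n‖ₑ * ‖ψ n‖ₑ = ENNReal.ofReal (‖φ n‖ * ‖ψ n‖) := fun n => by
      rw [ENNReal.ofReal_mul (norm_nonneg _), ofReal_norm, ofReal_norm]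
    simp only [h1]
    exact hs.tsum_ofReal_ne_top
  refine ⟨_, Lp.memLp (∑' n, (hm n).toLp _), ?_⟩
  filter_upwards [Lp.hasSum_coeFn_tsum hsum, ae_all_iff.2 fun n => (hm n).coeFn_toLp] with z h1 h2
  simpa only [h2] using h1

lemma IsBoundedKernel.hasSum_integral {E : X × X → ℂ} {c : NNReal} (h : IsBoundedKernel μ E c)
    {φ ψ : ℕ → Lp ℂ 2 μ} (hs : Summable fun n => ‖φ n‖ * ‖ψ n‖) {κ : X × X → ℂ}
    (hm : AEStronglyMeasurable κ (μ.prod μ))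
    (hκ : ∀ᵐ z ∂μ.prod μ, HasSum (fun n => φ n z.1 * conj (ψ n z.2)) (κ z)) :
    Integrable (fun z => E z * κ z) (μ.prod μ) ∧
      HasSum (fun n => ∫ z, E z * (φ n z.1 * conj (ψ n z.2)) ∂(μ.prod μ))
        (∫ z, E z * κ z ∂(μ.prod μ)) := by
  have h1 : ∀ n, ‖φ n‖ₑ * ‖ψ n‖ₑ = ENNReal.ofReal (‖φ n‖ * ‖ψ n‖) := fun n => by
    rw [ENNReal.ofReal_mul (norm_nonneg _), ofReal_norm, ofReal_norm]
  have h2 : ∑' n, ∫⁻ z, ‖E z * (φ n z.1 * conj (ψ n z.2))‖ₑ ∂(μ.prod μ) ≠ ⊤ := by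
    refine ne_top_of_le_ne_top ?_ (ENNReal.tsum_le_tsum fun n =>
      (IsBoundedKernel.lintegral_enorm_eq E (φ n) (ψ n)).le.trans (h.bound (φ n) (ψ n)))
    rw [ENNReal.tsum_mul_left]
    simp only [h1]
    exact ENNReal.mul_ne_top ENNReal.coe_ne_top hs.tsum_ofReal_ne_top
  have h3 : ∀ᵐ z ∂μ.prod μ, HasSum (fun n => E z * (φ n z.1 * conj (ψ n z.2))) (E z * κ z) := by
    filter_upwards [hκ] with z hz using hz.mul_left _
  constructor
  · refine ⟨h.measurable.aestronglyMeasurable.mul hm, ?_⟩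
    refine lt_of_le_of_lt (lintegral_mono_ae ?_) (lt_of_eq_of_lt
      (lintegral_tsum fun n => (h.integrable (φ n) (ψ n)).1.enorm) h2.lt_top)
    filter_upwards [h3] with z hz
    rw [← hz.tsum_eq]
    exact enorm_tsum_le_tsum_enorm
  · have h4 := hasSum_integral_of_summable_integral_norm (fun n => h.integrable (φ n) (ψ n)) ?_
    · rw [integral_congr_ae (g := fun z => ∑' n, E z * (φ n z.1 * conj (ψ n z.2)))]
      · exact h4
      · filter_upwards [h3] with z hz using hz.tsum_eq.symm
    · simp only [integral_norm_eq_lintegral_enorm (h.integrable _ _).1]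
      exact ENNReal.summable_toReal h2

end General

lemma inner_ofFourier_left {E : Type*} [NormedAddCommGroup E] [InnerProductSpace ℝ E]
    [FiniteDimensional ℝ E] [MeasurableSpace E] [BorelSpace E] (F : 𝓢(E, ℂ))
    (φ : Lp ℂ 2 (volume : Measure E)) :
    ⟪ofFourier F, φ⟫_ℂ = ∫ x, conj (F x) * (𝓕 φ : Lp ℂ 2 (volume : Measure E)) x := by
  rw [← Lp.inner_fourier_eq, fourier_ofFourier, L2.inner_def]
  refine integral_congr_ae ?_
  filter_upwards [F.coeFn_toLp 2 volume] with x hx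
  rw [hx, RCLike.inner_apply, mul_comm]

lemma isBoundedKernel_rankOne {k : ℕ} (F G : 𝓢(Config k, ℂ)) :
    ∃ c, IsBoundedKernel volume (fun z : Config k × Config k => conj (F z.1) * G z.2) c := by
  have hF := F.continuous
  have hG := G.continuous
  have := Complex.continuous_conj
  refine ⟨‖F.toLp 2 volume‖₊ * ‖G.toLp 2 volume‖₊, by fun_prop, fun φ ψ => ?_⟩
  have h1 : ∀ (F : 𝓢(Config k, ℂ)) (φ : L2 k), ∫⁻ x, ‖F x‖ₑ * ‖φ x‖ₑ ≤ ‖F.toLp 2 volume‖ₑ * ‖φ‖ₑ := by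
    intro F φ
    have h2 := ENNReal.lintegral_mul_le_Lp_mul_Lq (volume : Measure (Config k)) (p := 2) (q := 2)
      (Real.HolderConjugate.two_two) (Lp.aestronglyMeasurable (F.toLp 2 volume)).enorm
      (Lp.aestronglyMeasurable φ).enorm
    have h3 : ∀ φ : L2 k, (∫⁻ x, ‖φ x‖ₑ ^ (2 : ℝ)) ^ (1 / 2 : ℝ) = ‖φ‖ₑ := by
      intro φ
      simp only [ENNReal.rpow_ofNat]
      rw [← enorm_sq_eq_lintegral, ← ENNReal.rpow_natCast, ← ENNReal.rpow_mul]
      norm_num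
    rw [h3, h3] at h2
    refine le_trans (le_of_eq (lintegral_congr_ae ?_)) h2
    filter_upwards [F.coeFn_toLp 2 volume] with x hx
    rw [Pi.mul_apply, hx]
  calc ∫⁻ z, ‖conj (F z.1) * G z.2‖ₑ * (‖φ z.1‖ₑ * ‖ψ z.2‖ₑ) ∂(volume.prod volume)
      = ∫⁻ z, (‖F z.1‖ₑ * ‖φ z.1‖ₑ) * (‖G z.2‖ₑ * ‖ψ z.2‖ₑ) ∂(volume.prod volume) := by
        refine lintegral_congr fun z => ?_
        rw [enorm_mul, RCLike.enorm_conj]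
        ring
    _ = (∫⁻ x, ‖F x‖ₑ * ‖φ x‖ₑ) * ∫⁻ x, ‖G x‖ₑ * ‖ψ x‖ₑ :=
        lintegral_prod_mul (hF.measurable.enorm.aemeasurable.mul (Lp.aestronglyMeasurable φ).enorm)
          (hG.measurable.enorm.aemeasurable.mul (Lp.aestronglyMeasurable ψ).enorm)
    _ ≤ (‖F.toLp 2 volume‖ₑ * ‖φ‖ₑ) * (‖G.toLp 2 volume‖ₑ * ‖ψ‖ₑ) := mul_le_mul' (h1 F φ) (h1 G ψ)
    _ = _ := by
        push_cast
        simp only [enorm_eq_nnnorm]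
        ring

lemma inner_mulOp_mollifiedDelta {k : ℕ} (h : 𝓢(Plane, ℝ)) (j : Fin k) (ε : ℝ) (φ ψ : L2 (k + 1)) :
    ⟪mulOp (mollifiedDelta h j ε) volume φ, ψ⟫_ℂ = ⟪φ, mulOp (mollifiedDelta h j ε) volume ψ⟫_ℂ := by
  rw [L2.inner_def, L2.inner_def]
  refine integral_congr_ae ?_
  filter_upwards [coeFn_mulOp (mollifiedDelta h j ε) volume φ,
    coeFn_mulOp (mollifiedDelta h j ε) volume ψ] with x h1 h2
  have h8 : mollifiedDelta h j ε x =
    (((ε⁻¹) ^ 2 * h (ε⁻¹ • (pos (firstParticles x) j - pos x (Fin.last k))) : ℝ) : ℂ) := rfl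
  rw [h1, h2, RCLike.inner_apply, RCLike.inner_apply, map_mul, h8, Complex.conj_ofReal]
  ring

/-- `κ` is the integral kernel, in Fourier variables, of the operator `A`, and partial traces of
commutators of `A` can be computed from `κ`. -/
structure IsFourierKernel {k : ℕ} (A : Op (k + 1)) (κ : Config (k + 1) × Config (k + 1) → ℂ) :
    Prop where
  memLp : MemLp κ 2 (volume.prod volume)
  inner_eq : ∀ F G : 𝓢(Config (k + 1), ℂ), ⟪ofFourier F, A (ofFourier G)⟫_ℂ =
    ∫ z, (conj (F z.1) * G z.2) * κ z ∂(volume.prod volume)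
  integrable : ∀ (h : 𝓢(Plane, ℝ)) (j : Fin k) (ε : ℝ) (F G : 𝓢(Config k, ℂ)), 0 < ε →
    Integrable (fun z => collisionKernel h j ε F G z * κ z) (volume.prod volume) ∧
    Integrable (fun z => collisionKernel h j ε G F z * conj (κ z.swap)) (volume.prod volume)
  partialTrace_eq : ∀ (h : 𝓢(Plane, ℝ)) (j : Fin k) (ε : ℝ) (F G : 𝓢(Config k, ℂ)), 0 < ε →
    partialTraceForm (ofFourier F) (mollifiedCommutator h j ε A) (ofFourier G) =
      (∫ z, collisionKernel h j ε F G z * κ z ∂(volume.prod volume)) -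
        conj (∫ z, collisionKernel h j ε G F z * conj (κ z.swap) ∂(volume.prod volume))

lemma hasSum_mollifiedCommutator {k : ℕ} (h : 𝓢(Plane, ℝ)) (j : Fin k) (ε : ℝ) {A : Op (k + 1)}
    {φ ψ : ℕ → L2 (k + 1)} (hs : Summable fun n => ‖φ n‖ * ‖ψ n‖)
    (hA : ∀ u, HasSum (fun n => ⟪ψ n, u⟫_ℂ • φ n) (A u)) (f g : L2 k) :
    partialTraceForm f (mollifiedCommutator h j ε A) g =
      (∑' n, ⟪slice g (ψ n), slice f (mulOp (mollifiedDelta h j ε) volume (φ n))⟫_ℂ) -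
        ∑' n, ⟪slice g (mulOp (mollifiedDelta h j ε) volume (ψ n)), slice f (φ n)⟫_ℂ := by
  set M := mulOp (mollifiedDelta h j ε) (volume : Measure (Config (k + 1))) with hM
  have h1 := hasSum_partialTrace f g (A := M ∘L A) (φ := fun n => M (φ n)) (ψ := ψ)
    (Summable.of_nonneg_of_le (fun n => by positivity)
      (fun n => by
        have := M.le_opNorm (φ n)
        calc ‖M (φ n)‖ * ‖ψ n‖ ≤ (‖M‖ * ‖φ n‖) * ‖ψ n‖ := by gcongr
          _ = ‖M‖ * (‖φ n‖ * ‖ψ n‖) := by ring) (hs.mul_left ‖M‖))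
    (fun u => by simpa using! (hA u).mapL M)
  have h2 := hasSum_partialTrace f g (A := A ∘L M) (φ := φ) (ψ := fun n => M (ψ n))
    (Summable.of_nonneg_of_le (fun n => by positivity)
      (fun n => by
        have := M.le_opNorm (ψ n)
        calc ‖φ n‖ * ‖M (ψ n)‖ ≤ ‖φ n‖ * (‖M‖ * ‖ψ n‖) := by gcongr
          _ = ‖M‖ * (‖φ n‖ * ‖ψ n‖) := by ring) (hs.mul_left ‖M‖))
    (fun u => by
      simp only [hM, inner_mulOp_mollifiedDelta]
      exact hA _)
  rw [partialTraceForm, ← (h1.sub h2).tsum_eq]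
  refine tsum_congr fun i => ?_
  rw [← inner_sub_right]
  rfl

/-- Both terms of the commutator are sums over `n` of the contributions of rank one operators, to which
`IsBoundedKernel.hasSum_integral` applies. -/
theorem exists_isFourierKernel {k : ℕ} {A : Op (k + 1)} (hA : IsTraceClass A) :
    ∃ κ, IsFourierKernel A κ := by
  obtain ⟨φ, ψ, hs, hA⟩ := hA
  let Φ : ℕ → L2 (k + 1) := fun n => 𝓕 (φ n)
  let Ψ : ℕ → L2 (k + 1) := fun n => 𝓕 (ψ n)
  have hs1 : Summable fun n => ‖Φ n‖ * ‖Ψ n‖ := by simpa only [Φ, Ψ, Lp.norm_fourier_eq] using hs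
  have hs2 : Summable fun n => ‖Ψ n‖ * ‖Φ n‖ := by simpa only [mul_comm] using hs1
  obtain ⟨κ, hκ, hsum⟩ := exists_memLp_hasSum hs1
  have hκ' : AEStronglyMeasurable (fun z : Config (k + 1) × Config (k + 1) => conj (κ z.swap))
      (volume.prod volume) :=
    Complex.continuous_conj.comp_aestronglyMeasurable hκ.1.prod_swap
  -- The kernel of the adjoint, for the second term of the commutator.
  have hsum' : ∀ᵐ z ∂(volume.prod volume : Measure (Config (k + 1) × Config (k + 1))),
      HasSum (fun n => Ψ n z.1 * conj (Φ n z.2)) (conj (κ z.swap)) := by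
    have h1 := (Measure.measurePreserving_swap (μ := (volume : Measure (Config (k + 1))))
      (ν := (volume : Measure (Config (k + 1))))).quasiMeasurePreserving.ae hsum
    filter_upwards [h1] with z hz
    have h2 : (fun n => Ψ n z.1 * conj (Φ n z.2)) =
        starRingEnd ℂ ∘ fun n => Φ n z.swap.1 * conj (Ψ n z.swap.2) := by
      funext n
      simp only [Function.comp_apply, map_mul, Complex.conj_conj, Prod.fst_swap, Prod.snd_swap]
      ring
    rw [h2]
    exact hz.map (starRingEnd ℂ) Complex.continuous_conj
  refine ⟨κ, hκ, fun F G => ?_, fun h j ε F G hε => ?_, fun h j ε F G hε => ?_⟩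
  · obtain ⟨c, hc⟩ := isBoundedKernel_rankOne F G
    have h1 := (hc.hasSum_integral hs1 hκ.1 hsum).2
    rw [← h1.tsum_eq, ← innerSL_apply_apply ℂ,
      ← ((hA (ofFourier G)).mapL (innerSL ℂ (ofFourier F))).tsum_eq]
    refine tsum_congr fun n => ?_
    rw [innerSL_apply_apply, inner_smul_right, inner_ofFourier_left, ← inner_conj_symm,
      inner_ofFourier_left, ← integral_conj, mul_comm, ← integral_prod_mul]
    refine integral_congr_ae (.of_forall fun z => ?_)
    simp only [map_mul, Complex.conj_conj, Φ, Ψ]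
    ring
  · obtain ⟨c, hc⟩ := exists_isBoundedKernel_collisionKernel h j hε F G
    obtain ⟨c', hc'⟩ := exists_isBoundedKernel_collisionKernel h j hε G F
    exact ⟨(hc.hasSum_integral hs1 hκ.1 hsum).1, (hc'.hasSum_integral hs2 hκ' hsum').1⟩
  · obtain ⟨c, hc⟩ := exists_isBoundedKernel_collisionKernel h j hε F G
    obtain ⟨c', hc'⟩ := exists_isBoundedKernel_collisionKernel h j hε G F
    rw [hasSum_mollifiedCommutator h j ε hs hA, ← (hc.hasSum_integral hs1 hκ.1 hsum).2.tsum_eq,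
      ← (hc'.hasSum_integral hs2 hκ' hsum').2.tsum_eq, ← Complex.conjCLE_apply,
      ContinuousLinearEquiv.map_tsum]
    congr 1
    · refine tsum_congr fun n => ?_
      exact inner_slice_mollifiedDelta h j hε F G _ _
    · refine tsum_congr fun n => ?_
      rw [Complex.conjCLE_apply, ← inner_conj_symm]
      congr 1
      exact inner_slice_mollifiedDelta h j hε G F _ _

end FourierKernel

/-! ### Coordinates for the collision of two particles -/

section CollisionCoordinates

lemma _root_.MeasureTheory.MeasurePreserving.integral_comp_continuous {X Y : Type*}
    [TopologicalSpace X] [MeasurableSpace X] [TopologicalSpace Y] [MeasurableSpace Y]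
    [OpensMeasurableSpace Y] [SecondCountableTopology Y] {μ : Measure X} {ν : Measure Y} {θ : X → Y}
    (hθ : MeasurePreserving θ μ ν) {f : Y → ℂ} (hf : Continuous f) :
    ∫ x, f (θ x) ∂μ = ∫ y, f y ∂ν := by
  rw [← hθ.map_eq, integral_map hθ.measurable.aemeasurable hf.aestronglyMeasurable]

/-- The momenta `((u, η), (v, w))` of a pair of colliding particles, where `w` is determined by
the conservation law `ξ + w = u + v`. -/
def collisionMomenta (z : (Plane × Plane × Plane) × Plane) : (Plane × Plane) × (Plane × Plane) :=
  ((z.1.2.1, z.2), (z.1.2.2, z.1.2.1 + z.1.2.2 - z.1.1))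

lemma measurePreserving_collisionMomenta : MeasurePreserving collisionMomenta := by
  have m1 := (Measure.measurePreserving_swap (μ := (volume : Measure Plane))
    (ν := (volume : Measure (Plane × Plane)))).prod (MeasurePreserving.id (volume : Measure Plane))
  have m2' : MeasurePreserving (fun z : (Plane × Plane) × Plane => (z.1, z.1.1 + z.1.2 - z.2))
      ((volume : Measure (Plane × Plane)).prod volume) (volume.prod volume) := by
    refine (MeasurePreserving.id _).skew_product
      (g := fun (p : Plane × Plane) (ξ : Plane) => p.1 + p.2 - ξ) (by fun_prop)
      (.of_forall fun p => ?_)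
    exact (Measure.measurePreserving_sub_left (volume : Measure Plane) (p.1 + p.2)).map_eq
  have m2 := m2'.prod (MeasurePreserving.id (volume : Measure Plane))
  have m3 := measurePreserving_prodAssoc (volume : Measure (Plane × Plane))
    (volume : Measure Plane) (volume : Measure Plane)
  have m4 := measurePreserving_prodAssoc (volume : Measure Plane)
    (volume : Measure Plane) (volume : Measure (Plane × Plane))
  have m5 := (MeasurePreserving.id (volume : Measure Plane)).prod
    ((Measure.measurePreserving_swap (μ := (volume : Measure (Plane × Plane)))
      (ν := (volume : Measure Plane))).comp ((measurePreserving_prodAssoc (volume : Measure Plane)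
    (volume : Measure Plane) (volume : Measure Plane)).symm))
  have m6 := (measurePreserving_prodAssoc (volume : Measure Plane)
    (volume : Measure Plane) (volume : Measure (Plane × Plane))).symm
  exact m6.comp (m5.comp (m4.comp (m3.comp (m2.comp m1))))

/-- The coordinates of the particles `j` and `k + 1`, and of the remaining ones. -/
def collisionCoords {Y : Type*} {k : ℕ} (j : Fin (k + 1)) (q : Fin (k + 2) → Y) :
    (Y × Y) × (Fin k → Y) :=
  ((q j.castSucc, q (Fin.last (k + 1))), fun m => q (j.succAbove m).castSucc)

lemma measurePreserving_collisionCoords {Y : Type*} [MeasureSpace Y]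
    [SigmaFinite (volume : Measure Y)] {k : ℕ} (j : Fin (k + 1)) :
    MeasurePreserving (collisionCoords (Y := Y) j) := by
  have c1 := volume_preserving_piFinSuccAbove (fun _ : Fin (k + 2) => Y) (Fin.last (k + 1))
  have c2 := (MeasurePreserving.id (volume : Measure Y)).prod
    (volume_preserving_piFinSuccAbove (fun _ : Fin (k + 1) => Y) j)
  have c3 := (measurePreserving_prodAssoc (volume : Measure Y)
    (volume : Measure Y) (volume : Measure (Fin k → Y))).symm
  have c4 := (Measure.measurePreserving_swap (μ := (volume : Measure Y))
    (ν := (volume : Measure Y))).prod (MeasurePreserving.id (volume : Measure (Fin k → Y)))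
  have h := c4.comp (c3.comp (c2.comp c1))
  have he : collisionCoords (Y := Y) j = Prod.map Prod.swap id ∘
      (MeasurableEquiv.prodAssoc.symm : Y × Y × (Fin k → Y) ≃ᵐ (Y × Y) × (Fin k → Y)) ∘
      Prod.map id (MeasurableEquiv.piFinSuccAbove (fun _ : Fin (k + 1) => Y) j) ∘
      MeasurableEquiv.piFinSuccAbove (fun _ : Fin (k + 2) => Y) (Fin.last (k + 1)) := by
    funext q
    refine Prod.ext (Prod.ext ?_ rfl) (funext fun m => ?_)
    · change q j.castSucc = q ((Fin.last (k + 1)).succAbove j)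
      rw [Fin.succAbove_last]
    · change q (j.succAbove m).castSucc = q ((Fin.last (k + 1)).succAbove (j.succAbove m))
      rw [Fin.succAbove_last]
  rw [he]
  exact h

lemma continuous_collisionCoords {Y : Type*} [TopologicalSpace Y] {k : ℕ} (j : Fin (k + 1)) :
    Continuous (collisionCoords (Y := Y) j) := by
  unfold collisionCoords
  fun_prop

end CollisionCoordinates

section CollisionSymbol

variable {ι : Type*} {e : ι → Plane → ℂ} {w : Plane → ℝ}

/-- The outgoing momentum `ξ = u + v - w` of a collision. -/
def outMomentum (y : (Plane × Plane) × (Plane × Plane)) : Plane := y.1.1 + y.2.1 - y.2.2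

/-- The kernel of the regularized collision of two particles in weighted momentum space, without
its oscillating factor. -/
def collisionAmplitude (α : ℝ) (e : ι → Plane → ℂ) (h : 𝓢(Plane, ℝ)) (ε : ℝ) (c : ι × ι)
    (y : (Plane × Plane) × (Plane × Plane)) : ℂ :=
  profileHat h (ε • (y.2.1 - y.2.2)) * (conj (e c.1 (outMomentum y)) * e c.2 y.1.2 *
    (collisionWeight α (outMomentum y) y.1.1 y.2.1 : ℂ))

/-- The frequency of the oscillating factor of a collision. -/
def collisionFrequency (y : (Plane × Plane) × (Plane × Plane)) : ℝ :=
  resonance (outMomentum y) y.1.1 y.2.1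

lemma collisionAmplitude_momenta (α : ℝ) (h : 𝓢(Plane, ℝ)) (ε : ℝ) (c : ι × ι)
    (z : (Plane × Plane × Plane) × Plane) : collisionAmplitude α e h ε c (collisionMomenta z) =
      profileHat h (ε • (z.1.1 - z.1.2.1)) * (conj (e c.1 z.1.1) * e c.2 z.2 *
        (collisionWeight α z.1.1 z.1.2.1 z.1.2.2 : ℂ)) := by
  have h1 : outMomentum (collisionMomenta z) = z.1.1 := by
    simp only [outMomentum, collisionMomenta]
    abel
  have h2 : z.1.2.2 - (z.1.2.1 + z.1.2.2 - z.1.1) = z.1.1 - z.1.2.1 := by abel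
  rw [collisionAmplitude, h1]
  simp only [collisionMomenta, h2]

lemma collisionFrequency_momenta (z : (Plane × Plane × Plane) × Plane) :
    collisionFrequency (collisionMomenta z) = resonance z.1.1 z.1.2.1 z.1.2.2 := by
  have h1 : outMomentum (collisionMomenta z) = z.1.1 := by
    simp only [outMomentum, collisionMomenta]
    abel
  rw [collisionFrequency, h1]
  rfl

lemma continuous_collisionFrequency : Continuous collisionFrequency := by
  have h1 : Continuous fun y : (Plane × Plane) × (Plane × Plane) =>
      (outMomentum y, y.1.1, y.2.1) := by
    unfold outMomentum
    fun_prop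
  unfold collisionFrequency
  simpa only [Function.comp_def] using continuous_resonance.comp h1

namespace IsSmoothBasis

lemma continuous_collisionAmplitude (he : IsSmoothBasis e w) (α : ℝ) (h : 𝓢(Plane, ℝ)) (ε : ℝ)
    (c : ι × ι) : Continuous (collisionAmplitude α e h ε c) := by
  have h0 : Continuous outMomentum := by
    unfold outMomentum
    fun_prop
  have h1 : Continuous fun y : (Plane × Plane) × (Plane × Plane) =>
      (outMomentum y, y.1.1, y.2.1) := by
    fun_prop
  have h2 : Continuous fun y => collisionWeight α (outMomentum y) y.1.1 y.2.1 := by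
    simpa only [Function.comp_def] using (continuous_collisionWeight α).comp h1
  have h3 : Continuous fun y => conj (e c.1 (outMomentum y)) :=
    Complex.continuous_conj.comp ((he.continuous c.1).comp h0)
  have h4 : Continuous fun y : (Plane × Plane) × (Plane × Plane) => e c.2 y.1.2 :=
    (he.continuous c.2).comp (by fun_prop)
  have h5 : Continuous fun y : (Plane × Plane) × (Plane × Plane) =>
      profileHat h (ε • (y.2.1 - y.2.2)) := (profileHat h).continuous.comp (by fun_prop)
  exact h5.mul ((h3.mul h4).mul (Complex.continuous_ofReal.comp h2))

end IsSmoothBasis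

end CollisionSymbol

/-! ### The regularized collision as a square integrable kernel -/

section CollisionSymbol

variable {ι : Type*} {e : ι → Plane → ℂ} {w : Plane → ℝ}

/-- `‖ĥ‖_∞²` for the profile `h` of the approximate identity. -/
def profileSup (h : 𝓢(Plane, ℝ)) : NNReal := ‖(profileHat h).toBoundedContinuousFunction‖₊ ^ 2

lemma enorm_profileHat_sq_le (h : 𝓢(Plane, ℝ)) (ζ : Plane) :
    ‖profileHat h ζ‖ₑ ^ 2 ≤ profileSup h := by
  have h1 : ‖profileHat h ζ‖₊ ≤ ‖(profileHat h).toBoundedContinuousFunction‖₊ :=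
    (profileHat h).toBoundedContinuousFunction.norm_coe_le_norm ζ
  rw [profileSup, enorm_eq_nnnorm]
  exact_mod_cast pow_le_pow_left' h1 2

lemma lintegral_sobolevSymbol_neg_four_lt_top {α : ℝ} (hα : 1 / 2 < α) :
    ∫⁻ v : Plane, ENNReal.ofReal (((sobolevSymbol α v) ^ 4)⁻¹) < ⊤ := by
  have h1 : Integrable (fun x : Plane => (1 + ‖x‖ ^ 2) ^ (-(4 * α) / 2)) :=
    integrable_rpow_neg_one_add_norm_sq (by simp; linarith)
  refine lt_of_le_of_lt (lintegral_mono fun t => ENNReal.ofReal_le_ofReal ?_) h1.lintegral_lt_top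
  have h2 : 1 + ‖t‖ ^ 2 ≤ japanese t := by
    unfold japanese
    have : (1 : ℝ) ≤ 4 * Real.pi ^ 2 := by nlinarith [Real.pi_gt_three]
    nlinarith [sq_nonneg ‖t‖]
  have h3 : (sobolevSymbol α t) ^ 4 = japanese t ^ (2 * α) := by
    rw [sobolevSymbol, ← Real.rpow_natCast, ← Real.rpow_mul (japanese_pos t).le]
    congr 1
    push_cast
    ring
  rw [h3, ← Real.rpow_neg (japanese_pos t).le, show -(4 * α) / 2 = -(2 * α) by ring]
  exact Real.rpow_le_rpow_of_nonpos (by positivity) h2 (by linarith)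

lemma collisionWeight_sq_le_pow_four {α : ℝ} (hα : 0 ≤ α) (ξ u v : Plane) : collisionWeight α ξ u v ^ 2 ≤
    sobolevSymbol α ξ ^ 2 * ((sobolevSymbol α v ^ 4)⁻¹ + (sobolevSymbol α (u + v - ξ) ^ 4)⁻¹) := by
  have hu := one_le_sobolevSymbol hα u
  have hv := sobolevSymbol_pos α v
  have hw := sobolevSymbol_pos α (u + v - ξ)
  set a := sobolevSymbol α u
  set b := sobolevSymbol α v
  set c := sobolevSymbol α (u + v - ξ)
  have h1 : collisionWeight α ξ u v = sobolevSymbol α ξ / (a * b * c) := rfl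
  rw [h1, div_pow, div_eq_mul_inv]
  refine mul_le_mul_of_nonneg_left ?_ (sq_nonneg _)
  have h2 : ((a * b * c) ^ 2)⁻¹ ≤ (b ^ 2)⁻¹ * (c ^ 2)⁻¹ := by
    rw [← mul_inv]
    refine inv_anti₀ (by positivity) ?_
    have : 1 ≤ a ^ 2 := one_le_pow₀ hu
    calc b ^ 2 * c ^ 2 = 1 * (b ^ 2 * c ^ 2) := (one_mul _).symm
      _ ≤ a ^ 2 * (b ^ 2 * c ^ 2) := by gcongr
      _ = (a * b * c) ^ 2 := by ring
  have h3 : ∀ x : ℝ, (x ^ 4)⁻¹ = ((x ^ 2)⁻¹) ^ 2 := fun x => by rw [inv_pow (x ^ 2) 2, ← pow_mul]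
  rw [h3, h3]
  refine h2.trans ?_
  nlinarith [sq_nonneg ((b ^ 2)⁻¹ - (c ^ 2)⁻¹), sq_nonneg ((b ^ 2)⁻¹), sq_nonneg ((c ^ 2)⁻¹)]

namespace IsSmoothBasis

lemma lintegral_enorm_sq (he : IsSmoothBasis e w) (i : ι) : ∫⁻ x, ‖e i x‖ₑ ^ 2 = 1 := by
  simpa using he.lintegral_enorm_sq_sum {i} fun _ => 1

/-- The square of the amplitude of the collision, in the coordinates `collisionMomenta`. -/
lemma lintegral_collisionAmplitude (he : IsSmoothBasis e w) (α : ℝ) (h : 𝓢(Plane, ℝ)) (ε : ℝ)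
    (c : ι × ι) {m : ℝ → ℝ≥0∞} (hm : Continuous m) :
    ∫⁻ y, ‖collisionAmplitude α e h ε c y‖ₑ ^ 2 * m (collisionFrequency y) =
      ∫⁻ ξ, ‖e c.1 ξ‖ₑ ^ 2 * ∫⁻ q : Plane × Plane, ‖profileHat h (ε • (ξ - q.1))‖ₑ ^ 2 *
        (‖(collisionWeight α ξ q.1 q.2 : ℂ)‖ₑ ^ 2 * m (resonance ξ q.1 q.2)) := by
  have hA := he.continuous_collisionAmplitude α h ε c
  have hF : Measurable fun y => ‖collisionAmplitude α e h ε c y‖ₑ ^ 2 * m (collisionFrequency y) :=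
    (hA.measurable.enorm.pow_const 2).mul
      (hm.measurable.comp continuous_collisionFrequency.measurable)
  have hW : Continuous fun z : Plane × Plane × Plane => (collisionWeight α z.1 z.2.1 z.2.2 : ℂ) :=
    Complex.continuous_ofReal.comp (continuous_collisionWeight α)
  have hP : Continuous fun z : Plane × Plane × Plane => profileHat h (ε • (z.1 - z.2.1)) :=
    (profileHat h).continuous.comp (by fun_prop)
  have hG : Measurable fun z : Plane × Plane × Plane => ‖e c.1 z.1‖ₑ ^ 2 *
      (‖profileHat h (ε • (z.1 - z.2.1))‖ₑ ^ 2 *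
        (‖(collisionWeight α z.1 z.2.1 z.2.2 : ℂ)‖ₑ ^ 2 * m (resonance z.1 z.2.1 z.2.2))) :=
    ((((he.continuous c.1).comp continuous_fst).measurable.enorm.pow_const 2)).mul
      ((hP.measurable.enorm.pow_const 2).mul ((hW.measurable.enorm.pow_const 2).mul
        (hm.measurable.comp continuous_resonance.measurable)))
  rw [← measurePreserving_collisionMomenta.lintegral_comp hF]
  have h1 : ∀ z : (Plane × Plane × Plane) × Plane,
      ‖collisionAmplitude α e h ε c (collisionMomenta z)‖ₑ ^ 2 *
        m (collisionFrequency (collisionMomenta z)) =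
      (‖e c.1 z.1.1‖ₑ ^ 2 * (‖profileHat h (ε • (z.1.1 - z.1.2.1))‖ₑ ^ 2 *
        (‖(collisionWeight α z.1.1 z.1.2.1 z.1.2.2 : ℂ)‖ₑ ^ 2 *
          m (resonance z.1.1 z.1.2.1 z.1.2.2)))) * ‖e c.2 z.2‖ₑ ^ 2 := by
    intro z
    rw [collisionAmplitude_momenta, collisionFrequency_momenta]
    simp only [enorm_mul, RCLike.enorm_conj, mul_pow]
    ring
  simp only [h1]
  rw [Measure.volume_eq_prod, lintegral_prod_mul hG.aemeasurable
    ((he.continuous c.2).measurable.enorm.pow_const 2).aemeasurable, he.lintegral_enorm_sq, mul_one,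
    Measure.volume_eq_prod Plane (Plane × Plane), lintegral_prod _ hG.aemeasurable]
  refine lintegral_congr fun ξ => ?_
  simp only
  rw [lintegral_const_mul' (‖e c.1 ξ‖ₑ ^ 2) _ (by simp)]

/-- The estimate of the resonance set, for the regularized collision. -/
lemma lintegral_collisionAmplitude_le (he : IsSmoothBasis e w) {α : ℝ} {C : NNReal}
    (hC : ResonanceBound α C) (h : 𝓢(Plane, ℝ)) (ε : ℝ) (c : ι × ι) (τ : ℝ) :
    ∫⁻ y, ‖collisionAmplitude α e h ε c y‖ₑ ^ 2 *
      ENNReal.ofReal (Real.exp (-(collisionFrequency y - τ) ^ 2 / 4)) ≤ profileSup h * C := by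
  rw [he.lintegral_collisionAmplitude α h ε c
    (m := fun t => ENNReal.ofReal (Real.exp (-(t - τ) ^ 2 / 4)))
    (ENNReal.continuous_ofReal.comp (by fun_prop))]
  calc _ ≤ ∫⁻ ξ, ‖e c.1 ξ‖ₑ ^ 2 * (profileSup h * C) := by
        refine lintegral_mono fun ξ => ?_
        gcongr
        calc _ ≤ ∫⁻ q : Plane × Plane, profileSup h * (‖(collisionWeight α ξ q.1 q.2 : ℂ)‖ₑ ^ 2 *
              ENNReal.ofReal (Real.exp (-(resonance ξ q.1 q.2 - τ) ^ 2 / 4))) := by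
              refine lintegral_mono fun q => ?_
              gcongr
              exact enorm_profileHat_sq_le h _
          _ ≤ _ := by
              rw [lintegral_const_mul' _ _ (by simp)]
              gcongr
              exact lintegral_enorm_collisionWeight_le ξ τ (hC ξ τ)
    _ = _ := by rw [lintegral_mul_const' _ _ (by finiteness), he.lintegral_enorm_sq, one_mul]

/-- Only for positive `ε` is the amplitude square integrable: the factor `ĥ(ε(ξ - u))` makes the
integral over `u` converge. -/
lemma lintegral_collisionAmplitude_lt_top (he : IsSmoothBasis e w) {α : ℝ} (hα : 1 / 2 < α)
    (h : 𝓢(Plane, ℝ)) {ε : ℝ} (hε : 0 < ε) (c : ι × ι) :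
    ∫⁻ y, ‖collisionAmplitude α e h ε c y‖ₑ ^ 2 < ⊤ := by
  have h1 := he.lintegral_collisionAmplitude α h ε c (m := fun _ => 1) continuous_const
  simp only [mul_one] at h1
  rw [h1]
  have hS := lintegral_sobolevSymbol_neg_four_lt_top hα
  set S := ∫⁻ v : Plane, ENNReal.ofReal (((sobolevSymbol α v) ^ 4)⁻¹) with hSd
  have hσ := continuous_sobolevSymbol α
  have hP : ∫⁻ u : Plane, ‖profileHat h (ε • u)‖ₑ ^ 2 < ⊤ := by
    have h2 : Integrable fun u : Plane => ‖profileHat h (ε • u)‖ ^ 2 := by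
      have h3 := (memLp_two_iff_integrable_sq_norm
        (profileHat h).continuous.aestronglyMeasurable).1 ((profileHat h).memLp 2 volume)
      exact (integrable_comp_smul_iff volume _ hε.ne').2 h3
    have h4 := h2.lintegral_lt_top
    refine lt_of_eq_of_lt (lintegral_congr fun u => ?_) h4
    rw [ENNReal.ofReal_pow (norm_nonneg _), ofReal_norm]
  set P := ∫⁻ u : Plane, ‖profileHat h (ε • u)‖ₑ ^ 2 with hPd
  -- For fixed `ξ`, `u` the squared weight is integrable in `v`.
  have hweight : ∀ ξ u, ∫⁻ v, ‖(collisionWeight α ξ u v : ℂ)‖ₑ ^ 2 ≤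
      ENNReal.ofReal (sobolevSymbol α ξ ^ 2) * (S + S) := by
    intro ξ u
    calc _ ≤ ∫⁻ v, ENNReal.ofReal (sobolevSymbol α ξ ^ 2) *
          (ENNReal.ofReal ((sobolevSymbol α v ^ 4)⁻¹) +
            ENNReal.ofReal ((sobolevSymbol α (v + (u - ξ)) ^ 4)⁻¹)) := by
          refine lintegral_mono fun v => ?_
          rw [← ENNReal.ofReal_add (by positivity) (by positivity),
            ← ENNReal.ofReal_mul (by positivity), ← ofReal_norm, Complex.norm_real,
            ← ENNReal.ofReal_pow (norm_nonneg _), Real.norm_eq_abs, sq_abs,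
            show v + (u - ξ) = u + v - ξ by abel]
          exact ENNReal.ofReal_le_ofReal (collisionWeight_sq_le_pow_four (by linarith) ξ u v)
      _ = _ := by
          rw [lintegral_const_mul' _ _ (by simp), lintegral_add_left]
          · rw [lintegral_add_right_eq_self
              (fun v => ENNReal.ofReal ((sobolevSymbol α v ^ 4)⁻¹))]
          · exact ((hσ.pow 4).measurable.inv).ennreal_ofReal
  have hinner : ∀ ξ, ∫⁻ q : Plane × Plane, ‖profileHat h (ε • (ξ - q.1))‖ₑ ^ 2 *
      ‖(collisionWeight α ξ q.1 q.2 : ℂ)‖ₑ ^ 2 ≤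
      P * (ENNReal.ofReal (sobolevSymbol α ξ ^ 2) * (S + S)) := by
    intro ξ
    have hW : Continuous fun z : Plane × Plane => (collisionWeight α ξ z.1 z.2 : ℂ) := by
      have h2 : Continuous fun z : Plane × Plane => (ξ, z) := by fun_prop
      have h3 := Complex.continuous_ofReal.comp ((continuous_collisionWeight α).comp h2)
      simpa only [Function.comp_def] using h3
    have hPc : Continuous fun z : Plane × Plane => profileHat h (ε • (ξ - z.1)) :=
      (profileHat h).continuous.comp (by fun_prop)
    rw [Measure.volume_eq_prod, lintegral_prod (fun q : Plane × Plane =>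
      ‖profileHat h (ε • (ξ - q.1))‖ₑ ^ 2 * ‖(collisionWeight α ξ q.1 q.2 : ℂ)‖ₑ ^ 2)
      ((hPc.measurable.enorm.pow_const 2).mul
      (hW.measurable.enorm.pow_const 2)).aemeasurable]
    calc _ ≤ ∫⁻ u : Plane, ‖profileHat h (ε • (ξ - u))‖ₑ ^ 2 *
          (ENNReal.ofReal (sobolevSymbol α ξ ^ 2) * (S + S)) := by
          refine lintegral_mono fun u => ?_
          simp only
          rw [lintegral_const_mul' (‖profileHat h (ε • (ξ - u))‖ₑ ^ 2) _ (by simp)]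
          gcongr
          exact hweight ξ u
      _ = _ := by
          rw [lintegral_mul_const' _ _ (by finiteness),
            lintegral_sub_left_eq_self (fun u => ‖profileHat h (ε • u)‖ₑ ^ 2)]
  have hout : ∫⁻ ξ, ‖e c.1 ξ‖ₑ ^ 2 * ENNReal.ofReal (sobolevSymbol α ξ ^ 2) < ⊤ := by
    have h2 : MemLp (fun ξ => e c.1 ξ * (sobolevSymbol α ξ : ℂ)) 2 :=
      ((he.continuous c.1).mul (Complex.continuous_ofReal.comp hσ)).memLp_of_hasCompactSupport
        (he.hasCompactSupport c.1).mul_right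
    refine lt_of_eq_of_lt (lintegral_congr fun ξ => ?_) (lintegral_enorm_sq_lt_top h2)
    rw [enorm_mul, mul_pow, ← ofReal_norm (sobolevSymbol α ξ : ℂ), Complex.norm_real,
      ← ENNReal.ofReal_pow (norm_nonneg _), Real.norm_eq_abs, sq_abs]
  calc _ ≤ ∫⁻ ξ, (‖e c.1 ξ‖ₑ ^ 2 * ENNReal.ofReal (sobolevSymbol α ξ ^ 2)) * (P * (S + S)) := by
        refine lintegral_mono fun ξ => ?_
        calc _ ≤ ‖e c.1 ξ‖ₑ ^ 2 * (P * (ENNReal.ofReal (sobolevSymbol α ξ ^ 2) * (S + S))) := by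
              gcongr
              exact hinner ξ
          _ = _ := by ring
    _ < ⊤ := by
        rw [lintegral_mul_const' _ _ (by finiteness)]
        finiteness

end IsSmoothBasis

end CollisionSymbol

section CollisionSymbol

instance sFinite_volume_pairs (n : ℕ) : SFinite (volume : Measure (Fin n → Plane × Plane)) := by
  have : SigmaFinite (volume : Measure (Plane × Plane)) := by
    rw [Measure.volume_eq_prod]
    infer_instance
  rw [volume_pi]
  infer_instance

variable {ι : Type*} {e : ι → Plane → ℂ} {w : Plane → ℝ}

/-- The kernel of the regularized collision of the `j`-th and the last particle in weighted
momentum space and in the interaction picture, paired with the basis function of the word `c`. -/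
def collisionSymbol (α : ℝ) (e : ι → Plane → ℂ) (h : 𝓢(Plane, ℝ)) {k : ℕ} (j : Fin (k + 1))
    (c : Fin (k + 1) → ι × ι) (ε s : ℝ) (q : Fin (k + 2) → Plane × Plane) : ℂ :=
  collisionAmplitude α e h ε (c j) (collisionCoords j q).1 *
    conj (wordFun e (fun m => c (j.succAbove m)) (collisionCoords j q).2) *
    Complex.exp (-(Complex.I * (s * collisionFrequency (collisionCoords j q).1 : ℝ)))

lemma norm_cexp_neg_I_mul (x : ℝ) : ‖Complex.exp (-(Complex.I * (x : ℂ)))‖ = 1 := by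
  rw [← mul_neg, mul_comm, ← Complex.ofReal_neg, Complex.norm_exp_ofReal_mul_I]

lemma wordFun_eq_collisionCoords {k : ℕ} (j : Fin (k + 1)) (c : Fin (k + 2) → ι × ι)
    (q : Fin (k + 2) → Plane × Plane) : wordFun e c q =
      pairFun e (c j.castSucc) (collisionCoords j q).1.1 *
        pairFun e (c (Fin.last (k + 1))) (collisionCoords j q).1.2 *
        wordFun e (fun m => c (j.succAbove m).castSucc) (collisionCoords j q).2 := by
  rw [wordFun, Fin.prod_univ_castSucc, Fin.prod_univ_succAbove _ j, wordFun]
  simp only [collisionCoords]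
  ring

namespace IsSmoothBasis

lemma lintegral_enorm_wordFun_sq (he : IsSmoothBasis e w) {k : ℕ} (c : Fin k → ι × ι) :
    ∫⁻ q, ‖wordFun e c q‖ₑ ^ 2 = 1 := by
  have h1 := (he.orthonormal_wordFun k).1 c
  have h2 := enorm_sq_eq_lintegral ((he.memLp_wordFun c).toLp (wordFun e c))
  rw [← ofReal_norm, h1, ENNReal.ofReal_one, one_pow] at h2
  rw [h2]
  refine lintegral_congr_ae ?_
  filter_upwards [(he.memLp_wordFun c).coeFn_toLp] with x hx
  rw [hx]

lemma continuous_wordFun (he : IsSmoothBasis e w) {k : ℕ} (c : Fin k → ι × ι) :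
    Continuous (wordFun e c) :=
  continuous_finsetProd _ fun m _ => (he.continuous_pairFun (c m)).comp (continuous_apply m)

variable {k : ℕ} (j : Fin (k + 1)) (c : Fin (k + 1) → ι × ι)

/-- The collision symbol without its oscillating factor. -/
lemma lintegral_collisionSymbol (he : IsSmoothBasis e w) (α : ℝ) (h : 𝓢(Plane, ℝ)) (ε : ℝ)
    {m : ℝ → ℝ≥0∞} (hm : Continuous m) :
    ∫⁻ q, ‖collisionAmplitude α e h ε (c j) (collisionCoords j q).1 *
      conj (wordFun e (fun m => c (j.succAbove m)) (collisionCoords j q).2)‖ₑ ^ 2 *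
        m (collisionFrequency (collisionCoords j q).1) =
      ∫⁻ y, ‖collisionAmplitude α e h ε (c j) y‖ₑ ^ 2 * m (collisionFrequency y) := by
  have h1 : Measurable fun y => ‖collisionAmplitude α e h ε (c j) y‖ₑ ^ 2 *
      m (collisionFrequency y) :=
    ((he.continuous_collisionAmplitude α h ε (c j)).measurable.enorm.pow_const 2).mul
      (hm.measurable.comp continuous_collisionFrequency.measurable)
  have h2 : Measurable fun r => ‖wordFun e (fun m => c (j.succAbove m)) r‖ₑ ^ 2 :=
    (he.continuous_wordFun _).measurable.enorm.pow_const 2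
  have h3 := (measurePreserving_collisionCoords (Y := Plane × Plane) j).lintegral_comp
    ((h1.comp measurable_fst).mul (h2.comp measurable_snd))
  simp only [Pi.mul_apply, Function.comp_apply] at h3
  rw [Measure.volume_eq_prod ((Plane × Plane) × (Plane × Plane)), lintegral_prod_mul
    h1.aemeasurable h2.aemeasurable, he.lintegral_enorm_wordFun_sq, mul_one] at h3
  rw [← h3]
  refine lintegral_congr fun q => ?_
  rw [enorm_mul, RCLike.enorm_conj, mul_pow]
  ring

lemma continuous_collisionBase (he : IsSmoothBasis e w) (α : ℝ) (h : 𝓢(Plane, ℝ)) (ε : ℝ) :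
    Continuous fun q => collisionAmplitude α e h ε (c j) (collisionCoords j q).1 *
      conj (wordFun e (fun m => c (j.succAbove m)) (collisionCoords j q).2) := by
  have h0 := continuous_collisionCoords (Y := Plane × Plane) j
  exact ((he.continuous_collisionAmplitude α h ε (c j)).comp (continuous_fst.comp h0)).mul
    (Complex.continuous_conj.comp ((he.continuous_wordFun _).comp (continuous_snd.comp h0)))

lemma continuous_collisionSymbol (he : IsSmoothBasis e w) (α : ℝ) (h : 𝓢(Plane, ℝ)) (ε s : ℝ) :
    Continuous (collisionSymbol α e h j c ε s) := by
  have h0 := continuous_collisionCoords (Y := Plane × Plane) j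
  have h1 : Continuous fun q : Fin (k + 2) → Plane × Plane =>
      collisionFrequency (collisionCoords j q).1 :=
    continuous_collisionFrequency.comp (continuous_fst.comp h0)
  refine (he.continuous_collisionBase j c α h ε).mul (Complex.continuous_exp.comp ?_)
  fun_prop

lemma memLp_collisionBase (he : IsSmoothBasis e w) {α : ℝ} (hα : 1 / 2 < α) (h : 𝓢(Plane, ℝ))
    {ε : ℝ} (hε : 0 < ε) :
    MemLp (fun q => collisionAmplitude α e h ε (c j) (collisionCoords j q).1 *
      conj (wordFun e (fun m => c (j.succAbove m)) (collisionCoords j q).2)) 2 := by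
  refine memLp_two_of_lintegral (he.continuous_collisionBase j c α h ε).aestronglyMeasurable ?_
  have h1 := he.lintegral_collisionSymbol j c α h ε (m := fun _ => 1) continuous_const
  simp only [mul_one] at h1
  rw [h1]
  exact he.lintegral_collisionAmplitude_lt_top hα h hε (c j)

lemma memLp_collisionSymbol (he : IsSmoothBasis e w) {α : ℝ} (hα : 1 / 2 < α) (h : 𝓢(Plane, ℝ))
    {ε : ℝ} (hε : 0 < ε) (s : ℝ) : MemLp (collisionSymbol α e h j c ε s) 2 := by
  refine (memLp_congr_norm (he.continuous_collisionSymbol j c α h ε s).aestronglyMeasurable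
    (he.continuous_collisionBase j c α h ε).aestronglyMeasurable
    (.of_forall fun q => ?_)).2 (he.memLp_collisionBase j c hα h hε)
  rw [collisionSymbol, norm_mul, norm_cexp_neg_I_mul, mul_one]

/-- The square function estimate for the collision symbol. -/
lemma lintegral_sq_collisionSymbol_le (he : IsSmoothBasis e w) {α : ℝ} (hα : 1 / 2 < α)
    {C : NNReal} (hC : ResonanceBound α C)
    (h : 𝓢(Plane, ℝ)) {ε : ℝ} (hε : 0 < ε) (T : ℝ) {Z : (Fin (k + 2) → Plane × Plane) → ℂ}
    (hZ : MemLp Z 2) :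
    ∫⁻ s in Ioc 0 T, ‖∫ q, collisionSymbol α e h j c ε s q * Z q‖ₑ ^ 2 ≤
      (Real.exp (T ^ 2)).toNNReal * ((√Real.pi).toNNReal * (profileSup h * C)) *
        ∫⁻ q, ‖Z q‖ₑ ^ 2 := by
  have hb := he.continuous_collisionBase j c α h ε
  have hω : Continuous fun q : Fin (k + 2) → Plane × Plane =>
      collisionFrequency (collisionCoords j q).1 :=
    continuous_collisionFrequency.comp (continuous_fst.comp (continuous_collisionCoords j))
  have h1 := lintegral_sq_oscillatory_le (μ := (volume : Measure (Fin (k + 2) → Plane × Plane)))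
    hb.measurable hω.measurable hZ.1.aemeasurable
    ((he.memLp_collisionBase j c hα h hε).integrable_mul hZ) (M := profileSup h * C) fun τ => by
      rw [he.lintegral_collisionSymbol j c α h ε
        (m := fun t => ENNReal.ofReal (Real.exp (-(t - τ) ^ 2 / 4)))
        (ENNReal.continuous_ofReal.comp (by fun_prop))]
      exact he.lintegral_collisionAmplitude_le hC h ε (c j) τ
  have h2 : ∀ s, ∫ q, collisionSymbol α e h j c ε s q * Z q =
      ∫ q, collisionAmplitude α e h ε (c j) (collisionCoords j q).1 *
      conj (wordFun e (fun m => c (j.succAbove m)) (collisionCoords j q).2) * Z q *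
      Complex.exp (-(Complex.I * (s * collisionFrequency (collisionCoords j q).1 : ℝ))) := by
    intro s
    refine integral_congr_ae (.of_forall fun q => ?_)
    simp only [collisionSymbol]
    ring
  simp only [h2]
  refine (setLIntegral_le_gaussian T _).trans ((mul_le_mul_right h1 _).trans_eq ?_)
  simp only [ENNReal.ofReal]
  ring

lemma continuous_integral_collisionSymbol (he : IsSmoothBasis e w) {α : ℝ} (hα : 1 / 2 < α)
    (h : 𝓢(Plane, ℝ)) {ε : ℝ} (hε : 0 < ε) {Z : (Fin (k + 2) → Plane × Plane) → ℂ}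
    (hZ : MemLp Z 2) : Continuous fun s => ∫ q, collisionSymbol α e h j c ε s q * Z q := by
  refine continuous_of_dominated (fun s => (he.continuous_collisionSymbol j c α h ε
    s).aestronglyMeasurable.mul hZ.1) (fun s => Eventually.of_forall fun q => ?_)
    ((he.memLp_collisionBase j c hα h hε).integrable_mul hZ).norm
    (.of_forall fun q => ?_)
  · rw [collisionSymbol, norm_mul, norm_mul, norm_cexp_neg_I_mul, mul_one, Pi.mul_apply,
      norm_mul _ (Z q)]
  · unfold collisionSymbol
    fun_prop

lemma integral_collisionAmplitude_mul (he : IsSmoothBasis e w) (α : ℝ) (h : 𝓢(Plane, ℝ))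
    (ε s : ℝ) (c a b : ι × ι) [Decidable (a.2 = c.2)] :
    ∫ y, collisionAmplitude α e h ε c y *
        Complex.exp (-(Complex.I * (s * collisionFrequency y : ℝ))) *
        (pairFun e a y.1 * pairFun e b y.2) =
      (∫ z : Plane × Plane × Plane, profileHat h (ε • (z.1 - z.2.1)) * (conj (e c.1 z.1) *
        ((collisionWeight α z.1 z.2.1 z.2.2 : ℂ) * collisionProduct e a.1 b.1 b.2 z *
          Complex.exp (-(Complex.I * (s * resonance z.1 z.2.1 z.2.2 : ℝ)))))) *
        if a.2 = c.2 then 1 else 0 := by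
  have hc : Continuous fun y => collisionAmplitude α e h ε c y *
      Complex.exp (-(Complex.I * (s * collisionFrequency y : ℝ))) *
      (pairFun e a y.1 * pairFun e b y.2) := by
    have h1 := continuous_collisionFrequency
    have h2 := he.continuous_collisionAmplitude α h ε c
    have h3 := he.continuous_pairFun a
    have h4 := he.continuous_pairFun b
    fun_prop
  rw [← measurePreserving_collisionMomenta.integral_comp_continuous hc, ← he.integral_conj_mul,
    ← integral_prod_mul]
  refine integral_congr_ae (.of_forall fun z => ?_)
  simp only [collisionAmplitude_momenta, collisionFrequency_momenta]
  simp only [collisionMomenta, pairFun, collisionProduct]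
  ring

/-- The matrix elements of the collision symbol converge to the structure coefficients of the
collision as the regularization is removed. -/
lemma tendsto_integral_collisionSymbol (he : IsSmoothBasis e w) (α : ℝ) {h : 𝓢(Plane, ℝ)}
    (hh : ∫ x, h x = 1) (s : ℝ) (c' : Fin (k + 2) → ι × ι)
    [Decidable ((c' j.castSucc).2 = (c j).2)]
    [Decidable ((fun m => c (j.succAbove m)) = fun m => c' (j.succAbove m).castSucc)] :
    Tendsto (fun ε : ℝ => ∫ q, collisionSymbol α e h j c ε s q * wordFun e c' q) (𝓝 0)
      (𝓝 ((if (c' j.castSucc).2 = (c j).2 then collisionCoeff α e (c j).1 (c' j.castSucc).1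
        (c' (Fin.last (k + 1))).1 (c' (Fin.last (k + 1))).2 s else 0) *
        if (fun m => c (j.succAbove m)) = (fun m => c' (j.succAbove m).castSucc) then 1 else 0)) := by
  classical
  -- The particles outside of the collision contribute Kronecker symbols.
  have h1 : ∀ ε : ℝ, ∫ q, collisionSymbol α e h j c ε s q * wordFun e c' q =
      ((∫ z : Plane × Plane × Plane, profileHat h (ε • (z.1 - z.2.1)) * (conj (e (c j).1 z.1) *
        ((collisionWeight α z.1 z.2.1 z.2.2 : ℂ) *
          collisionProduct e (c' j.castSucc).1 (c' (Fin.last (k + 1))).1 (c' (Fin.last (k + 1))).2 z *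
          Complex.exp (-(Complex.I * (s * resonance z.1 z.2.1 z.2.2 : ℝ)))))) *
        if (c' j.castSucc).2 = (c j).2 then 1 else 0) *
        if (fun m => c (j.succAbove m)) = (fun m => c' (j.succAbove m).castSucc) then 1 else 0 := by
    intro ε
    have h2 : Continuous fun z : ((Plane × Plane) × (Plane × Plane)) × (Fin k → Plane × Plane) =>
        (collisionAmplitude α e h ε (c j) z.1 *
          Complex.exp (-(Complex.I * (s * collisionFrequency z.1 : ℝ))) *
          (pairFun e (c' j.castSucc) z.1.1 * pairFun e (c' (Fin.last (k + 1))) z.1.2)) *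
        (conj (wordFun e (fun m => c (j.succAbove m)) z.2) *
          wordFun e (fun m => c' (j.succAbove m).castSucc) z.2) := by
      have h1 := continuous_collisionFrequency
      have h2 := he.continuous_collisionAmplitude α h ε (c j)
      have h3 := he.continuous_pairFun (c' j.castSucc)
      have h4 := he.continuous_pairFun (c' (Fin.last (k + 1)))
      have h5 := he.continuous_wordFun (fun m => c (j.succAbove m))
      have h6 := he.continuous_wordFun (fun m => c' (j.succAbove m).castSucc)
      have h7 := Complex.continuous_conj
      fun_prop
    have h3 := (measurePreserving_collisionCoords (Y := Plane × Plane) j).integral_comp_continuous h2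
    rw [Measure.volume_eq_prod ((Plane × Plane) × (Plane × Plane)), integral_prod_mul
      (fun y => collisionAmplitude α e h ε (c j) y *
          Complex.exp (-(Complex.I * (s * collisionFrequency y : ℝ))) *
          (pairFun e (c' j.castSucc) y.1 * pairFun e (c' (Fin.last (k + 1))) y.2))
      (fun r => conj (wordFun e (fun m => c (j.succAbove m)) r) *
          wordFun e (fun m => c' (j.succAbove m).castSucc) r),
      he.integral_conj_wordFun_mul, he.integral_collisionAmplitude_mul] at h3
    refine Eq.trans (integral_congr_ae (.of_forall fun q => ?_)) (h3.trans (by congr))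
    simp only [collisionSymbol, wordFun_eq_collisionCoords j c']
    ring
  simp only [h1]
  refine Tendsto.mul_const _ ?_
  -- Dominated convergence: `ĥ` is bounded and `ĥ(0) = ∫ h = 1`.
  have h4 : Tendsto (fun ε : ℝ => ∫ z : Plane × Plane × Plane,
      profileHat h (ε • (z.1 - z.2.1)) * (conj (e (c j).1 z.1) *
        ((collisionWeight α z.1 z.2.1 z.2.2 : ℂ) *
          collisionProduct e (c' j.castSucc).1 (c' (Fin.last (k + 1))).1 (c' (Fin.last (k + 1))).2 z *
          Complex.exp (-(Complex.I * (s * resonance z.1 z.2.1 z.2.2 : ℝ)))))) (𝓝 0)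
      (𝓝 (collisionCoeff α e (c j).1 (c' j.castSucc).1
        (c' (Fin.last (k + 1))).1 (c' (Fin.last (k + 1))).2 s)) := by
    have hi := he.integrable_collisionCoeff α (c j).1 (c' j.castSucc).1
      (c' (Fin.last (k + 1))).1 (c' (Fin.last (k + 1))).2 s
    refine tendsto_integral_filter_of_dominated_convergence _ (.of_forall fun ε => ?_)
      (.of_forall fun ε => Eventually.of_forall fun z => ?_)
      (hi.norm.const_mul ‖(profileHat h).toBoundedContinuousFunction‖)
      (.of_forall fun z => ?_)
    · exact ((profileHat h).continuous.comp (by fun_prop)).aestronglyMeasurable.mul hi.1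
    · rw [norm_mul]
      gcongr
      exact (profileHat h).toBoundedContinuousFunction.norm_coe_le_norm _
    · have h5 : Continuous fun ε : ℝ => profileHat h (ε • (z.1 - z.2.1)) :=
        (profileHat h).continuous.comp (by fun_prop)
      have h6 := (h5.tendsto 0).mul_const (conj (e (c j).1 z.1) *
        ((collisionWeight α z.1 z.2.1 z.2.2 : ℂ) *
          collisionProduct e (c' j.castSucc).1 (c' (Fin.last (k + 1))).1 (c' (Fin.last (k + 1))).2 z *
          Complex.exp (-(Complex.I * (s * resonance z.1 z.2.1 z.2.2 : ℝ)))))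
      simpa only [zero_smul, profileHat_zero, hh, Complex.ofReal_one, one_mul] using h6
  have h7 := h4.mul_const (if (c' j.castSucc).2 = (c j).2 then (1 : ℂ) else 0)
  simpa only [mul_ite, mul_one, mul_zero] using h7

end IsSmoothBasis

end CollisionSymbol

/-! ### The regularized collision as a functional -/

section CollisionFunctional

variable {ι : Type*} {e : ι → Plane → ℂ} {w : Plane → ℝ}

/-- The functional `u ↦ ∫ Ψ u` for a square integrable function `Ψ`. -/
def pairing {X : Type*} [MeasurableSpace X] {μ : Measure X} {Ψ : X → ℂ} (hΨ : MemLp Ψ 2 μ) :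
    Lp ℂ 2 μ →L[ℂ] ℂ :=
  innerSL ℂ ((memLp_conj hΨ).toLp _)

lemma pairing_apply {X : Type*} [MeasurableSpace X] {μ : Measure X} {Ψ : X → ℂ} (hΨ : MemLp Ψ 2 μ)
    (u : Lp ℂ 2 μ) : pairing hΨ u = ∫ x, Ψ x * u x ∂μ := by
  rw [pairing, innerSL_apply_apply, L2.inner_def]
  refine integral_congr_ae ?_
  filter_upwards [(memLp_conj hΨ).coeFn_toLp] with x hx
  rw [hx, RCLike.inner_apply, Complex.conj_conj, mul_comm]

/-- Exchange of the two arguments of a kernel, `(ξ_m, η_m) ↦ (η_m, ξ_m)`. -/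
def swapPairs (n : ℕ) : (Fin n → Plane × Plane) ≃ᵐ (Fin n → Plane × Plane) :=
  MeasurableEquiv.piCongrRight fun _ => MeasurableEquiv.prodComm

lemma swapPairs_apply {n : ℕ} (q : Fin n → Plane × Plane) (m : Fin n) :
    swapPairs n q m = (q m).swap := rfl

lemma swapPairs_swapPairs {n : ℕ} (q : Fin n → Plane × Plane) :
    swapPairs n (swapPairs n q) = q := rfl

lemma measurePreserving_swapPairs (n : ℕ) : MeasurePreserving (swapPairs n) := by
  have : SigmaFinite (volume : Measure (Plane × Plane)) := by
    rw [Measure.volume_eq_prod]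
    infer_instance
  have h : MeasurePreserving (Prod.swap : Plane × Plane → Plane × Plane) :=
    Measure.measurePreserving_swap
  exact volume_preserving_pi fun _ => h

lemma conj_wordFun_swapPairs {n : ℕ} (c : Fin n → ι × ι) (q : Fin n → Plane × Plane) :
    conj (wordFun e c (swapPairs n q)) = wordFun e (fun m => (c m).swap) q := by
  simp only [wordFun, map_prod]
  refine Finset.prod_congr rfl fun m _ => ?_
  simp only [pairFun, swapPairs_apply, Prod.fst_swap, Prod.snd_swap, map_mul, Complex.conj_conj]
  ring

variable {k : ℕ} (j : Fin (k + 1)) (c : Fin (k + 1) → ι × ι)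

/-- The two terms of the commutator in the collision. -/
def commutatorSymbol (α : ℝ) (e : ι → Plane → ℂ) (h : 𝓢(Plane, ℝ)) {k : ℕ} (j : Fin (k + 1))
    (c : Fin (k + 1) → ι × ι) (ε s : ℝ) (q : Fin (k + 2) → Plane × Plane) : ℂ :=
  collisionSymbol α e h j c ε s q -
    conj (collisionSymbol α e h j (fun m => (c m).swap) ε s (swapPairs (k + 2) q))

/-- The complex conjugate of a kernel with exchanged arguments. -/
def adjointKernel {n : ℕ} (Z : (Fin n → Plane × Plane) → ℂ) (q : Fin n → Plane × Plane) : ℂ :=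
  conj (Z (swapPairs n q))

lemma memLp_adjointKernel {n : ℕ} {Z : (Fin n → Plane × Plane) → ℂ} (hZ : MemLp Z 2) :
    MemLp (adjointKernel Z) 2 :=
  memLp_conj (hZ.comp_measurePreserving (measurePreserving_swapPairs n))

lemma lintegral_adjointKernel {n : ℕ} (Z : (Fin n → Plane × Plane) → ℂ) :
    ∫⁻ q, ‖adjointKernel Z q‖ₑ ^ 2 = ∫⁻ q, ‖Z q‖ₑ ^ 2 := by
  simp only [adjointKernel, RCLike.enorm_conj]
  exact (measurePreserving_swapPairs n).lintegral_comp_emb (swapPairs n).measurableEmbedding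
    (fun q => ‖Z q‖ₑ ^ 2)

lemma integral_adjointKernel_mul {n : ℕ} (Ψ Z : (Fin n → Plane × Plane) → ℂ) :
    ∫ q, adjointKernel Ψ q * Z q = conj (∫ q, Ψ q * adjointKernel Z q) := by
  rw [← integral_conj, ← (measurePreserving_swapPairs n).integral_comp']
  refine integral_congr_ae (.of_forall fun q => ?_)
  simp only [adjointKernel, swapPairs_swapPairs, map_mul, Complex.conj_conj]

namespace IsSmoothBasis

variable {α : ℝ}

lemma memLp_commutatorSymbol (he : IsSmoothBasis e w) (hα : 1 / 2 < α) (h : 𝓢(Plane, ℝ))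
    {ε : ℝ} (hε : 0 < ε) (s : ℝ) : MemLp (commutatorSymbol α e h j c ε s) 2 :=
  (he.memLp_collisionSymbol j c hα h hε s).sub
    (memLp_adjointKernel (he.memLp_collisionSymbol j _ hα h hε s))

lemma integral_commutatorSymbol (he : IsSmoothBasis e w) (hα : 1 / 2 < α) (h : 𝓢(Plane, ℝ))
    {ε : ℝ} (hε : 0 < ε) (s : ℝ) {Z : (Fin (k + 2) → Plane × Plane) → ℂ} (hZ : MemLp Z 2) :
    ∫ q, commutatorSymbol α e h j c ε s q * Z q = (∫ q, collisionSymbol α e h j c ε s q * Z q) -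
      conj (∫ q, collisionSymbol α e h j (fun m => (c m).swap) ε s q * adjointKernel Z q) := by
  rw [← integral_adjointKernel_mul, ← integral_sub]
  · refine integral_congr_ae (.of_forall fun q => ?_)
    simp only [commutatorSymbol, adjointKernel]
    ring
  · exact (he.memLp_collisionSymbol j c hα h hε s).integrable_mul hZ
  · exact (memLp_adjointKernel (he.memLp_collisionSymbol j _ hα h hε s)).integrable_mul hZ

/-- The regularized collision as a functional of the coefficients of a kernel. -/
def collisionFunctional (he : IsSmoothBasis e w) (hα : 1 / 2 < α) (h : 𝓢(Plane, ℝ))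
    {ε : ℝ} (hε : 0 < ε) (s : ℝ) : WordSpace (ι × ι) →L[ℂ] ℂ :=
  pairing (he.memLp_commutatorSymbol j c hα h hε s) ∘L synthesis (he.orthonormal_wordFun (k + 2))

lemma collisionFunctional_apply (he : IsSmoothBasis e w) (hα : 1 / 2 < α) (h : 𝓢(Plane, ℝ))
    {ε : ℝ} (hε : 0 < ε) (s : ℝ) (Y : WordSpace (ι × ι)) :
    he.collisionFunctional j c hα h hε s Y = ∫ q, commutatorSymbol α e h j c ε s q *
      synthesis (he.orthonormal_wordFun (k + 2)) Y q :=
  pairing_apply (he.memLp_commutatorSymbol j c hα h hε s) _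

lemma continuous_collisionFunctional (he : IsSmoothBasis e w) (hα : 1 / 2 < α) (h : 𝓢(Plane, ℝ))
    {ε : ℝ} (hε : 0 < ε) (Y : WordSpace (ι × ι)) :
    Continuous fun s => he.collisionFunctional j c hα h hε s Y := by
  have hZ := Lp.memLp (synthesis (he.orthonormal_wordFun (k + 2)) Y)
  simp only [collisionFunctional_apply, he.integral_commutatorSymbol j c hα h hε _ hZ]
  exact (he.continuous_integral_collisionSymbol j c hα h hε hZ).sub
    (Complex.continuous_conj.comp (he.continuous_integral_collisionSymbol j _ hα h hε
      (memLp_adjointKernel hZ)))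

/-- The square function estimate; its constant does not depend on `ε`. -/
lemma lintegral_collisionFunctional_le (he : IsSmoothBasis e w) (hα : 1 / 2 < α)
    {C : NNReal} (hC : ResonanceBound α C)
    (h : 𝓢(Plane, ℝ)) {ε : ℝ} (hε : 0 < ε) (T : ℝ) (Y : WordSpace (ι × ι)) :
    ∫⁻ s in Ioc 0 T, ‖he.collisionFunctional j c hα h hε s Y‖ₑ ^ 2 ≤
      (4 * ((Real.exp (T ^ 2)).toNNReal * ((√Real.pi).toNNReal * (profileSup h * C))) : NNReal) *
        ‖Y‖ₑ ^ 2 := by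
  set b := he.orthonormal_wordFun (k + 2)
  have hZ := Lp.memLp (synthesis b Y)
  have hY : ∫⁻ q, ‖synthesis b Y q‖ₑ ^ 2 ≤ ‖Y‖ₑ ^ 2 := by
    rw [← enorm_sq_eq_lintegral]
    gcongr
    rw [enorm_le_iff_norm_le]
    exact norm_synthesis_le b Y
  have h1 := he.lintegral_sq_collisionSymbol_le j c hα hC h hε T hZ
  have h2 := he.lintegral_sq_collisionSymbol_le j (fun m => (c m).swap) hα hC h hε T
    (memLp_adjointKernel hZ)
  rw [lintegral_adjointKernel] at h2
  simp only [collisionFunctional_apply, he.integral_commutatorSymbol j c hα h hε _ hZ]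
  have hm := (he.continuous_integral_collisionSymbol j c hα h hε hZ).enorm.measurable.pow_const 2
  set K : ℝ≥0∞ := (Real.exp (T ^ 2)).toNNReal * ((√Real.pi).toNNReal * (profileSup h * C)) with hK
  calc _ ≤ ∫⁻ s in Ioc 0 T, 2 * (‖∫ q, collisionSymbol α e h j c ε s q * synthesis b Y q‖ₑ ^ 2 +
        ‖∫ q, collisionSymbol α e h j (fun m => (c m).swap) ε s q *
          adjointKernel (synthesis b Y) q‖ₑ ^ 2) := by
        refine lintegral_mono fun s => ?_
        refine (enorm_add_sq_le _ _).trans ?_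
        rw [RCLike.enorm_conj]
    _ ≤ 2 * (K * ‖Y‖ₑ ^ 2 + K * ‖Y‖ₑ ^ 2) := by
        rw [lintegral_const_mul' _ _ (by simp), lintegral_add_left hm]
        gcongr
        · exact h1.trans (by gcongr)
        · exact h2.trans (by gcongr)
    _ = _ := by
        push_cast
        rw [← hK]
        ring

open Classical in
lemma tendsto_collisionFunctional_single (he : IsSmoothBasis e w) (hα : 1 / 2 < α)
    {h : 𝓢(Plane, ℝ)} (hh : ∫ x, h x = 1) {ε : ℕ → ℝ} (hε : ∀ n, 0 < ε n)
    (hlim : Tendsto ε atTop (𝓝 0)) (s : ℝ) (c' : Fin (k + 2) → ι × ι) (r : ℂ) :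
    Tendsto (fun n => he.collisionFunctional j c hα h (hε n) s
      (lp.single (E := fun _ : List (ι × ι) => ℂ) 2 (List.ofFn c') r)) atTop
      (𝓝 (r * if (fun m => c (j.succAbove m)) = (fun m => c' (j.succAbove m).castSucc) then
        pairCoeff α e (c j) (c' j.castSucc) (c' (Fin.last (k + 1))) s else 0)) := by
  have h1 : ∀ n, he.collisionFunctional j c hα h (hε n) s
      (lp.single (E := fun _ : List (ι × ι) => ℂ) 2 (List.ofFn c') r) =
      r * ((∫ q, collisionSymbol α e h j c (ε n) s q * wordFun e c' q) -
        conj (∫ q, collisionSymbol α e h j (fun m => (c m).swap) (ε n) s q *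
          wordFun e (fun m => (c' m).swap) q)) := by
    intro n
    rw [collisionFunctional, ContinuousLinearMap.comp_apply, synthesis_single, map_smul,
      smul_eq_mul, pairing_apply]
    congr 1
    have h2 := he.integral_commutatorSymbol j c hα h (hε n) s (he.memLp_wordFun c')
    have h3 : adjointKernel (wordFun e c') = wordFun e fun m => (c' m).swap := by
      funext q
      exact conj_wordFun_swapPairs c' q
    rw [h3] at h2
    rw [← h2]
    refine integral_congr_ae ?_
    filter_upwards [(he.memLp_wordFun c').coeFn_toLp] with q hq
    rw [hq]
  simp only [h1]
  refine Tendsto.const_mul r ?_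
  have h4 := (he.tendsto_integral_collisionSymbol j c α hh s c').comp hlim
  have h5 := (he.tendsto_integral_collisionSymbol j (fun m => (c m).swap) α hh s
    fun m => (c' m).swap).comp hlim
  have h6 := h4.sub ((Complex.continuous_conj.tendsto _).comp h5)
  have h7 : ((fun m => (c (j.succAbove m)).swap) = fun m => (c' (j.succAbove m).castSucc).swap) ↔
      ((fun m => c (j.succAbove m)) = fun m => c' (j.succAbove m).castSucc) := by
    simp only [funext_iff, Prod.swap_inj]
  refine h6.congr' ?_ |>.trans_eq ?_
  · exact Eventually.of_forall fun n => rfl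
  · congr 1
    simp only [pairCoeff, h7, Prod.fst_swap, Prod.snd_swap]
    split_ifs <;> simp

end IsSmoothBasis

end CollisionFunctional

section Truncation

variable {ι : Type*} {k : ℕ}

/-- The word in which the `j`-th letter of `c` is replaced by `a` and the letter `b` is appended. -/
def collideWord {β : Type*} (c : Fin k → β) (j : Fin k) (a b : β) : Fin (k + 1) → β :=
  Fin.snoc (α := fun _ => β) (Function.update c j a) b

open Classical in
lemma sum_piFinset_collideWord {β : Type*} {M : Type*} [AddCommMonoid M] (c : Fin (k + 1) → β)
    (j : Fin (k + 1)) {S : Finset β} (hS : ∀ m, c m ∈ S) (f : (Fin (k + 2) → β) → M) :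
    (∑ w ∈ Fintype.piFinset fun _ : Fin (k + 2) => S,
      if (fun m => c (j.succAbove m)) = (fun m => w (j.succAbove m).castSucc) then f w else 0) =
      ∑ a ∈ S, ∑ b ∈ S, f (collideWord c j a b) := by
  rw [← Finset.sum_filter, ← Finset.sum_product']
  refine Finset.sum_nbij' (fun w => (w j.castSucc, w (Fin.last _)))
    (fun p => collideWord c j p.1 p.2) ?_ ?_ ?_ ?_ ?_
  · intro w hw
    simp only [Finset.mem_filter, Fintype.mem_piFinset] at hw
    exact Finset.mem_product.2 ⟨hw.1 _, hw.1 _⟩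
  · intro p hp
    rw [Finset.mem_product] at hp
    simp only [Finset.mem_filter, Fintype.mem_piFinset]
    refine ⟨fun i => ?_, funext fun m => ?_⟩
    · refine Fin.lastCases ?_ (fun i => ?_) i
      · simpa [collideWord] using hp.2
      · rcases eq_or_ne i j with rfl | hij
        · simpa [collideWord] using hp.1
        · simpa [collideWord, hij] using hS i
    · simp [collideWord]
  · intro w hw
    simp only [Finset.mem_filter, Fintype.mem_piFinset] at hw
    funext i
    refine Fin.lastCases ?_ (fun i => ?_) i
    · simp [collideWord]
    · rcases j.eq_self_or_eq_succAbove i with rfl | ⟨m, rfl⟩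
      · simp [collideWord]
      · simpa [collideWord] using congrFun hw.2 m
  · intro p _
    simp [collideWord]
  · intro w hw
    simp only [Finset.mem_filter, Fintype.mem_piFinset] at hw
    congr 1
    funext i
    refine Fin.lastCases ?_ (fun i => ?_) i
    · simp [collideWord]
    · rcases j.eq_self_or_eq_succAbove i with rfl | ⟨m, rfl⟩
      · simp [collideWord]
      · simpa [collideWord] using (congrFun hw.2 m).symm

variable {e : ι → Plane → ℂ} {w : Plane → ℝ} {α : ℝ}

open Classical in
/-- For finitely many letters the regularization can be removed term by term. -/
lemma IsSmoothBasis.tendsto_collisionFunctional_truncWords (he : IsSmoothBasis e w)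
    (j : Fin (k + 1)) (c : Fin (k + 1) → ι × ι) (hα : 1 / 2 < α)
    {h : 𝓢(Plane, ℝ)} (hh : ∫ x, h x = 1) {ε : ℕ → ℝ} (hε : ∀ n, 0 < ε n)
    (hlim : Tendsto ε atTop (𝓝 0)) (s : ℝ) {S : Finset (ι × ι)} (hS : ∀ m, c m ∈ S)
    (X : List (ι × ι) → ℂ) :
    Tendsto (fun n => he.collisionFunctional j c hα h (hε n) s (truncWords S (k + 2) X)) atTop
      (𝓝 (∑ a ∈ S, ∑ b ∈ S, pairCoeff α e (c j) a b s *
        X (List.ofFn (collideWord c j a b)))) := by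
  simp only [truncWords, LinearMap.coe_mk, AddHom.coe_mk, map_sum]
  have h1 := tendsto_finsetSum (Fintype.piFinset fun _ : Fin (k + 2) => S) fun c' _ =>
    he.tendsto_collisionFunctional_single j c hα hh hε hlim s c' (X (List.ofFn c'))
  refine h1.trans_eq (congrArg 𝓝 ?_)
  simp only [mul_ite, mul_zero]
  refine Eq.trans ?_ ((sum_piFinset_collideWord c j hS fun c' => X (List.ofFn c') *
    pairCoeff α e (c j) (c' j.castSucc) (c' (Fin.last (k + 1))) s).trans ?_)
  · congr!
  refine Finset.sum_congr rfl fun a _ => Finset.sum_congr rfl fun b _ => ?_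
  rw [mul_comm]
  congr 2 <;> simp [collideWord]

end Truncation

/-! ### Kernels in the interaction picture -/

section WeightedKernel

variable {ι : Type*} {e : ι → Plane → ℂ} {w : Plane → ℝ}

/-- The oscillating factor by which the free evolution acts on the Fourier transform of the kernel
of a one-particle operator. -/
def oscillation (s : ℝ) (p : Plane × Plane) : ℂ :=
  Complex.exp (-(Complex.I *
    ((s * (4 * Real.pi ^ 2 * ‖p.2‖ ^ 2 - 4 * Real.pi ^ 2 * ‖p.1‖ ^ 2) : ℝ))))

/-- The oscillating factor by which the free evolution acts on the Fourier transform of a kernel,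
as a function of the momenta of the pairs. -/
def pairPhase {n : ℕ} (s : ℝ) (q : Fin n → Plane × Plane) : ℂ := ∏ m, oscillation s (q m)

lemma norm_pairPhase {n : ℕ} (s : ℝ) (q : Fin n → Plane × Plane) : ‖pairPhase s q‖ = 1 := by
  simp only [pairPhase, oscillation, norm_prod, norm_cexp_neg_I_mul, Finset.prod_const_one]

lemma continuous_pairPhase {n : ℕ} (s : ℝ) : Continuous (pairPhase (n := n) s) := by
  unfold pairPhase oscillation
  fun_prop

lemma conj_cexp_neg_I_mul (x : ℝ) :
    conj (Complex.exp (-(Complex.I * (x : ℂ)))) = Complex.exp (-(Complex.I * ((-x : ℝ) : ℂ))) := by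
  rw [← Complex.exp_conj]
  simp

lemma conj_pairPhase_swapPairs {n : ℕ} (s : ℝ) (q : Fin n → Plane × Plane) :
    conj (pairPhase s (swapPairs n q)) = pairPhase s q := by
  simp only [pairPhase, oscillation, map_prod, conj_cexp_neg_I_mul, swapPairs_apply, Prod.fst_swap,
    Prod.snd_swap]
  refine Finset.prod_congr rfl fun m _ => ?_
  congr 4
  ring

lemma pairWeight_swapPairs {n : ℕ} (q : Fin n → Plane × Plane) :
    pairWeight w (swapPairs n q) = pairWeight w q :=
  Finset.prod_congr rfl fun _ _ => mul_comm _ _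

/-- A kernel in Fourier variables in the interaction picture, multiplied by the weights and written
as a function of the momenta of the pairs. -/
def weightedKernel {n : ℕ} (w : Plane → ℝ) (s : ℝ) (κ : Config n × Config n → ℂ)
    (q : Fin n → Plane × Plane) : ℂ :=
  pairWeight w q * pairPhase s q * κ (pairPositions n q)

lemma adjointKernel_weightedKernel {n : ℕ} (s : ℝ) (κ : Config n × Config n → ℂ)
    (q : Fin n → Plane × Plane) : adjointKernel (weightedKernel w s κ) q =
      pairWeight w q * pairPhase s q * conj (κ (pairPositions n q).swap) := by
  rw [adjointKernel, weightedKernel, map_mul, map_mul, conj_pairPhase_swapPairs, Complex.conj_ofReal,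
    pairWeight_swapPairs]
  rfl

namespace IsSmoothBasis

lemma conj_particleSchwartz_mul (he : IsSmoothBasis e w) (hw : ContDiff ℝ (⊤ : ℕ∞) w) (a b : ι)
    (s : ℝ) (u v : Plane) : conj (he.particleSchwartz hw a s u) * he.particleSchwartz hw b s v =
      conj (e a u) * e b v * (w u * w v) * oscillation s (u, v) := by
  rw [particleSchwartz_apply, particleSchwartz_apply, map_mul, map_mul, conj_cexp_neg_I_mul,
    Complex.conj_ofReal]
  have h1 : oscillation s (u, v) =
      Complex.exp (-(Complex.I * ((-(s * (4 * Real.pi ^ 2 * ‖u‖ ^ 2)) : ℝ)))) *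
        Complex.exp (-(Complex.I * ((s * (4 * Real.pi ^ 2 * ‖v‖ ^ 2) : ℝ)))) := by
    rw [oscillation, ← Complex.exp_add]
    congr 1
    push_cast
    ring
  rw [h1]
  ring

lemma conj_wordSchwartz_mul (he : IsSmoothBasis e w) (hw : ContDiff ℝ (⊤ : ℕ∞) w) {n : ℕ}
    (c : Fin n → ι × ι) (s : ℝ) (q : Fin n → Plane × Plane) :
    conj (he.wordSchwartz hw (fun m => (c m).1) s (pairPositions n q).1) *
      he.wordSchwartz hw (fun m => (c m).2) s (pairPositions n q).2 =
      conj (wordFun e c q) * (pairWeight w q * pairPhase s q) := by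
  rw [wordSchwartz_apply, wordSchwartz_apply, map_prod, ← Finset.prod_mul_distrib, wordFun,
    map_prod, pairWeight, pairPhase, Complex.ofReal_prod, ← Finset.prod_mul_distrib,
    ← Finset.prod_mul_distrib]
  refine Finset.prod_congr rfl fun m _ => ?_
  rw [conj_particleSchwartz_mul, pairFun, map_mul, Complex.conj_conj, pos_pairPositions_fst,
    pos_pairPositions_snd]
  push_cast
  ring

variable {α : ℝ} {k : ℕ}

/-- Dividing by the weights and phases of the two incoming pairs produces the weight quotient and the
resonance of the collision. -/
lemma conj_particleSchwartz_mul_eq_collisionAmplitude (he : IsSmoothBasis e (sobolevSymbol α))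
    (h : 𝓢(Plane, ℝ)) (ε : ℝ) (c : ι × ι) (s : ℝ) (y : (Plane × Plane) × (Plane × Plane)) :
    profileHat h (ε • (y.2.1 - y.2.2)) *
      (conj (he.particleSchwartz (contDiff_sobolevSymbol α) c.1 s (outMomentum y)) *
        he.particleSchwartz (contDiff_sobolevSymbol α) c.2 s y.1.2) =
      collisionAmplitude α e h ε c y *
        Complex.exp (-(Complex.I * (s * collisionFrequency y : ℝ))) *
        ((sobolevSymbol α y.1.1 * sobolevSymbol α y.1.2) *
          (sobolevSymbol α y.2.1 * sobolevSymbol α y.2.2)) *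
        (oscillation s y.1 *
        oscillation s y.2) := by
  have h0 : y.1.1 + y.2.1 - outMomentum y = y.2.2 := by
    simp only [outMomentum]
    abel
  have h1 : oscillation s (outMomentum y, y.1.2) =
      Complex.exp (-(Complex.I * (s * collisionFrequency y : ℝ))) * (oscillation s y.1 *
        oscillation s y.2) := by
    simp only [oscillation]
    rw [← Complex.exp_add, ← Complex.exp_add, collisionFrequency, resonance, h0]
    congr 1
    push_cast
    ring
  have hne : ∀ p, (sobolevSymbol α p : ℂ) ≠ 0 := fun p => by
    exact_mod_cast (sobolevSymbol_pos α p).ne'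
  have h2 : (sobolevSymbol α (outMomentum y) : ℂ) =
      collisionWeight α (outMomentum y) y.1.1 y.2.1 *
        (sobolevSymbol α y.1.1 * (sobolevSymbol α y.2.1 * sobolevSymbol α y.2.2)) := by
    rw [collisionWeight, h0]
    push_cast
    field_simp [hne]
  rw [conj_particleSchwartz_mul, collisionAmplitude, h1, h2]
  ring

/-- The trace of the collision, tested against weighted products, in terms of the collision symbol of
the pairs; the missing weights and phases are those of `weightedKernel`. -/
lemma collisionKernel_pairPositions (he : IsSmoothBasis e (sobolevSymbol α)) (h : 𝓢(Plane, ℝ))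
    (j : Fin (k + 1)) (c : Fin (k + 1) → ι × ι) (ε s : ℝ) (q : Fin (k + 2) → Plane × Plane) :
    collisionKernel h j ε (he.wordSchwartz (contDiff_sobolevSymbol α) (fun m => (c m).1) s)
      (he.wordSchwartz (contDiff_sobolevSymbol α) (fun m => (c m).2) s)
      (pairPositions (k + 2) q) =
      collisionSymbol α e h j c ε s q *
        (pairWeight (sobolevSymbol α) q * pairPhase s q) := by
  set y := (collisionCoords j q).1 with hy
  set r := (collisionCoords j q).2 with hr
  have hw := contDiff_sobolevSymbol α
  -- Separation of particle `j` from the particles that do not collide.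
  have e1 : ∀ a : Fin (k + 1) → ι, he.wordSchwartz hw a s
      (firstParticles (pairPositions (k + 2) q).1 + singleConfig j
        (pos (pairPositions (k + 2) q).1 (Fin.last (k + 1)) -
          pos (pairPositions (k + 2) q).2 (Fin.last (k + 1)))) =
      he.particleSchwartz hw (a j) s (outMomentum y) *
        he.wordSchwartz hw (fun m => a (j.succAbove m)) s (pairPositions k r).1 := by
    intro a
    rw [wordSchwartz_apply, wordSchwartz_apply, Fin.prod_univ_succAbove _ j]
    congr 1
    · rw [pos_add, pos_singleConfig, if_pos rfl]
      congr 1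
      exact (add_sub_assoc _ _ _).symm
    · refine Finset.prod_congr rfl fun m _ => ?_
      rw [pos_add, pos_singleConfig, if_neg (Fin.succAbove_ne j m), add_zero]
      rfl
  have e2 : ∀ a : Fin (k + 1) → ι, he.wordSchwartz hw a s
      (firstParticles (pairPositions (k + 2) q).2) = he.particleSchwartz hw (a j) s y.1.2 *
        he.wordSchwartz hw (fun m => a (j.succAbove m)) s (pairPositions k r).2 := by
    intro a
    rw [wordSchwartz_apply, wordSchwartz_apply, Fin.prod_univ_succAbove _ j]
    rfl
  have e3 : (pairWeight (sobolevSymbol α) q : ℂ) =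
      (sobolevSymbol α y.1.1 * sobolevSymbol α y.1.2) *
      (sobolevSymbol α y.2.1 * sobolevSymbol α y.2.2) * pairWeight (sobolevSymbol α) r := by
    rw [pairWeight, Fin.prod_univ_castSucc, Fin.prod_univ_succAbove _ j, pairWeight]
    simp only [hy, hr, collisionCoords]
    push_cast
    ring
  have e4 : pairPhase s q = (oscillation s y.1 *
      oscillation s y.2) * pairPhase s r := by
    rw [pairPhase, Fin.prod_univ_castSucc, Fin.prod_univ_succAbove _ j, pairPhase]
    simp only [hy, hr, collisionCoords]
    ring
  have e5 := he.conj_particleSchwartz_mul_eq_collisionAmplitude h ε (c j) s y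
  have e6 := he.conj_wordSchwartz_mul hw (fun m => c (j.succAbove m)) s r
  rw [collisionKernel, e1, e2, e3, e4, collisionSymbol, ← hy, ← hr, map_mul]
  change profileHat h (ε • (y.2.1 - y.2.2)) * _ * _ = _
  linear_combination (conj (he.wordSchwartz hw (fun m => (c (j.succAbove m)).1) s
    (pairPositions k r).1) * he.wordSchwartz hw (fun m => (c (j.succAbove m)).2) s
    (pairPositions k r).2) * e5 + (collisionAmplitude α e h ε (c j) y *
        Complex.exp (-(Complex.I * (s * collisionFrequency y : ℝ))) *
        ((sobolevSymbol α y.1.1 * sobolevSymbol α y.1.2) *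
          (sobolevSymbol α y.2.1 * sobolevSymbol α y.2.2)) *
        (oscillation s y.1 *
        oscillation s y.2)) * e6

end IsSmoothBasis

end WeightedKernel

section InteractionPicture

variable {ι : Type*} {e : ι → Plane → ℂ} {α : ℝ}

lemma one_le_pairWeight (hα : 0 ≤ α) {n : ℕ} (q : Fin n → Plane × Plane) :
    1 ≤ pairWeight (sobolevSymbol α) q :=
  Finset.one_le_prod fun m _ => one_le_mul_of_one_le_of_one_le (one_le_sobolevSymbol hα (q m).1)
    (one_le_sobolevSymbol hα (q m).2)

lemma continuous_pairWeight {n : ℕ} : Continuous (pairWeight (k := n) (sobolevSymbol α)) := by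
  have := continuous_sobolevSymbol α
  unfold pairWeight
  fun_prop

namespace IsSmoothBasis

lemma integral_conj_wordSchwartz_mul (he : IsSmoothBasis e (sobolevSymbol α)) {n : ℕ}
    (c : Fin n → ι × ι) (s : ℝ) (κ : Config n × Config n → ℂ) :
    ∫ z, conj (he.wordSchwartz (contDiff_sobolevSymbol α) (fun m => (c m).1) s z.1) *
      he.wordSchwartz (contDiff_sobolevSymbol α) (fun m => (c m).2) s z.2 * κ z
        ∂(volume.prod volume) =
      ∫ q, conj (wordFun e c q) * weightedKernel (sobolevSymbol α) s κ q := by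
  rw [← (measurePreserving_pairPositions n).integral_comp']
  refine integral_congr_ae (.of_forall fun q => ?_)
  simp only [he.conj_wordSchwartz_mul, weightedKernel]
  ring

/-- If the matrix elements of a kernel between the evolved test functions are the coefficients of a
square summable family `Y`, then the weighted kernel in the interaction picture is square
integrable, with coefficients `Y` in the orthonormal family of word functions. -/
lemma weightedKernel_ae_eq_synthesis [Countable ι] (he : IsSmoothBasis e (sobolevSymbol α))
    (hα : 0 ≤ α) {n : ℕ} (s : ℝ) {κ : Config n × Config n → ℂ}
    (hκ : MemLp κ 2 (volume.prod volume)) (Y : WordSpace (ι × ι))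
    (hY : ∀ c : Fin n → ι × ι,
      ∫ z, conj (he.wordSchwartz (contDiff_sobolevSymbol α) (fun m => (c m).1) s z.1) *
        he.wordSchwartz (contDiff_sobolevSymbol α) (fun m => (c m).2) s z.2 * κ z
          ∂(volume.prod volume) = Y (List.ofFn c)) :
    weightedKernel (sobolevSymbol α) s κ =ᵐ[volume]
      synthesis (he.orthonormal_wordFun n) Y := by
  set Z := synthesis (he.orthonormal_wordFun n) Y with hZ
  set W : (Fin n → Plane × Plane) → ℂ := fun q => (pairWeight (sobolevSymbol α) q : ℂ) with hW
  have hW1 : ∀ q : Fin n → Plane × Plane, 1 ≤ ‖W q‖ := fun q => by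
    rw [hW, Complex.norm_real]
    exact (one_le_pairWeight hα q).trans (le_abs_self _)
  have hW0 : ∀ q, W q ≠ 0 := fun q => norm_pos_iff.1 (zero_lt_one.trans_le (hW1 q))
  have hWc : Continuous W := Complex.continuous_ofReal.comp continuous_pairWeight
  -- the difference, divided by the weight, is square integrable and orthogonal to a total family
  set u : (Fin n → Plane × Plane) → ℂ :=
    fun q => pairPhase s q * κ (pairPositions n q) - (W q)⁻¹ * Z q with hu
  have hκ' : MemLp (fun q => κ (pairPositions n q)) 2 :=
    hκ.comp_measurePreserving (measurePreserving_pairPositions n)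
  have hu1 : MemLp (fun q => pairPhase s q * κ (pairPositions n q)) 2 :=
    hκ'.of_le ((continuous_pairPhase s).aestronglyMeasurable.mul hκ'.1)
      (.of_forall fun q => by rw [norm_mul, norm_pairPhase, one_mul])
  have hu2 : MemLp (fun q => (W q)⁻¹ * Z q) 2 :=
    (Lp.memLp Z).of_le ((hWc.inv₀ hW0).aestronglyMeasurable.mul (Lp.memLp Z).1)
      (.of_forall fun q => by
        rw [norm_mul, norm_inv]
        exact mul_le_of_le_one_left (norm_nonneg _) (inv_le_one_of_one_le₀ (hW1 q)))
  have hzero : u =ᵐ[volume] 0 := by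
    refine (he.isTotalFamily_wordFun (continuous_sobolevSymbol α) n).eq_zero u (hu1.sub hu2) ?_
    intro c
    have h1 : ∫ q, conj (wordFun e c q) * Z q = Y (List.ofFn c) := by
      have h2 := inner_synthesis (he.orthonormal_wordFun n) Y c
      rw [L2.inner_def] at h2
      rw [← h2]
      refine integral_congr_ae ?_
      filter_upwards [(he.memLp_wordFun c).coeFn_toLp] with q hq
      rw [hq, RCLike.inner_apply, mul_comm]
    have h3 := hY c
    rw [he.integral_conj_wordSchwartz_mul c s κ] at h3
    have h4 : ∀ q, conj (wordFun e c q * W q) * u q =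
        conj (wordFun e c q) * weightedKernel (sobolevSymbol α) s κ q -
          conj (wordFun e c q) * Z q := by
      intro q
      have h5 := hW0 q
      simp only [hu, weightedKernel, map_mul, hW, Complex.conj_ofReal] at h5 ⊢
      field_simp
    refine (integral_congr_ae (Eventually.of_forall h4)).trans ?_
    have i1 : Integrable fun q => conj (wordFun e c q * W q) *
        (pairPhase s q * κ (pairPositions n q)) :=
      (memLp_conj ((he.isTotalFamily_wordFun (continuous_sobolevSymbol α) n).memLp c)).integrable_mul
        hu1
    have i2 : Integrable fun q => conj (wordFun e c q) * Z q :=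
      (memLp_conj (he.memLp_wordFun c)).integrable_mul (Lp.memLp Z)
    rw [integral_sub (i1.congr (.of_forall fun q => ?_)) i2, h3, h1, sub_self]
    simp only [weightedKernel, map_mul, hW, Complex.conj_ofReal]
    ring
  filter_upwards [hzero] with q hq
  have h5 := hW0 q
  have h6 : pairPhase s q * κ (pairPositions n q) = (W q)⁻¹ * Z q := sub_eq_zero.1 hq
  rw [weightedKernel, mul_assoc, h6]
  exact mul_inv_cancel_left₀ h5 _

/-- The regularized collision of the difference of two operators in terms of the coefficients of
the difference in the interaction picture. -/
lemma partialTraceForm_sub_eq [Countable ι] (he : IsSmoothBasis e (sobolevSymbol α))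
    (hα : 1 / 2 < α) {k : ℕ} {A A' : Op (k + 2)} {κ κ' : Config (k + 2) × Config (k + 2) → ℂ}
    (hA : IsFourierKernel A κ) (hA' : IsFourierKernel A' κ') (s : ℝ) (Y : WordSpace (ι × ι))
    (hY : ∀ c : Fin (k + 2) → ι × ι,
      ⟪ofFourier (he.wordSchwartz (contDiff_sobolevSymbol α) (fun m => (c m).1) s),
        (A - A') (ofFourier (he.wordSchwartz (contDiff_sobolevSymbol α) (fun m => (c m).2) s))⟫_ℂ =
        Y (List.ofFn c))
    (h : 𝓢(Plane, ℝ)) (j : Fin (k + 1)) (c : Fin (k + 1) → ι × ι) {ε : ℝ} (hε : 0 < ε) :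
    partialTraceForm (ofFourier (he.wordSchwartz (contDiff_sobolevSymbol α) (fun m => (c m).1) s))
        (mollifiedCommutator h j ε A)
        (ofFourier (he.wordSchwartz (contDiff_sobolevSymbol α) (fun m => (c m).2) s)) -
      partialTraceForm (ofFourier (he.wordSchwartz (contDiff_sobolevSymbol α) (fun m => (c m).1) s))
        (mollifiedCommutator h j ε A')
        (ofFourier (he.wordSchwartz (contDiff_sobolevSymbol α) (fun m => (c m).2) s)) =
      he.collisionFunctional j c hα h hε s Y := by
  set F := he.wordSchwartz (contDiff_sobolevSymbol α) (fun m => (c m).1) s with hF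
  set G := he.wordSchwartz (contDiff_sobolevSymbol α) (fun m => (c m).2) s with hG
  have hFG : ∀ F G : 𝓢(Config (k + 2), ℂ),
      MemLp (fun z : Config (k + 2) × Config (k + 2) => conj (F z.1) * G z.2) 2
        (volume.prod volume) := fun F G => memLp_prod_mul (memLp_conj (F.memLp 2)) (G.memLp 2)
  -- The weighted kernel of the difference is reconstructed from its coefficients.
  have hX := he.weightedKernel_ae_eq_synthesis (by linarith : 0 ≤ α) s (hA.memLp.sub hA'.memLp) Y (fun c => by
      rw [← hY c, sub_apply, inner_sub_right, hA.inner_eq, hA'.inner_eq, ← integral_sub]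
      · refine integral_congr_ae (.of_forall fun z => ?_)
        simp only [Pi.sub_apply]
        ring
      · exact (hFG _ _).integrable_mul hA.memLp
      · exact (hFG _ _).integrable_mul hA'.memLp)
  have hZ := Lp.memLp (synthesis (he.orthonormal_wordFun (k + 2)) Y)
  have e1 : (∫ z, collisionKernel h j ε F G z * κ z ∂(volume.prod volume)) -
      ∫ z, collisionKernel h j ε F G z * κ' z ∂(volume.prod volume) =
      ∫ q, collisionSymbol α e h j c ε s q * synthesis (he.orthonormal_wordFun (k + 2)) Y q := by
    rw [← integral_sub (hA.integrable h j ε F G hε).1 (hA'.integrable h j ε F G hε).1,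
      ← (measurePreserving_pairPositions (k + 2)).integral_comp']
    refine integral_congr_ae ?_
    filter_upwards [hX] with q hq
    rw [← hq, hF, hG, he.collisionKernel_pairPositions, weightedKernel, Pi.sub_apply]
    ring
  have e2 : (∫ z, collisionKernel h j ε G F z * conj (κ z.swap) ∂(volume.prod volume)) -
      ∫ z, collisionKernel h j ε G F z * conj (κ' z.swap) ∂(volume.prod volume) =
      ∫ q, collisionSymbol α e h j (fun m => (c m).swap) ε s q *
        adjointKernel (synthesis (he.orthonormal_wordFun (k + 2)) Y) q := by
    rw [← integral_sub (hA.integrable h j ε F G hε).2 (hA'.integrable h j ε F G hε).2,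
      ← (measurePreserving_pairPositions (k + 2)).integral_comp']
    refine integral_congr_ae ?_
    filter_upwards [(measurePreserving_swapPairs (k + 2)).quasiMeasurePreserving.ae hX] with q hq
    have h1 := adjointKernel_weightedKernel (w := sobolevSymbol α) s (κ - κ') q
    rw [adjointKernel, hq] at h1
    have h2 := he.collisionKernel_pairPositions h j (fun m => (c m).swap) ε s q
    simp only [Prod.fst_swap, Prod.snd_swap] at h2
    rw [adjointKernel, h1, hF, hG, h2, Pi.sub_apply, map_sub]
    ring
  rw [hA.partialTrace_eq h j ε F G hε, hA'.partialTrace_eq h j ε F G hε,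
    collisionFunctional_apply, he.integral_commutatorSymbol j c hα h hε s hZ, ← e1, ← e2, map_sub]
  ring

end IsSmoothBasis

end InteractionPicture

/-! ### Permutation symmetry -/

section Symmetry

/-- Both families become equal after sorting. -/
lemma exists_perm_of_ofFn_perm {β : Type*} {n : ℕ} {f g : Fin n → β}
    (h : (List.ofFn f).Perm (List.ofFn g)) : ∃ σ : Equiv.Perm (Fin n), f = g ∘ σ := by
  let _ : LinearOrder β := IsWellOrder.linearOrder WellOrderingRel
  have h1 : f ∘ Tuple.sort f = g ∘ Tuple.sort g := List.ofFn_injective <|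
    ((((Tuple.sort f).ofFn_comp_perm f).trans h).trans
      ((Tuple.sort g).ofFn_comp_perm g).symm).eq_of_pairwise'
      (Tuple.monotone_sort f).sortedLE_ofFn.pairwise (Tuple.monotone_sort g).sortedLE_ofFn.pairwise
  refine ⟨(Tuple.sort f).symm.trans (Tuple.sort g), funext fun i => ?_⟩
  simpa using congrFun h1 ((Tuple.sort f).symm i)

lemma splitLetter_ofFn_perm {β : Type*} {k : ℕ} (c : Fin k → β) (j : Fin k) (a b : β) :
    (splitLetter j a b (List.ofFn c)).Perm (List.ofFn (collideWord c j a b)) := by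
  have h1 : List.ofFn (collideWord c j a b) = (List.ofFn c).set j a ++ [b] := by
    rw [collideWord, List.ofFn_succ', List.concat_eq_append]
    simp only [Fin.snoc_castSucc, Fin.snoc_last]
    congr 1
    refine List.ext_getElem (by simp) fun i h1 h2 => ?_
    simp [List.getElem_set, Function.update_apply, Fin.ext_iff, eq_comm]
  rw [h1, splitLetter, List.set_eq_take_append_cons_drop, if_pos (by simp), List.append_assoc]
  refine List.Perm.append_left _ ?_
  rw [List.cons_append]
  exact (List.perm_append_singleton b _).symm.cons a

/-- `relabel σ` as a linear isometry. -/
def relabelIsometry {k : ℕ} (σ : Equiv.Perm (Fin k)) : Config k ≃ₗᵢ[ℝ] Config k :=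
  LinearIsometryEquiv.piLpCongrLeft 2 ℝ ℝ (Equiv.prodCongr σ.symm (Equiv.refl (Fin 2)))

lemma relabelIsometry_apply {k : ℕ} (σ : Equiv.Perm (Fin k)) (x : Config k) :
    relabelIsometry σ x = relabel σ x := by
  ext p
  simp [relabelIsometry, relabel, LinearIsometryEquiv.piLpCongrLeft_apply,
    Equiv.piCongrLeft'_apply, Prod.map]

lemma permOp_ofFourier {k : ℕ} (σ : Equiv.Perm (Fin k)) {F F' : 𝓢(Config k, ℂ)}
    (h : ∀ x, F' x = F (relabel σ x)) : permOp σ (ofFourier F) = ofFourier F' := by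
  have h1 : ∀ x, (𝓕⁻ F' : 𝓢(Config k, ℂ)) x = (𝓕⁻ F : 𝓢(Config k, ℂ)) (relabel σ x) := by
    intro x
    have h2 : (F' : Config k → ℂ) = F ∘ relabelIsometry σ := by
      funext y
      rw [h, Function.comp_apply, relabelIsometry_apply]
    rw [SchwartzMap.fourierInv_coe, SchwartzMap.fourierInv_coe, h2,
      Real.fourierInv_comp_linearIsometry, relabelIsometry_apply]
  refine Lp.ext ?_
  have h3 := Lp.coeFn_compMeasurePreserving (ofFourier F) (measurePreserving_relabel σ)
  have h4 := (measurePreserving_relabel σ).quasiMeasurePreserving.ae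
    ((𝓕⁻ F : 𝓢(Config k, ℂ)).coeFn_toLp 2 volume)
  have h5 := (𝓕⁻ F' : 𝓢(Config k, ℂ)).coeFn_toLp 2 volume
  filter_upwards [h3, h4, h5] with x h3 h4 h5
  exact h3.trans (h4.trans ((h1 x).symm.trans h5.symm))

lemma inner_permOp {k : ℕ} (σ : Equiv.Perm (Fin k)) (f g : L2 k) :
    ⟪permOp σ f, permOp σ g⟫_ℂ = ⟪f, g⟫_ℂ :=
  LinearIsometry.inner_map_map _ f g

/-- The matrix elements of a symmetric operator between products of one-particle functions depend
only on the multiset of the factors. -/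
lemma IsSmoothBasis.inner_wordSchwartz_eq_of_perm {ι : Type*} {e : ι → Plane → ℂ} {w : Plane → ℝ}
    (he : IsSmoothBasis e w) (hw : ContDiff ℝ (⊤ : ℕ∞) w) {k : ℕ} {A : Op k}
    (hA : IsPermSymmetric A) {c c' : Fin k → ι × ι} (h : (List.ofFn c).Perm (List.ofFn c')) (s : ℝ) :
    ⟪ofFourier (he.wordSchwartz hw (fun m => (c m).1) s),
        A (ofFourier (he.wordSchwartz hw (fun m => (c m).2) s))⟫_ℂ =
      ⟪ofFourier (he.wordSchwartz hw (fun m => (c' m).1) s),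
        A (ofFourier (he.wordSchwartz hw (fun m => (c' m).2) s))⟫_ℂ := by
  obtain ⟨σ, rfl⟩ := exists_perm_of_ofFn_perm h
  have h1 : ∀ (a : Fin k → ι) (x : Config k), he.wordSchwartz hw a s x =
      he.wordSchwartz hw (fun m => a (σ m)) s (relabel σ x) := by
    intro a x
    rw [wordSchwartz_apply, wordSchwartz_apply, ← Equiv.prod_comp σ]
    rfl
  have h2 : ∀ a : Fin k → ι, ofFourier (he.wordSchwartz hw a s) =
      permOp σ (ofFourier (he.wordSchwartz hw (fun m => a (σ m)) s)) := fun a =>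
    (permOp_ofFourier σ (h1 a)).symm
  have h3 := fun u => DFunLike.congr_fun (hA σ) u
  simp only [ContinuousLinearMap.comp_apply] at h3
  rw [h2 fun m => (c' m).1, h2 fun m => (c' m).2, ← h3, inner_permOp]
  rfl

end Symmetry

/-! ### Matrix elements of integral kernels -/

section KernelForm

/-- The momenta of the pairs as a point of `Λ^k × Λ^k`. The Fourier transform of
`f(𝐱) conj g(𝐱')` is `F(ξ) conj G(-ξ')`, which explains the sign of the second component. -/
def kernelMomenta (k : ℕ) : (Fin k → Plane × Plane) ≃ᵐ PairConfig k :=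
  ((pairPositions k).trans ((MeasurableEquiv.refl _).prodCongr (MeasurableEquiv.neg _))).trans
    (MeasurableEquiv.toLp 2 (Config k × Config k))

lemma kernelMomenta_apply {k : ℕ} (q : Fin k → Plane × Plane) :
    kernelMomenta k q = WithLp.toLp 2 ((pairPositions k q).1, -(pairPositions k q).2) := rfl

lemma measurePreserving_kernelMomenta (k : ℕ) : MeasurePreserving (kernelMomenta k) := by
  have h1 := (MeasurePreserving.id (volume : Measure (Config k))).prod
    (Measure.measurePreserving_neg (volume : Measure (Config k)))
  exact (WithLp.volume_preserving_toLp (Config k) (Config k)).comp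
    (h1.comp (measurePreserving_pairPositions k))

variable {k : ℕ}

/-- The function `F(ξ) conj G(-ξ')`. -/
def pairSchwartz (F G : 𝓢(Config k, ℂ)) (hF : HasCompactSupport F) (hG : HasCompactSupport G) :
    𝓢(PairConfig k, ℂ) :=
  HasCompactSupport.toSchwartzMap (f := fun ζ : PairConfig k => F ζ.fst * conj (G (-ζ.snd)))
    (by
      refine HasCompactSupport.intro ((hF.isCompact.prod hG.isCompact.neg).image
        (WithLp.prod_continuous_toLp 2 _ _)) fun ζ hζ => ?_
      by_contra hne
      refine hζ ⟨(ζ.fst, ζ.snd), ⟨subset_tsupport _ (left_ne_zero_of_mul hne), ?_⟩, rfl⟩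
      refine subset_tsupport _ fun h0 => ?_
      exact hne (by rw [h0, map_zero, mul_zero]))
    (by
      have h1 := (F.smooth ⊤).comp (WithLp.fstL 2 ℝ (Config k) (Config k)).contDiff
      have h2 := (G.smooth ⊤).comp (WithLp.sndL 2 ℝ (Config k) (Config k)).contDiff.neg
      exact h1.mul (Complex.conjCLE.contDiff.comp h2))

lemma pairSchwartz_apply (F G : 𝓢(Config k, ℂ)) (hF : HasCompactSupport F)
    (hG : HasCompactSupport G) (ζ : PairConfig k) :
    pairSchwartz F G hF hG ζ = F ζ.fst * conj (G (-ζ.snd)) := rfl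

lemma fourierInv_pairSchwartz (F G : 𝓢(Config k, ℂ)) (hF : HasCompactSupport F)
    (hG : HasCompactSupport G) (z : PairConfig k) :
    (𝓕⁻ (pairSchwartz F G hF hG) : 𝓢(PairConfig k, ℂ)) z =
      (𝓕⁻ F : 𝓢(Config k, ℂ)) z.fst * conj ((𝓕⁻ G : 𝓢(Config k, ℂ)) z.snd) := by
  simp only [SchwartzMap.fourierInv_coe, Real.fourierInv_eq]
  rw [← (WithLp.volume_preserving_toLp (Config k) (Config k)).integral_comp
    (MeasurableEquiv.toLp 2 (Config k × Config k)).measurableEmbedding, ← integral_conj,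
    ← integral_neg_eq_self (fun v => conj (Real.fourierChar (inner ℝ v z.snd) • G v)),
    Measure.volume_eq_prod, ← integral_prod_mul]
  refine integral_congr_ae (.of_forall fun v => ?_)
  simp only [pairSchwartz_apply, WithLp.prod_inner_apply, AddChar.map_add_eq_mul,
    Circle.smul_def, smul_eq_mul, map_mul, inner_neg_left, AddChar.map_neg_eq_inv,
    Circle.coe_mul, Circle.coe_inv_eq_conj, Complex.conj_conj]
  change _ * (F v.1 * conj (G (-v.2))) = Real.fourierChar (inner ℝ v.1 z.ofLp.1) * F v.1 *
    (Real.fourierChar (inner ℝ v.2 z.ofLp.2) * conj (G (-v.2)))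
  ring

/-- Matrix elements of a kernel as inner products on `L²(Λ^k × Λ^k)`. -/
lemma kernelForm_ofFourier (F G : 𝓢(Config k, ℂ)) (hF : HasCompactSupport F)
    (hG : HasCompactSupport G) (K : KernelSpace k) :
    kernelForm (ofFourier F) K (ofFourier G) = ⟪ofFourier (pairSchwartz F G hF hG), K⟫_ℂ := by
  rw [L2.inner_def, kernelForm]
  have h1 := (𝓕⁻ (pairSchwartz F G hF hG) : 𝓢(PairConfig k, ℂ)).coeFn_toLp 2 volume
  have hp := (WithLp.volume_preserving_ofLp (Config k) (Config k)).quasiMeasurePreserving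
  have h2 := (Measure.quasiMeasurePreserving_fst.comp hp).ae
    ((𝓕⁻ F : 𝓢(Config k, ℂ)).coeFn_toLp 2 volume)
  have h3 := (Measure.quasiMeasurePreserving_snd.comp hp).ae
    ((𝓕⁻ G : 𝓢(Config k, ℂ)).coeFn_toLp 2 volume)
  refine integral_congr_ae ?_
  filter_upwards [h1, h2, h3] with z h1 h2 h3
  have e1 : (ofFourier F : L2 k) z.fst = (𝓕⁻ F : 𝓢(Config k, ℂ)) z.fst := h2
  have e2 : (ofFourier G : L2 k) z.snd = (𝓕⁻ G : 𝓢(Config k, ℂ)) z.snd := h3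
  have e3 : (ofFourier (pairSchwartz F G hF hG) : KernelSpace k) z =
    (𝓕⁻ (pairSchwartz F G hF hG) : 𝓢(PairConfig k, ℂ)) z := h1
  rw [e1, e2, e3, fourierInv_pairSchwartz, RCLike.inner_apply, map_mul, Complex.conj_conj]
  ring

lemma fourier_fourierFlow {E : Type*} [NormedAddCommGroup E] [InnerProductSpace ℝ E]
    [FiniteDimensional ℝ E] [MeasurableSpace E] [BorelSpace E] (θ : C(E, ℝ)) (t : ℝ)
    (u : Lp ℂ 2 (volume : Measure E)) :
    (𝓕 (fourierFlow θ t u) : Lp ℂ 2 (volume : Measure E)) =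
      mulOp (phase θ t) volume (𝓕 u) :=
  (Lp.fourierTransformₗᵢ E ℂ).apply_symm_apply _

/-- The free evolution of a kernel for the time `t - s` is undone by evolving the test functions
backwards. -/
lemma inner_ofFourier_freeKernel {Φ Ψ : 𝓢(PairConfig k, ℂ)} (τ : ℝ)
    (h : ∀ ζ, Φ ζ = Ψ ζ * phase (pairSymbol k) τ ζ) (K : KernelSpace k) :
    ⟪ofFourier Φ, freeKernel τ K⟫_ℂ = ⟪ofFourier Ψ, K⟫_ℂ := by
  rw [inner_ofFourier_left, inner_ofFourier_left, freeKernel, fourier_fourierFlow]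
  refine integral_congr_ae ?_
  filter_upwards [coeFn_mulOp (phase (pairSymbol k) τ) volume (𝓕 K : KernelSpace k)] with ζ hζ
  have h1 : conj (phase (pairSymbol k) τ ζ) * phase (pairSymbol k) τ ζ = 1 := by
    rw [RCLike.conj_mul, phase]
    change ((‖Complex.exp (-(Complex.I * ((τ * pairSymbol k ζ : ℝ) : ℂ)))‖ : ℂ)) ^ 2 = 1
    rw [norm_cexp_neg_I_mul]
    simp
  rw [hζ, h, map_mul]
  linear_combination conj (Ψ ζ) * (𝓕 K : KernelSpace k) ζ * h1

end KernelForm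

section KernelTest

variable {ι : Type*} {e : ι → Plane → ℂ} {w : Plane → ℝ} {k : ℕ}

namespace IsSmoothBasis

lemma hasCompactSupport_wordSchwartz (he : IsSmoothBasis e w) (hw : ContDiff ℝ (⊤ : ℕ∞) w)
    (c : Fin k → ι) (t : ℝ) : HasCompactSupport (he.wordSchwartz hw c t) :=
  hasCompactSupport_prod fun m => he.hasCompactSupport_particle (c m) t

/-- The test function on `Λ^k × Λ^k`, in Fourier variables, whose pairing with the kernel of an
operator is its matrix element between the two products of one-particle functions given by `c`. -/
def kernelTest (he : IsSmoothBasis e w) (hw : ContDiff ℝ (⊤ : ℕ∞) w) (c : Fin k → ι × ι) (t : ℝ) :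
    𝓢(PairConfig k, ℂ) :=
  pairSchwartz (he.wordSchwartz hw (fun m => (c m).1) t) (he.wordSchwartz hw (fun m => (c m).2) t)
    (he.hasCompactSupport_wordSchwartz hw _ t) (he.hasCompactSupport_wordSchwartz hw _ t)

lemma kernelForm_wordSchwartz (he : IsSmoothBasis e w) (hw : ContDiff ℝ (⊤ : ℕ∞) w)
    (c : Fin k → ι × ι) (t : ℝ) (K : KernelSpace k) :
    kernelForm (ofFourier (he.wordSchwartz hw (fun m => (c m).1) t)) K
      (ofFourier (he.wordSchwartz hw (fun m => (c m).2) t)) =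
      ⟪ofFourier (he.kernelTest hw c t), K⟫_ℂ :=
  kernelForm_ofFourier _ _ _ _ K

lemma inner_kernelTest_freeKernel (he : IsSmoothBasis e w) (hw : ContDiff ℝ (⊤ : ℕ∞) w)
    (c : Fin k → ι × ι) (s t : ℝ) (K : KernelSpace k) :
    ⟪ofFourier (he.kernelTest hw c t), freeKernel (t - s) K⟫_ℂ =
      ⟪ofFourier (he.kernelTest hw c s), K⟫_ℂ := by
  refine inner_ofFourier_freeKernel (t - s) (fun ζ => ?_) K
  have h1 : laplaceSymbol k (-ζ.snd) = laplaceSymbol k ζ.snd := by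
    change 4 * Real.pi ^ 2 * ‖-ζ.snd‖ ^ 2 = 4 * Real.pi ^ 2 * ‖ζ.snd‖ ^ 2
    rw [norm_neg]
  have h2 : phase (pairSymbol k) (t - s) ζ = Complex.exp (-(Complex.I *
      (((t - s) * (laplaceSymbol k ζ.fst - laplaceSymbol k ζ.snd) : ℝ) : ℂ))) := rfl
  simp only [kernelTest, pairSchwartz_apply, wordSchwartz_eq, map_mul, conj_cexp_neg_I_mul, h1, h2]
  have h3 : ∀ A B a b c d f : ℂ, a * b = c * d * f → A * a * (B * b) = A * c * (B * d) * f := by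
    intro A B a b c d f h
    linear_combination A * B * h
  refine h3 _ _ _ _ _ _ _ ?_
  simp only [← Complex.exp_add]
  congr 1
  push_cast
  ring

lemma conj_kernelTest_kernelMomenta (he : IsSmoothBasis e w) (hw : ContDiff ℝ (⊤ : ℕ∞) w)
    (c : Fin k → ι × ι) (s : ℝ) (q : Fin k → Plane × Plane) :
    conj (he.kernelTest hw c s (kernelMomenta k q)) =
      conj (wordFun e c q) * (pairWeight w q * pairPhase s q) := by
  rw [← he.conj_wordSchwartz_mul hw c s q, kernelTest, pairSchwartz_apply, map_mul,
    Complex.conj_conj, kernelMomenta_apply]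
  change _ * he.wordSchwartz hw (fun m => (c m).2) s (-(-(pairPositions k q).2)) = _
  rw [neg_neg]
  rfl

lemma sobolevWeight_kernelMomenta (α : ℝ) (q : Fin k → Plane × Plane) :
    sobolevWeight α (kernelMomenta k q) = pairWeight (sobolevSymbol α) q := by
  refine Finset.prod_congr rfl fun m _ => ?_
  have h1 : pos (-(pairPositions k q).2) m = -(q m).2 := rfl
  change (1 + 4 * Real.pi ^ 2 * ‖(q m).1‖ ^ 2) ^ (α / 2) *
    (1 + 4 * Real.pi ^ 2 * ‖pos (-(pairPositions k q).2) m‖ ^ 2) ^ (α / 2) = _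
  rw [h1, norm_neg]
  rfl

/-- Bessel's inequality: the matrix elements of `K` between weighted test functions are
coefficients of `S^{(k,α)} K` in an orthonormal family. -/
lemma sum_norm_inner_kernelTest_sq_le {α : ℝ} (he : IsSmoothBasis e (sobolevSymbol α))
    {K G : KernelSpace k} (hG : IsSobolevImage α K G) (s : ℝ) (S : Finset (Fin k → ι × ι)) :
    ∑ c ∈ S, ‖⟪ofFourier (he.kernelTest (contDiff_sobolevSymbol α) c s), K⟫_ℂ‖ ^ 2 ≤
      ‖G‖ ^ 2 := by
  set g : KernelSpace k := 𝓕 G with hg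
  have hgm : MemLp (fun q => g (kernelMomenta k q)) 2 :=
    (Lp.memLp g).comp_measurePreserving (measurePreserving_kernelMomenta k)
  have hV : MemLp (fun q => pairPhase s q * g (kernelMomenta k q)) 2 :=
    hgm.of_le ((continuous_pairPhase s).aestronglyMeasurable.mul hgm.1)
      (.of_forall fun q => by rw [norm_mul, norm_pairPhase, one_mul])
  have h1 : ∀ c : Fin k → ι × ι,
      ⟪ofFourier (he.kernelTest (contDiff_sobolevSymbol α) c s), K⟫_ℂ =
        ⟪(he.memLp_wordFun c).toLp _, hV.toLp _⟫_ℂ := by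
    intro c
    rw [inner_ofFourier_left, L2.inner_def,
      ← (measurePreserving_kernelMomenta k).integral_comp']
    refine integral_congr_ae ?_
    filter_upwards [(he.memLp_wordFun c).coeFn_toLp, hV.coeFn_toLp,
      (measurePreserving_kernelMomenta k).quasiMeasurePreserving.ae hG] with q h2 h3 h4
    rw [h2, h3, RCLike.inner_apply, he.conj_kernelTest_kernelMomenta, hg, h4,
      sobolevWeight_kernelMomenta]
    ring
  have h5 : ‖hV.toLp _‖ = ‖G‖ := by
    rw [← Lp.norm_fourier_eq G, ← hg, Lp.norm_toLp, Lp.norm_def]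
    congr 1
    rw [← eLpNorm_comp_measurePreserving (Lp.aestronglyMeasurable g)
      (measurePreserving_kernelMomenta k)]
    refine eLpNorm_congr_norm_ae (.of_forall fun q => ?_)
    rw [norm_mul, norm_pairPhase, one_mul, Function.comp_apply]
  simp only [h1]
  rw [← h5]
  exact (he.orthonormal_wordFun k).sum_inner_products_le _

end IsSmoothBasis

end KernelTest

/-! ### Kernels of the collision terms -/

section Solutions

variable {ι : Type*} {e : ι → Plane → ℂ} {h : 𝓢(Plane, ℝ)} {b₀ T : ℝ} {J : ∀ k, ℕ → Op k}
  {Γ : ∀ k, Op k} {γ γ' : ∀ k, ℝ → Op k}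

/-- `B` is a choice of the kernels of the collision terms of a solution `γ` of the hierarchy. -/
structure IsCollisionKernel (h : 𝓢(Plane, ℝ)) (b₀ T : ℝ) (Γ : ∀ k, Op k) (γ : ∀ k, ℝ → Op k)
    (B : ∀ k, Fin k → ℝ → KernelSpace k) : Prop where
  hasCollision : ∀ k j, ∀ s ∈ Icc 0 T, HasCollision h j (γ (k + 1) s) (B k j s)
  intervalIntegrable : ∀ k j, ∀ t ∈ Icc 0 T,
    IntervalIntegrable (fun s => freeKernel (t - s) (B k j s)) volume 0 t
  hasKernel : ∀ k, 1 ≤ k → ∀ t ∈ Icc 0 T, HasKernel (γ k t - freeOp t (Γ k))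
    (-(Complex.I * (b₀ : ℂ)) • ∑ j, ∫ s in (0 : ℝ)..t, freeKernel (t - s) (B k j s))

lemma IsHierarchySolution.exists_isCollisionKernel (hγ : IsHierarchySolution h b₀ T J Γ γ) :
    ∃ B, IsCollisionKernel h b₀ T Γ γ B := by
  have h1 : ∀ k, ∃ B : Fin k → ℝ → KernelSpace k, 1 ≤ k →
      (∀ j, ∀ s ∈ Icc 0 T, HasCollision h j (γ (k + 1) s) (B j s)) ∧ ∀ t ∈ Icc 0 T,
        (∀ j, IntervalIntegrable (fun s => freeKernel (t - s) (B j s)) volume 0 t) ∧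
        HasKernel (γ k t - freeOp t (Γ k))
          (-(Complex.I * (b₀ : ℂ)) • ∑ j, ∫ s in (0 : ℝ)..t, freeKernel (t - s) (B j s)) := by
    intro k
    by_cases hk : 1 ≤ k
    · obtain ⟨B, hB⟩ := hγ.equation k hk
      exact ⟨B, fun _ => hB⟩
    · exact ⟨0, fun h => absurd h hk⟩
  choose B hB using h1
  have hpos : ∀ {k} (_ : Fin k), 1 ≤ k := fun j => j.pos
  exact ⟨B, fun k j => (hB k (hpos j)).1 j, fun k j t ht => ((hB k (hpos j)).2 t ht).1 j,
    fun k hk t ht => ((hB k hk).2 t ht).2⟩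

/-- Kernels of the collision terms are determined by the operators, on Schwartz functions. -/
lemma HasCollision.kernelForm_eq {k : ℕ} {j : Fin k} {A : Op (k + 1)} {K K' : KernelSpace k}
    (hK : HasCollision h j A K) (hK' : HasCollision h j A K') (F G : 𝓢(Config k, ℂ)) :
    kernelForm (ofFourier F) K (ofFourier G) = kernelForm (ofFourier F) K' (ofFourier G) :=
  tendsto_nhds_unique (hK (𝓕⁻ F) (𝓕⁻ G)) (hK' (𝓕⁻ F) (𝓕⁻ G))

namespace IsCollisionKernel

variable {α : ℝ} {B B' : ∀ k, Fin k → ℝ → KernelSpace k} {w : Plane → ℝ}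

lemma intervalIntegrable_inner (hB : IsCollisionKernel h b₀ T Γ γ B) (he : IsSmoothBasis e w)
    (hw : ContDiff ℝ (⊤ : ℕ∞) w) {k : ℕ} (c : Fin k → ι × ι) (j : Fin k) {t : ℝ}
    (ht : t ∈ Icc 0 T) :
    IntervalIntegrable (fun s => ⟪ofFourier (he.kernelTest hw c s), B k j s⟫_ℂ) volume 0 t := by
  have h1 := hB.intervalIntegrable k j t ht
  rw [intervalIntegrable_iff] at h1 ⊢
  refine (h1.const_inner (ofFourier (he.kernelTest hw c t))).congr
    (.of_forall fun s => ?_)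
  exact he.inner_kernelTest_freeKernel hw c s t _

/-- Duhamel's formula for the matrix elements in the interaction picture. -/
lemma inner_wordSchwartz_eq (hB : IsCollisionKernel h b₀ T Γ γ B) (he : IsSmoothBasis e w)
    (hw : ContDiff ℝ (⊤ : ℕ∞) w) {k : ℕ} (hk : 1 ≤ k) (c : Fin k → ι × ι) {t : ℝ}
    (ht : t ∈ Icc 0 T) :
    ⟪ofFourier (he.wordSchwartz hw (fun m => (c m).1) t), (γ k t - freeOp t (Γ k))
      (ofFourier (he.wordSchwartz hw (fun m => (c m).2) t))⟫_ℂ =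
      -(Complex.I * (b₀ : ℂ)) *
        ∑ j, ∫ s in (0 : ℝ)..t, ⟪ofFourier (he.kernelTest hw c s), B k j s⟫_ℂ := by
  rw [hB.hasKernel k hk t ht, he.kernelForm_wordSchwartz, inner_smul_right, inner_sum]
  congr 1
  refine Finset.sum_congr rfl fun j _ => ?_
  rw [← innerSL_apply_apply ℂ,
    ← ContinuousLinearMap.intervalIntegral_comp_comm _ (hB.intervalIntegrable k j t ht)]
  exact intervalIntegral.integral_congr fun s _ => he.inner_kernelTest_freeKernel hw c s t _

/-- Bessel's inequality for the difference of two collision terms. -/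
lemma sum_norm_inner_sub_sq_le (hB : IsCollisionKernel h b₀ T Γ γ B)
    (hB' : IsCollisionKernel h b₀ T Γ γ' B') (he : IsSmoothBasis e (sobolevSymbol α)) {C C' : ℝ}
    (hC : CollisionBound h α T C γ) (hC' : CollisionBound h α T C' γ') {k : ℕ} (j : Fin k) {s : ℝ}
    (hs : s ∈ Icc 0 T) (S : Finset (Fin k → ι × ι)) :
    ∑ c ∈ S, ‖⟪ofFourier (he.kernelTest (contDiff_sobolevSymbol α) c s),
      B k j s - B' k j s⟫_ℂ‖ ^ 2 ≤ ((|C| + |C'|) ^ k) ^ 2 := by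
  obtain ⟨K, G, hK, hG, hGC⟩ := hC k j.pos j s hs
  obtain ⟨K', G', hK', hG', hGC'⟩ := hC' k j.pos j s hs
  have h1 : ∀ c : Fin k → ι × ι, ⟪ofFourier (he.kernelTest (contDiff_sobolevSymbol α) c s),
      B k j s - B' k j s⟫_ℂ =
      ⟪ofFourier (he.kernelTest (contDiff_sobolevSymbol α) c s), K - K'⟫_ℂ := by
    intro c
    rw [inner_sub_right, inner_sub_right]
    simp only [← he.kernelForm_wordSchwartz]
    rw [(hB.hasCollision k j s hs).kernelForm_eq hK, (hB'.hasCollision k j s hs).kernelForm_eq hK']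
  have h2 : IsSobolevImage α (K - K') (G - G') := by
    have e1 : (𝓕 (G - G') : KernelSpace k) = 𝓕 G - 𝓕 G' :=
      map_sub (Lp.fourierTransformₗᵢ (PairConfig k) ℂ) G G'
    have e2 : (𝓕 (K - K') : KernelSpace k) = 𝓕 K - 𝓕 K' :=
      map_sub (Lp.fourierTransformₗᵢ (PairConfig k) ℂ) K K'
    rw [IsSobolevImage, e1, e2]
    filter_upwards [hG, hG', Lp.coeFn_sub (𝓕 G : KernelSpace k) (𝓕 G'),
      Lp.coeFn_sub (𝓕 K : KernelSpace k) (𝓕 K')] with ζ h3 h4 h5 h6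
    rw [h5, h6, Pi.sub_apply, Pi.sub_apply, h3, h4]
    ring
  simp only [h1]
  refine (he.sum_norm_inner_kernelTest_sq_le h2 s S).trans ?_
  refine pow_le_pow_left₀ (norm_nonneg _) ((norm_sub_le _ _).trans ?_) 2
  have h3 : ∀ x : ℝ, x ^ k ≤ |x| ^ k := fun x => (le_abs_self _).trans_eq (abs_pow x k)
  exact (add_le_add (hGC.trans (h3 C)) (hGC'.trans (h3 C'))).trans
    (pow_add_pow_le (abs_nonneg _) (abs_nonneg _) j.pos.ne')

end IsCollisionKernel

end Solutions

/-! ### Coefficients of the difference of two solutions -/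

section Coefficients

/-- A family of functions of finite tuples, as a function of lists. -/
def onWords {β M : Type*} (f : ∀ k, (Fin k → β) → M) (C : List β) : M := f C.length C.get

lemma onWords_ofFn {β M : Type*} (f : ∀ k, (Fin k → β) → M) {n : ℕ} (c : Fin n → β) :
    onWords f (List.ofFn c) = f n c :=
  congrArg (fun p : Σ n, Fin n → β => f p.1 p.2) (List.equivSigmaTuple.apply_symm_apply ⟨n, c⟩)

variable {ι : Type*} {e : ι → Plane → ℂ} {h : 𝓢(Plane, ℝ)} {b₀ T : ℝ} {J : ∀ k, ℕ → Op k}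
  {Γ : ∀ k, Op k} {γ γ' : ∀ k, ℝ → Op k} {α : ℝ} {B B' : ∀ k, Fin k → ℝ → KernelSpace k}

/-- The coefficients of `γ - γ'` in the interaction picture; the empty word plays no role. -/
def IsSmoothBasis.differenceCoeff (he : IsSmoothBasis e (sobolevSymbol α)) (γ γ' : ∀ k, ℝ → Op k)
    (C : List (ι × ι)) (t : ℝ) : ℂ :=
  onWords (fun k c => if k = 0 then 0 else
    ⟪ofFourier (he.wordSchwartz (contDiff_sobolevSymbol α) (fun m => (c m).1) t), (γ k t - γ' k t)
      (ofFourier (he.wordSchwartz (contDiff_sobolevSymbol α) (fun m => (c m).2) t))⟫_ℂ) C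

/-- The coefficients of the difference of the collision terms in the interaction picture. -/
def IsSmoothBasis.sourceCoeff (he : IsSmoothBasis e (sobolevSymbol α))
    (B B' : ∀ k, Fin k → ℝ → KernelSpace k) (j : ℕ) (C : List (ι × ι)) (s : ℝ) : ℂ :=
  onWords (fun k c => if hj : j < k then
    ⟪ofFourier (he.kernelTest (contDiff_sobolevSymbol α) c s),
      B k ⟨j, hj⟩ s - B' k ⟨j, hj⟩ s⟫_ℂ else 0) C

lemma IsSmoothBasis.differenceCoeff_ofFn (he : IsSmoothBasis e (sobolevSymbol α)) {k : ℕ}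
    (hk : k ≠ 0) (c : Fin k → ι × ι) (t : ℝ) : he.differenceCoeff γ γ' (List.ofFn c) t =
      ⟪ofFourier (he.wordSchwartz (contDiff_sobolevSymbol α) (fun m => (c m).1) t),
        (γ k t - γ' k t) (ofFourier (he.wordSchwartz (contDiff_sobolevSymbol α)
          (fun m => (c m).2) t))⟫_ℂ := by
  rw [differenceCoeff, onWords_ofFn, if_neg hk]

lemma IsSmoothBasis.differenceCoeff_eq_of_perm (he : IsSmoothBasis e (sobolevSymbol α)) {k : ℕ}
    {t : ℝ} (hγ : IsPermSymmetric (γ k t)) (hγ' : IsPermSymmetric (γ' k t)) {D D' : List (ι × ι)}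
    (hD : D.length = k) (h : D.Perm D') :
    he.differenceCoeff γ γ' D t = he.differenceCoeff γ γ' D' t := by
  obtain ⟨c, rfl⟩ : ∃ c : Fin k → ι × ι, D = List.ofFn c := by
    subst hD
    exact ⟨D.get, (List.ofFn_get D).symm⟩
  obtain ⟨c', rfl⟩ : ∃ c : Fin k → ι × ι, D' = List.ofFn c := by
    have hD' : k = D'.length := hD.symm.trans h.length_eq
    subst hD'
    exact ⟨D'.get, (List.ofFn_get D').symm⟩
  rcases eq_or_ne k 0 with rfl | hk
  · rw [Subsingleton.elim c c']
  · rw [he.differenceCoeff_ofFn hk, he.differenceCoeff_ofFn hk]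
    refine he.inner_wordSchwartz_eq_of_perm _ (fun σ => ?_) h t
    rw [ContinuousLinearMap.comp_sub, ContinuousLinearMap.sub_comp, hγ σ, hγ' σ]

lemma IsSmoothBasis.sourceCoeff_ofFn (he : IsSmoothBasis e (sobolevSymbol α)) {k : ℕ}
    (j : Fin k) (c : Fin k → ι × ι) (s : ℝ) : he.sourceCoeff B B' j (List.ofFn c) s =
      ⟪ofFourier (he.kernelTest (contDiff_sobolevSymbol α) c s), B k j s - B' k j s⟫_ℂ := by
  rw [sourceCoeff, onWords_ofFn, dif_pos j.2]

/-- The coefficients of the difference are primitives of those of the collision terms, which are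
bounded by the assumed bound on collisions. -/
lemma IsCollisionKernel.isWordEquation (hB : IsCollisionKernel h b₀ T Γ γ B)
    (hB' : IsCollisionKernel h b₀ T Γ γ' B') (he : IsSmoothBasis e (sobolevSymbol α)) {C C' : ℝ}
    (hT : 0 ≤ T) (hC : CollisionBound h α T C γ) (hC' : CollisionBound h α T C' γ') :
    IsWordEquation T (|C| + |C'|).toNNReal (-(Complex.I * (b₀ : ℂ))) (he.differenceCoeff γ γ')
      (he.sourceCoeff B B') where
  measurable j D hj := by
    obtain ⟨n, c, rfl⟩ : ∃ n, ∃ c : Fin n → ι × ι, D = List.ofFn c :=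
      ⟨_, D.get, (List.ofFn_get D).symm⟩
    rw [List.length_ofFn] at hj
    have h1 := ((hB.intervalIntegrable_inner he (contDiff_sobolevSymbol α) c ⟨j, hj⟩
      (right_mem_Icc.2 hT)).sub (hB'.intervalIntegrable_inner he (contDiff_sobolevSymbol α) c
        ⟨j, hj⟩ (right_mem_Icc.2 hT))).1.aestronglyMeasurable
    refine h1.congr (.of_forall fun s => ?_)
    exact (inner_sub_right _ _ _).symm.trans (he.sourceCoeff_ofFn ⟨j, hj⟩ c s).symm
  bound k j hj s hs F hF := by
    rw [← Finset.sum_preimage List.ofFn F (List.ofFn_injective (n := k)).injOn]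
    · rw [Real.coe_toNNReal _ (by positivity)]
      refine le_trans (le_of_eq (Finset.sum_congr rfl fun c _ => ?_))
        (hB.sum_norm_inner_sub_sq_le hB' he hC hC' ⟨j, hj⟩ hs _)
      rw [← he.sourceCoeff_ofFn]
    · intro D hD hD'
      have h1 := hF D hD
      subst h1
      exact absurd ⟨D.get, List.ofFn_get D⟩ hD'
  equation D t ht := by
    obtain ⟨n, c, rfl⟩ : ∃ n, ∃ c : Fin n → ι × ι, D = List.ofFn c :=
      ⟨_, D.get, (List.ofFn_get D).symm⟩
    rcases eq_or_ne n 0 with rfl | hn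
    · rw [IsSmoothBasis.differenceCoeff, onWords_ofFn, if_pos rfl, List.length_ofFn,
        Finset.range_zero, Finset.sum_empty, mul_zero]
    · have hw := contDiff_sobolevSymbol α
      have h1 := hB.inner_wordSchwartz_eq he hw (Nat.one_le_iff_ne_zero.2 hn) c ht
      have h2 := hB'.inner_wordSchwartz_eq he hw (Nat.one_le_iff_ne_zero.2 hn) c ht
      rw [he.differenceCoeff_ofFn hn, ← sub_sub_sub_cancel_right (γ n t) (γ' n t) (freeOp t (Γ n)),
        sub_apply, inner_sub_right, h1, h2, List.length_ofFn, Finset.sum_range, ← mul_sub,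
        ← Finset.sum_sub_distrib]
      congr 1
      refine Finset.sum_congr rfl fun j _ => ?_
      rw [← intervalIntegral.integral_sub (hB.intervalIntegrable_inner he hw c j ht)
        (hB'.intervalIntegrable_inner he hw c j ht)]
      refine intervalIntegral.integral_congr fun s _ => ?_
      simp only [he.sourceCoeff_ofFn, inner_sub_right]

lemma tendsto_one_div_nat_nhdsGT :
    Tendsto (fun n : ℕ => 1 / ((n : ℝ) + 1)) atTop (𝓝[>] 0) :=
  tendsto_nhdsWithin_iff.2 ⟨tendsto_one_div_add_atTop_nhds_zero_nat,
    Eventually.of_forall fun _ => mem_Ioi.2 Nat.one_div_pos_of_nat⟩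

open Classical in
/-- The collision terms are the sums over all intermediate letters of the coefficients of the next
level: the error made by restricting the letters to a finite set is bounded by the sources outside
of the finite set, uniformly in the regularization of the delta function. -/
lemma IsCollisionKernel.tendsto_sourceCoeff [Countable ι] (hB : IsCollisionKernel h b₀ T Γ γ B)
    (hB' : IsCollisionKernel h b₀ T Γ γ' B') (hh : ∫ x, h x = 1)
    (hγ : IsHierarchySolution h b₀ T J Γ γ) (hγ' : IsHierarchySolution h b₀ T J Γ γ')
    (he : IsSmoothBasis e (sobolevSymbol α)) (hα : 1 / 2 < α) {C C' : ℝ}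
    (hT : 0 ≤ T) (hC : CollisionBound h α T C γ) (hC' : CollisionBound h α T C' γ')
    (D : List (ι × ι)) (j : ℕ) (d : ι × ι) (hj : D[j]? = some d) :
    Tendsto (fun S : Finset (ι × ι) => ∫⁻ s in Ioc 0 T, ‖he.sourceCoeff B B' j D s -
      ∑ a ∈ S, ∑ b ∈ S, pairCoeff α e d a b s *
        he.differenceCoeff γ γ' (splitLetter j a b D) s‖ₑ) atTop (𝓝 0) := by
  obtain ⟨n, c, rfl⟩ : ∃ n, ∃ c : Fin n → ι × ι, D = List.ofFn c :=
    ⟨_, D.get, (List.ofFn_get D).symm⟩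
  obtain ⟨hjn, rfl⟩ := List.getElem?_eq_some_iff.1 hj
  rw [List.length_ofFn] at hjn
  obtain ⟨k, rfl⟩ : ∃ k, n = k + 1 := ⟨n - 1, by omega⟩
  obtain ⟨i, rfl⟩ : ∃ i : Fin (k + 1), j = i := ⟨⟨j, hjn⟩, rfl⟩
  simp only [List.getElem_ofFn]
  have hword := hB.isWordEquation hB' he hT hC hC'
  obtain ⟨g, hg, hgi, hgl⟩ := hword.exists_source_curve (k + 2) (left_mem_Icc.2 hT)
    (right_mem_Icc.2 hT) hT
  obtain ⟨M, hM⟩ := exists_resonanceBound hα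
  set X : ℝ → WordSpace (ι × ι) := fun s => ∫ r in (0 : ℝ)..s, g r with hX
  -- The coefficients of level `k + 2` form a primitive in `WordSpace`.
  have hXw : ∀ s ∈ Ioc 0 T, ∀ c' : Fin (k + 2) → ι × ι,
      X s (List.ofFn c') = he.differenceCoeff γ γ' (List.ofFn c') s := by
    intro s hs c'
    rw [hword.eq_integral_source _ (Ioc_subset_Icc_self hs), hX]
    have hgs : IntervalIntegrable g volume 0 s :=
      (intervalIntegrable_iff_integrableOn_Ioc_of_le hs.1.le).2
        (hgi.mono_set (Ioc_subset_Ioc_right hs.2))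
    refine ((lp.evalCLM ℂ (fun _ : List (ι × ι) => ℂ) 2
      (List.ofFn c')).intervalIntegral_comp_comm hgs).symm.trans ?_
    refine intervalIntegral.integral_congr_ae (.of_forall fun r hr => ?_)
    rw [uIoc_of_le hs.1.le] at hr
    exact (hg r ⟨hr.1, hr.2.trans hs.2⟩ _).trans (if_pos List.length_ofFn)
  set ε : ℕ → ℝ := fun n => 1 / ((n : ℝ) + 1) with hε
  have hε0 : ∀ n, 0 < ε n := fun n => Nat.one_div_pos_of_nat
  set κ : NNReal := 4 * ((Real.exp (T ^ 2)).toNNReal * ((√Real.pi).toNNReal * (profileSup h * M)))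
  have hbound : ∀ S : Finset (ι × ι), (∀ m, c m ∈ S) →
      ∫⁻ s in Ioc 0 T, ‖he.sourceCoeff B B' i (List.ofFn c) s -
        ∑ a ∈ S, ∑ b ∈ S, pairCoeff α e (c i) a b s *
          he.differenceCoeff γ γ' (splitLetter i a b (List.ofFn c)) s‖ₑ ≤
      ENNReal.ofReal (√(T * κ)) *
        ∫⁻ r in Ioc 0 T, ‖g r - truncWords S (k + 2) (g r)‖ₑ := by
    intro S hS
    let P : WordSpace (ι × ι) →L[ℂ] WordSpace (ι × ι) :=
      LinearMap.mkContinuous { toFun := fun Y => truncWords S (k + 2) Y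
                               map_add' := fun Y Z => by rw [lp.coeFn_add, map_add]
                               map_smul' := fun r Y => by rw [lp.coeFn_smul, map_smul]; rfl } 1
        fun Y => by rw [one_mul]; exact norm_truncWords_le S (k + 2) Y
    refine lintegral_enorm_sub_le hT
      (fun n Y => he.continuous_collisionFunctional i c hα h (hε0 n) Y)
      (fun n Y => he.lintegral_collisionFunctional_le i c hα hM h (hε0 n) T Y)
      hgi (fun s _ => rfl) P (fun s hs => ?_) (fun s hs => ?_)
    -- The new particle is the last one; by symmetry it may be put next to particle `i`.
    · refine (he.tendsto_collisionFunctional_truncWords i c hα hh hε0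
        tendsto_one_div_add_atTop_nhds_zero_nat s hS (X s)).trans_eq (congrArg 𝓝 ?_)
      refine Finset.sum_congr rfl fun a _ => Finset.sum_congr rfl fun b _ => ?_
      rw [hXw s hs, he.differenceCoeff_eq_of_perm
        (hγ.symmetric (k + 2) (by omega) s (Ioc_subset_Icc_self hs))
        (hγ'.symmetric (k + 2) (by omega) s (Ioc_subset_Icc_self hs)) List.length_ofFn
        (splitLetter_ofFn_perm c i a b).symm]
    -- Without truncation, the limit is the matrix element of the collision terms.
    · have hs' := Ioc_subset_Icc_self hs
      obtain ⟨κ₁, hκ₁⟩ := exists_isFourierKernel ((hγ.curve (k + 2) (by omega)).traceClass s hs')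
      obtain ⟨κ₂, hκ₂⟩ := exists_isFourierKernel ((hγ'.curve (k + 2) (by omega)).traceClass s hs')
      have h1 := fun n => he.partialTraceForm_sub_eq hα hκ₁ hκ₂ s (X s)
        (fun c' => by rw [hXw s hs, he.differenceCoeff_ofFn (by omega)]) h i c (hε0 n)
      refine Tendsto.congr h1 ?_
      rw [he.sourceCoeff_ofFn, inner_sub_right, ← he.kernelForm_wordSchwartz,
        ← he.kernelForm_wordSchwartz]
      exact ((hB.hasCollision (k + 1) i s hs' _ _).comp tendsto_one_div_nat_nhdsGT).sub
        ((hB'.hasCollision (k + 1) i s hs' _ _).comp tendsto_one_div_nat_nhdsGT)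
  have hlim := ENNReal.Tendsto.const_mul (a := ENNReal.ofReal (√(T * κ))) hgl
    (Or.inr ENNReal.ofReal_ne_top)
  rw [mul_zero] at hlim
  refine tendsto_of_tendsto_of_tendsto_of_le_of_le' tendsto_const_nhds hlim
    (.of_forall fun _ => zero_le) ?_
  filter_upwards [eventually_ge_atTop (Finset.univ.image c)] with S hS
  exact hbound S fun m => hS (Finset.mem_image_of_mem c (Finset.mem_univ m))

end Coefficients

/-! ### Uniqueness of solutions -/

section Uniqueness

variable {ι : Type*} {e : ι → Plane → ℂ} {h : 𝓢(Plane, ℝ)} {b₀ T : ℝ} {J : ∀ k, ℕ → Op k}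
  {Γ : ∀ k, Op k} {γ γ' : ∀ k, ℝ → Op k} {α : ℝ}

namespace IsSmoothBasis

variable {w : Plane → ℝ}

lemma eq_zero_of_inner_wordSchwartz [Countable ι] (he : IsSmoothBasis e w)
    (hw : ContDiff ℝ (⊤ : ℕ∞) w) {k : ℕ} (t : ℝ) {u : L2 k}
    (hu : ∀ a : Fin k → ι, ⟪ofFourier (he.wordSchwartz hw a t), u⟫_ℂ = 0) : u = 0 := by
  set v : L2 k := 𝓕 u with hv
  have h1 := (he.isTotalFamily_wordSchwartz hw k).eq_zero _
    (Lp.memLp (mulOp (phase (laplaceSymbol k) (-t)) volume v)) fun a => by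
      rw [← hu a, inner_ofFourier_left]
      refine integral_congr_ae ?_
      filter_upwards [coeFn_mulOp (phase (laplaceSymbol k) (-t)) volume v] with ξ hξ
      have h2 : phase (laplaceSymbol k) (-t) ξ =
        Complex.exp (-(Complex.I * ((-t * laplaceSymbol k ξ : ℝ) : ℂ))) := rfl
      rw [hξ, wordSchwartz_eq, wordSchwartz_eq, map_mul, map_mul, conj_cexp_neg_I_mul,
        conj_cexp_neg_I_mul, h2, zero_mul, neg_zero, Complex.ofReal_zero, mul_zero, neg_zero,
        Complex.exp_zero, neg_mul]
      ring
  have h3 : v = 0 := by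
    refine Lp.ext ?_
    filter_upwards [h1, coeFn_mulOp (phase (laplaceSymbol k) (-t)) volume v,
      Lp.coeFn_zero ℂ 2 (volume : Measure (Config k))] with ξ h4 h5 h6
    rw [h4, Pi.zero_apply] at h5
    rw [h6, Pi.zero_apply]
    exact (mul_eq_zero.1 h5.symm).resolve_left (Complex.exp_ne_zero _)
  rw [← norm_eq_zero, ← Lp.norm_fourier_eq, ← hv, h3, norm_zero]

lemma eq_zero_of_inner_wordSchwartz_apply [Countable ι] (he : IsSmoothBasis e w)
    (hw : ContDiff ℝ (⊤ : ℕ∞) w) {k : ℕ} (t : ℝ) {D : Op k}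
    (hD : ∀ a b : Fin k → ι, ⟪ofFourier (he.wordSchwartz hw a t),
      D (ofFourier (he.wordSchwartz hw b t))⟫_ℂ = 0) : D = 0 := by
  have h1 : ∀ b : Fin k → ι, D (ofFourier (he.wordSchwartz hw b t)) = 0 := fun b =>
    he.eq_zero_of_inner_wordSchwartz hw t fun a => hD a b
  rw [← ContinuousLinearMap.adjoint.map_eq_zero_iff]
  ext1 v
  refine he.eq_zero_of_inner_wordSchwartz hw t fun b => ?_
  rw [ContinuousLinearMap.adjoint_inner_right, h1, inner_zero_left]

end IsSmoothBasis

/-- Two solutions with the same initial data agree, given an adapted smooth basis. -/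
theorem IsHierarchySolution.eq_of_isSmoothBasis [Countable ι] (hγ : IsHierarchySolution h b₀ T J Γ γ)
    (hγ' : IsHierarchySolution h b₀ T J Γ γ') (he : IsSmoothBasis e (sobolevSymbol α))
    (hh : ∫ x, h x = 1) (hα : 1 / 2 < α) (hT : 0 ≤ T) {C C' : ℝ} (hC : CollisionBound h α T C γ)
    (hC' : CollisionBound h α T C' γ') {k : ℕ} (hk : 1 ≤ k) {t : ℝ} (ht : t ∈ Icc 0 T) :
    γ k t = γ' k t := by
  classical
  obtain ⟨B, hB⟩ := hγ.exists_isCollisionKernel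
  obtain ⟨B', hB'⟩ := hγ'.exists_isCollisionKernel
  obtain ⟨M, hM⟩ := exists_resonanceBound hα
  have hword : IsWordHierarchy (pairCoeff α e) T
      ((Real.exp (T ^ 2)).toNNReal * (2 * (2 * ((√Real.pi).toNNReal * M)))) _ _
      (he.differenceCoeff γ γ') (he.sourceCoeff B B') :=
    { hB.isWordEquation hB' he hT hC hC' with
      continuous := he.continuous_pairCoeff α
      smoothing := fun S y => by
        refine (he.lintegral_pairCoeff_le hM T S y).trans_eq ?_
        push_cast
        rfl
      limit := hB.tendsto_sourceCoeff hB' hh hγ hγ' he hα hT hC hC' }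
  refine sub_eq_zero.1 (he.eq_zero_of_inner_wordSchwartz_apply (contDiff_sobolevSymbol α) t
    fun a b => ?_)
  rw [← he.differenceCoeff_ofFn (Nat.one_le_iff_ne_zero.1 hk) (fun m => (a m, b m)) t]
  exact hword.eq_zero _ ht

end Uniqueness

end GPHierarchy

end

theorem mainTheorem3
    (h : SchwartzMap GPHierarchy.Plane ℝ) (hh : ∫ x, h x = 1)
    (α : ℝ) (hα : 1 / 2 < α) (T : ℝ) (hT : 0 < T) (b₀ : ℝ)
    (J : ∀ k, ℕ → GPHierarchy.Op k) (hJ : ∀ k, 1 ≤ k → GPHierarchy.IsDenseCompactSeq (J k))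
    (Γ : ∀ k, GPHierarchy.Op k) (hΓ : ∀ k, 1 ≤ k → GPHierarchy.IsTraceClass (Γ k))
    (γ γ' : ∀ k, ℝ → GPHierarchy.Op k)
    (hγ : GPHierarchy.IsHierarchySolution h b₀ T J Γ γ)
    (hγ' : GPHierarchy.IsHierarchySolution h b₀ T J Γ γ')
    (hbound : ∃ C, GPHierarchy.CollisionBound h α T C γ)
    (hbound' : ∃ C, GPHierarchy.CollisionBound h α T C γ') :
    ∀ k, 1 ≤ k → ∀ t ∈ Set.Icc 0 T, γ k t = γ' k t := by
  obtain ⟨C, hC⟩ := hbound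
  obtain ⟨C', hC'⟩ := hbound'
  obtain ⟨N, e, he⟩ := GPHierarchy.exists_isSmoothBasis
    (GPHierarchy.contDiff_sobolevSymbol α) (GPHierarchy.sobolevSymbol_pos α)
  intro k hk t ht
  exact hγ.eq_of_isSmoothBasis hγ' he hh hα hT.le hC hC' hk ht
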